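/- **Setting.** Let $q,d\in\mathbb C^\times$, $q_1=q^{-1}d$, $q_2=q^2$, $q_3=q^{-1}d^{-1}$, and assume that $q_1^{n_1}q_2^{n_2}q_3^{n_3}=1$ with $n_i\in\mathbb Z$ holds only if $n_1=n_2=n_3$. Fix a value of $\log q_1$ and put $q_1^r=e^{r\log q_1}$ for $r\in\mathbb Q$. For $m\ge1$ and $\mathbf N=(N_1,\dots,N_m)\in\mathbb Z_{\ge0}^m$ let $Sh_{m,\mathbf N}=Sh_{m,\mathbf N}(q_1,q_2,q_3)$ be the space of rational functions $F(x_1;\cdots;x_m)$, $x_i=(x_{i,1},\dots,x_{i,N_i})$ (the colour $i$ is read modulo $m$), such that 1. $F=f/\prod_{i=1}^m\prod_{a,b}(x_{i,a}-x_{i+1,b})$ with a Laurent polynomial $f$ (for $m=1$ the denominator is $\prod_{a<b}(x_a-x_b)^2$); 2. $F$ is symmetric in the variables of each colour; 3. $F$ vanishes if, for some $i,a,b,c$, either $x_{i,b}=q_3x_{i-1,a}$ and $x_{i,c}=q_2x_{i,b}$, or $x_{i,b}=q_2x_{i,a}$ and $x_{i+1,c}=q_3x_{i,b}$. $Sh_m=\bigoplus_{\mathbf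 N}Sh_{m,\mathbf N}$ is an algebra for the shuffle product $$(F*G)(x_1;\cdots;x_m)=\sum F(x_{1,I_1};\cdots;x_{m,I_m})\,G(x_{1,J_1};\cdots;x_{m,J_m})\prod_{i,j}\prod_{a\in I_i,\,b\in J_j}\omega_{i,j}(x_{i,a},x_{j,b}),$$ the sum over all decompositions of the index sets of the $x_i$ into $I_i\sqcup J_i$ with $|I_i|$, $|J_i|$ the numbers of variables of colour $i$ of $F$, $G$. For $m\ge3$, $$\omega_{i,i}=\frac{x-q_2y}{x-y},\quad \omega_{i-1,i}=\frac{x-q_1y}{x-y},\quad \omega_{i,i-1}=d\,\frac{x-q_3y}{x-y},$$ and $\omega_{i,j}=1$ otherwise. For $m=2$, $\omega_{i,i}=\frac{x-q_2y}{x-y}$ and $\omega_{i,i-1}=\frac{(x-q_1y)(x-q_3y)}{(x-y)^2}$. For $m=1$, $\omega_{1,1}=\frac{(x-q_1y)(x-q_2y)(x-q_3y)}{(x-y)^3}$. Let $Sh^0_m=\bigoplus_{N\ge0}Sh^0_{m,N}$, $Sh^0_{m,N}=Sh_{m,(N,\dots,N)}$; thus $Sh^0_1=Sh_1$. When the parameters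 $q_1,q_3$ are changed, $q$ stays fixed and $d$ becomes $q$ times the new $q_1$. **Fusion.** Let $m\ge2$, $t=q_1^{1/(m-1)}$, $\tilde q_1=q_1t$, $\tilde q_3=q_3t^{-1}$. For $F\in Sh^0_{m,N}$ and $N=L+K$, let $\tilde\rho_{N,L}(F)$ be obtained by the substitution $$x_{i,a}=t^{-(m-i)}y_{i,a}\ (1\le a\le L),\qquad x_{i,b}=q_3^{i-1}z_b\ (L<b\le N),\qquad 1\le i\le m,$$ where $y_{m,a}=y_{1,a}$, and define $\tilde F_{N,L}(y_1;\cdots;y_{m-1}|z)$ by $$\begin{aligned} \tilde\rho_{N,L}(F)={}&\tilde F_{N,L}\cdot c_m(L,K) \prod_{1\le a<b\le L}\frac{(y_{1,a}-q_2y_{1,b})(y_{1,a}-q_2^{-1}y_{1,b})}{(y_{1,a}-q_1y_{1,b})(y_{1,a}-q_1^{-1}y_{1,b})} \prod_{i=1}^{m-1}\prod_{1\le a,b\le L}{}^{\!\!\!\prime}\ \frac{y_{i,a}-y_{i+1,b}}{y_{i,a}-t\,y_{i+1,b}}\\ &\times\prod_{L<a<b\le N}\Bigl(\frac{(z_a-q_2z_b)(z_a-q_2^{-1}z_b)}{(z_a-q_3z_b)(z_a-q_3^{-1}z_b)}\Bigr)^{m-1}\frac{(z_a-z_b)^2}{(z_a-q_3^{m-1}z_b)(z_a-q_3^{-m+1}z_b)}\\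 &\times\prod_{a\le L<b}\ \prod_{i=2}^{m-1}\frac{(t^{-(m-i)}y_{i,a}-q_1q_3^iz_b)(t^{-(m-i)}y_{i,a}-q_1^{-1}q_3^{i-2}z_b)}{(t^{-(m-i)}y_{i,a}-q_3^iz_b)(t^{-(m-i)}y_{i,a}-q_3^{i-2}z_b)}\\ &\times\prod_{a\le L<b}\frac{(y_{1,a}-q_1^2q_3z_b)(y_{1,a}-q_3^{-1}z_b)}{(y_{1,a}-q_1q_3z_b)(y_{1,a}-z_b)}\cdot\frac{(y_{1,a}-q_1^{-1}q_3^{m-2}z_b)(y_{1,a}-q_1q_3^mz_b)}{(y_{1,a}-q_3^{m-2}z_b)(y_{1,a}-q_1q_3^{m-1}z_b)}. \end{aligned}$$ Here $\prod'$ means that for $m=2$ the factors with $a=b$ are omitted, and $c_m(L,K)=d^{\binom L2+m\binom K2+mLK}$ for $m\ge4$, $c_3(L,K)=(dq_1^{1/2})^{L(L-1)}\,d^{\binom L2+3\binom K2+3LK}$, $c_2(L,K)=q_1^{\binom L2}$. **Claim 1.** For $m\ge2$, the map sending $F\in Sh^0_{m,N}$ to $\sum_{L=0}^N\tilde F_{N,L}$,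 where $\tilde F_{N,L}$ is regarded as an element of the tensor product in the variables $(y;z)$, is a well-defined homomorphism of $\mathbb Z_{\ge0}$-graded algebras $$\pi_m^{m-1}:Sh^0_m(q_1,q_2,q_3)\longrightarrow Sh^0_{m-1}(\tilde q_1,q_2,\tilde q_3)\otimes Sh_1(q_1q_3^{-m+1},q_2,q_3^m).$$ **Claim 2.** For $m\ge1$, iterating these maps (that is, $\pi_1=\mathrm{id}$ and $\pi_m=(\pi_{m-1}\otimes\mathrm{id})\circ\pi_m^{m-1}$, with $\pi_{m-1}$ taken for the parameters $(\tilde q_1,q_2,\tilde q_3)$ and $\log\tilde q_1=\frac m{m-1}\log q_1$) gives a homomorphism of $\mathbb Z_{\ge0}$-graded algebras $$\pi_m:Sh^0_m(q_1,q_2,q_3)\longrightarrow\bigotimes_{j=0}^{m-1}Sh_1(q_2^jq_1^m,\,q_2,\,q_2^{-j-1}q_1^{-m}).$$ -/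

import Mathlib

open scoped TensorProduct


namespace Shuffle
open Finset
noncomputable section

/-- The parameters: nonzero complex numbers `q` and `q₁`. They determine
`q₂ = q²`, `q₃ = (q₁ q₂)⁻¹` and `d = q q₁`; equivalently one gives `q, d ≠ 0` and puts
`q₁ = q⁻¹ d`, `q₂ = q²`, `q₃ = q⁻¹ d⁻¹` (see `q1_eq`, `q3_eq`). -/
structure Params where
  q : ℂ
  q1 : ℂ
  q_ne : q ≠ 0
  q1_ne : q1 ≠ 0

namespace Params
/-- `q₂ = q²`. -/
def q2 (p : Params) : ℂ := p.q ^ 2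
/-- `q₃`, so that `q₁ q₂ q₃ = 1`. -/
def q3 (p : Params) : ℂ := (p.q1 * p.q2)⁻¹
/-- `d`, so that `q₁ = q⁻¹ d` and `q₃ = q⁻¹ d⁻¹`. -/
def d (p : Params) : ℂ := p.q * p.q1

lemma q2_ne (p : Params) : p.q2 ≠ 0 := pow_ne_zero 2 p.q_ne
lemma q3_ne (p : Params) : p.q3 ≠ 0 := inv_ne_zero (mul_ne_zero p.q1_ne p.q2_ne)
lemma prod_eq_one (p : Params) : p.q1 * p.q2 * p.q3 = 1 :=
  mul_inv_cancel₀ (mul_ne_zero p.q1_ne p.q2_ne)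
lemma q1_eq (p : Params) : p.q1 = p.q⁻¹ * p.d := by
  rw [d, inv_mul_cancel_left₀ p.q_ne]
lemma q3_eq (p : Params) : p.q3 = p.q⁻¹ * p.d⁻¹ := by
  have := p.q_ne; have := p.q1_ne
  rw [q3, q2, d]; field_simp

/-- `q₁^{n₁} q₂^{n₂} q₃^{n₃} = 1` holds only if `n₁ = n₂ = n₃`. -/
def Generic (p : Params) : Prop :=
  ∀ n₁ n₂ n₃ : ℤ, p.q1 ^ n₁ * p.q2 ^ n₂ * p.q3 ^ n₃ = 1 → n₁ = n₂ ∧ n₂ = n₃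

/-- The structure functions `ω_{i,j}(x, y)` of the shuffle algebra with `m` cyclically ordered
colours. `finRotate m i` is the colour after `i`. For `m = 1` and `m = 2` there are separate formulas, without `d`. -/
def omega (p : Params) {m : ℕ} (i j : Fin m) (x y : ℂ) : ℂ :=
  if m = 1 then (x - p.q1 * y) * (x - p.q2 * y) * (x - p.q3 * y) / (x - y) ^ 3
  else if i = j then (x - p.q2 * y) / (x - y)
  else if m = 2 then (x - p.q1 * y) * (x - p.q3 * y) / (x - y) ^ 2
  else if j = finRotate m i then (x - p.q1 * y) / (x - y)
  else if i = finRotate m j then p.d * ((x - p.q3 * y) / (x - y))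
  else 1
end Params

/-- A configuration is a finite set `S` of coloured points `(i, x)`. The points of colour `i` in `S`
are the values of the variables `x_{i,1}, …, x_{i,N_i}`, regardless of their order. It is
admissible if all values are nonzero and pairwise distinct. -/
def Admissible {m : ℕ} (S : Finset (Fin m × ℂ)) : Prop :=
  (∀ u ∈ S, u.2 ≠ 0) ∧ Set.InjOn Prod.snd (S : Set (Fin m × ℂ))

lemma Admissible.mono {m : ℕ} {S T : Finset (Fin m × ℂ)} (hT : Admissible T) (h : S ⊆ T) :
    Admissible S :=
  ⟨fun u hu => hT.1 u (h hu), hT.2.mono (by exact_mod_cast h)⟩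

lemma admissible_empty {m : ℕ} : Admissible (∅ : Finset (Fin m × ℂ)) := by
  simp [Admissible]

/-- The functions that vanish outside the admissible configurations; in other words, the functions
of admissible configurations. A function of configurations is the same thing as a function of
variables `x_{i,a}` that is symmetric in the variables of each colour. -/
def supported (m : ℕ) : Submodule ℂ (Finset (Fin m × ℂ) → ℂ) where
  carrier := {F | ∀ S, ¬ Admissible S → F S = 0}
  add_mem' := fun {F G} hF hG S hS => by simp [hF S hS, hG S hS]
  zero_mem' := fun _ _ => rfl
  smul_mem' := fun c F hF S hS => by simp [hF S hS]

/-- The ambient space of the shuffle algebra with `m` colours and parameters `p`. The rational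
functions that make up the shuffle algebra have no poles at admissible configurations, which form
a Zariski dense open set, and are therefore given by their values there. -/
def ShFun (m : ℕ) (_p : Params) : Type := supported m

namespace ShFun
variable {m : ℕ} {p : Params}

instance : AddCommGroup (ShFun m p) := inferInstanceAs (AddCommGroup (supported m))
instance : Module ℂ (ShFun m p) := inferInstanceAs (Module ℂ (supported m))

/-- The value of `F` at a configuration (zero if it is not admissible). -/
def toFun (F : ShFun m p) : Finset (Fin m × ℂ) → ℂ := Subtype.val (p := (· ∈ supported m)) F

instance : CoeFun (ShFun m p) (fun _ => Finset (Fin m × ℂ) → ℂ) := ⟨toFun⟩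

@[simp] lemma add_apply (F G : ShFun m p) (S : Finset (Fin m × ℂ)) : (F + G) S = F S + G S := rfl
@[simp] lemma zero_apply (S : Finset (Fin m × ℂ)) : (0 : ShFun m p) S = 0 := rfl
@[simp] lemma smul_apply (a : ℂ) (F : ShFun m p) (S : Finset (Fin m × ℂ)) :
    (a • F) S = a * F S := rfl

/-- Evaluation at a configuration, as a linear form. -/
def evalAt (S : Finset (Fin m × ℂ)) : ShFun m p →ₗ[ℂ] ℂ where
  toFun F := F S
  map_add' _ _ := rfl
  map_smul' _ _ := rfl

lemma eq_zero (F : ShFun m p) {S : Finset (Fin m × ℂ)} (hS : ¬ Admissible S) : F S = 0 :=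
  F.2 S hS

@[ext] lemma ext {F G : ShFun m p} (h : ∀ S, Admissible S → F S = G S) : F = G := by
  apply Subtype.ext
  funext S
  by_cases hS : Admissible S
  · exact h S hS
  · exact (F.2 S hS).trans (G.2 S hS).symm

/-- `∏_{i,j} ∏_{a ∈ I_i, b ∈ J_j} ω_{i,j}(x_{i,a}, x_{j,b})`. -/
def cross (p : Params) (I J : Finset (Fin m × ℂ)) : ℂ :=
  ∏ u ∈ I, ∏ v ∈ J, p.omega u.1 v.1 u.2 v.2

lemma cross_union_left {I I' J : Finset (Fin m × ℂ)} (h : Disjoint I I') :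
    cross p (I ∪ I') J = cross p I J * cross p I' J := by
  rw [cross, prod_union h]; rfl

lemma cross_union_right {I J J' : Finset (Fin m × ℂ)} (h : Disjoint J J') :
    cross p I (J ∪ J') = cross p I J * cross p I J' := by
  simp only [cross, prod_union h, prod_mul_distrib]

open Classical in
/-- The shuffle product: the sum over all decompositions `S = I ⊔ J` of the set of variables of
`F(x_I) G(x_J) ∏ ω_{i,j}(x_{i,a}, x_{j,b})`, the last product over `(i, a) ∈ I`, `(j, b) ∈ J`. If
`F` and `G` are homogeneous, then only those `I` and `J` contribute that have the right number of
points of each colour. -/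
instance : Mul (ShFun m p) where
  mul F G :=
    ⟨fun S => if Admissible S then ∑ I ∈ S.powerset, F I * G (S \ I) * cross p I (S \ I) else 0,
      fun S hS => if_neg hS⟩

open Classical in
instance : One (ShFun m p) where
  one := ⟨fun S => if S = ∅ then 1 else 0, fun S hS => if_neg (by
    rintro rfl; exact hS admissible_empty)⟩

open Classical in
lemma mul_apply (F G : ShFun m p) {S : Finset (Fin m × ℂ)} (hS : Admissible S) :
    (F * G) S = ∑ I ∈ S.powerset, F I * G (S \ I) * cross p I (S \ I) :=
  if_pos hS

open Classical in
lemma one_apply (S : Finset (Fin m × ℂ)) : (1 : ShFun m p) S = if S = ∅ then 1 else 0 := rfl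

open Classical in
protected lemma mul_assoc (F G H : ShFun m p) : F * G * H = F * (G * H) := by
  ext S hS
  rw [mul_apply _ _ hS, mul_apply _ _ hS]
  have h1 : ∀ T ∈ S.powerset, (F * G) T * H (S \ T) * cross p T (S \ T) =
      ∑ I ∈ T.powerset, F I * G (T \ I) * H (S \ T) *
        (cross p I (T \ I) * cross p I (S \ T) * cross p (T \ I) (S \ T)) := by
    intro T hT
    rw [mul_apply _ _ (hS.mono (mem_powerset.1 hT)), sum_mul, sum_mul]
    refine sum_congr rfl fun I hI => ?_
    have hc : cross p T (S \ T) = cross p I (S \ T) * cross p (T \ I) (S \ T) := by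
      rw [← cross_union_left disjoint_sdiff, union_sdiff_of_subset (mem_powerset.1 hI)]
    rw [hc]; ring
  have h2 : ∀ I ∈ S.powerset, F I * (G * H) (S \ I) * cross p I (S \ I) =
      ∑ U ∈ (S \ I).powerset, F I * G U * H ((S \ I) \ U) *
        (cross p I U * cross p I ((S \ I) \ U) * cross p U ((S \ I) \ U)) := by
    intro I hI
    rw [mul_apply _ _ (hS.mono sdiff_subset), mul_sum, sum_mul]
    refine sum_congr rfl fun U hU => ?_
    have hc : cross p I (S \ I) = cross p I U * cross p I ((S \ I) \ U) := by
      rw [← cross_union_right disjoint_sdiff, union_sdiff_of_subset (mem_powerset.1 hU)]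
    rw [hc]; ring
  rw [sum_congr rfl h1, sum_congr rfl h2, sum_sigma', sum_sigma']
  refine sum_bij' (fun a _ => ⟨a.2, a.1 \ a.2⟩) (fun b _ => ⟨b.1 ∪ b.2, b.1⟩) ?_ ?_ ?_ ?_ ?_
  · rintro ⟨T, I⟩ h
    simp only [mem_sigma, mem_powerset] at h ⊢
    exact ⟨h.2.trans h.1, sdiff_subset_sdiff h.1 subset_rfl⟩
  · rintro ⟨I, U⟩ h
    simp only [mem_sigma, mem_powerset] at h ⊢
    exact ⟨union_subset h.1 (h.2.trans sdiff_subset), subset_union_left⟩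
  · rintro ⟨T, I⟩ h
    simp only [mem_sigma, mem_powerset] at h
    simp [union_sdiff_of_subset h.2]
  · rintro ⟨I, U⟩ h
    simp only [mem_sigma, mem_powerset] at h
    have : Disjoint I U := (disjoint_sdiff (s := I) (t := S)).mono_right h.2
    simp [union_sdiff_cancel_left this]
  · rintro ⟨T, I⟩ h
    simp only [mem_sigma, mem_powerset] at h
    have : (S \ I) \ (T \ I) = S \ T := by
      ext v
      have := @h.2 v
      simp only [mem_sdiff]; tauto
    simp only [this]

instance : Ring (ShFun m p) :=
  { (inferInstance : AddCommGroup (ShFun m p)), (inferInstance : Mul (ShFun m p)),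
    (inferInstance : One (ShFun m p)) with
    mul_assoc := ShFun.mul_assoc
    left_distrib := fun F G H => by
      classical
      ext S hS
      simp only [mul_apply _ _ hS, add_apply, mul_add, add_mul, sum_add_distrib]
    right_distrib := fun F G H => by
      classical
      ext S hS
      simp only [mul_apply _ _ hS, add_apply, add_mul, sum_add_distrib]
    zero_mul := fun F => by
      classical
      ext S hS
      simp [mul_apply _ _ hS]
    mul_zero := fun F => by
      classical
      ext S hS
      simp [mul_apply _ _ hS]
    one_mul := fun F => by
      classical
      ext S hS
      rw [mul_apply _ _ hS, sum_eq_single ∅]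
      · simp [one_apply, cross]
      · intro I _ hI
        simp [one_apply, hI]
      · simp
    mul_one := fun F => by
      classical
      ext S hS
      rw [mul_apply _ _ hS, sum_eq_single S]
      · simp [one_apply, cross]
      · intro I hI hne
        have : S \ I ≠ ∅ := fun h => hne (subset_antisymm (mem_powerset.1 hI)
          (sdiff_eq_empty_iff_subset.1 h))
        simp [one_apply, this]
      · simp }

instance : Algebra ℂ (ShFun m p) :=
  Algebra.ofModule
    (fun c F G => by
      classical
      ext S hS
      simp only [mul_apply _ _ hS, smul_apply, mul_sum, mul_assoc])
    (fun c F G => by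
      classical
      ext S hS
      simp only [mul_apply _ _ hS, smul_apply, mul_sum]
      exact sum_congr rfl fun _ _ => by ring)
end ShFun

section Laurent
variable {ι : Type} [Fintype ι]

/-- The values of the variables `x_l` are nonzero and pairwise distinct. -/
def Distinct (x : ι → ℂ) : Prop := (∀ l, x l ≠ 0) ∧ Function.Injective x

open Classical in
/-- The configuration of the variables `x_l`, where `l` has the colour `c l`. -/
def conf {m : ℕ} (c : ι → Fin m) (x : ι → ℂ) : Finset (Fin m × ℂ) :=
  univ.image fun l => (c l, x l)

open Classical in
/-- The pole denominator, the product of `x_l - x_{l'}` over all pairs of variables such that the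
colour of `l'` comes after the colour of `l` in the cyclic order. For `m ≥ 2` colours this is
`∏_i ∏_{a,b} (x_{i,a} - x_{i+1,b})`, and for one colour it is `∏_{a<b} (x_a - x_b)²` up to a
sign. -/
def poleDenom {m : ℕ} (c : ι → Fin m) (x : ι → ℂ) : ℂ :=
  ∏ l, ∏ l', if l ≠ l' ∧ c l' = finRotate m (c l) then x l - x l' else 1

lemma poleDenom_ne_zero {m : ℕ} (c : ι → Fin m) {x : ι → ℂ} (hx : Distinct x) :
    poleDenom c x ≠ 0 := by
  refine prod_ne_zero_iff.2 fun l _ => prod_ne_zero_iff.2 fun l' _ => ?_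
  split_ifs with h
  · exact sub_ne_zero.2 fun e => h.1 (hx.2 e)
  · exact one_ne_zero

lemma Distinct.prod_ne_zero {x : ι → ℂ} (hx : Distinct x) : ∏ l, x l ≠ 0 :=
  prod_ne_zero_iff.2 fun l _ => hx.1 l

lemma Distinct.admissible {m : ℕ} (c : ι → Fin m) {x : ι → ℂ} (hx : Distinct x) :
    Admissible (conf c x) := by
  classical
  constructor
  · intro u hu
    obtain ⟨l, -, rfl⟩ := mem_image.1 hu
    exact hx.1 l
  · intro u hu v hv h
    obtain ⟨l, -, rfl⟩ := mem_image.1 (mem_coe.1 hu)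
    obtain ⟨l', -, rfl⟩ := mem_image.1 (mem_coe.1 hv)
    rw [hx.2 h]

/-- `f` is given by a Laurent polynomial. -/
def IsLaurent (f : (ι → ℂ) → ℂ) : Prop :=
  ∃ (P : MvPolynomial ι ℂ) (k : ℕ), ∀ x, Distinct x → f x * (∏ l, x l) ^ k = MvPolynomial.eval x P

lemma IsLaurent.congr {f g : (ι → ℂ) → ℂ} (hf : IsLaurent f) (h : ∀ x, Distinct x → f x = g x) :
    IsLaurent g := by
  obtain ⟨P, k, hP⟩ := hf
  exact ⟨P, k, fun x hx => by rw [← h x hx, hP x hx]⟩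

lemma IsLaurent.const (a : ℂ) : IsLaurent (fun _ : ι → ℂ => a) :=
  ⟨MvPolynomial.C a, 0, fun x _ => by simp⟩

lemma IsLaurent.coord (l : ι) : IsLaurent (fun x : ι → ℂ => x l) :=
  ⟨MvPolynomial.X l, 0, fun x _ => by simp⟩

lemma IsLaurent.add {f g : (ι → ℂ) → ℂ} (hf : IsLaurent f) (hg : IsLaurent g) :
    IsLaurent (fun x => f x + g x) := by
  obtain ⟨P, k, hP⟩ := hf
  obtain ⟨Q, j, hQ⟩ := hg
  refine ⟨P * (∏ l, MvPolynomial.X l) ^ j + Q * (∏ l, MvPolynomial.X l) ^ k, k + j,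
    fun x hx => ?_⟩
  simp only [map_add, map_mul, map_pow, map_prod, MvPolynomial.eval_X, ← hP x hx, ← hQ x hx]
  ring

lemma IsLaurent.mul {f g : (ι → ℂ) → ℂ} (hf : IsLaurent f) (hg : IsLaurent g) :
    IsLaurent (fun x => f x * g x) := by
  obtain ⟨P, k, hP⟩ := hf
  obtain ⟨Q, j, hQ⟩ := hg
  refine ⟨P * Q, k + j, fun x hx => ?_⟩
  simp only [map_mul, ← hP x hx, ← hQ x hx]
  ring

lemma IsLaurent.sub {f g : (ι → ℂ) → ℂ} (hf : IsLaurent f) (hg : IsLaurent g) :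
    IsLaurent (fun x => f x - g x) :=
  (hf.add ((IsLaurent.const (-1)).mul hg)).congr fun x _ => by ring

lemma IsLaurent.sum {α : Type*} (s : Finset α) {f : α → (ι → ℂ) → ℂ}
    (h : ∀ a ∈ s, IsLaurent (f a)) : IsLaurent (fun x => ∑ a ∈ s, f a x) := by
  classical
  induction s using Finset.induction_on with
  | empty => exact (IsLaurent.const 0).congr fun x _ => by simp
  | insert a s ha ih =>
    refine ((h a (mem_insert_self a s)).add
      (ih fun b hb => h b (mem_insert_of_mem hb))).congr fun x _ => ?_
    rw [sum_insert ha]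

lemma IsLaurent.prod {α : Type*} (s : Finset α) {f : α → (ι → ℂ) → ℂ}
    (h : ∀ a ∈ s, IsLaurent (f a)) : IsLaurent (fun x => ∏ a ∈ s, f a x) := by
  classical
  induction s using Finset.induction_on with
  | empty => exact (IsLaurent.const 1).congr fun x _ => by simp
  | insert a s ha ih =>
    refine ((h a (mem_insert_self a s)).mul
      (ih fun b hb => h b (mem_insert_of_mem hb))).congr fun x _ => ?_
    rw [prod_insert ha]

/-- A polynomial that vanishes at all distinct nonzero arguments is zero. -/
lemma eq_zero_of_eval {P : MvPolynomial ι ℂ}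
    (h : ∀ x, Distinct x → MvPolynomial.eval x P = 0) : P = 0 := by
  classical
  set D : MvPolynomial ι ℂ := (∏ l, MvPolynomial.X l) *
    ∏ l, ∏ l', if l ≠ l' then MvPolynomial.X l - MvPolynomial.X l' else 1 with hD
  have hD0 : D ≠ 0 := by
    refine mul_ne_zero (prod_ne_zero_iff.2 fun l _ => MvPolynomial.X_ne_zero l)
      (prod_ne_zero_iff.2 fun l _ => prod_ne_zero_iff.2 fun l' _ => ?_)
    split_ifs with hl
    · exact sub_ne_zero.2 fun e => hl (MvPolynomial.X_injective e)
    · exact one_ne_zero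
  have : P * D = 0 := by
    refine MvPolynomial.funext fun x => ?_
    rw [map_mul, map_zero]
    by_cases hx : Distinct x
    · rw [h x hx, zero_mul]
    · rw [mul_eq_zero]; right
      by_contra hne
      apply hx
      rw [hD, map_mul, ← ne_eq, mul_ne_zero_iff, map_prod, map_prod] at hne
      refine ⟨fun l hl => hne.1 (prod_eq_zero (mem_univ l) (by simpa using hl)),
        fun l l' e => ?_⟩
      by_contra hl
      refine hne.2 (prod_eq_zero (mem_univ l) ?_)
      rw [map_prod]
      exact prod_eq_zero (mem_univ l') (by simp [hl, e])
  exact (mul_eq_zero.1 this).resolve_right hD0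

open Classical in
/-- The substitution `x_l = x_{l'}`. -/
def merge (l l' : ι) : MvPolynomial ι ℂ →ₐ[ℂ] MvPolynomial ι ℂ :=
  MvPolynomial.rename (Function.update id l l')

lemma dvd_of_merge (l l' : ι) {P : MvPolynomial ι ℂ} (h : merge l l' P = 0) :
    (MvPolynomial.X l - MvPolynomial.X l' : MvPolynomial ι ℂ) ∣ P := by
  classical
  have key : ∀ P : MvPolynomial ι ℂ,
      (MvPolynomial.X l - MvPolynomial.X l' : MvPolynomial ι ℂ) ∣ P - merge l l' P := by
    intro P
    induction P using MvPolynomial.induction_on with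
    | C a => simp [merge]
    | add P Q hP hQ =>
      rw [map_add, add_sub_add_comm]; exact dvd_add hP hQ
    | mul_X P n hP =>
      have : P * MvPolynomial.X n - merge l l' (P * MvPolynomial.X n) =
          (P - merge l l' P) * MvPolynomial.X n +
            merge l l' P * (MvPolynomial.X n - merge l l' (MvPolynomial.X n)) := by
        rw [map_mul]; ring
      rw [this]
      refine dvd_add (hP.mul_right _) (Dvd.dvd.mul_left ?_ _)
      by_cases hn : n = l
      · subst hn; simp [merge]
      · simp [merge, Function.update_of_ne hn]
  simpa [h] using key P

lemma prod_dvd_of_merge (s : Finset (ι × ι)) (hs : ∀ a ∈ s, a.1 ≠ a.2)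
    (hs' : ∀ a ∈ s, a.swap ∉ s) {P : MvPolynomial ι ℂ} (h : ∀ a ∈ s, merge a.1 a.2 P = 0) :
    (∏ a ∈ s, (MvPolynomial.X a.1 - MvPolynomial.X a.2) : MvPolynomial ι ℂ) ∣ P := by
  classical
  induction s using Finset.induction_on with
  | empty => simp
  | insert a s ha ih =>
    obtain ⟨Q, rfl⟩ := ih (fun b hb => hs b (mem_insert_of_mem hb))
      (fun b hb hb' => hs' b (mem_insert_of_mem hb) (mem_insert_of_mem hb'))
      (fun b hb => h b (mem_insert_of_mem hb))
    rw [prod_insert ha, mul_comm (MvPolynomial.X a.1 - MvPolynomial.X a.2)]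
    refine mul_dvd_mul_left _ (dvd_of_merge _ _ ?_)
    have h1 := h a (mem_insert_self a s)
    rw [map_mul, mul_eq_zero] at h1
    refine h1.resolve_left ?_
    rw [map_prod, ← ne_eq, prod_ne_zero_iff]
    intro b hb e
    have hab : a ≠ b := fun e => ha (e ▸ hb)
    have hba : a ≠ b.swap := fun e =>
      hs' a (mem_insert_self a s) (by rw [e, Prod.swap_swap]; exact mem_insert_of_mem hb)
    have hb1 := hs b (mem_insert_of_mem hb)
    rw [map_sub, sub_eq_zero] at e
    simp only [merge, MvPolynomial.rename_X] at e
    have e := MvPolynomial.X_injective e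
    obtain ⟨a1, a2⟩ := a
    obtain ⟨b1, b2⟩ := b
    simp only [Function.update_apply, id, ne_eq, Prod.mk.injEq, Prod.swap_prod_mk] at *
    split_ifs at e <;> aesop
end Laurent

/-- The graded component `Sh_{m,N}` of degree `N = (N_1, …, N_m)` of the shuffle algebra: functions
`F` of `N_i` variables of colour `i`, symmetric in the variables of each colour (being functions
of configurations), such that
* `F = f / ∏ (x_{i,a} - x_{i+1,b})` with a Laurent polynomial `f` (for one colour, the denominator
  is `∏_{a<b} (x_a - x_b)²`);
* `F` vanishes if `x_{i+1,b} = q₃ x_{i,a}` and `x_{i+1,c} = q₂ x_{i+1,b}` for some `a, b, c` and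
  some colour `i` (cyclically);
* `F` vanishes if `x_{i,b} = q₂ x_{i,a}` and `x_{i+1,c} = q₃ x_{i,b}` for some `a, b, c` and some
  colour `i` (cyclically). -/
def Sh {m : ℕ} (p : Params) (N : Fin m → ℕ) : Submodule ℂ (ShFun m p) where
  carrier := {F |
    (∀ S, F S ≠ 0 → ∀ i, (S.filter fun u => u.1 = i).card = N i) ∧
    (∃ (f : MvPolynomial (Σ i, Fin (N i)) ℂ) (k : ℕ), ∀ x : (Σ i, Fin (N i)) → ℂ, Distinct x →
      F (conf Sigma.fst x) =
        MvPolynomial.eval x f / (∏ l, x l) ^ k / poleDenom Sigma.fst x) ∧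
    (∀ S i u, (i, u) ∈ S → (finRotate m i, p.q3 * u) ∈ S →
      (finRotate m i, p.q2 * (p.q3 * u)) ∈ S → F S = 0) ∧
    (∀ S i u, (i, u) ∈ S → (i, p.q2 * u) ∈ S →
      (finRotate m i, p.q3 * (p.q2 * u)) ∈ S → F S = 0)}
  add_mem' := by
    rintro F G ⟨hF1, ⟨f, k, hf⟩, hF3, hF4⟩ ⟨hG1, ⟨g, j, hg⟩, hG3, hG4⟩
    refine ⟨fun S hS => ?_, ⟨f * (∏ l, MvPolynomial.X l) ^ j + g * (∏ l, MvPolynomial.X l) ^ k,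
      k + j, fun x hx => ?_⟩, fun S i u h1 h2 h3 => ?_, fun S i u h1 h2 h3 => ?_⟩
    · by_cases h : F S = 0
      · exact hG1 S (by simpa [h] using hS)
      · exact hF1 S h
    · have h1 := hx.prod_ne_zero
      have h2 := poleDenom_ne_zero Sigma.fst hx
      simp only [ShFun.add_apply, map_add, map_mul, map_pow, map_prod, MvPolynomial.eval_X, hf x hx,
        hg x hx]
      generalize (∏ l, x l) = A at *
      generalize poleDenom Sigma.fst x = B at *
      field_simp
      ring
    · simp [hF3 S i u h1 h2 h3, hG3 S i u h1 h2 h3]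
    · simp [hF4 S i u h1 h2 h3, hG4 S i u h1 h2 h3]
  zero_mem' := ⟨fun S h => by simp at h, ⟨0, 0, fun x _ => by simp⟩,
    fun S i u _ _ _ => by simp, fun S i u _ _ _ => by simp⟩
  smul_mem' := by
    rintro a F ⟨hF1, ⟨f, k, hf⟩, hF3, hF4⟩
    refine ⟨fun S hS => hF1 S fun h => hS (by simp [h]), ⟨MvPolynomial.C a * f, k, fun x hx => ?_⟩,
      fun S i u h1 h2 h3 => ?_, fun S i u h1 h2 h3 => ?_⟩
    · simp only [map_mul, MvPolynomial.eval_C, ShFun.smul_apply, hf x hx]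
      ring
    · simp [hF3 S i u h1 h2 h3]
    · simp [hF4 S i u h1 h2 h3]

section Closed
variable {m : ℕ} {p : Params}

open Classical in
lemma wheel_mul {F G : ShFun m p} {S : Finset (Fin m × ℂ)} {u v w : Fin m × ℂ}
    (hu : u ∈ S) (hv : v ∈ S) (hw : w ∈ S)
    (hF : ∀ T, u ∈ T → v ∈ T → w ∈ T → F T = 0) (hG : ∀ T, u ∈ T → v ∈ T → w ∈ T → G T = 0)
    (h1 : p.omega v.1 u.1 v.2 u.2 = 0) (h2 : p.omega w.1 v.1 w.2 v.2 = 0)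
    (h3 : p.omega u.1 w.1 u.2 w.2 = 0) : (F * G) S = 0 := by
  by_cases hS : Admissible S
  swap
  · exact ShFun.eq_zero _ hS
  rw [ShFun.mul_apply _ _ hS]
  refine sum_eq_zero fun I _ => ?_
  have hc : ∀ a b : Fin m × ℂ, a ∈ S → b ∈ S → p.omega a.1 b.1 a.2 b.2 = 0 → a ∈ I → b ∉ I →
      F I * G (S \ I) * ShFun.cross p I (S \ I) = 0 := fun a b _ hb h0 haI hbI => by
    rw [ShFun.cross, prod_eq_zero haI (prod_eq_zero (mem_sdiff.2 ⟨hb, hbI⟩) h0), mul_zero]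
  by_cases huI : u ∈ I <;> by_cases hvI : v ∈ I <;> by_cases hwI : w ∈ I
  · rw [hF I huI hvI hwI]; ring
  · exact hc u w hu hw h3 huI hwI
  · exact hc w v hw hv h2 hwI hvI
  · exact hc u w hu hw h3 huI hwI
  · exact hc v u hv hu h1 hvI huI
  · exact hc v u hv hu h1 hvI huI
  · exact hc w v hw hv h2 hwI hvI
  · rw [hG (S \ I) (mem_sdiff.2 ⟨hu, huI⟩) (mem_sdiff.2 ⟨hv, hvI⟩) (mem_sdiff.2 ⟨hw, hwI⟩)]; ring

lemma omega_self (i : Fin m) {x y : ℂ} (h : x = p.q2 * y) : p.omega i i x y = 0 := by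
  subst h
  simp [Params.omega]

lemma finRotate_ne (hm : m ≠ 1) (i : Fin m) : finRotate m i ≠ i := by
  obtain _ | _ | m := m
  · exact i.elim0
  · exact absurd rfl hm
  · rw [finRotate_apply]; simp

lemma finRotate_finRotate_ne (hm : m ≠ 1) (hm' : m ≠ 2) (i : Fin m) :
    finRotate m (finRotate m i) ≠ i := by
  obtain _ | _ | _ | m := m
  · exact i.elim0
  · exact absurd rfl hm
  · exact absurd rfl hm'
  · intro h
    simp only [finRotate_apply] at h
    have := congrArg Fin.val (add_eq_left.1 ((add_assoc i 1 1).symm.trans h))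
    simp only [Fin.val_add, Fin.val_one, Fin.val_zero] at this
    rw [Nat.mod_eq_of_lt (by omega)] at this
    omega

lemma omega_up (i : Fin m) {x y : ℂ} (h : x = p.q1 * y) :
    p.omega i (finRotate m i) x y = 0 := by
  subst h
  by_cases hm : m = 1
  · simp [Params.omega, hm]
  · rw [Params.omega, if_neg hm, if_neg (finRotate_ne hm i).symm]
    by_cases hm' : m = 2
    · rw [if_pos hm']; simp
    rw [if_neg hm', if_pos rfl]
    simp

lemma omega_down (i : Fin m) {x y : ℂ} (h : x = p.q3 * y) :
    p.omega (finRotate m i) i x y = 0 := by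
  subst h
  by_cases hm : m = 1
  · simp [Params.omega, hm]
  · rw [Params.omega, if_neg hm, if_neg (finRotate_ne hm i)]
    by_cases hm' : m = 2
    · rw [if_pos hm']; simp
    · rw [if_neg hm', if_neg (finRotate_finRotate_ne hm hm' i).symm, if_pos rfl]; simp

open Classical in
lemma card_conf_fiber {ι : Type} [Fintype ι] (c : ι → Fin m) (A : Finset ι) {x : ι → ℂ}
    (hx : Distinct x) (i : Fin m) :
    ((A.image fun l => (c l, x l)).filter fun u => u.1 = i).card =
      (A.filter fun l => c l = i).card := by
  rw [filter_image, card_image_of_injective]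
  intro a b h
  exact hx.2 (Prod.ext_iff.1 h).2

open Classical in
lemma laurent_sub {ι : Type} [Fintype ι] (c : ι → Fin m) (A : Finset ι) {N : Fin m → ℕ}
    {F : ShFun m p} (hF : F ∈ Sh p N) :
    IsLaurent fun x : ι → ℂ => F (A.image fun l => (c l, x l)) *
      ∏ l ∈ A, ∏ l' ∈ A, if l ≠ l' ∧ c l' = finRotate m (c l) then x l - x l' else 1 := by
  obtain ⟨h1, ⟨f, k, hf⟩, -, -⟩ := hF
  by_cases hN : ∀ i, (A.filter fun l => c l = i).card = N i
  swap
  · refine (IsLaurent.const 0).congr fun x hx => ?_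
    have : F (A.image fun l => (c l, x l)) = 0 := by
      by_contra h
      exact hN fun i => by rw [← card_conf_fiber c A hx i]; exact h1 _ h i
    rw [this, zero_mul]
  let eq : ∀ i, Fin (N i) ≃ {l // l ∈ A.filter fun l => c l = i} := fun i =>
    (Finset.equivFinOfCardEq (hN i)).symm
  let e : (Σ i, Fin (N i)) → ι := fun s => (eq s.1 s.2).1
  have heA : ∀ s, e s ∈ A ∧ c (e s) = s.1 := fun s => mem_filter.1 (eq s.1 s.2).2
  have he : Function.Injective e := by
    rintro ⟨i, a⟩ ⟨j, b⟩ h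
    have hij : i = j := (heA ⟨i, a⟩).2.symm.trans ((congrArg c h).trans (heA ⟨j, b⟩).2)
    subst hij
    have : a = b := (eq i).injective (Subtype.ext h)
    rw [this]
  have hA : univ.image e = A := by
    ext l
    constructor
    · intro h
      obtain ⟨s, -, rfl⟩ := mem_image.1 h
      exact (heA s).1
    · intro h
      refine mem_image.2 ⟨⟨c l, (eq (c l)).symm ⟨l, mem_filter.2 ⟨h, rfl⟩⟩⟩, mem_univ _, ?_⟩
      simp [e]
  refine ⟨MvPolynomial.rename e f * (∏ l ∈ Aᶜ, MvPolynomial.X l) ^ k, k, fun x hx => ?_⟩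
  have hxe : Distinct (x ∘ e) := ⟨fun s => hx.1 _, hx.2.comp he⟩
  have hconf : (A.image fun l => (c l, x l)) = conf Sigma.fst (x ∘ e) := by
    conv_lhs => rw [← hA]
    rw [image_image, conf]
    refine image_congr fun s _ => ?_
    simp [(heA s).2]
  have hpole : (∏ l ∈ A, ∏ l' ∈ A,
      if l ≠ l' ∧ c l' = finRotate m (c l) then x l - x l' else 1) =
      poleDenom Sigma.fst (x ∘ e) := by
    conv_lhs => rw [← hA]
    rw [prod_image he.injOn, poleDenom]
    refine prod_congr rfl fun s _ => ?_
    rw [prod_image he.injOn]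
    refine prod_congr rfl fun s' _ => ?_
    rw [(heA s).2, (heA s').2]
    simp [he.eq_iff]
  have hmon : ∏ l, x l = (∏ s, (x ∘ e) s) * ∏ l ∈ Aᶜ, x l := by
    rw [← prod_mul_prod_compl A]
    congr 1
    conv_lhs => rw [← hA]
    rw [prod_image he.injOn]; rfl
  have h2 := hxe.prod_ne_zero
  have h3 := poleDenom_ne_zero Sigma.fst hxe
  beta_reduce
  rw [hconf, hpole, hf _ hxe, hmon, map_mul, map_pow, map_prod, MvPolynomial.eval_rename]
  simp only [MvPolynomial.eval_X]
  field_simp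
  ring

lemma laurent_omega {ι : Type} [Fintype ι] (p : Params) (c : ι → Fin m) {l l' : ι} (h : l ≠ l')
    (w : (ι → ℂ) → ℂ)
    (hw : IsLaurent w)
    (hw' : c l = c l' → (∀ x, w x = x l - x l') ∨ (∀ x, w x = - (x l - x l'))) :
    IsLaurent fun x => p.omega (c l) (c l') (x l) (x l') *
      ((if c l' = finRotate m (c l) then x l - x l' else 1) *
        (if c l = finRotate m (c l') then x l' - x l else 1) * w x) := by
  have hlin : ∀ a : ℂ, IsLaurent fun x : ι → ℂ => x l - a * x l' := fun a =>
    (IsLaurent.coord l).sub ((IsLaurent.const a).mul (IsLaurent.coord l'))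
  have h0 : ∀ x : ι → ℂ, Distinct x → x l - x l' ≠ 0 := fun x hx =>
    sub_ne_zero.2 fun e => h (hx.2 e)
  by_cases hm : m = 1
  · subst hm
    have h1 : ∀ i j : Fin 1, i = j := fun i j => Subsingleton.elim i j
    have e : ∀ a : ℂ, IsLaurent fun x : ι → ℂ =>
        a * ((x l - p.q1 * x l') * (x l - p.q2 * x l') * (x l - p.q3 * x l')) := fun a =>
      (IsLaurent.const a).mul (((hlin _).mul (hlin _)).mul (hlin _))
    rcases hw' (h1 _ _) with hw' | hw'
    · refine (e (-1)).congr fun x hx => ?_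
      have := h0 x hx
      rw [Params.omega, if_pos rfl, if_pos (h1 _ _), if_pos (h1 _ _), hw']
      field_simp
      ring
    · refine (e 1).congr fun x hx => ?_
      have := h0 x hx
      rw [Params.omega, if_pos rfl, if_pos (h1 _ _), if_pos (h1 _ _), hw']
      field_simp
      ring
  by_cases hc : c l = c l'
  · have h1 : c l' ≠ finRotate m (c l) := by rw [← hc]; exact (finRotate_ne hm _).symm
    have h2 : c l ≠ finRotate m (c l') := by rw [← hc]; exact (finRotate_ne hm _).symm
    rcases hw' hc with hw' | hw'
    · refine (hlin p.q2).congr fun x hx => ?_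
      have := h0 x hx
      rw [Params.omega, if_neg hm, if_pos hc, if_neg h1, if_neg h2, hw']
      field_simp
    · refine ((IsLaurent.const (-1)).mul (hlin p.q2)).congr fun x hx => ?_
      have := h0 x hx
      rw [Params.omega, if_neg hm, if_pos hc, if_neg h1, if_neg h2, hw']
      field_simp
  by_cases hm' : m = 2
  · subst hm'
    have h1 : ∀ i j : Fin 2, i ≠ j → i = finRotate 2 j := by decide
    refine ((IsLaurent.const (-1)).mul (((hlin p.q1).mul (hlin p.q3)).mul hw)).congr
      fun x hx => ?_
    have := h0 x hx
    rw [Params.omega, if_neg hm, if_neg hc, if_pos rfl, if_pos (h1 _ _ (Ne.symm hc)),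
      if_pos (h1 _ _ hc)]
    field_simp
    ring
  by_cases h1 : c l' = finRotate m (c l)
  · have h2 : c l ≠ finRotate m (c l') := by
      rw [h1]; exact (finRotate_finRotate_ne hm hm' _).symm
    refine ((hlin p.q1).mul hw).congr fun x hx => ?_
    have := h0 x hx
    rw [Params.omega, if_neg hm, if_neg hc, if_neg hm', if_pos h1, if_pos h1, if_neg h2]
    field_simp
  by_cases h2 : c l = finRotate m (c l')
  · refine (((IsLaurent.const (-p.d)).mul (hlin p.q3)).mul hw).congr fun x hx => ?_
    have := h0 x hx
    rw [Params.omega, if_neg hm, if_neg hc, if_neg hm', if_neg h1, if_pos h2, if_neg h1,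
      if_pos h2]
    field_simp
    ring
  · refine hw.congr fun x _ => ?_
    rw [Params.omega, if_neg hm, if_neg hc, if_neg hm', if_neg h1, if_neg h2, if_neg h1,
      if_neg h2]
    ring

open Classical in
lemma laurent_mul {ι : Type} [Fintype ι] (c : ι → Fin m) {M N : Fin m → ℕ}
    {F G : ShFun m p} (hF : F ∈ Sh p M) (hG : G ∈ Sh p N) (s : Finset (ι × ι))
    (hs : ∀ a ∈ s, c a.1 = c a.2 ∧ a.1 ≠ a.2)
    (hs' : ∀ l l', l ≠ l' → c l = c l' → ((l, l') ∈ s ↔ (l', l) ∉ s)) :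
    IsLaurent fun x : ι → ℂ => (F * G) (conf c x) *
      (poleDenom c x * ∏ a ∈ s, (x a.1 - x a.2)) := by
  let δ : (ι → ℂ) → ι → ι → ℂ := fun x l l' =>
    if l ≠ l' ∧ c l' = finRotate m (c l) then x l - x l' else 1
  let w : (ι → ℂ) → ι → ι → ℂ := fun x l l' => if (l, l') ∈ s then x l - x l' else 1
  have hV : ∀ x : ι → ℂ, ∏ a ∈ s, (x a.1 - x a.2) = ∏ l, ∏ l', w x l l' := by
    intro x
    rw [← Finset.prod_product' univ univ, univ_product_univ, prod_ite]
    simp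
  have hsplit : ∀ (g : ι → ι → ℂ) (A : Finset ι), ∏ l, ∏ l', g l l' =
      (∏ l ∈ A, ∏ l' ∈ A, g l l') * (∏ l ∈ Aᶜ, ∏ l' ∈ Aᶜ, g l l') *
        ∏ l ∈ A, ∏ l' ∈ Aᶜ, (g l l' * g l' l) := by
    intro g A
    have h1 : ∀ l, ∏ l', g l l' = (∏ l' ∈ A, g l l') * ∏ l' ∈ Aᶜ, g l l' := fun l =>
      (prod_mul_prod_compl A _).symm
    simp only [h1]
    rw [← prod_mul_prod_compl A]
    simp only [prod_mul_distrib]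
    rw [prod_comm (s := Aᶜ) (t := A)]
    ring
  have hwL : ∀ l l', IsLaurent fun x : ι → ℂ => w x l l' := by
    intro l l'
    by_cases h : (l, l') ∈ s
    · simpa [w, h] using (IsLaurent.coord l).sub (IsLaurent.coord l')
    · simpa [w, h] using IsLaurent.const 1
  have hterm : ∀ A : Finset ι, IsLaurent fun x : ι → ℂ =>
      F (A.image fun l => (c l, x l)) * G (Aᶜ.image fun l => (c l, x l)) *
        (∏ l ∈ A, ∏ l' ∈ Aᶜ, p.omega (c l) (c l') (x l) (x l')) *
          ((∏ l, ∏ l', δ x l l') * ∏ l, ∏ l', w x l l') := by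
    intro A
    have e1 := (laurent_sub c A hF).mul (laurent_sub c Aᶜ hG)
    have e2 : IsLaurent fun x : ι → ℂ =>
        (∏ l ∈ A, ∏ l' ∈ A, w x l l') * ∏ l ∈ Aᶜ, ∏ l' ∈ Aᶜ, w x l l' :=
      (IsLaurent.prod _ fun l _ => IsLaurent.prod _ fun l' _ => hwL l l').mul
        (IsLaurent.prod _ fun l _ => IsLaurent.prod _ fun l' _ => hwL l l')
    have e3 : IsLaurent fun x : ι → ℂ => ∏ l ∈ A, ∏ l' ∈ Aᶜ,
        (p.omega (c l) (c l') (x l) (x l') *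
          ((δ x l l' * δ x l' l) * (w x l l' * w x l' l))) := by
      refine IsLaurent.prod _ fun l hl => IsLaurent.prod _ fun l' hl' => ?_
      have hne : l ≠ l' := fun e => (mem_compl.1 hl') (e ▸ hl)
      refine (laurent_omega p c hne _ ((hwL l l').mul (hwL l' l)) fun hc => ?_).congr
        fun x _ => by simp [δ, hne, hne.symm]
      have := hs' l l' hne hc
      by_cases h : (l, l') ∈ s
      · have h2 := this.1 h
        left; intro x; simp [w, h, h2]
      · have h2 : (l', l) ∈ s := by tauto
        right; intro x; simp [w, h, h2]
    refine ((e1.mul e2).mul e3).congr fun x _ => ?_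
    rw [hsplit _ A, hsplit (w x) A]
    simp only [prod_mul_distrib]
    ring
  refine (IsLaurent.sum (univ : Finset (Finset ι)) fun A _ => hterm A).congr fun x hx => ?_
  have hinj : Function.Injective fun l => (c l, x l) := fun a b h => hx.2 (Prod.ext_iff.1 h).2
  rw [← sum_mul, hV]
  congr 1
  rw [ShFun.mul_apply _ _ (hx.admissible c), conf, powerset_image,
    sum_image (Finset.image_injective hinj).injOn, powerset_univ]
  refine sum_congr rfl fun A _ => ?_
  rw [← image_sdiff _ _ hinj, ← compl_eq_univ_sdiff, ShFun.cross, prod_image hinj.injOn]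
  congr 1
  refine prod_congr rfl fun l _ => ?_
  rw [prod_image hinj.injOn]

/-- The pairs of variables of the same colour, the larger index first. -/
def pairs (N : Fin m → ℕ) : Finset ((Σ i, Fin (N i)) × (Σ i, Fin (N i))) :=
  univ.filter fun z => z.1.1 = z.2.1 ∧ z.2.2.val < z.1.2.val

lemma mem_pairs {N : Fin m → ℕ} {i j : Fin m} {a : Fin (N i)} {b : Fin (N j)} :
    ((⟨i, a⟩, ⟨j, b⟩) : (Σ i, Fin (N i)) × (Σ i, Fin (N i))) ∈ pairs N ↔
      i = j ∧ b.val < a.val := by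
  simp [pairs]

lemma prod_pairs (N : Fin m → ℕ) (x : (Σ i, Fin (N i)) → ℂ) :
    ∏ a ∈ pairs N, (x a.1 - x a.2) = ∏ i, (Matrix.vandermonde fun a => x ⟨i, a⟩).det := by
  simp only [Matrix.det_vandermonde]
  simp only [prod_sigma']
  symm
  refine prod_bij (fun z _ => (⟨z.1, z.2.2⟩, ⟨z.1, z.2.1⟩)) ?_ ?_ ?_ ?_
  · rintro ⟨i, a, b⟩ h
    simpa [pairs] using h
  · rintro ⟨i, a, b⟩ h ⟨i', a', b'⟩ h' e
    simp only [Prod.mk.injEq, Sigma.mk.injEq] at e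
    obtain ⟨⟨rfl, e1⟩, -, e2⟩ := e
    rw [eq_of_heq e1, eq_of_heq e2]
  · rintro ⟨⟨i, a⟩, ⟨j, b⟩⟩ h
    obtain ⟨rfl, h⟩ := mem_pairs.1 h
    exact ⟨⟨i, b, a⟩, by simpa using h, rfl⟩
  · rintro ⟨i, a, b⟩ h
    rfl

lemma prod_pairs_swap (N : Fin m → ℕ) (x : (Σ i, Fin (N i)) → ℂ) (i : Fin m) {a b : Fin (N i)}
    (hab : a ≠ b) :
    ∏ z ∈ pairs N, ((x ∘ Equiv.swap ⟨i, a⟩ ⟨i, b⟩) z.1 - (x ∘ Equiv.swap ⟨i, a⟩ ⟨i, b⟩) z.2) =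
      - ∏ z ∈ pairs N, (x z.1 - x z.2) := by
  rw [prod_pairs, prod_pairs, ← mul_prod_erase _ _ (mem_univ i), ← mul_prod_erase _ _ (mem_univ i),
    ← neg_mul]
  congr 1
  · have : (fun e => (x ∘ Equiv.swap (⟨i, a⟩ : Σ i, Fin (N i)) ⟨i, b⟩) ⟨i, e⟩) =
        (fun e => x ⟨i, e⟩) ∘ Equiv.swap a b := by
      funext e
      simp only [Function.comp, Equiv.swap_apply_def, Sigma.mk.injEq, heq_eq_eq, true_and]
      split_ifs <;> rfl
    rw [this]
    have h2 : Matrix.vandermonde ((fun e => x ⟨i, e⟩) ∘ Equiv.swap a b) =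
        (Matrix.vandermonde fun e => x ⟨i, e⟩).submatrix (Equiv.swap a b) id := rfl
    rw [h2, Matrix.det_permute, Equiv.Perm.sign_swap hab]
    simp
  · refine prod_congr rfl fun j hj => ?_
    have hj : j ≠ i := (mem_erase.1 hj).1
    congr 2
    funext e
    simp [Equiv.swap_apply_def, hj]

lemma mul_mem_Sh {M N : Fin m → ℕ} {F G : ShFun m p} (hF : F ∈ Sh p M) (hG : G ∈ Sh p N) :
    F * G ∈ Sh p (M + N) := by
  classical
  refine ⟨fun S hS i => ?_, ?_, fun S i u h1 h2 h3 => ?_, fun S i u h1 h2 h3 => ?_⟩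
  · by_cases hA : Admissible S
    swap
    · exact absurd (ShFun.eq_zero _ hA) hS
    rw [ShFun.mul_apply _ _ hA] at hS
    obtain ⟨I, hI, hne⟩ := exists_ne_zero_of_sum_ne_zero hS
    have h1 := hF.1 I (left_ne_zero_of_mul (left_ne_zero_of_mul hne)) i
    have h2 := hG.1 (S \ I) (right_ne_zero_of_mul (left_ne_zero_of_mul hne)) i
    rw [Pi.add_apply, ← h1, ← h2, ← card_union_of_disjoint
      (disjoint_filter_filter disjoint_sdiff), ← filter_union,
      union_sdiff_of_subset (mem_powerset.1 hI)]
  · obtain ⟨P, k, hP⟩ := laurent_mul (ι := Σ i, Fin ((M + N) i)) Sigma.fst hF hG (pairs (M + N))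
      (by
        rintro ⟨⟨i, a⟩, ⟨j, b⟩⟩ h
        obtain ⟨rfl, h⟩ := mem_pairs.1 h
        refine ⟨rfl, fun e => ?_⟩
        simp only [Sigma.mk.injEq, heq_eq_eq, true_and] at e
        subst e
        exact lt_irrefl _ h)
      (by
        rintro ⟨i, a⟩ ⟨j, b⟩ hne hij
        obtain rfl : i = j := hij
        have : a ≠ b := fun e => hne (by rw [e])
        simp only [pairs, mem_filter, mem_univ, true_and, not_lt, Fin.val_fin_lt, Fin.val_fin_le]
        exact ⟨fun h => h.le, fun h => lt_of_le_of_ne h this.symm⟩)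
    beta_reduce at hP
    have hdvd : (∏ a ∈ pairs (M + N), (MvPolynomial.X a.1 - MvPolynomial.X a.2) :
        MvPolynomial _ ℂ) ∣ P := by
      apply prod_dvd_of_merge
      · rintro ⟨⟨i, a⟩, ⟨j, b⟩⟩ h e
        obtain ⟨rfl, h⟩ := mem_pairs.1 h
        simp only [Sigma.mk.injEq, heq_eq_eq, true_and] at e
        subst e
        exact lt_irrefl _ h
      · rintro ⟨⟨i, a⟩, ⟨j, b⟩⟩ h e
        obtain ⟨rfl, h⟩ := mem_pairs.1 h
        have := (mem_pairs.1 e).2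
        exact lt_asymm h this
      · rintro ⟨⟨i, a⟩, ⟨j, b⟩⟩ h
        obtain ⟨rfl, h⟩ := mem_pairs.1 h
        have hab : a ≠ b := by rintro rfl; exact lt_irrefl _ h
        set σ : Equiv.Perm (Σ i, Fin ((M + N) i)) := Equiv.swap ⟨i, a⟩ ⟨i, b⟩ with hσ
        have hfst : ∀ l, (σ l).1 = l.1 := by
          intro l
          rw [hσ, Equiv.swap_apply_def]
          split_ifs with h1 h2
          · rw [h1]
          · rw [h2]
          · rfl
        have hanti : MvPolynomial.rename σ P + P = 0 := by
          refine eq_zero_of_eval fun x hx => ?_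
          have hxσ : Distinct (x ∘ σ) := ⟨fun l => hx.1 _, hx.2.comp σ.injective⟩
          have hconf : conf Sigma.fst (x ∘ σ) = conf Sigma.fst x := by
            have : (fun l => (l.1, (x ∘ σ) l)) = (fun l => (l.1, x l)) ∘ σ := by
              funext l; simp [hfst]
            rw [conf, this, ← image_image, image_univ_equiv, conf]
          have hmon : ∏ l, (x ∘ σ) l = ∏ l, x l := Equiv.prod_comp σ x
          have hpole : poleDenom Sigma.fst (x ∘ σ) = poleDenom Sigma.fst x := by
            exact Fintype.prod_equiv σ _ _ fun l => Fintype.prod_equiv σ _ _ fun l' => by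
              simp [hfst]
          rw [map_add, MvPolynomial.eval_rename, ← hP x hx, ← hP _ hxσ, hconf, hmon, hpole, hσ,
            prod_pairs_swap _ _ _ hab]
          ring
        have hm : merge (⟨i, a⟩ : Σ i, Fin ((M + N) i)) ⟨i, b⟩ (MvPolynomial.rename σ P) =
            merge ⟨i, a⟩ ⟨i, b⟩ P := by
          rw [merge, MvPolynomial.rename_rename]
          congr 2
          funext l
          simp only [Function.comp, Function.update_apply, id, hσ, Equiv.swap_apply_def]
          split_ifs <;> simp_all
        have h0 := congrArg (merge (⟨i, a⟩ : Σ i, Fin ((M + N) i)) ⟨i, b⟩) hanti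
        rw [map_add, hm, map_zero, ← two_mul] at h0
        exact (mul_eq_zero.1 h0).resolve_left two_ne_zero
    obtain ⟨Q, rfl⟩ := hdvd
    refine ⟨Q, k, fun x hx => ?_⟩
    have h1 := hP x hx
    have h2 := hx.prod_ne_zero
    have h3 := poleDenom_ne_zero Sigma.fst hx
    have h4 : ∏ a ∈ pairs (M + N), (x a.1 - x a.2) ≠ 0 := by
      refine prod_ne_zero_iff.2 ?_
      rintro ⟨⟨i, a⟩, ⟨j, b⟩⟩ h
      obtain ⟨rfl, h⟩ := mem_pairs.1 h
      refine sub_ne_zero.2 fun e => ?_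
      have := hx.2 e
      simp only [Sigma.mk.injEq, heq_eq_eq, true_and] at this
      subst this
      exact lt_irrefl _ h
    simp only [map_mul, map_prod, map_sub, MvPolynomial.eval_X] at h1
    rw [div_div, eq_div_iff (mul_ne_zero (pow_ne_zero _ h2) h3)]
    refine mul_left_cancel₀ h4 ?_
    rw [← h1]; ring
  · refine wheel_mul h1 h2 h3 (fun T => hF.2.2.1 T i u) (fun T => hG.2.2.1 T i u)
      (omega_down _ rfl) (omega_self _ rfl) (omega_up _ ?_)
    linear_combination (-u) * p.prod_eq_one
  · refine wheel_mul h1 h2 h3 (fun T => hF.2.2.2 T i u) (fun T => hG.2.2.2 T i u)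
      (omega_self _ rfl) (omega_down _ rfl) (omega_up _ ?_)
    linear_combination (-u) * p.prod_eq_one

lemma one_mem_Sh : (1 : ShFun m p) ∈ Sh p 0 := by
  classical
  refine ⟨fun S hS i => ?_, ⟨1, 0, fun x _ => ?_⟩, fun S i u h1 h2 h3 => ?_,
    fun S i u h1 h2 h3 => ?_⟩
  · rw [ShFun.one_apply] at hS
    have : S = ∅ := by by_contra h; exact hS (if_neg h)
    simp [this]
  · have : IsEmpty (Σ i : Fin m, Fin ((0 : Fin m → ℕ) i)) := ⟨fun s => Fin.elim0 s.2⟩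
    simp [ShFun.one_apply, conf, poleDenom]
  · rw [ShFun.one_apply, if_neg (ne_empty_of_mem h1)]
  · rw [ShFun.one_apply, if_neg (ne_empty_of_mem h1)]
end Closed

/-- The subalgebra `Sh⁰ₘ = ⨁_N Sh_{m,(N,…,N)}` of the shuffle algebra (for `m = 1` this is all of
`Sh₁`). The sum is direct because elements of different degrees have disjoint supports. -/
def Sh0 (m : ℕ) (p : Params) : Subalgebra ℂ (ShFun m p) :=
  Submodule.toSubalgebra (⨆ N : ℕ, Sh p fun _ : Fin m => N)
    (Submodule.mem_iSup_of_mem 0 one_mem_Sh)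
    (fun F G hF hG => by
      induction hF using Submodule.iSup_induction' with
      | mem M F hF =>
        induction hG using Submodule.iSup_induction' with
        | mem N G hG => exact Submodule.mem_iSup_of_mem (M + N) (mul_mem_Sh hF hG)
        | zero => rw [mul_zero]; exact Submodule.zero_mem _
        | add G H _ _ hG hH => rw [mul_add]; exact Submodule.add_mem _ hG hH
      | zero => rw [zero_mul]; exact Submodule.zero_mem _
      | add F H _ _ hF hH => rw [add_mul]; exact Submodule.add_mem _ hF hH)

/-- The degree `N` component `Sh⁰_{m,N} = Sh_{m,(N,…,N)}`, as a subspace of `Sh⁰ₘ`. -/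
def Sh0.deg (m : ℕ) (p : Params) (N : ℕ) : Submodule ℂ (Sh0 m p) :=
  (Sh p fun _ : Fin m => N).comap (Sh0 m p).val.toLinearMap

/-- The value at the configuration `S`, as a linear form on `Sh⁰ₘ`. -/
def Sh0.ev {m : ℕ} {p : Params} (S : Finset (Fin m × ℂ)) : Sh0 m p →ₗ[ℂ] ℂ :=
  (ShFun.evalAt S).comp (Sh0 m p).val.toLinearMap

/-- The value of an element of `Sh⁰ₘ ⊗ Sh₁` as a function of two groups of variables:
`G ⊗ H ↦ G(S) H(T)`. -/
def evTensor {m : ℕ} {p p' : Params} (S : Finset (Fin m × ℂ)) (T : Finset (Fin 1 × ℂ)) :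
    Sh0 m p ⊗[ℂ] Sh0 1 p' →ₗ[ℂ] ℂ :=
  LinearMap.mul' ℂ ℂ ∘ₗ TensorProduct.map (Sh0.ev S) (Sh0.ev T)

/-- The component of total degree `N` of `Sh⁰ₘ ⊗ Sh₁`. -/
def tensorDeg (m : ℕ) (p p' : Params) (N : ℕ) : Submodule ℂ (Sh0 m p ⊗[ℂ] Sh0 1 p') :=
  Submodule.span ℂ {t | ∃ L K : ℕ, L + K = N ∧
    ∃ G ∈ Sh0.deg m p L, ∃ H ∈ Sh0.deg 1 p' K, t = G ⊗ₜ[ℂ] H}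

/-- The value of an element of a tensor product of `m` algebras `Sh₁` as a function of `m` groups
of variables: `⨂ⱼ Hⱼ ↦ ∏ⱼ Hⱼ(Sⱼ)`. -/
def evPi {m : ℕ} {p : Fin m → Params} (S : Fin m → Finset (Fin 1 × ℂ)) :
    (⨂[ℂ] j, Sh0 1 (p j)) →ₗ[ℂ] ℂ :=
  PiTensorProduct.lift
    ((MultilinearMap.mkPiAlgebra ℂ (Fin m) ℂ).compLinearMap fun j => Sh0.ev (S j))

/-- The component of total degree `N` of a tensor product of `m` algebras `Sh₁`. -/
def piDeg {m : ℕ} (p : Fin m → Params) (N : ℕ) : Submodule ℂ (⨂[ℂ] j, Sh0 1 (p j)) :=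
  Submodule.span ℂ {t | ∃ n : Fin m → ℕ, ∑ j, n j = N ∧
    ∃ H : ∀ j, Sh0 1 (p j), (∀ j, H j ∈ Sh0.deg 1 (p j) (n j)) ∧ t = PiTensorProduct.tprod ℂ H}

/-- `q₁ ^ r = exp (r ℓ)`, where `ℓ` is the chosen value of `log q₁`. -/
def qpow (ℓ : ℂ) (r : ℚ) : ℂ := Complex.exp (r * ℓ)

/-- The parameters `(q₁ q₁^{1/(M-1)}, q₂, q₃ q₁^{-1/(M-1)})`; see `tilde_q3` for the last one. -/
def Params.tilde (p : Params) (ℓ : ℂ) (M : ℕ) : Params where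
  q := p.q
  q1 := p.q1 * qpow ℓ (1 / ((M : ℚ) - 1))
  q_ne := p.q_ne
  q1_ne := mul_ne_zero p.q1_ne (Complex.exp_ne_zero _)

lemma Params.tilde_q3 (p : Params) (ℓ : ℂ) (M : ℕ) :
    (p.tilde ℓ M).q3 = p.q3 * qpow ℓ (-(1 / ((M : ℚ) - 1))) := by
  have : qpow ℓ (-(1 / ((M : ℚ) - 1))) = (qpow ℓ (1 / ((M : ℚ) - 1)))⁻¹ := by
    rw [qpow, qpow, ← Complex.exp_neg]; push_cast; ring_nf
  rw [this, q3, q3, q2, q2, tilde, ← mul_inv]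
  ring_nf

/-- The value of `log (q₁ q₁^{1/(M-1)})` that goes with the value `ℓ` of `log q₁`. -/
def logTilde (ℓ : ℂ) (M : ℕ) : ℂ := ℓ + ((1 / ((M : ℚ) - 1) : ℚ) : ℂ) * ℓ

lemma exp_logTilde (p : Params) {ℓ : ℂ} (h : Complex.exp ℓ = p.q1) (M : ℕ) :
    Complex.exp (logTilde ℓ M) = (p.tilde ℓ M).q1 := by
  rw [logTilde, Complex.exp_add, h]; rfl

/-- The parameters `(q₁ q₃^{-M+1}, q₂, q₃^M)`; see `fused_q3` for the last one. -/
def Params.fused (p : Params) (M : ℕ) : Params where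
  q := p.q
  q1 := p.q1 * p.q3 ^ (-(M : ℤ) + 1)
  q_ne := p.q_ne
  q1_ne := mul_ne_zero p.q1_ne (zpow_ne_zero _ p.q3_ne)

lemma Params.fused_q3 (p : Params) (M : ℕ) : (p.fused M).q3 = p.q3 ^ M := by
  have h3 := p.q3_ne
  have h : p.q3 ^ (-(M : ℤ) + 1) * p.q3 ^ M = p.q3 := by
    rw [← zpow_natCast, ← zpow_add₀ h3, neg_add_cancel_comm, zpow_one]
  rw [q3, inv_eq_iff_eq_inv]
  refine eq_inv_of_mul_eq_one_left ?_
  have h1 := p.prod_eq_one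
  change p.q1 * p.q3 ^ (-(M : ℤ) + 1) * p.q2 * p.q3 ^ M = 1
  linear_combination (p.q1 * p.q2) * h + h1

/-- The parameters `(q₂^j q₁^M, q₂, q₂^{-j-1} q₁^{-M})`; see `iter_q3` for the last one. -/
def Params.iter (p : Params) (M j : ℕ) : Params where
  q := p.q
  q1 := p.q2 ^ j * p.q1 ^ M
  q_ne := p.q_ne
  q1_ne := mul_ne_zero (pow_ne_zero _ p.q2_ne) (pow_ne_zero _ p.q1_ne)

lemma Params.iter_q3 (p : Params) (M j : ℕ) :
    (p.iter M j).q3 = p.q2 ^ (-(j : ℤ) - 1) * p.q1 ^ (-(M : ℤ)) := by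
  have h2 := p.q2_ne
  have h1 := p.q1_ne
  change (p.q2 ^ j * p.q1 ^ M * p.q2)⁻¹ = _
  rw [zpow_neg, zpow_natCast, show -(j : ℤ) - 1 = -((j + 1 : ℕ) : ℤ) by push_cast; ring, zpow_neg,
    zpow_natCast, ← mul_inv, pow_succ]
  ring_nf

/-- With `M = m + 2` colours in the source: the specialization of the variables `x_{i,a}`,
`1 ≤ i ≤ M`, to `y_{i,a}` (`1 ≤ i ≤ M - 1`, `1 ≤ a ≤ L`) and `z_b` (`1 ≤ b ≤ K`):
`x_{i,a} = q₁^{-(M-i)/(M-1)} y_{i,a}` with `y_{M,a} = y_{1,a}`, and `x_{i,L+b} = q₃^{i-1} z_b`.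
In the code colours are counted from `0`. -/
def specialize (m : ℕ) (p : Params) (ℓ : ℂ) {L K : ℕ} (y : Fin (m + 1) → Fin L → ℂ)
    (z : Fin K → ℂ) : Fin (m + 2) × (Fin L ⊕ Fin K) → ℂ
  | (i, Sum.inl a) =>
      qpow ℓ (-(((m + 2 : ℕ) : ℚ) - ((i : ℕ) + 1)) / (((m + 2 : ℕ) : ℚ) - 1)) *
        y (Fin.ofNat (m + 1) i) a
  | (i, Sum.inr b) => p.q3 ^ (i : ℕ) * z b

/-- The constant in the fusion factor, for `M = m + 2` colours in the source. For `M ≥ 4` it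
collects the powers of `d`; it is different for `M = 2, 3` because the structure functions for one
and two colours are normalized without `d`. -/
def fusionConst (m : ℕ) (p : Params) (ℓ : ℂ) (L K : ℕ) : ℂ :=
  if m = 0 then p.q1 ^ L.choose 2
  else (if m = 1 then (p.d * qpow ℓ (1 / 2)) ^ (2 * L.choose 2) else 1) *
    p.d ^ (L.choose 2 + (m + 2) * K.choose 2 + (m + 2) * (L * K))

/-- The ratio of `F` at the specialized variables to its fusion `F̃(y; z)`, for `M = m + 2` colours
in the source. For `M = 2` the factors with `a = b` are left out of the second product. -/
def fusionFactor (m : ℕ) (p : Params) (ℓ : ℂ) {L K : ℕ} (y : Fin (m + 1) → Fin L → ℂ)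
    (z : Fin K → ℂ) : ℂ :=
  let M : ℕ := m + 2
  let u : Fin (m + 1) → Fin L → ℂ := fun i a =>
    qpow ℓ (-((M : ℚ) - ((i : ℕ) + 1)) / ((M : ℚ) - 1)) * y i a
  fusionConst m p ℓ L K
  * (∏ a : Fin L, ∏ b ∈ Finset.Ioi a,
      ((y 0 a - p.q2 * y 0 b) * (y 0 a - p.q2⁻¹ * y 0 b))
        / ((y 0 a - p.q1 * y 0 b) * (y 0 a - p.q1⁻¹ * y 0 b)))
  * (∏ i : Fin (m + 1), ∏ a : Fin L, ∏ b : Fin L,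
      if m = 0 ∧ a = b then 1
      else (y i a - y (i + 1) b) / (y i a - qpow ℓ (1 / ((M : ℚ) - 1)) * y (i + 1) b))
  * (∏ a : Fin K, ∏ b ∈ Finset.Ioi a,
      (((z a - p.q2 * z b) * (z a - p.q2⁻¹ * z b))
        / ((z a - p.q3 * z b) * (z a - p.q3⁻¹ * z b))) ^ (M - 1)
      * ((z a - z b) ^ 2
        / ((z a - p.q3 ^ ((M : ℤ) - 1) * z b) * (z a - p.q3 ^ (-(M : ℤ) + 1) * z b))))
  * (∏ a : Fin L, ∏ b : Fin K,
      (∏ i : Fin (m + 1), if i = 0 then 1 else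
        ((u i a - p.q1 * p.q3 ^ ((i : ℤ) + 1) * z b)
          * (u i a - p.q1⁻¹ * p.q3 ^ ((i : ℤ) - 1) * z b))
        / ((u i a - p.q3 ^ ((i : ℤ) + 1) * z b) * (u i a - p.q3 ^ ((i : ℤ) - 1) * z b)))
      * (((y 0 a - p.q1 ^ 2 * p.q3 * z b) * (y 0 a - p.q3⁻¹ * z b))
        / ((y 0 a - p.q1 * p.q3 * z b) * (y 0 a - z b)))
      * (((y 0 a - p.q1⁻¹ * p.q3 ^ ((M : ℤ) - 2) * z b) * (y 0 a - p.q1 * p.q3 ^ (M : ℤ) * z b))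
        / ((y 0 a - p.q3 ^ ((M : ℤ) - 2) * z b) * (y 0 a - p.q1 * p.q3 ^ ((M : ℤ) - 1) * z b))))

/-- `π` is the fusion map `F ↦ ∑_L F̃_{N,L}`, with `M = m + 2` colours in the source: if `L` is
the number of variables of each colour in the first tensor factor and `K` the number of variables
in the second one, then the value of `π F` at `(y; z)` is the value of `F` at the specialized
variables divided by the fusion factor. This is required wherever all the quantities involved
are defined, that is, on a non-empty Zariski open set of points `(y; z)`. (For these `L` and `K`
only the component of `F` of degree `N = L + K` contributes.) -/
def IsFusion (m : ℕ) (p : Params) (ℓ : ℂ)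
    (π : Sh0 (m + 2) p →ₐ[ℂ] Sh0 (m + 1) (p.tilde ℓ (m + 2)) ⊗[ℂ] Sh0 1 (p.fused (m + 2))) :
    Prop :=
  ∀ (F : Sh0 (m + 2) p) (L K : ℕ) (y : Fin (m + 1) → Fin L → ℂ) (z : Fin K → ℂ),
    Distinct (Function.uncurry y) → Distinct z → Distinct (specialize m p ℓ y z) →
      evTensor (conf Prod.fst (Function.uncurry y)) (conf (fun _ => 0) z) (π F) *
          fusionFactor m p ℓ y z =
        Sh0.ev (conf Prod.fst (specialize m p ℓ y z)) F

/-- `Φ` is the iterated fusion map on `Sh⁰_{m+1}`: for one colour it is the identity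
`Sh₁ = Sh₁`, and for `m + 2` colours it is `(Φ' ⊗ id) ∘ π`, where `π` is the fusion map and
`Φ'` is the iterated fusion map on the first tensor factor of its target. The identities are
written in terms of values, so that the last tensor factor is evaluated at `T` and the
other ones at `S`. -/
def IsIteratedFusion : (m : ℕ) → (p : Params) → (ℓ : ℂ) →
    (Sh0 (m + 1) p →ₐ[ℂ] ⨂[ℂ] j : Fin (m + 1), Sh0 1 (p.iter (m + 1) j)) → Prop
  | 0, _, _, Φ => ∀ F S, evPi S (Φ F) = Sh0.ev (S 0) F
  | m + 1, p, ℓ, Φ =>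
      ∃ (π : Sh0 (m + 2) p →ₐ[ℂ] Sh0 (m + 1) (p.tilde ℓ (m + 2)) ⊗[ℂ] Sh0 1 (p.fused (m + 2)))
        (Φ' : Sh0 (m + 1) (p.tilde ℓ (m + 2)) →ₐ[ℂ]
          ⨂[ℂ] j : Fin (m + 1), Sh0 1 ((p.tilde ℓ (m + 2)).iter (m + 1) j)),
        IsFusion m p ℓ π ∧
        IsIteratedFusion m (p.tilde ℓ (m + 2)) (logTilde ℓ (m + 2)) Φ' ∧
        ∀ F (S : Fin (m + 1) → Finset (Fin 1 × ℂ)) (T : Finset (Fin 1 × ℂ)),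
          evPi (Fin.snoc (α := fun _ => Finset (Fin 1 × ℂ)) S T) (Φ F) =
            LinearMap.mul' ℂ ℂ
              (TensorProduct.map (evPi S ∘ₗ Φ'.toLinearMap) (Sh0.ev T) (π F))

end
end Shuffle

/-! Every variable of the target has a fibre of source points (`fib`). Above `y_i` with `i ≠ 0`
there is one point, of colour `i`. Above `y_0` there are two points with ratio `q₁`, of the first
and of the last colour. Above `z` there is a chain with ratio `q₃`, one point of each colour. Fusing
`F` means evaluating it on a union of fibres (`spec`) and dividing by a factor `psi`.

Multiplicativity: in `F * G` at such a configuration, the zeros of the structure functions force a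
contributing part `I` to contain, with a point of a fibre, all lower points of that fibre. A
homogeneous `F` has equally many points of the first and of the last colour, and counting then shows
that `I` is a union of whole fibres (`Good.exists_spec_eq`). So only decompositions of the target
variables survive. Between two fibres the source structure functions multiply to the target
structure function times a symmetric function `g` (`cross_fib_eq`). Dividing by the product of `g`
over unordered pairs therefore turns one shuffle product into the other (`IsFused.mul`). For a mixed
pair `y`, `z` both orders give the same `g`, as the tensor product of algebras requires.

Regularity and wheel conditions: up to a monomial, `psi` times the source pole denominator is the
target pole denominator times a product `num` of powers of linear forms `u - α v`
(`exists_psi_mul_poleDenom`). Each form comes from wheels of the source, so the specialized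
numerator of `F` is divisible by `num` (`lin_pow_dvd_spl`, `exists_quotient`). The quotient
satisfies the wheel conditions of the target, because on a target wheel the source numerator
vanishes to one order more than `num` does (`wheel_inr_up`, `wheel_inr_down`, `wheel_inl_up`,
`wheel_inl_down`). Higher orders are obtained by moving points of a fibre independently: a
polynomial that vanishes as soon as one of `r` parameters does vanishes to order `r`
(`pow_card_dvd_aeval`).

Tensor products: the fused function is symmetric and of finite rank in `(y; z)`. Its sections lie in
the two shuffle algebras, and `exists_sum_mul` uses them to write it as an element of the tensor
product (`exists_tensor`). Such an element is determined by its values at generic points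
(`eq_zero_of_evTensor`), so the fusion is unique, hence linear, multiplicative and graded. The
iteration rests on the matching of parameters (`Params.tilde_iter`, `Params.fused_eq_iter`) and on
the inheritance of genericity (`Params.Generic.tilde`). -/

namespace Shuffle
open Finset
noncomputable section

/-! ### Divisibility by linear forms and orders of vanishing -/

section Polynomial
variable {κ : Type}

open Classical in
/-- The ideal generated by `X_u - r`, where `r` does not involve `X_u`, consists of the polynomials that
vanish on the graph `x_u = r(x)`. -/
lemma X_sub_dvd_iff (u : κ) (r : MvPolynomial κ ℂ)
    (hr : ∀ (w : κ → ℂ) (a : ℂ), MvPolynomial.eval (Function.update w u a) r = MvPolynomial.eval w r)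
    (P : MvPolynomial κ ℂ) :
    (MvPolynomial.X u - r) ∣ P ↔
      ∀ w, w u = MvPolynomial.eval w r → MvPolynomial.eval w P = 0 := by
  constructor
  · rintro ⟨Q, rfl⟩ w hw
    simp [hw]
  · intro h
    set φ : MvPolynomial κ ℂ →ₐ[ℂ] MvPolynomial κ ℂ :=
      MvPolynomial.aeval (Function.update MvPolynomial.X u r) with hφ
    have key : ∀ P : MvPolynomial κ ℂ, (MvPolynomial.X u - r) ∣ P - φ P := by
      intro P
      induction P using MvPolynomial.induction_on with
      | C a => simp [hφ]
      | add P Q hP hQ => rw [map_add, add_sub_add_comm]; exact dvd_add hP hQ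
      | mul_X P n hP =>
        have : P * MvPolynomial.X n - φ (P * MvPolynomial.X n) =
            (P - φ P) * MvPolynomial.X n + φ P * (MvPolynomial.X n - φ (MvPolynomial.X n)) := by
          rw [map_mul]; ring
        rw [this]
        refine dvd_add (hP.mul_right _) (Dvd.dvd.mul_left ?_ _)
        by_cases hn : n = u
        · subst hn; simp [hφ]
        · simp [hφ, Function.update_of_ne hn]
    have h0 : φ P = 0 := by
      refine MvPolynomial.funext fun w => ?_
      have e : MvPolynomial.eval w (φ P) =
          MvPolynomial.eval (Function.update w u (MvPolynomial.eval w r)) P := by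
        have : (MvPolynomial.aeval w : MvPolynomial κ ℂ →ₐ[ℂ] ℂ).comp φ =
            MvPolynomial.aeval (Function.update w u (MvPolynomial.eval w r)) := by
          ext l
          by_cases hl : l = u
          · subst hl; simp [hφ]
          · simp [hφ, Function.update_of_ne hl]
        simpa [MvPolynomial.coe_aeval_eq_eval] using DFunLike.congr_fun this P
      rw [e, map_zero]
      exact h _ (by rw [hr]; simp)
    simpa [h0] using key P

open Classical in
-- Divisibility by this form means being killed by the substitution `φ`. This is a ring homomorphism
-- into a domain, so its kernel is prime.
lemma prime_X_sub (u : κ) (r : MvPolynomial κ ℂ)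
    (hr : ∀ (w : κ → ℂ) (a : ℂ), MvPolynomial.eval (Function.update w u a) r = MvPolynomial.eval w r) :
    Prime (MvPolynomial.X u - r) := by
  have hev : ∀ w : κ → ℂ, MvPolynomial.eval (Function.update w u (MvPolynomial.eval w r)) (MvPolynomial.X u - r) = 0 := by
    intro w; simp [hr]
  refine ⟨fun h => ?_, fun h => ?_, fun P Q h => ?_⟩
  · have := congrArg (MvPolynomial.eval
      (Function.update (fun _ => 0 : κ → ℂ) u (MvPolynomial.eval (fun _ => 0) r + 1))) h
    rw [map_sub, hr, MvPolynomial.eval_X] at this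
    simp at this
  · have := h.map (MvPolynomial.eval (Function.update (0 : κ → ℂ) u (MvPolynomial.eval 0 r)))
    rw [hev] at this
    exact not_isUnit_zero this
  · set φ : MvPolynomial κ ℂ →ₐ[ℂ] MvPolynomial κ ℂ :=
      MvPolynomial.aeval (Function.update MvPolynomial.X u r) with hφ
    have hφe : ∀ (P : MvPolynomial κ ℂ) (w : κ → ℂ), MvPolynomial.eval w (φ P) =
        MvPolynomial.eval (Function.update w u (MvPolynomial.eval w r)) P := by
      intro P w
      have : (MvPolynomial.aeval w : MvPolynomial κ ℂ →ₐ[ℂ] ℂ).comp φ =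
          MvPolynomial.aeval (Function.update w u (MvPolynomial.eval w r)) := by
        ext l
        by_cases hl : l = u
        · subst hl; simp [hφ]
        · simp [hφ, Function.update_of_ne hl]
      simpa [MvPolynomial.coe_aeval_eq_eval] using DFunLike.congr_fun this P
    have hiff : ∀ P : MvPolynomial κ ℂ, (MvPolynomial.X u - r) ∣ P ↔ φ P = 0 := by
      intro P
      rw [X_sub_dvd_iff u r hr]
      constructor
      · intro h
        refine MvPolynomial.funext fun w => ?_
        rw [hφe, map_zero]
        exact h _ (by rw [hr]; simp)
      · intro h w hw
        have := hφe P w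
        rw [h, map_zero, ← hw, Function.update_eq_self] at this
        exact this.symm
    rw [hiff, map_mul, mul_eq_zero] at h
    rwa [hiff, hiff]

/-- One prime at a time: `p a` divides none of the primes already split off, so `p a ^ e a` has to
divide the cofactor. -/
lemma prod_pow_dvd_of_prime {R ι : Type*} [CommRing R] [IsDomain R] (J : Finset ι) (p : ι → R)
    (e : ι → ℕ) (hp : ∀ i ∈ J, Prime (p i)) (hnd : ∀ i ∈ J, ∀ j ∈ J, i ≠ j → ¬ p i ∣ p j) {P : R}
    (h : ∀ i ∈ J, p i ^ e i ∣ P) : (∏ i ∈ J, p i ^ e i) ∣ P := by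
  classical
  induction J using Finset.induction_on with
  | empty => simp
  | insert a s ha ih =>
    obtain ⟨Q, rfl⟩ := ih (fun i hi => hp i (mem_insert_of_mem hi))
      (fun i hi j hj => hnd i (mem_insert_of_mem hi) j (mem_insert_of_mem hj))
      (fun i hi => h i (mem_insert_of_mem hi))
    rw [prod_insert ha, mul_comm (p a ^ e a)]
    refine mul_dvd_mul_left _ ((hp a (mem_insert_self _ _)).pow_dvd_of_dvd_mul_left _ ?_
      (h a (mem_insert_self _ _)))
    intro hd
    obtain ⟨j, hj, hd⟩ := ((hp a (mem_insert_self _ _)).dvd_finsetProd_iff _).1 hd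
    exact hnd a (mem_insert_self _ _) j (mem_insert_of_mem hj) (fun e => ha (e ▸ hj))
      ((hp a (mem_insert_self _ _)).dvd_of_dvd_pow hd)

/-- The linear form `X_u - α X_v`. -/
def lin (θ : κ × κ × ℂ) : MvPolynomial κ ℂ :=
  MvPolynomial.X θ.1 - MvPolynomial.C θ.2.2 * MvPolynomial.X θ.2.1

lemma eval_lin (θ : κ × κ × ℂ) (w : κ → ℂ) :
    MvPolynomial.eval w (lin θ) = w θ.1 - θ.2.2 * w θ.2.1 := by simp [lin]

lemma lin_dvd_iff {θ : κ × κ × ℂ} (h : θ.1 ≠ θ.2.1) (P : MvPolynomial κ ℂ) :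
    lin θ ∣ P ↔ ∀ w : κ → ℂ, w θ.1 = θ.2.2 * w θ.2.1 → MvPolynomial.eval w P = 0 := by
  classical
  rw [lin, X_sub_dvd_iff _ _ fun w a => by simp [Function.update_of_ne h.symm]]
  simp

lemma prime_lin {θ : κ × κ × ℂ} (h : θ.1 ≠ θ.2.1) : Prime (lin θ) := by
  classical
  exact prime_X_sub _ _ fun w a => by simp [Function.update_of_ne h.symm]

/-- A form vanishing on the hyperplane of `θ` involves only the two variables of `θ`, as unit
vectors show; the point with coordinates `α` and `1` then compares the coefficients. The second
alternative is the same hyperplane with the variables exchanged. -/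
lemma eq_of_lin_dvd {θ η : κ × κ × ℂ} (h : θ.1 ≠ θ.2.1) (h' : η.1 ≠ η.2.1) (h0 : η.2.2 ≠ 0)
    (hd : lin θ ∣ lin η) : η = θ ∨ (η.1 = θ.2.1 ∧ η.2.1 = θ.1 ∧ η.2.2 * θ.2.2 = 1) := by
  classical
  rw [lin_dvd_iff h] at hd
  obtain ⟨u, v, α⟩ := θ
  obtain ⟨u', v', β⟩ := η
  simp only [eval_lin] at *
  have h1 : u' = u ∨ u' = v := by
    by_contra! hc
    have := hd (Pi.single u' 1) (by simp [hc.1.symm, hc.2.symm])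
    simp [h'.symm] at this
  have h2 : v' = u ∨ v' = v := by
    by_contra! hc
    have := hd (Pi.single v' 1) (by simp [hc.1.symm, hc.2.symm])
    simp [h', h0] at this
  have h3 := hd (Function.update 1 u α) (by simp [Function.update_of_ne h.symm])
  rcases h1 with rfl | rfl <;> rcases h2 with rfl | rfl
  · exact absurd rfl h'
  · simp [Function.update_of_ne h.symm, sub_eq_zero] at h3
    simp [h3]
  · simp [Function.update_of_ne h.symm, sub_eq_zero] at h3
    exact Or.inr ⟨rfl, rfl, h3.symm⟩
  · exact absurd rfl h'

/-- By `eq_of_lin_dvd`, two different members of `J` can be associated only with their variables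
exchanged, and `hrev` excludes this. -/
lemma lin_prod_dvd (J : Finset (κ × κ × ℂ)) (e : κ × κ × ℂ → ℕ) (hne : ∀ θ ∈ J, θ.1 ≠ θ.2.1)
    (h0 : ∀ θ ∈ J, θ.2.2 ≠ 0)
    (hrev : ∀ θ ∈ J, ∀ η ∈ J, η.1 = θ.2.1 → η.2.1 = θ.1 → η.2.2 * θ.2.2 ≠ 1)
    {P : MvPolynomial κ ℂ} (h : ∀ θ ∈ J, lin θ ^ e θ ∣ P) : (∏ θ ∈ J, lin θ ^ e θ) ∣ P := by
  refine prod_pow_dvd_of_prime J lin e (fun θ hθ => prime_lin (hne θ hθ)) ?_ h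
  intro θ hθ η hη hn hd
  rcases eq_of_lin_dvd (hne θ hθ) (hne η hη) (h0 η hη) hd with h1 | h1
  · exact hn h1.symm
  · exact hrev θ hθ η hη h1.1 h1.2.1 h1.2.2

/-- The order of vanishing along a hyperplane can be tested on lines. -/
lemma lin_pow_dvd [DecidableEq κ] {θ : κ × κ × ℂ} (h : θ.1 ≠ θ.2.1) (e : ℕ) {P : MvPolynomial κ ℂ}
    (hP : ∀ w : κ → ℂ, (Polynomial.X ^ e : Polynomial ℂ) ∣ MvPolynomial.aeval
      (Function.update (fun l => Polynomial.C (w l)) θ.1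
        (Polynomial.C (θ.2.2 * w θ.2.1) + Polynomial.X)) P) :
    lin θ ^ e ∣ P := by
  induction e generalizing P with
  | zero => simp
  | succ e ih =>
    have h1 : lin θ ∣ P := by
      refine (lin_dvd_iff h P).2 fun w hw => ?_
      obtain ⟨Q, hQ⟩ := hP w
      have e1 := congrArg (Polynomial.aeval (0 : ℂ)) hQ
      rw [← AlgHom.comp_apply] at e1
      have e2 : ((Polynomial.aeval (0 : ℂ)).comp (MvPolynomial.aeval
          (Function.update (fun l => Polynomial.C (w l)) θ.1
          (Polynomial.C (θ.2.2 * w θ.2.1) + Polynomial.X))) : MvPolynomial κ ℂ →ₐ[ℂ] ℂ) =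
          MvPolynomial.aeval w := by
        ext l
        by_cases hl : l = θ.1
        · subst hl; simp [hw]
        · simp [Function.update_of_ne hl]
      rw [e2] at e1
      simpa [MvPolynomial.coe_aeval_eq_eval] using e1
    obtain ⟨Q, rfl⟩ := h1
    -- Along the test line `lin θ` becomes the coordinate `X`, so splitting off one factor lowers
    -- the required order by one on every line.
    rw [pow_succ']
    refine mul_dvd_mul_left _ (ih fun w => ?_)
    have h2 := hP w
    have h3 : MvPolynomial.aeval (Function.update (fun l => Polynomial.C (w l)) θ.1
        (Polynomial.C (θ.2.2 * w θ.2.1) + Polynomial.X)) (lin θ) = Polynomial.X := by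
      simp [lin, Function.update_of_ne h.symm]
    rw [map_mul, h3, pow_succ'] at h2
    exact (mul_dvd_mul_iff_left Polynomial.X_ne_zero).1 h2

/-- If a polynomial in the coordinates `φ_l(s)` vanishes as soon as one of the parameters `s_e` does, then it
vanishes to order `|E|` along a line through the origin in the parameter space. -/
lemma pow_card_dvd_aeval {ι E : Type} [Fintype E] (f : MvPolynomial ι ℂ) (φ : ι → MvPolynomial E ℂ)
    (h : ∀ (s : E → ℂ) (e : E), s e = 0 →
      MvPolynomial.eval (fun l => MvPolynomial.eval s (φ l)) f = 0) (c : E → ℂ)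
    (x : ι → Polynomial ℂ)
    (hx : ∀ l, MvPolynomial.aeval (fun e => Polynomial.C (c e) * Polynomial.X) (φ l) = x l) :
    (Polynomial.X ^ Fintype.card E : Polynomial ℂ) ∣ MvPolynomial.aeval x f := by
  classical
  set P : MvPolynomial E ℂ := MvPolynomial.aeval φ f with hP
  -- The pullback `P` to the parameter space is divisible by every coordinate, hence by their
  -- product. On the line `s_e = c_e X` this product is a constant times `X ^ |E|`.
  have hd : ∏ e : E, (MvPolynomial.X e - 0 : MvPolynomial E ℂ) ^ 1 ∣ P := by
    refine prod_pow_dvd_of_prime univ _ _ (fun e _ => prime_X_sub e 0 (by simp))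
      (fun i _ j _ hij hd => ?_) (fun e _ => ?_)
    · rw [X_sub_dvd_iff i 0 (by simp)] at hd
      have := hd (Pi.single j 1) (by simp [hij])
      simp at this
    · rw [pow_one, X_sub_dvd_iff e 0 (by simp)]
      intro w hw
      rw [← h w e (by simpa using hw)]
      have : (MvPolynomial.aeval w : MvPolynomial E ℂ →ₐ[ℂ] ℂ).comp (MvPolynomial.aeval φ) =
          MvPolynomial.aeval (fun l => MvPolynomial.eval w (φ l)) := by
        ext l; simp
      simpa [MvPolynomial.coe_aeval_eq_eval, hP] using DFunLike.congr_fun this f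
  have hc : (MvPolynomial.aeval (fun e => Polynomial.C (c e) * Polynomial.X) :
      MvPolynomial E ℂ →ₐ[ℂ] Polynomial ℂ).comp (MvPolynomial.aeval φ) = MvPolynomial.aeval x := by
    ext1 l; simp [hx]
  have := map_dvd (MvPolynomial.aeval (fun e => Polynomial.C (c e) * Polynomial.X) :
      MvPolynomial E ℂ →ₐ[ℂ] Polynomial ℂ) hd
  rw [hP, ← AlgHom.comp_apply, hc] at this
  refine Dvd.dvd.trans ?_ this
  simp only [sub_zero, pow_one, map_prod, MvPolynomial.aeval_X, prod_mul_distrib, prod_const,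
    card_univ]
  exact Dvd.intro_left _ rfl

lemma eval_aeval_poly {ι : Type} (f : MvPolynomial ι ℂ) (x : ι → Polynomial ℂ) (a : ℂ) :
    (MvPolynomial.aeval x f).eval a = MvPolynomial.eval (fun l => (x l).eval a) f := by
  have : (Polynomial.aeval a).comp (MvPolynomial.aeval x) =
      (MvPolynomial.aeval (fun l => (x l).eval a) : MvPolynomial ι ℂ →ₐ[ℂ] ℂ) := by
    ext l; simp [Polynomial.coe_aeval_eq_eval]
  simpa [MvPolynomial.coe_aeval_eq_eval, Polynomial.coe_aeval_eq_eval] using DFunLike.congr_fun this f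

/-- The substitution `x_l = c_l w_{τ l}`. -/
def monoSubst {ι : Type} (τ : ι → κ) (c : ι → ℂ) : MvPolynomial ι ℂ →ₐ[ℂ] MvPolynomial κ ℂ :=
  MvPolynomial.aeval fun l => MvPolynomial.C (c l) * MvPolynomial.X (τ l)

lemma eval_monoSubst {ι : Type} (τ : ι → κ) (c : ι → ℂ) (f : MvPolynomial ι ℂ) (w : κ → ℂ) :
    MvPolynomial.eval w (monoSubst τ c f) = MvPolynomial.eval (fun l => c l * w (τ l)) f := by
  have : (MvPolynomial.aeval w : MvPolynomial κ ℂ →ₐ[ℂ] ℂ).comp (monoSubst τ c) =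
      MvPolynomial.aeval (fun l => c l * w (τ l)) := by
    ext l; simp [monoSubst]
  simpa [MvPolynomial.coe_aeval_eq_eval] using DFunLike.congr_fun this f

lemma aeval_monoSubst {ι : Type} (τ : ι → κ) (c : ι → ℂ) (f : MvPolynomial ι ℂ)
    (w : κ → Polynomial ℂ) : MvPolynomial.aeval w (monoSubst τ c f) =
      MvPolynomial.aeval (fun l => Polynomial.C (c l) * w (τ l)) f := by
  have : (MvPolynomial.aeval w : MvPolynomial κ ℂ →ₐ[ℂ] Polynomial ℂ).comp (monoSubst τ c) =
      MvPolynomial.aeval (fun l => Polynomial.C (c l) * w (τ l)) := by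
    ext1 l; simp [monoSubst]
  exact DFunLike.congr_fun this f

/-- Multiplied by all `Q i`, the polynomial vanishes everywhere. In this way finitely many
hypersurfaces on which an argument breaks down can be disregarded. -/
lemma eq_zero_of_eval_of_ne {ι : Type*} (J : Finset ι) (Q : ι → MvPolynomial κ ℂ)
    (hQ : ∀ i ∈ J, Q i ≠ 0) {P : MvPolynomial κ ℂ}
    (h : ∀ w, (∀ i ∈ J, MvPolynomial.eval w (Q i) ≠ 0) → MvPolynomial.eval w P = 0) : P = 0 := by
  have h1 : P * ∏ i ∈ J, Q i = 0 := by
    refine MvPolynomial.funext fun w => ?_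
    rw [map_mul, map_prod, map_zero]
    by_cases hw : ∀ i ∈ J, MvPolynomial.eval w (Q i) ≠ 0
    · rw [h w hw, zero_mul]
    · push Not at hw
      obtain ⟨i, hi, h0⟩ := hw
      rw [prod_eq_zero hi h0, mul_zero]
  exact (mul_eq_zero.1 h1).resolve_right (prod_ne_zero_iff.2 hQ)

lemma two_term_ne_zero {κ : Type} {u v : κ} {a b : ℂ} (ha : a ≠ 0) (h : u = v → a ≠ b) :
    (MvPolynomial.C a * MvPolynomial.X u - MvPolynomial.C b * MvPolynomial.X v :
      MvPolynomial κ ℂ) ≠ 0 := by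
  classical
  intro h0
  by_cases huv : u = v
  · subst huv
    have := congrArg (MvPolynomial.eval fun _ => (1 : ℂ)) h0
    simp [sub_eq_zero] at this
    exact h rfl this
  · have := congrArg (MvPolynomial.eval (Pi.single u (1 : ℂ))) h0
    simp [huv, ha] at this

/-- A polynomial that vanishes at the points `x_l = c_l w_{τ l}` with distinct nonzero coordinates vanishes at all
points of this form. -/
lemma eval_eq_zero_of_distinct {ι : Type} [Fintype ι] (τ : ι → κ) (c : ι → ℂ) (hc : ∀ l, c l ≠ 0)
    (hinj : ∀ l l', τ l = τ l' → c l = c l' → l = l') {f : MvPolynomial ι ℂ}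
    (h : ∀ w : κ → ℂ, Distinct (fun l => c l * w (τ l)) →
      MvPolynomial.eval (fun l => c l * w (τ l)) f = 0) (w : κ → ℂ) :
    MvPolynomial.eval (fun l => c l * w (τ l)) f = 0 := by
  classical
  rw [← eval_monoSubst]
  have : monoSubst τ c f = 0 := by
    refine eq_zero_of_eval_of_ne (univ : Finset (ι × ι)) (fun i => if i.1 = i.2 then
      MvPolynomial.X (τ i.1) else MvPolynomial.C (c i.1) * MvPolynomial.X (τ i.1) -
        MvPolynomial.C (c i.2) * MvPolynomial.X (τ i.2)) ?_ ?_
    · rintro ⟨l, l'⟩ -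
      dsimp only
      split_ifs with hl
      · exact MvPolynomial.X_ne_zero _
      · exact two_term_ne_zero (hc l) fun h1 h2 => hl (hinj _ _ h1 h2)
    · intro w hw
      rw [eval_monoSubst]
      refine h w ⟨fun l => mul_ne_zero (hc l) ?_, fun l l' e => ?_⟩
      · simpa using hw (l, l) (mem_univ _)
      · by_contra hl
        have := hw (l, l') (mem_univ _)
        simp only [hl, if_false, map_sub, map_mul, MvPolynomial.eval_C, MvPolynomial.eval_X] at this
        exact this (sub_eq_zero.2 e)
  rw [this, map_zero]
end Polynomial

/-! ### Parameters of the fusion map -/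

lemma qpow_add (ℓ : ℂ) (r s : ℚ) : qpow ℓ (r + s) = qpow ℓ r * qpow ℓ s := by
  rw [qpow, qpow, qpow, ← Complex.exp_add]; push_cast; ring_nf

lemma qpow_pow (ℓ : ℂ) (r : ℚ) (n : ℕ) : qpow ℓ r ^ n = qpow ℓ (n * r) := by
  rw [qpow, qpow, ← Complex.exp_nat_mul]; push_cast; ring_nf

lemma qpow_neg (ℓ : ℂ) (r : ℚ) : qpow ℓ (-r) = (qpow ℓ r)⁻¹ := by
  rw [qpow, qpow, ← Complex.exp_neg]; push_cast; ring_nf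

lemma qpow_one (ℓ : ℂ) : qpow ℓ 1 = Complex.exp ℓ := by simp [qpow]

/-- The parameters of the fusion map with `m + 2` colours in the source: `p` are those of the source, `pt` and `pf`
those of the tensor factors of the target, and `t` is the chosen root of `q₁`. -/
structure FusionData (m : ℕ) where
  p : Params
  pt : Params
  pf : Params
  t : ℂ
  root : t ^ (m + 1) = p.q1
  generic : p.Generic
  pt_q : pt.q = p.q
  pt_q1 : pt.q1 = p.q1 * t
  pf_q : pf.q = p.q
  pf_q1 : pf.q1 * p.q3 ^ (m + 1) = p.q1

namespace FusionData
variable {m : ℕ} (D : FusionData m)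

lemma t_ne : D.t ≠ 0 := fun h => D.p.q1_ne (by rw [← D.root, h, zero_pow (Nat.succ_ne_zero m)])
lemma pt_q2 : D.pt.q2 = D.p.q2 := by rw [Params.q2, D.pt_q, Params.q2]
lemma pf_q2 : D.pf.q2 = D.p.q2 := by rw [Params.q2, D.pf_q, Params.q2]
lemma q3_def : D.p.q3 = D.p.q1⁻¹ * D.p.q2⁻¹ := by rw [Params.q3, mul_inv]
lemma pt_q3 : D.pt.q3 = D.p.q3 * D.t⁻¹ := by
  rw [Params.q3, D.pt_q2, D.pt_q1, Params.q3, mul_right_comm, mul_inv]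
lemma pf_q3 : D.pf.q3 = D.p.q3 ^ (m + 2) := by
  have h1 := D.p.prod_eq_one
  rw [Params.q3, inv_eq_iff_eq_inv]
  refine eq_inv_of_mul_eq_one_left ?_
  rw [D.pf_q2]
  linear_combination h1 + D.p.q2 * D.p.q3 * D.pf_q1

/-- `q₁` and `q₂` are multiplicatively independent, and `q₃` is a monomial in them. Coincidences
between coefficients are decided below by comparing exponents. -/
lemma pow_eq {a b c e : ℤ} (h : D.p.q1 ^ a * D.p.q2 ^ b = D.p.q1 ^ c * D.p.q2 ^ e) :
    a = c ∧ b = e := by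
  have h1 := D.p.q1_ne
  have h2 := D.p.q2_ne
  have := D.generic (a - c) (b - e) 0 (by
    rw [zpow_zero, mul_one, zpow_sub₀ h1, zpow_sub₀ h2, div_mul_div_comm, h, div_self]
    exact mul_ne_zero (zpow_ne_zero _ h1) (zpow_ne_zero _ h2))
  omega

lemma q3_pow (n : ℕ) : D.p.q3 ^ n = D.p.q1 ^ (-(n : ℤ)) * D.p.q2 ^ (-(n : ℤ)) := by
  rw [Params.q3, inv_pow, mul_pow, mul_inv, zpow_neg, zpow_neg, zpow_natCast, zpow_natCast]

/-- The coefficient of `y_{i,a}` in the specialization of `x_{i,a}`. -/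
def cy (i : ℕ) : ℂ := D.p.q1⁻¹ * D.t ^ i

lemma cy_ne (i : ℕ) : D.cy i ≠ 0 :=
  mul_ne_zero (inv_ne_zero D.p.q1_ne) (pow_ne_zero _ D.t_ne)
lemma cy_succ (i : ℕ) : D.cy (i + 1) = D.cy i * D.t := by rw [cy, cy, pow_succ, mul_assoc]
lemma cy_zero : D.cy 0 = D.p.q1⁻¹ := by simp [cy]
-- The last source colour carries `y` itself, at ratio `q₁` to the point of colour `0` above the
-- same variable.
lemma cy_last : D.cy (m + 1) = 1 := by rw [cy, D.root, inv_mul_cancel₀ D.p.q1_ne]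
end FusionData

/-! ### Products of structure functions over the fibres of the specialization -/

lemma eq_finRotate_iff {n : ℕ} (i j : Fin (n + 1)) :
    j = finRotate (n + 1) i ↔ (j.val = i.val + 1 ∨ (i.val = n ∧ j.val = 0)) := by
  rw [Fin.ext_iff, coe_finRotate]
  have := i.2
  have := j.2
  simp only [Fin.ext_iff, Fin.val_last]
  split_ifs <;> omega

/-- The constant in the structure functions for `m` colours. -/
def Params.delta (p : Params) (m : ℕ) : ℂ := if m ≤ 2 then 1 else p.d

lemma Params.delta_ne (p : Params) (m : ℕ) : p.delta m ≠ 0 := by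
  rw [Params.delta]
  split_ifs
  · exact one_ne_zero
  · exact mul_ne_zero p.q_ne p.q1_ne

/-- A function of coloured points that depends on whether the colours are equal or neighbours. -/
def nbr {n : ℕ} (a b c : ℂ → ℂ → ℂ) (l l' : Fin n × ℂ) : ℂ :=
  (if l.1 = l'.1 then a l.2 l'.2 else 1) * (if l'.1 = finRotate n l.1 then b l.2 l'.2 else 1) *
    (if l.1 = finRotate n l'.1 then c l.2 l'.2 else 1)

/-- With one colour all three colour conditions hold at once, and with two colours both neighbour
conditions hold for different colours. The special formulas for few colours are thus the same
product of three factors, up to the constant `delta`. -/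
lemma omega_eq_nbr (p : Params) {n : ℕ} (l l' : Fin (n + 1) × ℂ) :
    p.omega l.1 l'.1 l.2 l'.2 = nbr (fun x y => (x - p.q2 * y) / (x - y))
      (fun x y => (x - p.q1 * y) / (x - y))
      (fun x y => p.delta (n + 1) * ((x - p.q3 * y) / (x - y))) l l' := by
  obtain ⟨i, x⟩ := l
  obtain ⟨j, y⟩ := l'
  have hi := i.2
  have hj := j.2
  simp only [Params.omega, nbr, eq_finRotate_iff, Params.delta]
  simp only [Fin.ext_iff]
  by_cases h1 : n = 0
  · subst h1
    have : i.val = 0 := by omega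
    have : j.val = 0 := by omega
    simp [*]
    rw [div_mul_div_comm, div_mul_div_comm]
    congr 1 <;> ring
  by_cases h2 : n = 1
  · subst h2
    by_cases hij : i.val = j.val
    · have h3 : ¬ (j.val = i.val + 1 ∨ i.val = 1 ∧ j.val = 0) := by omega
      have h4 : ¬ (i.val = j.val + 1 ∨ j.val = 1 ∧ i.val = 0) := by omega
      rw [if_neg (by omega), if_pos hij, if_pos hij, if_neg h3, if_neg h4, mul_one, mul_one]
    · have h3 : (j.val = i.val + 1 ∨ i.val = 1 ∧ j.val = 0) := by omega
      have h4 : (i.val = j.val + 1 ∨ j.val = 1 ∧ i.val = 0) := by omega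
      rw [if_neg (by omega), if_neg hij, if_pos (by omega), if_neg hij, if_pos h3, if_pos h4, if_pos (by omega)]
      rw [one_mul, one_mul, div_mul_div_comm, pow_two]
  have h3 : ¬ (n + 1 = 1) := by omega
  have h4 : ¬ (n + 1 = 2) := by omega
  have h5 : ¬ (n + 1 ≤ 2) := by omega
  simp only [h3, h4, h5, if_false]
  by_cases hij : i.val = j.val
  · rw [if_pos hij, if_pos hij, if_neg (by omega), if_neg (by omega), mul_one, mul_one]
  · rw [if_neg hij, if_neg hij, one_mul]
    by_cases h6 : j.val = i.val + 1 ∨ i.val = n ∧ j.val = 0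
    · rw [if_pos h6, if_pos h6, if_neg (by omega), mul_one]
    · rw [if_neg h6, if_neg h6, one_mul]

/-- A variable of the target of the fusion map: a coloured point of the first tensor factor or a point of
the second one. -/
abbrev Pt (m : ℕ) : Type := (Fin (m + 1) × ℂ) ⊕ (Fin 1 × ℂ)

namespace FusionData
variable {m : ℕ} (D : FusionData m)

open Classical in
/-- The variables of the source that are specialized to a given variable of the target. -/
def fib : Pt m → Finset (Fin (m + 2) × ℂ)
  | Sum.inl (i, y) =>
      insert (i.castSucc, D.cy i * y) (if i = 0 then {(Fin.last (m + 1), y)} else ∅)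
  | Sum.inr (_, z) => univ.image fun j : Fin (m + 2) => (j, D.p.q3 ^ (j : ℕ) * z)

lemma prod_fib_inl (f : Fin (m + 2) × ℂ → ℂ) (i : Fin (m + 1)) (y : ℂ) :
    ∏ l ∈ D.fib (Sum.inl (i, y)), f l =
      f (i.castSucc, D.cy i * y) * (if i = 0 then f (Fin.last (m + 1), y) else 1) := by
  classical
  rw [fib, prod_insert]
  · split_ifs <;> simp
  · split_ifs with h
    · simp [Fin.ext_iff, h]
    · simp

lemma prod_fib_inr (f : Fin (m + 2) × ℂ → ℂ) (u : Fin 1 × ℂ) :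
    ∏ l ∈ D.fib (Sum.inr u), f l = ∏ j : Fin (m + 2), f (j, D.p.q3 ^ (j : ℕ) * u.2) := by
  classical
  rw [fib, prod_image]
  intro a _ b _ h
  exact (Prod.ext_iff.1 h).1

/-- The product of `f` over the pairs of variables above `u` and `v`. -/
def dbl (f : Fin (m + 2) × ℂ → Fin (m + 2) × ℂ → ℂ) (u v : Pt m) : ℂ :=
  ∏ l ∈ D.fib u, ∏ l' ∈ D.fib v, f l l'

/-- The neighbour relation of the source colours collapses to that of the target: the pair (`m`,
last) plays the role of the wrap-around, since `cy m * t = 1`. The last factor is what the second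
points of the fibres add: the pairs last–last, last–first and first–last above two variables of
colour `0`. -/
lemma dbl_inl_inl (a b c : ℂ → ℂ → ℂ) (i i' : Fin (m + 1)) (y y' : ℂ) :
    D.dbl (nbr a b c) (Sum.inl (i, y)) (Sum.inl (i', y')) =
      (if i = i' then a (D.cy i * y) (D.cy i * y') else 1) *
      (if i' = finRotate (m + 1) i then b (D.cy i * y) (D.cy i * D.t * y') else 1) *
      (if i = finRotate (m + 1) i' then c (D.cy i' * D.t * y) (D.cy i' * y') else 1) *
      (if i = 0 ∧ i' = 0 then a y y' * b y (D.cy 0 * y') * c (D.cy 0 * y) y' else 1) := by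
  have h1 := i.2
  have h2 := i'.2
  have hl := D.cy_last
  have hcy : ∀ {j k : ℕ}, j = k + 1 → D.cy k * D.t = D.cy j := fun h => by rw [h, D.cy_succ]
  rw [dbl, prod_fib_inl, prod_fib_inl, prod_fib_inl]
  simp only [nbr, eq_finRotate_iff]
  simp only [Fin.ext_iff, Fin.val_castSucc, Fin.val_last, Fin.val_zero]
  by_cases hi : i.val = 0 <;> by_cases hi' : i'.val = 0
  · by_cases hm : m = 0
    · subst hm
      have e1 : D.cy 0 * D.t = 1 := by rw [← D.cy_succ, hl]
      simp [e1]
      ring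
    · have hm' := Ne.symm hm
      simp [hi, hi', hm, hm']
      ring
  · have e1 : ¬ (0 = i'.val) := by omega
    have e2 : ¬ (i'.val = m + 1) := by omega
    have e3 : ¬ (i'.val = m + 1 + 1) := by omega
    have e4 : ¬ (m + 1 = i'.val) := by omega
    simp only [hi, hi', e1, e2, e3, e4, if_true, if_false, and_false, false_and, or_false, and_true,
      true_and, mul_one, one_mul, zero_add]
    have e5 : (m + 1 = i'.val + 1) ↔ (0 = i'.val + 1 ∨ i'.val = m) := by omega
    have e6 : ¬ (0 = i'.val + 1) := by omega
    simp only [e5, e6, false_or, if_false, mul_one]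
    congr 1
    · split_ifs with h
      · rw [hcy (k := 0) (by omega)]
      · rfl
    · split_ifs with h
      · rw [hcy (j := m + 1) (by omega), hl, one_mul]
      · rfl
  · have e1 : ¬ (i.val = m + 1) := by omega
    have e3 : ¬ (i.val = m + 1 + 1) := by omega
    have e6 : ¬ (0 = i.val + 1) := by omega
    simp only [hi, hi', e1, e3, e6, if_true, if_false, and_false, false_and, or_false, false_or,
      and_true, true_and, mul_one, one_mul, zero_add]
    have e5 : (m + 1 = i.val + 1) ↔ (i.val = m) := by omega
    simp only [e5]
    rw [mul_comm]
    congr 1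
    · split_ifs with h
      · rw [hcy (j := m + 1) (by omega), hl, one_mul]
      · rfl
    · split_ifs with h
      · rw [hcy (k := 0) (by omega)]
      · rfl
  · have e1 : ¬ (i.val = m + 1) := by omega
    have e2 : ¬ (i'.val = m + 1) := by omega
    simp only [hi, hi', e1, e2, if_false, and_false, false_and, or_false, mul_one]
    congr 1
    · congr 1
      · split_ifs with h
        · rw [h]
        · rfl
      · split_ifs with h
        · rw [hcy h]
        · rfl
    · split_ifs with h
      · rw [hcy h]
      · rfl

/-- A chain has one point of each colour, so a given source point meets only the one of its own
colour and the two of neighbouring colours. With two colours these neighbours coincide, and the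
formula still holds. -/
lemma prod_nbr_left (a b c : ℂ → ℂ → ℂ) (i : Fin (m + 2)) (x z : ℂ) :
    ∏ j : Fin (m + 2), nbr a b c (i, x) (j, D.p.q3 ^ (j : ℕ) * z) =
      a x (D.p.q3 ^ (i : ℕ) * z) * b x (D.p.q3 ^ (finRotate (m + 2) i : ℕ) * z) *
        c x (D.p.q3 ^ ((finRotate (m + 2)).symm i : ℕ) * z) := by
  simp only [nbr, prod_mul_distrib]
  congr 1
  · congr 1
    · rw [Fintype.prod_ite_eq]
    · rw [Fintype.prod_ite_eq']
  · simp only [← Equiv.symm_apply_eq (finRotate (m + 2))]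
    rw [Fintype.prod_ite_eq]

lemma prod_nbr_right (a b c : ℂ → ℂ → ℂ) (i : Fin (m + 2)) (x z : ℂ) :
    ∏ j : Fin (m + 2), nbr a b c (j, D.p.q3 ^ (j : ℕ) * z) (i, x) =
      a (D.p.q3 ^ (i : ℕ) * z) x * b (D.p.q3 ^ ((finRotate (m + 2)).symm i : ℕ) * z) x *
        c (D.p.q3 ^ (finRotate (m + 2) i : ℕ) * z) x := by
  simp only [nbr, prod_mul_distrib]
  congr 1
  · congr 1
    · rw [Fintype.prod_ite_eq']
    · simp only [← Equiv.symm_apply_eq (finRotate (m + 2))]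
      rw [Fintype.prod_ite_eq]
  · rw [Fintype.prod_ite_eq']

lemma finRotate_castSucc (j : Fin (m + 1)) : (finRotate (m + 2) j.castSucc : ℕ) = j + 1 := by
  rw [coe_finRotate, if_neg (by simp [Fin.ext_iff]; omega)]; simp

lemma finRotate_last' : (finRotate (m + 2) (Fin.last (m + 1)) : ℕ) = 0 := by
  simp

lemma finRotate_symm_succ (j : Fin (m + 1)) : ((finRotate (m + 2)).symm j.succ : ℕ) = j := by
  have : (finRotate (m + 2)).symm j.succ = j.castSucc := by
    rw [Equiv.symm_apply_eq, Fin.ext_iff, finRotate_castSucc]; simp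
  rw [this]; simp

lemma finRotate_symm_zero : ((finRotate (m + 2)).symm 0 : ℕ) = m + 1 := by
  have : (finRotate (m + 2)).symm 0 = Fin.last (m + 1) := by
    rw [Equiv.symm_apply_eq, Fin.ext_iff, finRotate_last']; simp
  rw [this]; simp

lemma dbl_inl_zero_inr (a b c : ℂ → ℂ → ℂ) (y : ℂ) (u : Fin 1 × ℂ) :
    D.dbl (nbr a b c) (Sum.inl (0, y)) (Sum.inr u) =
      a (D.cy 0 * y) u.2 * b (D.cy 0 * y) (D.p.q3 * u.2) * c (D.cy 0 * y) (D.p.q3 ^ (m + 1) * u.2) *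
        (a y (D.p.q3 ^ (m + 1) * u.2) * b y u.2 * c y (D.p.q3 ^ m * u.2)) := by
  rw [dbl, prod_fib_inl, prod_fib_inr, prod_fib_inr, prod_nbr_left, prod_nbr_left, if_pos rfl,
    finRotate_castSucc, finRotate_last', Fin.castSucc_zero, finRotate_symm_zero, ← Fin.succ_last,
    finRotate_symm_succ]
  simp

lemma dbl_inr_inl_zero (a b c : ℂ → ℂ → ℂ) (y : ℂ) (u : Fin 1 × ℂ) :
    D.dbl (nbr a b c) (Sum.inr u) (Sum.inl (0, y)) =
      a u.2 (D.cy 0 * y) * b (D.p.q3 ^ (m + 1) * u.2) (D.cy 0 * y) * c (D.p.q3 * u.2) (D.cy 0 * y) *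
        (a (D.p.q3 ^ (m + 1) * u.2) y * b (D.p.q3 ^ m * u.2) y * c u.2 y) := by
  rw [dbl, prod_comm, prod_fib_inl, prod_fib_inr, prod_fib_inr, prod_nbr_right, prod_nbr_right,
    if_pos rfl, finRotate_castSucc, finRotate_last', Fin.castSucc_zero, finRotate_symm_zero,
    ← Fin.succ_last, finRotate_symm_succ]
  simp

lemma dbl_inl_succ_inr (a b c : ℂ → ℂ → ℂ) {i : Fin (m + 1)} {k : ℕ} (hk : (i : ℕ) = k + 1) (y : ℂ)
    (u : Fin 1 × ℂ) : D.dbl (nbr a b c) (Sum.inl (i, y)) (Sum.inr u) =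
      a (D.cy i * y) (D.p.q3 ^ (k + 1) * u.2) * b (D.cy i * y) (D.p.q3 ^ (k + 2) * u.2) *
        c (D.cy i * y) (D.p.q3 ^ k * u.2) := by
  have hi := i.2
  have h1 : i.castSucc = (⟨k, by omega⟩ : Fin (m + 1)).succ := by simp [Fin.ext_iff, hk]
  have h2 : i ≠ 0 := by simp [Fin.ext_iff, hk]
  rw [dbl, prod_fib_inl, prod_fib_inr, prod_nbr_left, finRotate_castSucc, h1, finRotate_symm_succ,
    if_neg h2, mul_one, hk]
  simp

lemma dbl_inr_inl_succ (a b c : ℂ → ℂ → ℂ) {i : Fin (m + 1)} {k : ℕ} (hk : (i : ℕ) = k + 1) (y : ℂ)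
    (u : Fin 1 × ℂ) : D.dbl (nbr a b c) (Sum.inr u) (Sum.inl (i, y)) =
      a (D.p.q3 ^ (k + 1) * u.2) (D.cy i * y) * b (D.p.q3 ^ k * u.2) (D.cy i * y) *
        c (D.p.q3 ^ (k + 2) * u.2) (D.cy i * y) := by
  have hi := i.2
  have h1 : i.castSucc = (⟨k, by omega⟩ : Fin (m + 1)).succ := by simp [Fin.ext_iff, hk]
  have h2 : i ≠ 0 := by simp [Fin.ext_iff, hk]
  rw [dbl, prod_comm, prod_fib_inl, prod_fib_inr, prod_nbr_right, finRotate_castSucc, h1,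
    finRotate_symm_succ, if_neg h2, mul_one, hk]
  simp

/-- The wrap-around pairs of colours are kept apart from the others: they give rise to the
parameters `q₁` and `q₃` of the one-colour tensor factor. -/
lemma dbl_inr_inr (a b c : ℂ → ℂ → ℂ) (u v : Fin 1 × ℂ) :
    D.dbl (nbr a b c) (Sum.inr u) (Sum.inr v) =
      (∏ j : Fin (m + 2), a (D.p.q3 ^ (j : ℕ) * u.2) (D.p.q3 ^ (j : ℕ) * v.2)) *
      ((∏ j : Fin (m + 1), b (D.p.q3 ^ (j : ℕ) * u.2) (D.p.q3 ^ (j + 1 : ℕ) * v.2)) *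
        b (D.p.q3 ^ (m + 1) * u.2) v.2) *
      ((∏ j : Fin (m + 1), c (D.p.q3 ^ (j + 1 : ℕ) * u.2) (D.p.q3 ^ (j : ℕ) * v.2)) *
        c u.2 (D.p.q3 ^ (m + 1) * v.2)) := by
  rw [dbl, prod_fib_inr]
  simp only [prod_fib_inr, prod_nbr_left, prod_mul_distrib]
  congr 1
  · congr 1
    rw [Fin.prod_univ_castSucc]
    simp
  · rw [Fin.prod_univ_succ, mul_comm]
    simp only [finRotate_symm_succ, finRotate_symm_zero]
    simp
end FusionData

/-! ### Products over ordered pairs -/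

lemma prod_offDiag_insert {α : Type*} [DecidableEq α] (f : α → α → ℂ) {a : α} {s : Finset α}
    (ha : a ∉ s) : ∏ x ∈ (insert a s).offDiag, f x.1 x.2 =
      (∏ x ∈ s.offDiag, f x.1 x.2) * ∏ v ∈ s, f a v * f v a := by
  rw [offDiag_insert ha, prod_union, prod_union, prod_product, prod_product, prod_mul_distrib, mul_assoc]
  · simp
  · rw [disjoint_left]
    rintro ⟨x, y⟩ h1 h2
    rw [mem_product, mem_singleton] at h2
    rw [mem_offDiag] at h1
    exact ha (h2.1 ▸ h1.1)
  · rw [disjoint_left]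
    rintro ⟨x, y⟩ h1 h2
    rw [mem_product, mem_singleton] at h2
    rw [mem_union, mem_product, mem_singleton, mem_offDiag] at h1
    rcases h1 with h1 | h1
    · exact ha (h2.2 ▸ h1.2.1)
    · exact ha (h2.2 ▸ h1.2)

/-- An unordered pair contributes both `f u v` and `f v u`, so only their product matters. -/
lemma prod_offDiag_congr {α : Type*} [DecidableEq α] {f g : α → α → ℂ} (s : Finset α)
    (h : ∀ u ∈ s, ∀ v ∈ s, u ≠ v → f u v * f v u = g u v * g v u) :
    ∏ x ∈ s.offDiag, f x.1 x.2 = ∏ x ∈ s.offDiag, g x.1 x.2 := by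
  induction s using Finset.induction_on with
  | empty => simp
  | insert a s ha ih =>
    rw [prod_offDiag_insert f ha, prod_offDiag_insert g ha,
      ih fun u hu v hv => h u (mem_insert_of_mem hu) v (mem_insert_of_mem hv)]
    congr 1
    exact prod_congr rfl fun v hv => h a (mem_insert_self _ _) v (mem_insert_of_mem hv)
      fun e => ha (e ▸ hv)

lemma prod_offDiag_union {α : Type*} [DecidableEq α] (f : α → α → ℂ) {s t : Finset α}
    (h : Disjoint s t) : ∏ x ∈ (s ∪ t).offDiag, f x.1 x.2 =
      (∏ x ∈ s.offDiag, f x.1 x.2) * (∏ x ∈ t.offDiag, f x.1 x.2) *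
        ∏ u ∈ s, ∏ v ∈ t, f u v * f v u := by
  induction s using Finset.induction_on with
  | empty => simp
  | insert a s ha ih =>
    rw [disjoint_insert_left] at h
    rw [insert_union, prod_offDiag_insert f (by simp [ha, h.1]), ih h.2, prod_offDiag_insert f ha,
      prod_insert ha, prod_union h.2]
    ring

/-- Square roots serve only to write a product of a symmetric function over unordered pairs as a
product over ordered pairs, without ordering the points. The same number is taken to the power `1/2`
twice, so the branch plays no role. -/
lemma sqrt_mul_sqrt (a : ℂ) : a ^ (1 / 2 : ℂ) * a ^ (1 / 2 : ℂ) = a := by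
  rw [← pow_two, one_div]
  exact_mod_cast Complex.cpow_nat_inv_pow a two_ne_zero

lemma div_eq_div_of_scale {a b c e : ℂ} (k : ℂ) (hk : k ≠ 0) (h1 : a = k * c) (h2 : b = k * e) :
    a / b = c / e := by rw [h1, h2, mul_div_mul_left _ _ hk]

/-! ### Comparison of the structure functions of source and target -/

namespace FusionData
variable {m : ℕ} (D : FusionData m)

/-- The specialization moves the poles of the structure functions of neighbouring colours from `y =
y'` to `y = t y'`; this factor accounts for the shift. -/
def rr (y y' : ℂ) : ℂ := (y - y') / (y - D.t * y')

/-- The ratio of the constants of `ω_{i,i-1}` in source and target after rescaling by `t`. It is `1`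
if the target has at least three colours, where the new `d` is `d t`. -/
def eps : ℂ := D.p.delta (m + 2) * D.t / D.pt.delta (m + 1)

lemma eps_ne : D.eps ≠ 0 :=
  div_ne_zero (mul_ne_zero (Params.delta_ne _ _) D.t_ne) (Params.delta_ne _ _)

lemma eps_eq_one (h : 2 ≤ m) : D.eps = 1 := by
  have h1 := D.t_ne
  have h2 : D.p.d ≠ 0 := mul_ne_zero D.p.q_ne D.p.q1_ne
  rw [eps, Params.delta, Params.delta, if_neg (by omega), if_neg (by omega), Params.d, Params.d,
    D.pt_q, D.pt_q1, ← mul_assoc, div_self]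
  exact mul_ne_zero h2 h1

def gyy (i : Fin (m + 1)) (y : ℂ) (i' : Fin (m + 1)) (y' : ℂ) : ℂ :=
  (if i' = finRotate (m + 1) i then D.rr y y' else 1) *
    (if i = finRotate (m + 1) i' then D.eps * D.rr y' y else 1) *
    (if i = 0 ∧ i' = 0 then D.p.delta (m + 2) *
      (((y - D.p.q2 * y') * (y - D.p.q2⁻¹ * y')) / ((y - D.p.q1 * y') * (y - D.p.q1⁻¹ * y'))) else 1)

/-- The truncated subtraction in `(i : ℕ) - 1` is harmless, since it occurs only in the branch `i ≠
0`. -/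
def gyz (i : Fin (m + 1)) (y z : ℂ) : ℂ :=
  if i = 0 then D.p.delta (m + 2) ^ 2 *
    (((y - D.p.q1 ^ 2 * D.p.q3 * z) * (y - D.p.q3⁻¹ * z))
        / ((y - D.p.q1 * D.p.q3 * z) * (y - z)) *
      (((y - D.p.q1⁻¹ * D.p.q3 ^ m * z) * (y - D.p.q1 * D.p.q3 ^ (m + 2) * z))
        / ((y - D.p.q3 ^ m * z) * (y - D.p.q1 * D.p.q3 ^ (m + 1) * z))))
  else D.p.delta (m + 2) *
    (((D.cy i * y - D.p.q1 * D.p.q3 ^ ((i : ℕ) + 1) * z)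
          * (D.cy i * y - D.p.q1⁻¹ * D.p.q3 ^ ((i : ℕ) - 1) * z))
        / ((D.cy i * y - D.p.q3 ^ ((i : ℕ) + 1) * z) * (D.cy i * y - D.p.q3 ^ ((i : ℕ) - 1) * z)))

def gzz (z z' : ℂ) : ℂ :=
  D.p.delta (m + 2) ^ (m + 2) *
    ((((z - D.p.q2 * z') * (z - D.p.q2⁻¹ * z'))
        / ((z - D.p.q3 * z') * (z - D.p.q3⁻¹ * z'))) ^ (m + 1)
      * ((z - z') ^ 2 / ((z - D.p.q3 ^ (m + 1) * z') * (z - (D.p.q3 ^ (m + 1))⁻¹ * z'))))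

/-- The contribution of a pair of variables to the fusion factor. -/
def g : Pt m → Pt m → ℂ
  | Sum.inl (i, y), Sum.inl (i', y') => D.gyy i y i' y'
  | Sum.inl (i, y), Sum.inr z => D.gyz i y z.2
  | Sum.inr z, Sum.inl (i, y) => D.gyz i y z.2
  | Sum.inr z, Sum.inr z' => D.gzz z.2 z'.2

/-- The structure functions of the target. -/
def omegaT : Pt m → Pt m → ℂ
  | Sum.inl u, Sum.inl v => D.pt.omega u.1 v.1 u.2 v.2
  | Sum.inl _, Sum.inr _ => 1
  | Sum.inr _, Sum.inl _ => 1
  | Sum.inr z, Sum.inr z' => D.pf.omega z.1 z'.1 z.2 z'.2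

/-- The constant `eps` sits on one side of the neighbour relation only. For `m ≥ 2` it is `1`; for
at most two target colours the neighbour relation is itself symmetric. -/
lemma gyy_symm (i : Fin (m + 1)) (y : ℂ) (i' : Fin (m + 1)) (y' : ℂ) :
    D.gyy i y i' y' = D.gyy i' y' i y := by
  have h2 := D.p.q2_ne
  have h1 := D.p.q1_ne
  rw [gyy, gyy]
  congr 1
  · by_cases hm : 2 ≤ m
    · rw [D.eps_eq_one hm, one_mul, one_mul, mul_comm]
    · have : (i' = finRotate (m + 1) i) ↔ (i = finRotate (m + 1) i') := by
        have := i.2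
        have := i'.2
        rw [eq_finRotate_iff, eq_finRotate_iff]; omega
      simp only [this]
      split_ifs <;> ring
  · by_cases h : i = 0 ∧ i' = 0
    · rw [if_pos h, if_pos h.symm]
      congr 2
      · field_simp; ring
      · field_simp; ring
    · rw [if_neg h, if_neg fun e => h e.symm]

lemma gzz_symm (z z' : ℂ) : D.gzz z z' = D.gzz z' z := by
  have h2 := D.p.q2_ne
  have h3 := D.p.q3_ne
  rw [gzz, gzz]
  have hQ : D.p.q3 ^ (m + 1) ≠ 0 := pow_ne_zero _ h3
  generalize D.p.q3 ^ (m + 1) = Q at hQ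
  congr 2
  · congr 2
    · field_simp; ring
    · field_simp; ring
  · congr 1
    · ring
    · field_simp; ring

lemma g_symm (u v : Pt m) : D.g u v = D.g v u := by
  rcases u with ⟨i, y⟩ | z <;> rcases v with ⟨i', y'⟩ | z'
  · exact D.gyy_symm _ _ _ _
  · rfl
  · rfl
  · exact D.gzz_symm _ _

lemma mem_fib_inl (i : Fin (m + 1)) (y : ℂ) : (i.castSucc, D.cy i * y) ∈ D.fib (Sum.inl (i, y)) := by
  simp [fib]
lemma last_mem_fib_inl (y : ℂ) : (Fin.last (m + 1), y) ∈ D.fib (Sum.inl (0, y)) := by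
  simp [fib]
lemma mem_fib_inr (j : Fin (m + 2)) (z : Fin 1 × ℂ) :
    (j, D.p.q3 ^ (j : ℕ) * z.2) ∈ D.fib (Sum.inr z) := by
  simp [fib]

/-- The value of a variable. -/
def val : Pt m → ℂ := Sum.elim Prod.snd Prod.snd

/-- The specialized variables above `u` are different from those above `v`. -/
def Apart (u v : Pt m) : Prop := ∀ l ∈ D.fib u, ∀ l' ∈ D.fib v, l.2 ≠ l'.2

variable {D}
lemma Apart.symm {u v : Pt m} (h : D.Apart u v) : D.Apart v u :=
  fun l hl l' hl' => (h l' hl' l hl).symm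

/-- Equality would make the point of source colour `i` above `y` collide with the point of the next
colour above `y'`; for `i = m` the latter is the second point above a variable of colour `0`. -/
lemma Apart.up {i i' : Fin (m + 1)} {y y' : ℂ} (h : D.Apart (Sum.inl (i, y)) (Sum.inl (i', y')))
    (hi : i' = finRotate (m + 1) i) : y ≠ D.t * y' := by
  rintro rfl
  have h1 := D.cy_last
  rcases (eq_finRotate_iff _ _).1 hi with h2 | ⟨h2, h3⟩
  · refine h _ (D.mem_fib_inl i _) _ (D.mem_fib_inl i' _) ?_
    simp only [h2, D.cy_succ]; ring
  · have : i' = 0 := by simp [Fin.ext_iff, h3]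
    subst this
    refine h _ (D.mem_fib_inl i _) _ (D.last_mem_fib_inl _) ?_
    rw [D.cy_succ] at h1
    simp only [h2]
    linear_combination y' * h1

lemma Apart.wrap {y y' : ℂ} (h : D.Apart (Sum.inl (0, y)) (Sum.inl (0, y'))) :
    y ≠ D.p.q1⁻¹ * y' ∧ D.p.q1⁻¹ * y ≠ y' := by
  refine ⟨fun e => h _ (D.last_mem_fib_inl _) _ (D.mem_fib_inl 0 _) ?_,
    fun e => h _ (D.mem_fib_inl 0 _) _ (D.last_mem_fib_inl _) ?_⟩
  · simpa [D.cy_zero] using e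
  · simpa [D.cy_zero] using e

lemma Apart.inl_inr {i : Fin (m + 1)} {y : ℂ} {z : Fin 1 × ℂ}
    (h : D.Apart (Sum.inl (i, y)) (Sum.inr z)) {j : ℕ} (hj : j < m + 2) :
    D.cy i * y - D.p.q3 ^ j * z.2 ≠ 0 :=
  sub_ne_zero.2 (h _ (D.mem_fib_inl i _) _ (D.mem_fib_inr ⟨j, hj⟩ _))

lemma Apart.inl_inr' {y : ℂ} {z : Fin 1 × ℂ}
    (h : D.Apart (Sum.inl (0, y)) (Sum.inr z)) {j : ℕ} (hj : j < m + 2) :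
    y - D.p.q3 ^ j * z.2 ≠ 0 :=
  sub_ne_zero.2 (h _ (D.last_mem_fib_inl _) _ (D.mem_fib_inr ⟨j, hj⟩ _))

lemma Apart.inr_inr {z z' : Fin 1 × ℂ}
    (h : D.Apart (Sum.inr z) (Sum.inr z')) {j k : ℕ} (hj : j < m + 2) (hk : k < m + 2) :
    D.p.q3 ^ j * z.2 - D.p.q3 ^ k * z'.2 ≠ 0 :=
  sub_ne_zero.2 (h _ (D.mem_fib_inr ⟨j, hj⟩ _) _ (D.mem_fib_inr ⟨k, hk⟩ _))
variable (D)

lemma cross_fib (u v : Pt m) : ShFun.cross D.p (D.fib u) (D.fib v) =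
    D.dbl (nbr (fun x y => (x - D.p.q2 * y) / (x - y)) (fun x y => (x - D.p.q1 * y) / (x - y))
      (fun x y => D.p.delta (m + 2) * ((x - D.p.q3 * y) / (x - y)))) u v := by
  simp only [ShFun.cross, dbl, omega_eq_nbr]

/-- Common rescaling leaves the equal-colour factor unchanged, and the neighbour factors change by
`rr` and `eps`. The second points of the fibres leave one more factor, in which `y - y'` cancels
because `q₁ * cy 0 = 1`. -/
lemma cross_yy {i i' : Fin (m + 1)} {y y' : ℂ} (h : D.Apart (Sum.inl (i, y)) (Sum.inl (i', y')))
    (hy : y ≠ y') : ShFun.cross D.p (D.fib (Sum.inl (i, y))) (D.fib (Sum.inl (i', y'))) =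
      D.pt.omega i i' y y' * D.gyy i y i' y' := by
  have h1 := D.p.q1_ne
  have h2 := D.p.q2_ne
  have ht := D.t_ne
  have hy' : y - y' ≠ 0 := sub_ne_zero.2 hy
  have hs : ∀ {c : ℂ}, c ≠ 0 → ∀ a b : ℂ, (c * y - a * (c * b)) / (c * y - c * b) = (y - a * b) / (y - b) := by
    intro c hc a b
    rw [← mul_sub, mul_left_comm, ← mul_sub, mul_div_mul_left _ _ hc]
  rw [cross_fib, dbl_inl_inl]
  have hω := omega_eq_nbr D.pt (i, y) (i', y')
  dsimp only at hω
  rw [hω, nbr, gyy]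
  dsimp only
  have e1 : (if i = i' then (D.cy i * y - D.p.q2 * (D.cy i * y')) / (D.cy i * y - D.cy i * y') else 1)
      = if i = i' then (y - D.pt.q2 * y') / (y - y') else 1 := by
    rw [hs (D.cy_ne _), D.pt_q2]
  have e2 : (if i' = finRotate (m + 1) i then (D.cy i * y - D.p.q1 * (D.cy i * D.t * y')) /
      (D.cy i * y - D.cy i * D.t * y') else 1) =
      (if i' = finRotate (m + 1) i then (y - D.pt.q1 * y') / (y - y') else 1) *
        (if i' = finRotate (m + 1) i then D.rr y y' else 1) := by
    split_ifs with hi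
    · have := sub_ne_zero.2 (h.up hi)
      rw [mul_assoc (D.cy i), hs (D.cy_ne _), rr, D.pt_q1, div_mul_div_cancel₀ hy']
      ring
    · simp
  have e3 : (if i = finRotate (m + 1) i' then D.p.delta (m + 2) * ((D.cy i' * D.t * y -
      D.p.q3 * (D.cy i' * y')) / (D.cy i' * D.t * y - D.cy i' * y')) else 1) =
      (if i = finRotate (m + 1) i' then D.pt.delta (m + 1) * ((y - D.pt.q3 * y') / (y - y')) else 1) *
        (if i = finRotate (m + 1) i' then D.eps * D.rr y' y else 1) := by
    split_ifs with hi
    · have h3 := sub_ne_zero.2 (h.symm.up hi)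
      have hd := D.pt.delta_ne (m + 1)
      have h4 : D.t * y - y' ≠ 0 := fun e => h3 (by linear_combination -e)
      have e : (D.cy i' * D.t * y - D.p.q3 * (D.cy i' * y')) / (D.cy i' * D.t * y - D.cy i' * y') =
          (D.t * y - D.p.q3 * y') / (D.t * y - y') := by
        exact div_eq_div_of_scale _ (D.cy_ne i') (by ring) (by ring)
      rw [e, eps, rr, D.pt_q3]
      have : y' - D.t * y = - (D.t * y - y') := by ring
      rw [this]
      generalize D.pt.delta (m + 1) = dd at *
      field_simp
      ring
    · simp
  have e4 : (if i = 0 ∧ i' = 0 then (y - D.p.q2 * y') / (y - y') *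
      ((y - D.p.q1 * (D.cy 0 * y')) / (y - D.cy 0 * y')) *
      (D.p.delta (m + 2) * ((D.cy 0 * y - D.p.q3 * y') / (D.cy 0 * y - y'))) else 1) =
      (if i = 0 ∧ i' = 0 then D.p.delta (m + 2) *
      (((y - D.p.q2 * y') * (y - D.p.q2⁻¹ * y')) / ((y - D.p.q1 * y') * (y - D.p.q1⁻¹ * y'))) else 1) := by
    split_ifs with hi
    · obtain ⟨rfl, rfl⟩ := hi
      obtain ⟨h5, h6⟩ := h.wrap
      have h5 := sub_ne_zero.2 h5
      have h6 := sub_ne_zero.2 h6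
      have h7 : y - D.p.q1 * y' ≠ 0 := fun e => h6 (by field_simp; linear_combination e)
      have e5 : (y - D.p.q1 * (D.cy 0 * y')) = y - y' := by rw [D.cy_zero]; field_simp
      have e6 : (D.cy 0 * y - D.p.q3 * y') = D.p.q1⁻¹ * (y - D.p.q2⁻¹ * y') := by
        rw [D.cy_zero, D.q3_def]; field_simp
      have e7 : D.cy 0 * y - y' = D.p.q1⁻¹ * (y - D.p.q1 * y') := by rw [D.cy_zero]; field_simp
      rw [e5, e6, e7, D.cy_zero, mul_div_mul_left _ _ (inv_ne_zero h1)]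
      generalize y - D.p.q1 * y' = X1 at *
      generalize y - D.p.q1⁻¹ * y' = X2 at *
      generalize y - D.p.q2 * y' = X3 at *
      generalize y - D.p.q2⁻¹ * y' = X4 at *
      generalize y - y' = X5 at *
      field_simp
    · rfl
  rw [e1, e2, e3, e4]
  ring

lemma q2_q3 : D.p.q2 * D.p.q3 = D.p.q1⁻¹ := by
  have := D.p.q1_ne
  have := D.p.q2_ne
  rw [D.q3_def]; field_simp

lemma q1_q2 : D.p.q1 * D.p.q2 = D.p.q3⁻¹ := by rw [Params.q3, inv_inv]

lemma q1_q3 : D.p.q1 * D.p.q3 = D.p.q2⁻¹ := by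
  have := D.p.q1_ne
  have := D.p.q2_ne
  rw [D.q3_def]; field_simp

lemma cross_yz {i : Fin (m + 1)} {y : ℂ} {z : Fin 1 × ℂ}
    (h : D.Apart (Sum.inl (i, y)) (Sum.inr z)) :
    ShFun.cross D.p (D.fib (Sum.inl (i, y))) (D.fib (Sum.inr z)) = D.gyz i y z.2 := by
  have h1 := D.p.q1_ne
  have h23 := D.q2_q3
  have h12 := D.q1_q2
  rw [cross_fib]
  by_cases hi : i = 0
  · subst hi
    rw [dbl_inl_zero_inr, gyz, if_pos rfl]
    have a0 := h.inl_inr (j := 0) (by omega)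
    have a1 := h.inl_inr (j := 1) (by omega)
    have am := h.inl_inr (j := m + 1) (by omega)
    have b0 := h.inl_inr' (j := 0) (by omega)
    have bm := h.inl_inr' (j := m) (by omega)
    have bm1 := h.inl_inr' (j := m + 1) (by omega)
    obtain ⟨_, z⟩ := z
    have e2 : D.p.q2 * D.p.q3 ^ (m + 1) = D.p.q1⁻¹ * D.p.q3 ^ m := by rw [pow_succ', ← mul_assoc, h23]
    have e1 : D.p.q3 * D.p.q3 ^ (m + 1) = D.p.q3 ^ (m + 2) := by ring
    have e3 : D.p.q3 * D.p.q3 ^ m = D.p.q3 ^ (m + 1) := by ring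
    simp only [Fin.val_zero, cy_zero, pow_zero, pow_one, one_mul, ← mul_assoc, e1, e2, e3] at *
    rw [← h12]
    generalize D.p.q3 ^ (m + 2) = Q2 at *
    generalize D.p.q3 ^ (m + 1) = Q1 at *
    generalize D.p.q3 ^ m = Q0 at *
    have c : ∀ {a : ℂ}, D.p.q1⁻¹ * y - a ≠ 0 → y - D.p.q1 * a ≠ 0 := by
      intro a ha e; apply ha; rw [sub_eq_zero.1 e, inv_mul_cancel_left₀ h1, sub_self]
    have a0 := c a0
    have a1 := c a1
    have am := c am
    rw [← mul_assoc] at a1 am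
    have c' : ∀ a : ℂ, D.p.q1⁻¹ * y - a = D.p.q1⁻¹ * (y - D.p.q1 * a) := by intro a; field_simp
    simp only [c', mul_div_mul_left _ _ (inv_ne_zero h1), ← mul_assoc, ← pow_two]
    generalize y - D.p.q1 * z = A0 at *
    generalize y - D.p.q1 * D.p.q3 * z = A1 at *
    generalize y - D.p.q1 * Q1 * z = A2 at *
    generalize y - z = B0 at *
    generalize y - Q0 * z = B1 at *
    generalize y - Q1 * z = B2 at *
    generalize y - D.p.q1⁻¹ * Q0 * z = C0 at *
    generalize y - D.p.q1 * Q2 * z = C1 at *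
    generalize y - D.p.q1 ^ 2 * D.p.q3 * z = C2 at *
    field_simp
  · obtain ⟨k, hk⟩ : ∃ k, (i : ℕ) = k + 1 := Nat.exists_eq_succ_of_ne_zero (fun e => hi (Fin.ext e))
    have hlt := i.2
    rw [D.dbl_inl_succ_inr _ _ _ hk, gyz, if_neg hi, hk]
    have a0 := h.inl_inr (j := k) (by omega)
    have a1 := h.inl_inr (j := k + 1) (by omega)
    have a2 := h.inl_inr (j := k + 2) (by omega)
    obtain ⟨_, z⟩ := z
    have e2 : D.p.q2 * D.p.q3 ^ (k + 1) = D.p.q1⁻¹ * D.p.q3 ^ k := by rw [pow_succ', ← mul_assoc, h23]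
    have e3 : D.p.q3 * D.p.q3 ^ k = D.p.q3 ^ (k + 1) := by ring
    rw [hk] at a0 a1 a2
    simp only [← mul_assoc, e2, e3, Nat.add_sub_cancel, add_assoc, one_add_one_eq_two] at *
    generalize D.p.q3 ^ (k + 2) = Q2 at *
    generalize D.p.q3 ^ (k + 1) = Q1 at *
    generalize D.p.q3 ^ k = Q0 at *
    generalize D.cy (k + 1) * y = x at *
    generalize x - Q0 * z = A0 at *
    generalize x - Q1 * z = A1 at *
    generalize x - Q2 * z = A2 at *
    generalize x - D.p.q1⁻¹ * Q0 * z = C0 at *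
    generalize x - D.p.q1 * Q2 * z = C1 at *
    field_simp

/-- Reversing the order multiplies the individual factors by `q₁`, `q₂`, `q₃`, each equally often,
and `q₁ q₂ q₃ = 1`. Agreement with `cross_yz` is what makes the two tensor factors commute. -/
lemma cross_zy {i : Fin (m + 1)} {y : ℂ} {z : Fin 1 × ℂ}
    (h : D.Apart (Sum.inl (i, y)) (Sum.inr z)) :
    ShFun.cross D.p (D.fib (Sum.inr z)) (D.fib (Sum.inl (i, y))) = D.gyz i y z.2 := by
  have h1 := D.p.q1_ne
  have h2 := D.p.q2_ne
  have h3 := D.p.q3_ne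
  have h23 := D.q2_q3
  have h13 := D.q1_q3
  have h12 := D.q1_q2
  rw [cross_fib]
  by_cases hi : i = 0
  · subst hi
    rw [dbl_inr_inl_zero, gyz, if_pos rfl]
    have a0 := h.inl_inr (j := 0) (by omega)
    have a1 := h.inl_inr (j := 1) (by omega)
    have am := h.inl_inr (j := m + 1) (by omega)
    have b0 := h.inl_inr' (j := 0) (by omega)
    have bm := h.inl_inr' (j := m) (by omega)
    have bm1 := h.inl_inr' (j := m + 1) (by omega)
    obtain ⟨_, z⟩ := z
    simp only [Fin.val_zero, cy_zero, pow_zero, pow_one, one_mul] at *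
    have c : ∀ {a : ℂ}, D.p.q1⁻¹ * y - a ≠ 0 → y - D.p.q1 * a ≠ 0 := by
      intro a ha e; apply ha; rw [sub_eq_zero.1 e, inv_mul_cancel_left₀ h1, sub_self]
    have a0 := c a0
    have a1 := c a1
    have am := c am
    have c' : ∀ a : ℂ, D.p.q1⁻¹ * y - a = D.p.q1⁻¹ * (y - D.p.q1 * a) := by intro a; field_simp
    have f1 : (z - D.p.q2 * (D.p.q1⁻¹ * y)) / (z - D.p.q1⁻¹ * y) =
        D.p.q2 * (y - D.p.q1 ^ 2 * D.p.q3 * z) / (y - D.p.q1 * z) := by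
      refine div_eq_div_of_scale (-D.p.q1⁻¹) (neg_ne_zero.2 (inv_ne_zero h1)) ?_ (by field_simp; ring)
      linear_combination (-z * D.p.q1⁻¹ * D.p.q1) * D.p.prod_eq_one - z * (mul_inv_cancel₀ h1)
    have f2 : (D.p.q3 ^ (m + 1) * z - D.p.q1 * (D.p.q1⁻¹ * y)) / (D.p.q3 ^ (m + 1) * z - D.p.q1⁻¹ * y) =
        D.p.q1 * (y - D.p.q3 ^ (m + 1) * z) / (y - D.p.q1 * (D.p.q3 ^ (m + 1) * z)) := by
      exact div_eq_div_of_scale (-D.p.q1⁻¹) (neg_ne_zero.2 (inv_ne_zero h1)) (by field_simp; ring)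
        (by field_simp; ring)
    have f3 : (D.p.q3 * z - D.p.q3 * (D.p.q1⁻¹ * y)) / (D.p.q3 * z - D.p.q1⁻¹ * y) =
        D.p.q3 * (y - D.p.q1 * z) / (y - D.p.q1 * (D.p.q3 * z)) := by
      exact div_eq_div_of_scale (-D.p.q1⁻¹) (neg_ne_zero.2 (inv_ne_zero h1)) (by field_simp; ring)
        (by field_simp; ring)
    have f4 : (D.p.q3 ^ (m + 1) * z - D.p.q2 * y) / (D.p.q3 ^ (m + 1) * z - y) =
        D.p.q2 * (y - D.p.q1 * D.p.q3 ^ (m + 2) * z) / (y - D.p.q3 ^ (m + 1) * z) := by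
      refine div_eq_div_of_scale (-1) (by norm_num) ?_ (by ring)
      linear_combination (-D.p.q3 ^ (m + 1) * z) * D.p.prod_eq_one
    have f5 : (D.p.q3 ^ m * z - D.p.q1 * y) / (D.p.q3 ^ m * z - y) =
        D.p.q1 * (y - D.p.q1⁻¹ * D.p.q3 ^ m * z) / (y - D.p.q3 ^ m * z) := by
      refine div_eq_div_of_scale (-1) (by norm_num) ?_ (by ring)
      field_simp; ring
    have f6 : (z - D.p.q3 * y) / (z - y) = D.p.q3 * (y - D.p.q3⁻¹ * z) / (y - z) := by
      refine div_eq_div_of_scale (-1) (by norm_num) ?_ (by ring)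
      field_simp; ring
    rw [f1, f2, f3, f4, f5, f6]
    have hu : D.p.q2 * D.p.q1 * D.p.q3 = 1 := by linear_combination D.p.prod_eq_one
    rw [← mul_assoc D.p.q1] at a1 am
    rw [← mul_assoc D.p.q1 D.p.q3 z, ← mul_assoc D.p.q1 (D.p.q3 ^ (m + 1)) z]
    generalize y - D.p.q1 * z = A0 at *
    generalize y - D.p.q1 * D.p.q3 * z = A1 at *
    generalize y - D.p.q1 * D.p.q3 ^ (m + 1) * z = A2 at *
    generalize y - z = B0 at *
    generalize y - D.p.q3 ^ m * z = B1 at *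
    generalize y - D.p.q3 ^ (m + 1) * z = B2 at *
    generalize y - D.p.q1⁻¹ * D.p.q3 ^ m * z = C0 at *
    generalize y - D.p.q1 * D.p.q3 ^ (m + 2) * z = C1 at *
    generalize y - D.p.q1 ^ 2 * D.p.q3 * z = C2 at *
    generalize y - D.p.q3⁻¹ * z = C3 at *
    rw [show D.p.delta (m + 2) ^ 2 * (C2 * C3 / (A1 * B0) * (C0 * C1 / (B1 * A2))) =
      (D.p.q2 * D.p.q1 * D.p.q3) ^ 2 *
        (D.p.delta (m + 2) ^ 2 * (C2 * C3 / (A1 * B0) * (C0 * C1 / (B1 * A2)))) by rw [hu]; ring]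
    field_simp
  · obtain ⟨k, hk⟩ : ∃ k, (i : ℕ) = k + 1 := Nat.exists_eq_succ_of_ne_zero (fun e => hi (Fin.ext e))
    have hlt := i.2
    rw [D.dbl_inr_inl_succ _ _ _ hk, gyz, if_neg hi, hk]
    have a0 := h.inl_inr (j := k) (by omega)
    have a1 := h.inl_inr (j := k + 1) (by omega)
    have a2 := h.inl_inr (j := k + 2) (by omega)
    obtain ⟨_, z⟩ := z
    rw [hk] at a0 a1 a2
    simp only [Nat.add_sub_cancel, add_assoc, one_add_one_eq_two] at *
    generalize D.cy (k + 1) * y = x at *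
    have f1 : (D.p.q3 ^ (k + 1) * z - D.p.q2 * x) / (D.p.q3 ^ (k + 1) * z - x) =
        D.p.q2 * (x - D.p.q1 * D.p.q3 ^ (k + 2) * z) / (x - D.p.q3 ^ (k + 1) * z) := by
      refine div_eq_div_of_scale (-1) (by norm_num) ?_ (by ring)
      linear_combination (-D.p.q3 ^ (k + 1) * z) * D.p.prod_eq_one
    have f2 : (D.p.q3 ^ k * z - D.p.q1 * x) / (D.p.q3 ^ k * z - x) =
        D.p.q1 * (x - D.p.q1⁻¹ * D.p.q3 ^ k * z) / (x - D.p.q3 ^ k * z) := by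
      refine div_eq_div_of_scale (-1) (by norm_num) ?_ (by ring)
      field_simp; ring
    have f3 : (D.p.q3 ^ (k + 2) * z - D.p.q3 * x) / (D.p.q3 ^ (k + 2) * z - x) =
        D.p.q3 * (x - D.p.q3 ^ (k + 1) * z) / (x - D.p.q3 ^ (k + 2) * z) := by
      refine div_eq_div_of_scale (-1) (by norm_num) ?_ (by ring)
      ring
    rw [f1, f2, f3]
    have hu : D.p.q2 * D.p.q1 * D.p.q3 = 1 := by linear_combination D.p.prod_eq_one
    generalize x - D.p.q3 ^ k * z = A0 at *
    generalize x - D.p.q3 ^ (k + 1) * z = A1 at *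
    generalize x - D.p.q3 ^ (k + 2) * z = A2 at *
    generalize x - D.p.q1⁻¹ * D.p.q3 ^ k * z = C0 at *
    generalize x - D.p.q1 * D.p.q3 ^ (k + 2) * z = C1 at *
    rw [show D.p.delta (m + 2) * (C1 * C0 / (A2 * A0)) =
      (D.p.q2 * D.p.q1 * D.p.q3) * (D.p.delta (m + 2) * (C1 * C0 / (A2 * A0))) by rw [hu]; ring]
    field_simp

/-- The factors inside the chains depend only on `z` and `z'`, not on the colour, and so become
powers. The wrap-around factors contain `q₁ q₃^{-(m+1)}` and `q₃^{m+2}`, the parameters of the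
one-colour algebra. -/
lemma cross_zz {z z' : Fin 1 × ℂ} (h : D.Apart (Sum.inr z) (Sum.inr z')) :
    ShFun.cross D.p (D.fib (Sum.inr z)) (D.fib (Sum.inr z')) =
      D.pf.omega z.1 z'.1 z.2 z'.2 * D.gzz z.2 z'.2 := by
  have h1 := D.p.q1_ne
  have h2 := D.p.q2_ne
  have h3 := D.p.q3_ne
  obtain ⟨i, z⟩ := z
  obtain ⟨j, z'⟩ := z'
  have c00 := h.inr_inr (j := 0) (k := 0) (by omega) (by omega)
  have c01 := h.inr_inr (j := 0) (k := 1) (by omega) (by omega)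
  have c10 := h.inr_inr (j := 1) (k := 0) (by omega) (by omega)
  have c0m := h.inr_inr (j := 0) (k := m + 1) (by omega) (by omega)
  have cm0 := h.inr_inr (j := m + 1) (k := 0) (by omega) (by omega)
  rw [cross_fib, dbl_inr_inr]
  have f1 : ∀ k : ℕ, (D.p.q3 ^ k * z - D.p.q2 * (D.p.q3 ^ k * z')) / (D.p.q3 ^ k * z - D.p.q3 ^ k * z') =
      (z - D.p.q2 * z') / (z - z') := fun k =>
    div_eq_div_of_scale _ (pow_ne_zero k h3) (by ring) (by ring)
  have f2 : ∀ k : ℕ, (D.p.q3 ^ k * z - D.p.q1 * (D.p.q3 ^ (k + 1) * z')) /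
      (D.p.q3 ^ k * z - D.p.q3 ^ (k + 1) * z') = (z - D.p.q2⁻¹ * z') / (z - D.p.q3 * z') := fun k => by
    rw [← D.q1_q3]; exact div_eq_div_of_scale _ (pow_ne_zero k h3) (by ring) (by ring)
  have f3 : ∀ k : ℕ, (D.p.q3 ^ (k + 1) * z - D.p.q3 * (D.p.q3 ^ k * z')) /
      (D.p.q3 ^ (k + 1) * z - D.p.q3 ^ k * z') = (z - z') / (z - D.p.q3⁻¹ * z') := fun k =>
    div_eq_div_of_scale _ (pow_ne_zero (k + 1) h3) (by ring) (by rw [pow_succ]; field_simp)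
  simp only [f1, f2, f3, prod_const, card_univ, Fintype.card_fin]
  rw [Params.omega, if_pos rfl, D.pf_q2, D.pf_q3, gzz]
  have hq : D.pf.q1 = D.p.q1 * (D.p.q3 ^ (m + 1))⁻¹ := by
    rw [eq_mul_inv_iff_mul_eq₀ (pow_ne_zero _ h3), D.pf_q1]
  have hQ : D.p.q3 ^ (m + 1) ≠ 0 := pow_ne_zero _ h3
  have e4 : (D.p.q3 ^ (m + 1) * z - D.p.q1 * z') / (D.p.q3 ^ (m + 1) * z - z') =
      (z - D.pf.q1 * z') / (z - (D.p.q3 ^ (m + 1))⁻¹ * z') := by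
    rw [hq]
    exact div_eq_div_of_scale _ hQ (by field_simp) (by field_simp)
  rw [e4, show D.p.q3 * (D.p.q3 ^ (m + 1) * z') = D.p.q3 ^ (m + 2) * z' by ring]
  simp only [pow_zero, pow_one, one_mul] at *
  have c10' : z - D.p.q3⁻¹ * z' ≠ 0 := fun e => c10 (by
    have := congrArg (D.p.q3 * ·) e; field_simp at this; simpa using this)
  have cm0' : z - (D.p.q3 ^ (m + 1))⁻¹ * z' ≠ 0 := fun e => cm0 (by
    have := congrArg (D.p.q3 ^ (m + 1) * ·) e; field_simp at this; simpa using this)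
  generalize (D.p.q3 ^ (m + 1))⁻¹ = Q1 at *
  generalize D.p.q3 ^ (m + 1) = Q0 at *
  generalize D.p.q3 ^ (m + 2) = Q2 at *
  generalize D.p.q3⁻¹ = r3 at *
  generalize D.p.q2⁻¹ = r2 at *
  generalize D.pf.q1 = r1 at *
  generalize D.p.delta (m + 2) = δ at *
  generalize z - D.p.q2 * z' = A at *
  generalize z - r2 * z' = B at *
  generalize z - D.p.q3 * z' = C at *
  generalize z - r3 * z' = E at *
  generalize z - z' = G at *
  generalize z - Q1 * z' = H at *
  generalize z - Q0 * z' = I at *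
  generalize z - Q2 * z' = K at *
  generalize z - r1 * z' = M at *
  rw [pow_succ _ (m + 1)]
  simp only [div_pow, mul_pow]
  field_simp
  try ring

/-- The fusion factor accounts for the difference between the structure functions of the source and of the
target. -/
lemma cross_fib_eq {u v : Pt m} (h : D.Apart u v) (huv : val u = val v → u.isLeft = v.isLeft → False) :
    ShFun.cross D.p (D.fib u) (D.fib v) = D.omegaT u v * D.g u v := by
  rcases u with ⟨i, y⟩ | z <;> rcases v with ⟨i', y'⟩ | z'
  · exact D.cross_yy h fun e => huv e rfl
  · exact (D.cross_yz h).trans (one_mul _).symm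
  · exact (D.cross_zy h.symm).trans (one_mul _).symm
  · exact D.cross_zz h
end FusionData

/-! ### Multiplicativity of the fusion -/

lemma evTensor_tmul {m : ℕ} {p p' : Params} (S : Finset (Fin m × ℂ)) (T : Finset (Fin 1 × ℂ))
    (G : Sh0 m p) (H : Sh0 1 p') : evTensor S T (G ⊗ₜ[ℂ] H) = Sh0.ev S G * Sh0.ev T H := rfl

lemma Sh0.ev_mul {m : ℕ} {p : Params} {S : Finset (Fin m × ℂ)} (hS : Admissible S) (F G : Sh0 m p) :
    Sh0.ev S (F * G) = ∑ I ∈ S.powerset, Sh0.ev I F * Sh0.ev (S \ I) G * ShFun.cross p I (S \ I) := by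
  classical
  refine (ShFun.mul_apply F.1 G.1 hS).trans (sum_congr rfl fun I _ => ?_)
  congr!

/-- A linear property of the elements of `Sh⁰` needs to be checked on homogeneous elements only. -/
lemma Sh0.induction {m : ℕ} {p : Params} {P : Sh0 m p → Prop}
    (hom : ∀ (N : ℕ), ∀ F ∈ Sh0.deg m p N, P F) (zero : P 0) (add : ∀ F G, P F → P G → P (F + G))
    (F : Sh0 m p) : P F := by
  obtain ⟨F, hF⟩ := F
  have hF' : F ∈ (⨆ N : ℕ, Sh p fun _ : Fin m => N) := hF
  induction hF' using Submodule.iSup_induction' with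
  | mem N F h => exact hom N ⟨F, hF⟩ h
  | zero => exact zero
  | add F G hF' hG' h1 h2 => exact add ⟨F, hF'⟩ ⟨G, hG'⟩ (h1 hF') (h2 hG')

namespace FusionData
variable {m : ℕ} (D : FusionData m)

open Classical in
/-- The specialized variables. -/
def spec (U : Finset (Pt m)) : Finset (Fin (m + 2) × ℂ) := U.biUnion D.fib

/-- The specialized variables are distinct, and so are the variables of each tensor factor. -/
structure Good (U : Finset (Pt m)) : Prop where
  left : Admissible U.toLeft
  right : Admissible U.toRight
  apart : ∀ u ∈ U, ∀ v ∈ U, u ≠ v → D.Apart u v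

variable {D}

lemma Good.mono {U B : Finset (Pt m)} (h : D.Good U) (hB : B ⊆ U) : D.Good B :=
  ⟨h.left.mono (Finset.toLeft_subset_toLeft hB), h.right.mono (Finset.toRight_subset_toRight hB),
    fun u hu v hv => h.apart u (hB hu) v (hB hv)⟩

lemma Good.eq {U : Finset (Pt m)} (h : D.Good U) {u v : Pt m} (hu : u ∈ U) (hv : v ∈ U)
    {l : Fin (m + 2) × ℂ} (hl : l ∈ D.fib u) (hl' : l ∈ D.fib v) : u = v := by
  by_contra hne
  exact h.apart u hu v hv hne l hl l hl' rfl

lemma Good.val_ne_zero {U : Finset (Pt m)} (h : D.Good U) {u : Pt m} (hu : u ∈ U) : val u ≠ 0 := by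
  rcases u with u | u
  · exact h.left.1 u (by simpa using hu)
  · exact h.right.1 u (by simpa using hu)

lemma q1_ne_one : D.p.q1 ≠ 1 := fun e => by
  have := D.pow_eq (a := 1) (b := 0) (c := 0) (e := 0) (by simp [e]); omega

lemma q3_pow_injective {j k : ℕ} (h : D.p.q3 ^ j = D.p.q3 ^ k) : j = k := by
  rw [q3_pow, q3_pow] at h
  have := D.pow_eq h
  omega

/-- The two points above a variable of colour `0` have ratio `q₁ ≠ 1`, and the points of a chain are
separated by the distinct powers of `q₃`. -/
lemma injOn_fib {u : Pt m} (hu : val u ≠ 0) {l l' : Fin (m + 2) × ℂ} (hl : l ∈ D.fib u)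
    (hl' : l' ∈ D.fib u) (h : l.2 = l'.2) : l = l' := by
  rcases u with ⟨i, y⟩ | z
  · have hy : y ≠ 0 := hu
    have hc : D.cy (0 : ℕ) * y ≠ y := by
      rw [cy_zero]
      intro e
      have h1 : D.p.q1⁻¹ = 1 := mul_right_cancel₀ hy (e.trans (one_mul y).symm)
      exact q1_ne_one (D := D) (inv_eq_one.1 h1)
    by_cases hi : i = 0
    · subst hi
      simp only [fib, if_true, mem_insert, mem_singleton] at hl hl'
      rcases hl with rfl | rfl <;> rcases hl' with rfl | rfl
      · rfl
      · exact absurd h hc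
      · exact absurd h.symm hc
      · rfl
    · simp only [fib, if_neg hi, mem_insert, notMem_empty, or_false] at hl hl'
      rw [hl, hl']
  · simp only [fib, mem_image, mem_univ, true_and] at hl hl'
    obtain ⟨j, rfl⟩ := hl
    obtain ⟨k, rfl⟩ := hl'
    have : j = k := Fin.ext (q3_pow_injective (D := D) (mul_right_cancel₀ hu h))
    rw [this]

lemma fib_ne_zero {u : Pt m} (hu : val u ≠ 0) {l : Fin (m + 2) × ℂ} (hl : l ∈ D.fib u) : l.2 ≠ 0 := by
  rcases u with ⟨i, y⟩ | z
  · by_cases hi : i = 0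
    · simp only [fib, if_pos hi, mem_insert, mem_singleton] at hl
      rcases hl with rfl | rfl
      · exact mul_ne_zero (D.cy_ne _) hu
      · exact hu
    · simp only [fib, if_neg hi, mem_insert, notMem_empty, or_false] at hl
      subst hl
      exact mul_ne_zero (D.cy_ne _) hu
  · simp only [fib, mem_image, mem_univ, true_and] at hl
    obtain ⟨j, rfl⟩ := hl
    exact mul_ne_zero (pow_ne_zero _ D.p.q3_ne) hu

lemma mem_spec {U : Finset (Pt m)} {l : Fin (m + 2) × ℂ} : l ∈ D.spec U ↔ ∃ u ∈ U, l ∈ D.fib u := by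
  simp [spec]

lemma Good.admissible_spec {U : Finset (Pt m)} (h : D.Good U) : Admissible (D.spec U) := by
  constructor
  · intro l hl
    obtain ⟨u, hu, hl⟩ := mem_spec.1 hl
    exact fib_ne_zero (h.val_ne_zero hu) hl
  · intro l hl l' hl' e
    obtain ⟨u, hu, hl⟩ := mem_spec.1 (mem_coe.1 hl)
    obtain ⟨v, hv, hl'⟩ := mem_spec.1 (mem_coe.1 hl')
    by_cases huv : u = v
    · subst huv
      exact injOn_fib (h.val_ne_zero hu) hl hl' e
    · exact absurd e (h.apart u hu v hv huv l hl l' hl')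

lemma Good.pairwiseDisjoint {U : Finset (Pt m)} (h : D.Good U) :
    (U : Set (Pt m)).PairwiseDisjoint D.fib := fun u hu v hv huv => by
  rw [Function.onFun, disjoint_left]
  intro l hl hl'
  exact huv (h.eq hu hv hl hl')

open Classical in
lemma Good.spec_sdiff {U B : Finset (Pt m)} (h : D.Good U) (hB : B ⊆ U) :
    D.spec U \ D.spec B = D.spec (U \ B) := by
  ext l
  simp only [mem_sdiff, mem_spec]
  constructor
  · rintro ⟨⟨u, hu, hl⟩, h2⟩
    exact ⟨u, ⟨hu, fun hb => h2 ⟨u, hb, hl⟩⟩, hl⟩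
  · rintro ⟨u, ⟨hu, hb⟩, hl⟩
    refine ⟨⟨u, hu, hl⟩, ?_⟩
    rintro ⟨v, hv, hl'⟩
    exact hb (h.eq hu (hB hv) hl hl' ▸ hv)

lemma fib_nonempty (u : Pt m) : (D.fib u).Nonempty := by
  rcases u with ⟨i, y⟩ | z
  · exact ⟨_, D.mem_fib_inl i y⟩
  · exact ⟨_, D.mem_fib_inr 0 z⟩

lemma Good.spec_injOn {U : Finset (Pt m)} (h : D.Good U) :
    Set.InjOn D.spec (U.powerset : Set (Finset (Pt m))) := by
  have key : ∀ B ⊆ U, ∀ C ⊆ U, D.spec B = D.spec C → B ⊆ C := by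
    intro B hB C hC e u hu
    obtain ⟨l, hl⟩ := fib_nonempty (D := D) u
    have : l ∈ D.spec C := e ▸ mem_spec.2 ⟨u, hu, hl⟩
    obtain ⟨v, hv, hl'⟩ := mem_spec.1 this
    rw [h.eq (hB hu) (hC hv) hl hl']
    exact hv
  intro B hB C hC e
  rw [mem_coe, mem_powerset] at hB hC
  exact subset_antisymm (key B hB C hC e) (key C hC B hB e.symm)

/-- The decompositions of the specialized variables that contribute to a product of homogeneous elements come from
decompositions of the variables of the target. -/
lemma Good.exists_spec_eq {U : Finset (Pt m)} (h : D.Good U) {I : Finset (Fin (m + 2) × ℂ)}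
    (hI : I ⊆ D.spec U) (hc : ∀ l ∈ I, ∀ l' ∈ D.spec U, l' ∉ I → D.p.omega l.1 l'.1 l.2 l'.2 ≠ 0)
    (hcard : (I.filter fun l => l.1 = 0).card = (I.filter fun l => l.1 = Fin.last (m + 1)).card) :
    ∃ B ⊆ U, D.spec B = I := by
  classical
  let bot : Pt m → Fin (m + 2) × ℂ := Sum.elim (fun u => (0, D.cy 0 * u.2)) fun u => (0, u.2)
  let top : Pt m → Fin (m + 2) × ℂ := Sum.elim (fun u => (Fin.last (m + 1), u.2))
    fun u => (Fin.last (m + 1), D.p.q3 ^ (m + 1) * u.2)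
  -- `W` collects the variables whose fibre meets the first and the last colour: all `z` and the `y`
  -- of colour `0`. Every other fibre is a single point.
  let W : Finset (Pt m) := U.filter fun u => ∀ i y, u = Sum.inl (i, y) → i = 0
  have hbot : ∀ u ∈ W, bot u ∈ D.fib u := by
    rintro (⟨i, y⟩ | z) hu
    · obtain rfl := (mem_filter.1 hu).2 i y rfl
      simpa [bot] using D.mem_fib_inl 0 y
    · simpa [bot] using D.mem_fib_inr 0 z
  have htop : ∀ u ∈ W, top u ∈ D.fib u := by
    rintro (⟨i, y⟩ | z) hu
    · obtain rfl := (mem_filter.1 hu).2 i y rfl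
      exact D.last_mem_fib_inl y
    · simpa [top] using D.mem_fib_inr (Fin.last (m + 1)) z
  have hmem : ∀ {u : Pt m}, u ∈ U → ∀ {l}, l ∈ D.fib u → l ∈ D.spec U := fun hu l hl =>
    mem_spec.2 ⟨_, hu, hl⟩
  -- `ω` vanishes if `I` contains the point of colour `j + 1` of a chain but not that of colour `j`,
  -- so `I` cuts every chain in an initial segment.
  have hz : ∀ z, Sum.inr z ∈ U → ∀ j k : ℕ, k ≤ j → (hj : j < m + 2) → ((⟨j, hj⟩, D.p.q3 ^ j * z.2) : Fin (m + 2) × ℂ) ∈ I →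
      ∀ hk : k < m + 2, ((⟨k, hk⟩, D.p.q3 ^ k * z.2) : Fin (m + 2) × ℂ) ∈ I := by
    intro z hzU j k hkj
    induction j, hkj using Nat.le_induction with
    | base => exact fun _ hI _ => hI
    | succ j hkj ih =>
      intro hj hjI hk
      refine ih (by omega) ?_ hk
      by_contra hn
      refine hc _ hjI _ (hmem hzU (D.mem_fib_inr ⟨j, by omega⟩ z)) hn ?_
      have : (⟨j + 1, hj⟩ : Fin (m + 2)) = finRotate (m + 2) ⟨j, by omega⟩ := by
        rw [eq_finRotate_iff]; simp
      dsimp only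
      rw [this]
      exact omega_down _ (by ring)
  -- For a variable of colour `0` the ratio is `q₁` and the first colour follows the last one, so
  -- again the upper point forces the lower one into `I`.
  have hle : ∀ u ∈ W, top u ∈ I → bot u ∈ I := by
    rintro (⟨i, y⟩ | z) hu ht
    · by_contra hn
      refine hc _ ht _ (hmem (mem_filter.1 hu).1 (hbot _ hu)) hn ?_
      have : (0 : Fin (m + 2)) = finRotate (m + 2) (Fin.last (m + 1)) := by
        rw [eq_finRotate_iff]; simp
      simp only [bot, top, Sum.elim_inl]
      rw [this]
      refine omega_up _ ?_
      rw [cy_zero, mul_inv_cancel_left₀ D.p.q1_ne]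
    · simpa [bot] using hz z (mem_filter.1 hu).1 (m + 1) 0 (by omega) (by omega) ht (by omega)
  have hcol : ∀ (i : Fin (m + 2)) (ex : Pt m → Fin (m + 2) × ℂ), (∀ u ∈ W, ex u ∈ D.fib u) →
      (∀ u ∈ W, (ex u).1 = i) → (∀ u ∈ U, ∀ l ∈ D.fib u, l.1 = i → u ∈ W ∧ l = ex u) →
      (I.filter fun l => l.1 = i).card = (W.filter fun u => ex u ∈ I).card := by
    intro i ex h1 h2 h3
    have : (I.filter fun l => l.1 = i) = (W.filter fun u => ex u ∈ I).image ex := by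
      ext l
      simp only [mem_filter, mem_image]
      constructor
      · rintro ⟨hl, hli⟩
        obtain ⟨u, hu, hlu⟩ := mem_spec.1 (hI hl)
        obtain ⟨h4, rfl⟩ := h3 u hu l hlu hli
        exact ⟨u, ⟨h4, hl⟩, rfl⟩
      · rintro ⟨u, ⟨hu, hl⟩, rfl⟩
        exact ⟨hl, h2 u hu⟩
    rw [this, card_image_of_injOn]
    intro u hu v hv e
    have hu := (mem_filter.1 (mem_coe.1 hu)).1
    have hv := (mem_filter.1 (mem_coe.1 hv)).1
    exact h.eq (mem_filter.1 hu).1 (mem_filter.1 hv).1 (h1 u hu) (e ▸ h1 v hv)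
  have h0 := hcol 0 bot hbot (by rintro (u | u) _ <;> rfl) (by
    rintro (⟨i, y⟩ | z) hu l hl h0
    · by_cases hi : i = 0
      · subst hi
        simp only [fib, if_true, mem_insert, mem_singleton] at hl
        refine ⟨mem_filter.2 ⟨hu, by rintro i y' e; simp at e; exact e.1.symm⟩, ?_⟩
        rcases hl with rfl | rfl
        · rfl
        · exact absurd (congrArg Fin.val h0) (Nat.succ_ne_zero m)
      · simp only [fib, if_neg hi, mem_insert, notMem_empty, or_false] at hl
        subst hl
        exact absurd h0 (by rw [Fin.ext_iff]; exact fun e => hi (Fin.ext e))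
    · refine ⟨mem_filter.2 ⟨hu, by rintro i y' e; simp at e⟩, ?_⟩
      simp only [fib, mem_image, mem_univ, true_and] at hl
      obtain ⟨j, rfl⟩ := hl
      dsimp only at h0
      subst h0
      simp [bot])
  have h1 := hcol (Fin.last (m + 1)) top htop (by rintro (u | u) _ <;> rfl) (by
    rintro (⟨i, y⟩ | z) hu l hl h0
    · by_cases hi : i = 0
      · subst hi
        simp only [fib, if_true, mem_insert, mem_singleton] at hl
        refine ⟨mem_filter.2 ⟨hu, by rintro i y' e; simp at e; exact e.1.symm⟩, ?_⟩
        rcases hl with rfl | rfl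
        · exact absurd (congrArg Fin.val h0.symm) (Nat.succ_ne_zero m)
        · rfl
      · simp only [fib, if_neg hi, mem_insert, notMem_empty, or_false] at hl
        subst hl
        have := i.2
        exact absurd h0 (by simp [Fin.ext_iff]; omega)
    · refine ⟨mem_filter.2 ⟨hu, by rintro i y' e; simp at e⟩, ?_⟩
      simp only [fib, mem_image, mem_univ, true_and] at hl
      obtain ⟨j, rfl⟩ := hl
      dsimp only at h0
      subst h0
      simp [top])
  -- `hle` is one inclusion. By `hcard` both sets have the same number of elements, so no fibre is
  -- cut.
  have hW : (W.filter fun u => top u ∈ I) = W.filter fun u => bot u ∈ I := by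
    refine eq_of_subset_of_card_le (fun u hu => ?_) (by rw [← h0, ← h1, hcard])
    rw [mem_filter] at hu ⊢
    exact ⟨hu.1, hle u hu.1 hu.2⟩
  have hbt : ∀ u ∈ W, bot u ∈ I → top u ∈ I := fun u hu hb =>
    (mem_filter.1 (hW ▸ mem_filter.2 ⟨hu, hb⟩ : u ∈ W.filter fun u => top u ∈ I)).2
  have hfull : ∀ u ∈ U, ∀ l ∈ D.fib u, l ∈ I → D.fib u ⊆ I := by
    rintro (⟨i, y⟩ | z) hu l hl hlI
    · by_cases hi : i = 0
      · subst hi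
        have huW : (Sum.inl (0, y) : Pt m) ∈ W :=
          mem_filter.2 ⟨hu, by rintro i y' e; simp at e; exact e.1.symm⟩
        have hb : bot (Sum.inl (0, y)) ∈ I := by
          simp only [fib, if_true, mem_insert, mem_singleton] at hl
          rcases hl with rfl | rfl
          · simpa [bot] using hlI
          · exact hle _ huW hlI
        have ht := hbt _ huW hb
        intro l' hl'
        simp only [fib, if_true, mem_insert, mem_singleton] at hl'
        rcases hl' with rfl | rfl
        · simpa [bot] using hb
        · exact ht
      · simp only [fib, if_neg hi, mem_insert, notMem_empty, or_false] at hl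
        subst hl
        intro l' hl'
        simp only [fib, if_neg hi, mem_insert, notMem_empty, or_false] at hl'
        rwa [hl']
    · have huW : (Sum.inr z : Pt m) ∈ W := mem_filter.2 ⟨hu, by rintro i y' e; simp at e⟩
      simp only [fib, mem_image, mem_univ, true_and] at hl
      obtain ⟨j, rfl⟩ := hl
      have hb : bot (Sum.inr z) ∈ I := by
        simpa [bot] using hz z hu j 0 (by omega) j.2 hlI (by omega)
      have ht := hbt _ huW hb
      intro l' hl'
      simp only [fib, mem_image, mem_univ, true_and] at hl'
      obtain ⟨k, rfl⟩ := hl'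
      exact hz z hu (m + 1) k (by omega) (by omega) ht k.2
  refine ⟨U.filter fun u => D.fib u ⊆ I, filter_subset _ _, ?_⟩
  ext l
  rw [mem_spec]
  constructor
  · rintro ⟨u, hu, hl⟩
    exact (mem_filter.1 hu).2 hl
  · intro hl
    obtain ⟨u, hu, hlu⟩ := mem_spec.1 (hI hl)
    exact ⟨u, mem_filter.2 ⟨hu, hfull u hu l hlu hl⟩, hlu⟩

open Classical in
-- Homogeneity of the first factor provides the equal numbers of points in the two extreme colours
-- that `Good.exists_spec_eq` requires; decompositions that cut a fibre contribute zero.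
lemma Good.mul_spec {U : Finset (Pt m)} (h : D.Good U) {M : ℕ} {F G : Sh0 (m + 2) D.p}
    (hF : F ∈ Sh0.deg (m + 2) D.p M) :
    Sh0.ev (D.spec U) (F * G) = ∑ B ∈ U.powerset, Sh0.ev (D.spec B) F * Sh0.ev (D.spec (U \ B)) G *
      ∏ u ∈ B, ∏ v ∈ U \ B, ShFun.cross D.p (D.fib u) (D.fib v) := by
  rw [Sh0.ev_mul h.admissible_spec]
  symm
  refine sum_of_injOn D.spec h.spec_injOn ?_ ?_ ?_
  · intro B hB
    rw [mem_coe, mem_powerset] at hB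
    rw [mem_coe, mem_powerset]
    exact biUnion_subset_biUnion_of_subset_left _ hB
  · intro I hI hn
    by_contra h0
    apply hn
    rw [mem_powerset] at hI
    have hF0 : F.1 I ≠ 0 := left_ne_zero_of_mul (left_ne_zero_of_mul h0)
    have hF1 : F.1 ∈ Sh D.p fun _ => M := hF
    obtain ⟨B, hB, e⟩ := h.exists_spec_eq hI (fun l hl l' hl' hn => by
      have := right_ne_zero_of_mul h0
      rw [ShFun.cross, prod_ne_zero_iff] at this
      exact prod_ne_zero_iff.1 (this l hl) l' (mem_sdiff.2 ⟨hl', hn⟩))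
      ((hF1.1 I hF0 _).trans (hF1.1 I hF0 _).symm)
    exact ⟨B, mem_coe.2 (mem_powerset.2 hB), e⟩
  · intro B hB
    rw [mem_powerset] at hB
    have hs : D.spec U \ D.spec B = D.spec (U \ B) := h.spec_sdiff hB
    have e : ShFun.cross D.p (D.spec B) (D.spec (U \ B)) =
        ∏ u ∈ B, ∏ v ∈ U \ B, ShFun.cross D.p (D.fib u) (D.fib v) := by
      rw [ShFun.cross, spec, prod_biUnion (h.mono hB).pairwiseDisjoint]
      refine prod_congr rfl fun u _ => ?_
      rw [prod_comm]
      simp only [ShFun.cross]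
      rw [spec, prod_biUnion (h.mono sdiff_subset).pairwiseDisjoint]
      refine prod_congr rfl fun v _ => ?_
      rw [prod_comm]
    rw [← e, ← hs]

variable (D)

/-- A constant for each variable of colour `0`, needed only with three source colours. There the
pairs of variables produce `(d t)^{L²}`, whereas the fusion factor is normalized with `(d
t)^{L(L-1)}`. Being multiplicative in the set of variables, it does not affect products. -/
def eta : ℂ := if m = 1 then (D.p.d * D.t)⁻¹ else 1

/-- The fusion factor as a function of the set of variables of the target. -/
def psi (U : Finset (Pt m)) : ℂ :=
  (∏ u ∈ U, Sum.elim (fun y => if y.1 = 0 then D.eta else 1) (fun _ => 1) u) *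
    ∏ x ∈ U.offDiag, D.g x.1 x.2 ^ (1 / 2 : ℂ)

open Classical in
-- Only pairs with one member on each side link the two parts, and the two square roots of such a
-- pair combine to `g u v` by the symmetry of `g`.
lemma psi_split {U B : Finset (Pt m)} (hB : B ⊆ U) :
    D.psi U = D.psi B * D.psi (U \ B) * ∏ u ∈ B, ∏ v ∈ U \ B, D.g u v := by
  have h1 : Disjoint B (U \ B) := disjoint_sdiff
  have h2 : U = B ∪ (U \ B) := (union_sdiff_of_subset hB).symm
  have h3 := prod_offDiag_union (fun u v => D.g u v ^ (1 / 2 : ℂ)) h1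
  have h4 : ∀ u v, D.g u v ^ (1 / 2 : ℂ) * D.g v u ^ (1 / 2 : ℂ) = D.g u v := fun u v => by
    rw [D.g_symm v u, sqrt_mul_sqrt]
  simp only [h4] at h3
  rw [psi]
  conv_lhs => rw [h2]
  rw [prod_union h1, psi, psi]
  rw [h3]
  ring

/-- `t` is the fusion of `F`. -/
def IsFused (F : Sh0 (m + 2) D.p) (t : Sh0 (m + 1) D.pt ⊗[ℂ] Sh0 1 D.pf) : Prop :=
  ∀ U, D.Good U → evTensor U.toLeft U.toRight t * D.psi U = Sh0.ev (D.spec U) F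

variable {D}

lemma IsFused.add {F G : Sh0 (m + 2) D.p} {s t} (h : D.IsFused F s) (h' : D.IsFused G t) :
    D.IsFused (F + G) (s + t) := fun U hU => by
  rw [map_add, map_add, add_mul, h U hU, h' U hU]

lemma IsFused.smul {F : Sh0 (m + 2) D.p} {t} (c : ℂ) (h : D.IsFused F t) :
    D.IsFused (c • F) (c • t) := fun U hU => by
  rw [map_smul, map_smul, smul_mul_assoc, h U hU]

lemma isFused_zero : D.IsFused 0 0 := fun U _ => by simp

lemma isFused_one : D.IsFused 1 1 := fun U _ => by
  classical
  rw [Algebra.TensorProduct.one_def, evTensor_tmul]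
  have h1 : ∀ {n : ℕ} {p : Params} (S : Finset (Fin n × ℂ)),
      Sh0.ev S (1 : Sh0 n p) = if S = ∅ then 1 else 0 := fun {n p} S => by
    refine (ShFun.one_apply (p := p) S).trans ?_
    congr!
  rw [h1, h1, h1]
  by_cases hU : U = ∅
  · subst hU
    have e1 : (∅ : Finset (Pt m)).toLeft = ∅ := by ext; simp
    have e2 : (∅ : Finset (Pt m)).toRight = ∅ := by ext; simp
    simp [spec, psi, e1, e2]
  · have : D.spec U ≠ ∅ := by
      obtain ⟨u, hu⟩ := nonempty_iff_ne_empty.2 hU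
      obtain ⟨l, hl⟩ := fib_nonempty (D := D) u
      exact ne_empty_of_mem (mem_spec.2 ⟨u, hu, hl⟩)
    rw [if_neg this]
    by_cases h2 : U.toLeft = ∅
    · have h3 : U.toRight ≠ ∅ := fun h3 => by
        have := U.toLeft_disjSum_toRight
        rw [h2, h3] at this
        exact hU this.symm
      rw [if_neg h3]; simp
    · rw [if_neg h2]; simp

open Classical in
-- A decomposition of a disjoint union is a pair of decompositions, and mixed pairs contribute `1`
-- because the tensor factors commute.
lemma evTensor_mul {U : Finset (Pt m)} (hl : Admissible U.toLeft) (hr : Admissible U.toRight)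
    (s t : Sh0 (m + 1) D.pt ⊗[ℂ] Sh0 1 D.pf) :
    evTensor U.toLeft U.toRight (s * t) = ∑ B ∈ U.powerset,
      evTensor B.toLeft B.toRight s * evTensor (U \ B).toLeft (U \ B).toRight t *
        ∏ u ∈ B, ∏ v ∈ U \ B, D.omegaT u v := by
  induction s with
  | zero => simp
  | add s s' h1 h2 =>
    rw [add_mul, map_add, h1, h2, ← sum_add_distrib]
    refine sum_congr rfl fun B _ => ?_
    rw [map_add]; ring
  | tmul G H =>
    induction t with
    | zero => simp
    | add s s' h1 h2 =>
      rw [mul_add, map_add, h1, h2, ← sum_add_distrib]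
      refine sum_congr rfl fun B _ => ?_
      rw [map_add]; ring
    | tmul G' H' =>
      rw [Algebra.TensorProduct.tmul_mul_tmul, evTensor_tmul, Sh0.ev_mul hl, Sh0.ev_mul hr,
        sum_mul_sum, ← sum_product']
      refine sum_nbij' (fun B => B.1.disjSum B.2) (fun B => (B.toLeft, B.toRight)) ?_ ?_ ?_ ?_ ?_
      · rintro ⟨A, B⟩ h
        simp only [mem_product, mem_powerset] at h ⊢
        intro u hu
        rcases u with u | u
        · simpa using h.1 (by simpa using hu)
        · simpa using h.2 (by simpa using hu)
      · intro B h
        simp only [mem_product, mem_powerset] at h ⊢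
        exact ⟨Finset.toLeft_subset_toLeft h, Finset.toRight_subset_toRight h⟩
      · rintro ⟨A, B⟩ h; simp
      · intro B h; exact Finset.toLeft_disjSum_toRight
      · rintro ⟨A, B⟩ h
        have e1 : (U \ A.disjSum B).toLeft = U.toLeft \ A := by ext; simp
        have e2 : (U \ A.disjSum B).toRight = U.toRight \ B := by ext; simp
        have e3 : U \ A.disjSum B = (U.toLeft \ A).disjSum (U.toRight \ B) := by
          rw [← e1, ← e2, Finset.toLeft_disjSum_toRight]
        simp only [evTensor_tmul, e1, e2, toLeft_disjSum, toRight_disjSum]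
        have e4 : ∏ u ∈ A.disjSum B, ∏ v ∈ U \ A.disjSum B, D.omegaT u v =
            ShFun.cross D.pt A (U.toLeft \ A) * ShFun.cross D.pf B (U.toRight \ B) := by
          rw [e3]
          simp [omegaT, ShFun.cross]
        rw [e4]
        ring

/-- Both sides are sums over the decompositions of `U`, and they agree term by term: `cross_fib_eq`
contributes `omegaT * g`, and `g` is exactly what `psi` gains in `psi_split`. -/
lemma IsFused.mul {F G : Sh0 (m + 2) D.p} {s t} {M : ℕ} (hF : F ∈ Sh0.deg (m + 2) D.p M)
    (h : D.IsFused F s) (h' : D.IsFused G t) :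
    D.IsFused (F * G) (s * t) := fun U hU => by
  classical
  rw [hU.mul_spec hF, evTensor_mul hU.left hU.right, sum_mul]
  refine sum_congr rfl fun B hB => ?_
  rw [mem_powerset] at hB
  rw [← h B (hU.mono hB), ← h' (U \ B) (hU.mono sdiff_subset), D.psi_split hB]
  have : ∏ u ∈ B, ∏ v ∈ U \ B, ShFun.cross D.p (D.fib u) (D.fib v) =
      (∏ u ∈ B, ∏ v ∈ U \ B, D.omegaT u v) * ∏ u ∈ B, ∏ v ∈ U \ B, D.g u v := by
    simp only [← prod_mul_distrib]
    refine prod_congr rfl fun u hu => prod_congr rfl fun v hv => ?_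
    have hv := mem_sdiff.1 hv
    have huv : u ≠ v := fun e => hv.2 (e ▸ hu)
    refine D.cross_fib_eq (hU.apart u (hB hu) v hv.1 huv) fun e e' => huv ?_
    rcases u with u | u <;> rcases v with v | v
    · exact congrArg _ (hU.left.2 (by simpa using hB hu) (by simpa using hv.1) e)
    · simp at e'
    · simp at e'
    · exact congrArg _ (hU.right.2 (by simpa using hB hu) (by simpa using hv.1) e)
  rw [this]
  ring
end FusionData

/-! ### Poles and zeros of the fusion factor -/

/-- The constants of the unordered pairs multiply to one constant, which does not depend on the
point `w`. -/
lemma exists_prod_offDiag_eq {α β : Type*} [DecidableEq α] {f g : β → α → α → ℂ} {good : β → Prop}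
    (s : Finset α) (h : ∀ u v, u ≠ v →
      ∃ k : ℂ, k ≠ 0 ∧ ∀ w, good w → f w u v * f w v u = k * (g w u v * g w v u)) :
    ∃ k : ℂ, k ≠ 0 ∧ ∀ w, good w →
      ∏ x ∈ s.offDiag, f w x.1 x.2 = k * ∏ x ∈ s.offDiag, g w x.1 x.2 := by
  induction s using Finset.induction_on with
  | empty => exact ⟨1, one_ne_zero, fun w _ => by simp⟩
  | insert a s ha ih =>
    obtain ⟨k, hk, ih⟩ := ih
    choose! c hc using h a
    refine ⟨k * ∏ v ∈ s, c v, mul_ne_zero hk (prod_ne_zero_iff.2 fun v hv =>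
      (hc v fun e => ha (e ▸ hv)).1), fun w hw => ?_⟩
    rw [prod_offDiag_insert (f w) ha, prod_offDiag_insert (g w) ha, ih w hw,
      prod_congr rfl fun v hv => (hc v fun e => ha (e ▸ hv)).2 w hw, prod_mul_distrib]
    ring

lemma prod_prod_ne {α : Type*} [Fintype α] [DecidableEq α] (f : α → α → ℂ) :
    ∏ u, ∏ v, (if u ≠ v then f u v else 1) = ∏ x ∈ univ.offDiag, f x.1 x.2 := by
  rw [← Fintype.prod_prod_type' (f := fun u v => if u ≠ v then f u v else 1), ← prod_filter]
  refine prod_congr ?_ fun _ _ => rfl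
  ext x; simp

lemma prod_prod_eq_diag_mul {α : Type*} [Fintype α] [DecidableEq α] (f : α → α → ℂ) :
    ∏ u, ∏ v, f u v = (∏ u, f u u) * ∏ x ∈ univ.offDiag, f x.1 x.2 := by
  rw [← prod_prod_ne, ← prod_mul_distrib]
  refine prod_congr rfl fun u _ => ?_
  rw [← mul_prod_erase univ _ (mem_univ u), ← mul_prod_erase univ (fun v => if u ≠ v then f u v else 1)
    (mem_univ u), if_neg (by simp), one_mul]
  congr 1
  refine prod_congr rfl fun v hv => ?_
  rw [if_pos (ne_of_mem_erase hv).symm]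

/-- The labels of the variables of the target: `y_{i,a}` and `z_b`. -/
abbrev Var (m L K : ℕ) : Type := (Fin (m + 1) × Fin L) ⊕ Fin K

/-- The labels of the variables `x_{i,a}` of the source. -/
abbrev Src (m L K : ℕ) : Type := Fin (m + 2) × (Fin L ⊕ Fin K)

section
variable {m L K : ℕ}
/-- The variable of the target to which a variable of the source is specialized. -/
def Src.var : Src m L K → Var m L K
  | (i, Sum.inl a) => Sum.inl (Fin.ofNat (m + 1) i, a)
  | (_, Sum.inr b) => Sum.inr b

/-- The point of the target that belongs to a label. -/
def Var.pt (w : Var m L K → ℂ) : Var m L K → Pt m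
  | Sum.inl (i, a) => Sum.inl (i, w (Sum.inl (i, a)))
  | Sum.inr b => Sum.inr (0, w (Sum.inr b))

/-- The variables `y` are distinct and nonzero, and so are the variables `z`. -/
def Split (w : Var m L K → ℂ) : Prop := Distinct (w ∘ Sum.inl) ∧ Distinct (w ∘ Sum.inr)

lemma Split.ne_zero {w : Var m L K → ℂ} (h : Split w) (u : Var m L K) : w u ≠ 0 := by
  rcases u with u | u
  · exact h.1.1 u
  · exact h.2.1 u

lemma Split.pt_injective {w : Var m L K → ℂ} (h : Split w) : Function.Injective (Var.pt w) := by
  rintro (⟨i, a⟩ | b) (⟨i', a'⟩ | b') e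
  · simp only [Var.pt, Sum.inl.injEq, Prod.mk.injEq] at e
    rw [h.1.2 e.2]
  · simp [Var.pt] at e
  · simp [Var.pt] at e
  · simp only [Var.pt, Sum.inr.injEq, Prod.mk.injEq] at e
    rw [h.2.2 e.2]

open Classical in
/-- The set of points of the target given by `w`. -/
def Var.pts (w : Var m L K → ℂ) : Finset (Pt m) := univ.image (Var.pt w)

lemma Var.toLeft_pts (w : Var m L K → ℂ) : (Var.pts w).toLeft = conf Prod.fst (w ∘ Sum.inl) := by
  ext ⟨i, y⟩
  simp only [mem_toLeft, Var.pts, conf, mem_image, mem_univ, true_and, Sum.exists, Prod.exists, Var.pt]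
  simp

lemma Var.toRight_pts (w : Var m L K → ℂ) :
    (Var.pts w).toRight = conf (fun _ => 0) (w ∘ Sum.inr) := by
  ext ⟨i, y⟩
  simp only [mem_toRight, Var.pts, conf, mem_image, mem_univ, true_and, Sum.exists, Prod.exists, Var.pt]
  simp
end

namespace FusionData
variable {m : ℕ} (D : FusionData m) {L K : ℕ}

/-- The coefficient of the specialization. -/
def coef : Src m L K → ℂ
  | (i, Sum.inl _) => D.cy i
  | (i, Sum.inr _) => D.p.q3 ^ (i : ℕ)

lemma coef_ne (l : Src m L K) : D.coef l ≠ 0 := by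
  rcases l with ⟨i, a | b⟩
  · exact D.cy_ne _
  · exact pow_ne_zero _ D.p.q3_ne

/-- The specialization. -/
def spl (w : Var m L K → ℂ) (l : Src m L K) : ℂ := D.coef l * w l.var

lemma ofNat_castSucc (i : Fin (m + 1)) : Fin.ofNat (m + 1) (i.castSucc : Fin (m + 2)) = i := by
  ext; simp

lemma ofNat_last : Fin.ofNat (m + 1) (Fin.last (m + 1) : Fin (m + 2)) = 0 := by
  ext; simp

lemma prod_spl (w : Var m L K → ℂ) (f : Fin (m + 2) × ℂ → ℂ) :
    ∏ l : Src m L K, f (l.1, D.spl w l) = ∏ u, ∏ x ∈ D.fib (Var.pt w u), f x := by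
  rw [Fintype.prod_prod_type, prod_comm, Fintype.prod_sum_type, Fintype.prod_sum_type,
    Fintype.prod_prod_type, prod_comm (s := (univ : Finset (Fin (m + 1))))]
  congr 1
  · refine prod_congr rfl fun a _ => ?_
    simp only [Var.pt, prod_fib_inl, prod_mul_distrib]
    rw [Fin.prod_univ_castSucc]
    congr 1
    · refine prod_congr rfl fun i _ => ?_
      simp only [spl, Src.var, ofNat_castSucc, coef]
      rfl
    · rw [Fintype.prod_ite_eq']
      simp only [spl, Src.var, ofNat_last, coef]
      rw [Fin.val_last, D.cy_last, one_mul]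
  · refine prod_congr rfl fun b _ => ?_
    simp only [Var.pt, prod_fib_inr]
    rfl

/-- Membership of `x` is read off from the vanishing of a product of factors `0` and `1`, to which
`prod_spl` applies. -/
lemma conf_spl (w : Var m L K → ℂ) : conf Prod.fst (D.spl w) = D.spec (Var.pts w) := by
  classical
  ext x
  have h := D.prod_spl w fun l => if l = x then 0 else 1
  have h1 : (∏ l : Src m L K, if (l.1, D.spl w l) = x then (0 : ℂ) else 1) = 0 ↔
      x ∈ conf Prod.fst (D.spl w) := by
    simp [prod_eq_zero_iff, conf]
  have h2 : (∏ u, ∏ l ∈ D.fib (Var.pt w u), if l = x then (0 : ℂ) else 1) = 0 ↔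
      x ∈ D.spec (Var.pts w) := by
    rw [prod_eq_zero_iff, mem_spec]
    simp only [prod_eq_zero_iff, Var.pts, mem_image, mem_univ, true_and, exists_exists_eq_and]
    simp
  rw [← h1, ← h2, h]

/-- The poles of the specialization that come from a pair of variables of the target. -/
def polePair (u v : Pt m) : ℂ := D.dbl (nbr (fun _ _ => 1) (fun x y => x - y) fun _ _ => 1) u v

/-- With at least two colours no colour follows itself, so the condition `l ≠ l'` in the pole
denominator is automatic. The diagonal terms are the poles inside one fibre. -/
lemma poleDenom_spl (w : Var m L K → ℂ) : poleDenom Prod.fst (D.spl w) =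
    (∏ u, D.polePair (Var.pt w u) (Var.pt w u)) *
      ∏ x ∈ univ.offDiag, D.polePair (Var.pt w x.1) (Var.pt w x.2) := by
  rw [← prod_prod_eq_diag_mul fun u v => D.polePair (Var.pt w u) (Var.pt w v)]
  have : poleDenom Prod.fst (D.spl w) = ∏ l : Src m L K, ∏ l' : Src m L K,
      nbr (fun _ _ => 1) (fun x y => x - y) (fun _ _ => 1) (l.1, D.spl w l) (l'.1, D.spl w l') := by
    refine prod_congr rfl fun l _ => prod_congr rfl fun l' _ => ?_
    have h : l.1 ≠ finRotate (m + 2) l.1 := (finRotate_ne (by omega) _).symm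
    have h' : l'.1 = finRotate (m + 2) l.1 → l ≠ l' := by rintro e rfl; exact h e
    simp only [nbr, ite_self, one_mul, mul_one]
    by_cases e : l'.1 = finRotate (m + 2) l.1
    · rw [if_pos ⟨h' e, e⟩, if_pos e]
    · rw [if_neg fun h => e h.2, if_neg e]
  rw [this, D.prod_spl w fun x => ∏ l', nbr (fun _ _ => 1) (fun x y => x - y) (fun _ _ => 1) x (l'.1, D.spl w l')]
  refine prod_congr rfl fun u _ => ?_
  rw [prod_comm]
  simp only [polePair, dbl]
  conv_rhs => enter [2, v]; rw [prod_comm]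
  rw [← D.prod_spl w fun y => ∏ x ∈ D.fib (Var.pt w u),
    nbr (fun _ _ => 1) (fun x y => x - y) (fun _ _ => 1) x y]

/-- The poles of the target that come from a pair of variables. -/
def polePairT : Pt m → Pt m → ℂ
  | Sum.inl (i, y), Sum.inl (i', y') => if i' = finRotate (m + 1) i then y - y' else 1
  | Sum.inl _, Sum.inr _ => 1
  | Sum.inr _, Sum.inl _ => 1
  | Sum.inr z, Sum.inr z' => z.2 - z'.2

/-- The pole denominators of the two tensor factors of the target. -/
def poles (w : Var m L K → ℂ) : ℂ :=
  poleDenom Prod.fst (w ∘ Sum.inl) * poleDenom (fun _ => (0 : Fin 1)) (w ∘ Sum.inr)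

lemma poles_eq (w : Var m L K → ℂ) :
    poles w = ∏ x ∈ univ.offDiag, polePairT (Var.pt w x.1) (Var.pt w x.2) := by
  rw [← prod_prod_ne fun u v => polePairT (Var.pt w u) (Var.pt w v)]
  simp only [Fintype.prod_sum_type, Var.pt, polePairT, prod_mul_distrib]
  simp only [ite_self, prod_const_one, mul_one, one_mul, poles, poleDenom]
  congr 1
  · refine prod_congr rfl fun l _ => prod_congr rfl fun l' _ => ?_
    rw [ite_and]
    simp
  · refine prod_congr rfl fun l _ => prod_congr rfl fun l' _ => ?_
    simp

/-- The roots `α` of the numerator factors `u - α v` of the fusion factor. -/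
def roots : Var m L K → Var m L K → Finset ℂ
  | Sum.inl (i, _), Sum.inl (i', _) => if i = 0 ∧ i' = 0 then {D.p.q2} else ∅
  | Sum.inl (i, _), Sum.inr _ => if i = 0 then
      {D.p.q1 ^ 2 * D.p.q3, D.p.q3⁻¹, D.p.q1⁻¹ * D.p.q3 ^ m, D.p.q1 * D.p.q3 ^ (m + 2)}
    else {(D.cy i)⁻¹ * (D.p.q1 * D.p.q3 ^ ((i : ℕ) + 1)),
      (D.cy i)⁻¹ * (D.p.q1⁻¹ * D.p.q3 ^ ((i : ℕ) - 1))}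
  | Sum.inr _, Sum.inl _ => ∅
  | Sum.inr _, Sum.inr _ => {D.p.q2}

/-- The multiplicity of the numerator factors. -/
def mult : Var m L K → Var m L K → ℕ
  | Sum.inr _, Sum.inr _ => m + 1
  | _, _ => 1

/-- The numerator of the fusion factor, for a pair of variables. -/
def numPair (w : Var m L K → ℂ) (u v : Var m L K) : ℂ :=
  ∏ α ∈ D.roots u v, (w u - α * w v) ^ mult u v

/-- The exponents of `q₁` and `q₂` are different. If two roots coincided, the product over the
finite set `roots` would lose a factor of the fusion numerator. -/
lemma roots_distinct (n : ℕ) : [D.p.q1 ^ 2 * D.p.q3, D.p.q3⁻¹, D.p.q1⁻¹ * D.p.q3 ^ n,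
    D.p.q1 * D.p.q3 ^ (n + 2)].Nodup := by
  have h1 := D.p.q1_ne
  have e1 : D.p.q1 ^ 2 * D.p.q3 = D.p.q1 ^ (1 : ℤ) * D.p.q2 ^ (-1 : ℤ) := by
    rw [D.q3_def, zpow_one, zpow_neg_one]; field_simp
  have e2 : D.p.q3⁻¹ = D.p.q1 ^ (1 : ℤ) * D.p.q2 ^ (1 : ℤ) := by rw [zpow_one, zpow_one, D.q1_q2]
  have e3 : D.p.q1⁻¹ * D.p.q3 ^ n = D.p.q1 ^ (-1 - n : ℤ) * D.p.q2 ^ (-n : ℤ) := by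
    rw [D.q3_pow, ← zpow_neg_one, ← mul_assoc, ← zpow_add₀ h1]; ring_nf
  have e4 : D.p.q1 * D.p.q3 ^ (n + 2) = D.p.q1 ^ (-1 - n : ℤ) * D.p.q2 ^ (-n - 2 : ℤ) := by
    rw [D.q3_pow]
    nth_rewrite 1 [← zpow_one D.p.q1]
    rw [← mul_assoc, ← zpow_add₀ h1]; push_cast; ring_nf
  rw [e1, e2, e3, e4]
  simp only [List.nodup_cons, List.mem_cons, List.not_mem_nil, or_false, not_or, not_false_eq_true,
    List.nodup_nil, and_true]
  refine ⟨⟨?_, ?_, ?_⟩, ⟨?_, ?_⟩, ?_⟩ <;>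
  · intro e
    have := D.pow_eq e
    omega

lemma roots_succ_ne (i k : ℕ) : (D.cy i)⁻¹ * (D.p.q1 * D.p.q3 ^ (k + 2)) ≠
    (D.cy i)⁻¹ * (D.p.q1⁻¹ * D.p.q3 ^ k) := by
  intro e
  have := D.roots_distinct k
  simp only [List.nodup_cons, List.mem_cons, List.not_mem_nil, or_false, not_or, not_false_eq_true,
    List.nodup_nil, and_true] at this
  exact this.2.2 (mul_left_cancel₀ (inv_ne_zero (D.cy_ne i)) e).symm

lemma numPair_zero (w : Var m L K → ℂ) (a : Fin L) (b : Fin K) {y z : ℂ}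
    (hy : w (Sum.inl (0, a)) = y) (hz : w (Sum.inr b) = z) :
    D.numPair w (Sum.inl (0, a)) (Sum.inr b) =
      (y - D.p.q1 ^ 2 * D.p.q3 * z) * (y - D.p.q3⁻¹ * z) * (y - D.p.q1⁻¹ * D.p.q3 ^ m * z) *
        (y - D.p.q1 * D.p.q3 ^ (m + 2) * z) := by
  have := D.roots_distinct m
  simp only [List.nodup_cons, List.mem_cons, List.not_mem_nil, or_false, not_or, not_false_eq_true,
    List.nodup_nil, and_true] at this
  obtain ⟨⟨h1, h2, h3⟩, ⟨h4, h5⟩, h6⟩ := this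
  rw [numPair, roots, if_pos rfl, prod_insert (by simp [h1, h2, h3]), prod_insert (by simp [h4, h5]),
    prod_insert (by simp [h6]), prod_singleton]
  simp only [mult, pow_one, hy, hz]
  ring

lemma numPair_succ (w : Var m L K → ℂ) {i : Fin (m + 1)} {k : ℕ} (hk : (i : ℕ) = k + 1) (a : Fin L)
    (b : Fin K) {y z : ℂ} (hy : w (Sum.inl (i, a)) = y) (hz : w (Sum.inr b) = z) :
    D.numPair w (Sum.inl (i, a)) (Sum.inr b) =
      (y - (D.cy i)⁻¹ * (D.p.q1 * D.p.q3 ^ (k + 2)) * z) *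
        (y - (D.cy i)⁻¹ * (D.p.q1⁻¹ * D.p.q3 ^ k) * z) := by
  have h2 : i ≠ 0 := by simp [Fin.ext_iff, hk]
  rw [numPair, roots, if_neg h2]
  simp only [hk, Nat.add_sub_cancel, add_assoc, one_add_one_eq_two]
  rw [prod_insert (by rw [mem_singleton]; exact D.roots_succ_ne _ _), prod_singleton]
  simp only [mult, pow_one, hy, hz]

end FusionData

namespace FusionData
variable {m : ℕ} (D : FusionData m) {L K : ℕ}

lemma mem_fib_pt {w : Var m L K → ℂ} {u : Var m L K} {x : Fin (m + 2) × ℂ} :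
    x ∈ D.fib (Var.pt w u) ↔ ∃ l : Src m L K, l.var = u ∧ (l.1, D.spl w l) = x := by
  rcases u with ⟨i, a⟩ | b
  · constructor
    · intro h
      by_cases hi : i = 0
      · subst hi
        simp only [Var.pt, fib, if_true, mem_insert, mem_singleton] at h
        rcases h with rfl | rfl
        · exact ⟨(Fin.castSucc 0, Sum.inl a), by simp [Src.var], by simp [spl, coef, Src.var]⟩
        · exact ⟨(Fin.last (m + 1), Sum.inl a), by simp [Src.var],
            by rw [spl, Src.var, ofNat_last, coef, Fin.val_last, D.cy_last, one_mul]⟩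
      · simp only [Var.pt, fib, if_neg hi, mem_insert, notMem_empty, or_false] at h
        exact ⟨(i.castSucc, Sum.inl a), by simp only [Src.var, ofNat_castSucc],
          by simp only [spl, coef, Src.var, ofNat_castSucc, h]; rfl⟩
    · rintro ⟨⟨j, a' | b⟩, h, rfl⟩
      · simp only [Src.var, Sum.inl.injEq, Prod.mk.injEq] at h
        obtain ⟨h, rfl⟩ := h
        induction j using Fin.lastCases with
        | last =>
          rw [ofNat_last] at h
          subst h
          rw [spl, Src.var, ofNat_last, coef, Fin.val_last, D.cy_last, one_mul]
          exact D.last_mem_fib_inl _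
        | cast j =>
          rw [ofNat_castSucc] at h
          subst h
          simp only [spl, coef, Src.var, ofNat_castSucc]
          exact D.mem_fib_inl _ _
      · simp [Src.var] at h
  · constructor
    · intro h
      simp only [Var.pt, fib, mem_image, mem_univ, true_and] at h
      obtain ⟨j, rfl⟩ := h
      exact ⟨(j, Sum.inr b), rfl, rfl⟩
    · rintro ⟨⟨j, a' | b⟩, h, rfl⟩
      · simp [Src.var] at h
      · simp only [Src.var, Sum.inr.injEq] at h
        subst h
        exact D.mem_fib_inr _ _

lemma apart_pt {w : Var m L K → ℂ} (hw : Distinct (D.spl w)) {u v : Var m L K} (h : u ≠ v) :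
    D.Apart (Var.pt w u) (Var.pt w v) := by
  intro x hx x' hx' e
  obtain ⟨l, rfl, rfl⟩ := D.mem_fib_pt.1 hx
  obtain ⟨l', rfl, rfl⟩ := D.mem_fib_pt.1 hx'
  exact h (congrArg _ (hw.2 e))

lemma good_pts {w : Var m L K → ℂ} (h : Split w) (hw : Distinct (D.spl w)) : D.Good (Var.pts w) := by
  refine ⟨?_, ?_, ?_⟩
  · rw [Var.toLeft_pts]; exact h.1.admissible _
  · rw [Var.toRight_pts]; exact h.2.admissible _
  · intro u hu v hv huv
    obtain ⟨u, -, rfl⟩ := mem_image.1 hu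
    obtain ⟨v, -, rfl⟩ := mem_image.1 hv
    exact D.apart_pt hw fun e => huv (congrArg _ e)

/-- The specialized variables are distinct, and so are the variables of each tensor factor. -/
def Generic (w : Var m L K → ℂ) : Prop := Split w ∧ Distinct (D.spl w)

lemma numPair_inl_inl (w : Var m L K → ℂ) (i i' : Fin (m + 1)) (a a' : Fin L) :
    D.numPair w (Sum.inl (i, a)) (Sum.inl (i', a')) = if i = 0 ∧ i' = 0 then
      w (Sum.inl (i, a)) - D.p.q2 * w (Sum.inl (i', a')) else 1 := by
  rw [numPair, roots]
  split_ifs <;> simp [mult]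

lemma numPair_inr_inl (w : Var m L K → ℂ) (u : Fin (m + 1) × Fin L) (b : Fin K) :
    D.numPair w (Sum.inr b) (Sum.inl u) = 1 := by
  rw [numPair, roots, prod_empty]

lemma numPair_inr_inr (w : Var m L K → ℂ) (b b' : Fin K) :
    D.numPair w (Sum.inr b) (Sum.inr b') =
      (w (Sum.inr b) - D.p.q2 * w (Sum.inr b')) ^ (m + 1) := by
  rw [numPair, roots, prod_singleton, mult]

/-- The denominators of `gyy` are, up to constants, the source poles at the specialized variables
and cancel against them. The numerator and the target poles remain. The next three lemmas do the
same for the other kinds of pairs. -/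
lemma pair_yy (i i' : Fin (m + 1)) {y y' : ℂ} (h : D.Apart (Sum.inl (i, y)) (Sum.inl (i', y'))) :
    D.gyy i y i' y' * (D.polePair (Sum.inl (i, y)) (Sum.inl (i', y')) *
      D.polePair (Sum.inl (i', y')) (Sum.inl (i, y))) =
    ((if i' = finRotate (m + 1) i then D.cy i else 1) *
      (if i = finRotate (m + 1) i' then D.eps * D.cy i' else 1) *
      (if i = 0 ∧ i' = 0 then D.p.delta (m + 2) * (D.p.q1⁻¹ * D.p.q2⁻¹) else 1)) *
    ((if i = 0 ∧ i' = 0 then y - D.p.q2 * y' else 1) * (if i' = 0 ∧ i = 0 then y' - D.p.q2 * y else 1) *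
      ((if i' = finRotate (m + 1) i then y - y' else 1) *
        (if i = finRotate (m + 1) i' then y' - y else 1))) := by
  have h1 := D.p.q1_ne
  have h2 := D.p.q2_ne
  have ht := D.t_ne
  rw [polePair, polePair, dbl_inl_inl, dbl_inl_inl, gyy]
  simp only [ite_self, one_mul, mul_one]
  have e1 : (if i' = finRotate (m + 1) i then D.rr y y' else 1) *
      (if i' = finRotate (m + 1) i then D.cy i * y - D.cy i * D.t * y' else 1) =
      (if i' = finRotate (m + 1) i then D.cy i else 1) *
        (if i' = finRotate (m + 1) i then y - y' else 1) := by
    split_ifs with hi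
    · have := sub_ne_zero.2 (h.up hi)
      rw [rr, mul_assoc (D.cy i), ← mul_sub, div_mul_eq_mul_div, div_eq_iff this]; ring
    · simp
  have e2 : (if i = finRotate (m + 1) i' then D.eps * D.rr y' y else 1) *
      (if i = finRotate (m + 1) i' then D.cy i' * y' - D.cy i' * D.t * y else 1) =
      (if i = finRotate (m + 1) i' then D.eps * D.cy i' else 1) *
        (if i = finRotate (m + 1) i' then y' - y else 1) := by
    split_ifs with hi
    · have := sub_ne_zero.2 (h.symm.up hi)
      rw [rr, mul_assoc (D.cy i'), ← mul_sub, mul_assoc D.eps, div_mul_eq_mul_div, mul_div_assoc', div_eq_iff this]; ring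
    · simp
  have e3 : (if i = 0 ∧ i' = 0 then D.p.delta (m + 2) *
      (((y - D.p.q2 * y') * (y - D.p.q2⁻¹ * y')) / ((y - D.p.q1 * y') * (y - D.p.q1⁻¹ * y'))) else 1) *
      ((if i = 0 ∧ i' = 0 then y - D.cy (0 : ℕ) * y' else 1) *
       (if i' = 0 ∧ i = 0 then y' - D.cy (0 : ℕ) * y else 1)) =
      (if i = 0 ∧ i' = 0 then D.p.delta (m + 2) * (D.p.q1⁻¹ * D.p.q2⁻¹) else 1) *
      ((if i = 0 ∧ i' = 0 then y - D.p.q2 * y' else 1) * (if i' = 0 ∧ i = 0 then y' - D.p.q2 * y else 1)) := by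
    by_cases hi : i = 0 ∧ i' = 0
    · simp only [hi, if_true, and_self]
      obtain ⟨rfl, rfl⟩ := hi
      obtain ⟨h5, h6⟩ := h.wrap
      have h5 := sub_ne_zero.2 h5
      have h6 := sub_ne_zero.2 h6
      have h7 : y - D.p.q1 * y' ≠ 0 := fun e => h6 (by field_simp; linear_combination e)
      have e7 : y' - D.cy 0 * y = -D.p.q1⁻¹ * (y - D.p.q1 * y') := by rw [D.cy_zero]; field_simp; ring
      have e8 : y' - D.p.q2 * y = -D.p.q2 * (y - D.p.q2⁻¹ * y') := by field_simp; ring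
      rw [e7, e8, D.cy_zero]
      generalize y - D.p.q1 * y' = X1 at *
      generalize y - D.p.q1⁻¹ * y' = X2 at *
      generalize y - D.p.q2 * y' = X3 at *
      generalize y - D.p.q2⁻¹ * y' = X4 at *
      field_simp
    · rw [if_neg hi, if_neg hi, if_neg hi, if_neg hi, if_neg fun e => hi e.symm, if_neg fun e => hi e.symm]
  generalize (if i' = finRotate (m + 1) i then D.rr y y' else 1) = A1 at *
  generalize (if i = finRotate (m + 1) i' then D.eps * D.rr y' y else 1) = A2 at *
  linear_combination (exp := 1) (A2 *
      (if i = finRotate (m + 1) i' then D.cy i' * y' - D.cy i' * D.t * y else 1) *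
      ((if i = 0 ∧ i' = 0 then D.p.delta (m + 2) *
      (((y - D.p.q2 * y') * (y - D.p.q2⁻¹ * y')) / ((y - D.p.q1 * y') * (y - D.p.q1⁻¹ * y'))) else 1) *
      ((if i = 0 ∧ i' = 0 then y - D.cy (0 : ℕ) * y' else 1) *
       (if i' = 0 ∧ i = 0 then y' - D.cy (0 : ℕ) * y else 1)))) * e1 +
    ((if i' = finRotate (m + 1) i then D.cy i else 1) *
        (if i' = finRotate (m + 1) i then y - y' else 1) *
      ((if i = 0 ∧ i' = 0 then D.p.delta (m + 2) *
      (((y - D.p.q2 * y') * (y - D.p.q2⁻¹ * y')) / ((y - D.p.q1 * y') * (y - D.p.q1⁻¹ * y'))) else 1) *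
      ((if i = 0 ∧ i' = 0 then y - D.cy (0 : ℕ) * y' else 1) *
       (if i' = 0 ∧ i = 0 then y' - D.cy (0 : ℕ) * y else 1)))) * e2 +
    ((if i' = finRotate (m + 1) i then D.cy i else 1) *
        (if i' = finRotate (m + 1) i then y - y' else 1) *
      ((if i = finRotate (m + 1) i' then D.eps * D.cy i' else 1) *
        (if i = finRotate (m + 1) i' then y' - y else 1))) * e3

lemma pair_yz_zero {y : ℂ} {z : Fin 1 × ℂ} (h : D.Apart (Sum.inl (0, y)) (Sum.inr z)) :
    D.gyz 0 y z.2 * (D.polePair (Sum.inl (0, y)) (Sum.inr z) * D.polePair (Sum.inr z) (Sum.inl (0, y))) =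
      (D.p.delta (m + 2) ^ 2 * D.p.q1⁻¹ ^ 2) *
      ((y - D.p.q1 ^ 2 * D.p.q3 * z.2) * (y - D.p.q3⁻¹ * z.2) * (y - D.p.q1⁻¹ * D.p.q3 ^ m * z.2) *
        (y - D.p.q1 * D.p.q3 ^ (m + 2) * z.2)) := by
  have h1 := D.p.q1_ne
  rw [polePair, polePair, dbl_inl_zero_inr, dbl_inr_inl_zero, gyz, if_pos rfl]
  have a0 := h.inl_inr (j := 0) (by omega)
  have a1 := h.inl_inr (j := 1) (by omega)
  have am := h.inl_inr (j := m + 1) (by omega)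
  have b0 := h.inl_inr' (j := 0) (by omega)
  have bm := h.inl_inr' (j := m) (by omega)
  obtain ⟨_, z⟩ := z
  simp only [Fin.val_zero, cy_zero, pow_zero, pow_one, one_mul, mul_one] at *
  have c : ∀ {a : ℂ}, D.p.q1⁻¹ * y - a ≠ 0 → y - D.p.q1 * a ≠ 0 := by
    intro a ha e; apply ha; rw [sub_eq_zero.1 e, inv_mul_cancel_left₀ h1, sub_self]
  have a1 := c a1
  have am := c am
  have c' : ∀ a : ℂ, D.p.q1⁻¹ * y - a = D.p.q1⁻¹ * (y - D.p.q1 * a) := by intro a; field_simp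
  have c'' : ∀ a : ℂ, a - D.p.q1⁻¹ * y = -D.p.q1⁻¹ * (y - D.p.q1 * a) := by intro a; field_simp; ring
  rw [c', c'', ← neg_sub y (D.p.q3 ^ m * z)]
  simp only [← mul_assoc] at *
  generalize y - D.p.q1 * D.p.q3 * z = A1 at *
  generalize y - D.p.q1 * D.p.q3 ^ (m + 1) * z = A2 at *
  generalize y - z = B0 at *
  generalize y - D.p.q3 ^ m * z = B1 at *
  generalize y - D.p.q1⁻¹ * D.p.q3 ^ m * z = C0 at *
  generalize y - D.p.q1 * D.p.q3 ^ (m + 2) * z = C1 at *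
  generalize y - D.p.q1 ^ 2 * D.p.q3 * z = C2 at *
  generalize y - D.p.q3⁻¹ * z = C3 at *
  field_simp

lemma pair_yz_succ {i : Fin (m + 1)} {k : ℕ} (hk : (i : ℕ) = k + 1) {y : ℂ} {z : Fin 1 × ℂ}
    (h : D.Apart (Sum.inl (i, y)) (Sum.inr z)) :
    D.gyz i y z.2 * (D.polePair (Sum.inl (i, y)) (Sum.inr z) * D.polePair (Sum.inr z) (Sum.inl (i, y))) =
      (-D.p.delta (m + 2) * D.cy i ^ 2) *
      ((y - (D.cy i)⁻¹ * (D.p.q1 * D.p.q3 ^ (k + 2)) * z.2) *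
        (y - (D.cy i)⁻¹ * (D.p.q1⁻¹ * D.p.q3 ^ k) * z.2)) := by
  have h1 := D.p.q1_ne
  have hlt := i.2
  have hi : i ≠ 0 := by simp [Fin.ext_iff, hk]
  rw [polePair, polePair, D.dbl_inl_succ_inr _ _ _ hk, D.dbl_inr_inl_succ _ _ _ hk, gyz, if_neg hi]
  have a0 := h.inl_inr (j := k) (by omega)
  have a2 := h.inl_inr (j := k + 2) (by omega)
  obtain ⟨_, z⟩ := z
  have hc := D.cy_ne i
  simp only [hk, Nat.add_sub_cancel, add_assoc, one_add_one_eq_two, one_mul, mul_one] at *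
  have c : ∀ a : ℂ, y - (D.cy (k + 1))⁻¹ * a * z = (D.cy (k + 1))⁻¹ * (D.cy (k + 1) * y - a * z) := by
    intro a; field_simp
  rw [c, c, ← neg_sub (D.cy (k + 1) * y) (D.p.q3 ^ k * z)]
  generalize D.cy (k + 1) * y - D.p.q3 ^ k * z = A0 at *
  generalize D.cy (k + 1) * y - D.p.q3 ^ (k + 2) * z = A2 at *
  generalize D.cy (k + 1) * y - D.p.q1 * D.p.q3 ^ (k + 2) * z = C0 at *
  generalize D.cy (k + 1) * y - D.p.q1⁻¹ * D.p.q3 ^ k * z = C1 at *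
  field_simp

lemma pair_zz {z z' : Fin 1 × ℂ} (h : D.Apart (Sum.inr z) (Sum.inr z')) :
    D.gzz z.2 z'.2 * (D.polePair (Sum.inr z) (Sum.inr z') * D.polePair (Sum.inr z') (Sum.inr z)) =
      (D.p.delta (m + 2) ^ (m + 2) * (∏ j : Fin (m + 1), D.p.q3 ^ (j : ℕ)) ^ 2 *
        (D.p.q3 ^ (m + 1)) * ((-D.p.q3) * (-D.p.q2)⁻¹) ^ (m + 1)) *
      ((z.2 - D.p.q2 * z'.2) ^ (m + 1) * (z'.2 - D.p.q2 * z.2) ^ (m + 1) *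
        ((z.2 - z'.2) * (z'.2 - z.2))) := by
  have h1 := D.p.q1_ne
  have h2 := D.p.q2_ne
  have h3 := D.p.q3_ne
  obtain ⟨i, z⟩ := z
  obtain ⟨j, z'⟩ := z'
  have c01 := h.inr_inr (j := 0) (k := 1) (by omega) (by omega)
  have c10 := h.inr_inr (j := 1) (k := 0) (by omega) (by omega)
  have c0m := h.inr_inr (j := 0) (k := m + 1) (by omega) (by omega)
  have cm0 := h.inr_inr (j := m + 1) (k := 0) (by omega) (by omega)
  have hQ : D.p.q3 ^ (m + 1) ≠ 0 := pow_ne_zero _ h3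
  have f : ∀ (k : ℕ) (x y : ℂ), D.p.q3 ^ k * x - D.p.q3 ^ (k + 1) * y =
      D.p.q3 ^ k * (x - D.p.q3 * y) := fun k x y => by ring
  rw [polePair, polePair, dbl_inr_inr, dbl_inr_inr, gzz]
  simp only [prod_const_one, mul_one, one_mul, f, prod_mul_distrib, prod_const, card_univ, Fintype.card_fin]
  simp only [pow_zero, pow_one, one_mul] at *
  have c10' : z - D.p.q3⁻¹ * z' ≠ 0 := fun e => c10 (by
    have := congrArg (D.p.q3 * ·) e; field_simp at this; simpa using this)
  have cm0' : z - (D.p.q3 ^ (m + 1))⁻¹ * z' ≠ 0 := fun e => cm0 (by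
    have := congrArg (D.p.q3 ^ (m + 1) * ·) e; field_simp at this; simpa using this)
  have g1 : D.p.q3 ^ (m + 1) * z - z' = D.p.q3 ^ (m + 1) * (z - (D.p.q3 ^ (m + 1))⁻¹ * z') := by field_simp
  have g2 : D.p.q3 ^ (m + 1) * z' - z = - (z - D.p.q3 ^ (m + 1) * z') := by ring
  have g3 : z' - D.p.q3 * z = (- D.p.q3) * (z - D.p.q3⁻¹ * z') := by field_simp; ring
  have g4 : z' - D.p.q2 * z = (- D.p.q2) * (z - D.p.q2⁻¹ * z') := by field_simp; ring
  have g5 : z' - z = -(z - z') := by ring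
  rw [g1, g2, g3, g4, g5]
  generalize (D.p.q3 ^ (m + 1))⁻¹ = Q1 at *
  generalize z - D.p.q2 * z' = A at *
  generalize z - D.p.q2⁻¹ * z' = B at *
  generalize z - D.p.q3 * z' = C at *
  generalize z - D.p.q3⁻¹ * z' = E at *
  generalize z - z' = G at *
  generalize z - Q1 * z' = H at *
  generalize z - D.p.q3 ^ (m + 1) * z' = I at *
  have h2' := neg_ne_zero.2 h2
  generalize -D.p.q2 = r2 at *
  generalize -D.p.q3 = r3 at *
  simp only [div_pow, mul_pow, inv_pow]
  field_simp

/-- Taking both orders of a pair together removes the square roots. The constant has to be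
independent of `w`, so that the constants of all pairs can be collected by `exists_prod_offDiag_eq`.
-/
lemma exists_pair (u v : Var m L K) (huv : u ≠ v) : ∃ k : ℂ, k ≠ 0 ∧ ∀ w, D.Generic w →
    (D.g (Var.pt w u) (Var.pt w v) ^ (1 / 2 : ℂ) * D.polePair (Var.pt w u) (Var.pt w v)) *
      (D.g (Var.pt w v) (Var.pt w u) ^ (1 / 2 : ℂ) * D.polePair (Var.pt w v) (Var.pt w u)) =
    k * ((D.numPair w u v * polePairT (Var.pt w u) (Var.pt w v)) *
      (D.numPair w v u * polePairT (Var.pt w v) (Var.pt w u))) := by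
  suffices ∃ k : ℂ, k ≠ 0 ∧ ∀ w, D.Generic w →
      D.g (Var.pt w u) (Var.pt w v) * (D.polePair (Var.pt w u) (Var.pt w v) *
        D.polePair (Var.pt w v) (Var.pt w u)) =
      k * (D.numPair w u v * D.numPair w v u *
        (polePairT (Var.pt w u) (Var.pt w v) * polePairT (Var.pt w v) (Var.pt w u))) by
    obtain ⟨k, hk, h⟩ := this
    refine ⟨k, hk, fun w hw => ?_⟩
    have := h w hw
    have e := sqrt_mul_sqrt (D.g (Var.pt w u) (Var.pt w v))
    rw [D.g_symm (Var.pt w v)]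
    generalize D.g (Var.pt w u) (Var.pt w v) ^ (1 / 2 : ℂ) = s at *
    rw [← e] at this
    linear_combination this
  have h1 := inv_ne_zero D.p.q1_ne
  have h2 := inv_ne_zero D.p.q2_ne
  have h3 := D.p.q3_ne
  have hd := D.p.delta_ne (m + 2)
  have hk0 : D.p.delta (m + 2) ^ 2 * D.p.q1⁻¹ ^ 2 ≠ 0 := mul_ne_zero (pow_ne_zero _ hd) (pow_ne_zero _ h1)
  have hk1 : ∀ i : ℕ, -D.p.delta (m + 2) * D.cy i ^ 2 ≠ 0 := fun i =>
    mul_ne_zero (neg_ne_zero.2 hd) (pow_ne_zero _ (D.cy_ne i))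
  rcases u with ⟨i, a⟩ | b <;> rcases v with ⟨i', a'⟩ | b'
  · refine ⟨(if i' = finRotate (m + 1) i then D.cy i else 1) *
      (if i = finRotate (m + 1) i' then D.eps * D.cy i' else 1) *
      (if i = 0 ∧ i' = 0 then D.p.delta (m + 2) * (D.p.q1⁻¹ * D.p.q2⁻¹) else 1), ?_,
      fun w hw => (D.pair_yy i i' (D.apart_pt hw.2 huv)).trans ?_⟩
    · have h4 := D.cy_ne i
      have h5 := D.cy_ne i'
      have h6 := D.eps_ne
      refine mul_ne_zero (mul_ne_zero ?_ ?_) ?_ <;> split_ifs <;>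
        simp only [ne_eq, mul_eq_zero, not_or, one_ne_zero, not_false_eq_true] <;> tauto
    · rw [numPair_inl_inl, numPair_inl_inl]; rfl
  · by_cases hi : i = 0
    · subst hi
      refine ⟨_, hk0, fun w hw => (D.pair_yz_zero (D.apart_pt hw.2 huv)).trans ?_⟩
      rw [D.numPair_zero w a b' rfl rfl, numPair_inr_inl]
      simp only [polePairT, mul_one, Var.pt]
    · obtain ⟨k, hk⟩ : ∃ k, (i : ℕ) = k + 1 := Nat.exists_eq_succ_of_ne_zero (fun e => hi (Fin.ext e))
      refine ⟨_, hk1 i, fun w hw => (D.pair_yz_succ hk (D.apart_pt hw.2 huv)).trans ?_⟩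
      rw [D.numPair_succ w hk a b' rfl rfl, numPair_inr_inl]
      simp only [polePairT, mul_one, Var.pt]
  · have hg : ∀ w : Var m L K → ℂ, D.g (Var.pt w (Sum.inr b)) (Var.pt w (Sum.inl (i', a'))) *
        (D.polePair (Var.pt w (Sum.inr b)) (Var.pt w (Sum.inl (i', a'))) *
          D.polePair (Var.pt w (Sum.inl (i', a'))) (Var.pt w (Sum.inr b))) =
        D.gyz i' (w (Sum.inl (i', a'))) (w (Sum.inr b)) *
        (D.polePair (Var.pt w (Sum.inl (i', a'))) (Var.pt w (Sum.inr b)) *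
          D.polePair (Var.pt w (Sum.inr b)) (Var.pt w (Sum.inl (i', a')))) := fun w => by
      rw [mul_comm (D.polePair _ _)]; rfl
    by_cases hi : i' = 0
    · subst hi
      refine ⟨_, hk0, fun w hw => (hg w).trans ((D.pair_yz_zero (D.apart_pt hw.2 huv.symm)).trans ?_)⟩
      rw [D.numPair_zero w a' b rfl rfl, numPair_inr_inl]
      simp only [polePairT, mul_one, one_mul, Var.pt]
    · obtain ⟨k, hk⟩ : ∃ k, (i' : ℕ) = k + 1 := Nat.exists_eq_succ_of_ne_zero (fun e => hi (Fin.ext e))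
      refine ⟨_, hk1 i', fun w hw =>
        (hg w).trans ((D.pair_yz_succ hk (D.apart_pt hw.2 huv.symm)).trans ?_)⟩
      rw [D.numPair_succ w hk a' b rfl rfl, numPair_inr_inl]
      simp only [polePairT, mul_one, one_mul, Var.pt]
  · refine ⟨D.p.delta (m + 2) ^ (m + 2) * (∏ j : Fin (m + 1), D.p.q3 ^ (j : ℕ)) ^ 2 *
        (D.p.q3 ^ (m + 1)) * ((-D.p.q3) * (-D.p.q2)⁻¹) ^ (m + 1), ?_,
        fun w hw => (D.pair_zz (D.apart_pt hw.2 huv)).trans ?_⟩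
    · have h4 : ∏ j : Fin (m + 1), D.p.q3 ^ (j : ℕ) ≠ 0 := prod_ne_zero_iff.2 fun j _ => pow_ne_zero _ h3
      exact mul_ne_zero (mul_ne_zero (mul_ne_zero (pow_ne_zero _ hd) (pow_ne_zero _ h4)) (pow_ne_zero _ h3))
        (pow_ne_zero _ (mul_ne_zero (neg_ne_zero.2 h3) (inv_ne_zero (neg_ne_zero.2 D.p.q2_ne))))
    · rw [numPair_inr_inr, numPair_inr_inr]; rfl

/-- `φ` is given by a nonzero constant times a monomial. -/
def IsMonomial {κ : Type} [Fintype κ] (φ : (κ → ℂ) → ℂ) : Prop :=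
  ∃ (c : ℂ) (n : κ → ℕ), c ≠ 0 ∧ ∀ w, φ w = c * ∏ u, w u ^ n u

section Monomial
variable {κ : Type} [Fintype κ]
lemma IsMonomial.const {c : ℂ} (hc : c ≠ 0) : IsMonomial fun _ : κ → ℂ => c :=
  ⟨c, 0, hc, fun w => by simp⟩

lemma IsMonomial.coord (u : κ) : IsMonomial fun w : κ → ℂ => w u := by
  classical
  refine ⟨1, Pi.single u 1, one_ne_zero, fun w => ?_⟩
  rw [one_mul, prod_eq_single u]
  · simp
  · intro v _ hv; simp [hv]
  · simp

lemma IsMonomial.mul {φ ψ : (κ → ℂ) → ℂ} (h : IsMonomial φ) (h' : IsMonomial ψ) :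
    IsMonomial fun w => φ w * ψ w := by
  obtain ⟨c, n, hc, h⟩ := h
  obtain ⟨c', n', hc', h'⟩ := h'
  refine ⟨c * c', n + n', mul_ne_zero hc hc', fun w => ?_⟩
  simp only [h, h', Pi.add_apply, pow_add, prod_mul_distrib]
  ring

lemma IsMonomial.prod {α : Type*} (s : Finset α) {φ : α → (κ → ℂ) → ℂ} (h : ∀ a ∈ s, IsMonomial (φ a)) :
    IsMonomial fun w => ∏ a ∈ s, φ a w := by
  classical
  induction s using Finset.induction_on with
  | empty => simpa using IsMonomial.const one_ne_zero
  | insert a s ha ih =>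
    simp only [prod_insert ha]
    exact (h a (mem_insert_self _ _)).mul (ih fun b hb => h b (mem_insert_of_mem hb))

lemma IsMonomial.pow {φ : (κ → ℂ) → ℂ} (h : IsMonomial φ) (n : ℕ) : IsMonomial fun w => φ w ^ n := by
  simpa using IsMonomial.prod (range n) fun _ _ => h

lemma IsMonomial.ne_zero {φ : (κ → ℂ) → ℂ} (h : IsMonomial φ) {w : κ → ℂ} (hw : ∀ u, w u ≠ 0) :
    φ w ≠ 0 := by
  obtain ⟨c, n, hc, h⟩ := h
  rw [h]
  exact mul_ne_zero hc (prod_ne_zero_iff.2 fun u _ => pow_ne_zero _ (hw u))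

/-- The inverse of a monomial is a Laurent monomial. -/
lemma IsMonomial.exists_inv {φ : (κ → ℂ) → ℂ} (h : IsMonomial φ) : ∃ (Q : MvPolynomial κ ℂ) (k : ℕ),
    (∀ w, φ w * MvPolynomial.eval w Q = (∏ u, w u) ^ k) := by
  obtain ⟨c, n, hc, h⟩ := h
  refine ⟨MvPolynomial.C c⁻¹ * ∏ u, MvPolynomial.X u ^ (∑ v, n v - n u), ∑ v, n v, fun w => ?_⟩
  rw [h, map_mul, map_prod]
  simp only [map_pow, MvPolynomial.eval_C, MvPolynomial.eval_X]
  rw [mul_mul_mul_comm, mul_inv_cancel₀ hc, one_mul, ← prod_mul_distrib, ← prod_pow]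
  refine prod_congr rfl fun u _ => ?_
  rw [← pow_add, Nat.add_sub_cancel' (single_le_sum (f := n) (fun _ _ => Nat.zero_le _) (mem_univ u))]
end Monomial

/-- Points of one fibre have fixed ratios different from `1`, so their differences are nonzero
multiples of the variable. -/
lemma polePair_self (u : Var m L K) : IsMonomial fun w => D.polePair (Var.pt w u) (Var.pt w u) := by
  have h1 : 1 - D.p.q1⁻¹ ≠ 0 := sub_ne_zero.2 fun e => q1_ne_one (D := D) (inv_eq_one.1 e.symm)
  rcases u with ⟨i, a⟩ | b
  · simp only [Var.pt, polePair, dbl_inl_inl, one_mul, mul_one, ite_self]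
    refine IsMonomial.mul ?_ ?_
    · split_ifs with h
      · have h2 : D.cy i * (1 - D.t) ≠ 0 := by
          refine mul_ne_zero (D.cy_ne _) (sub_ne_zero.2 fun e => q1_ne_one (D := D) ?_)
          rw [← D.root, ← e, one_pow]
        have := (IsMonomial.const h2).mul (IsMonomial.coord (Sum.inl (i, a) : Var m L K))
        convert this using 2
        ring
      · exact IsMonomial.const one_ne_zero
    · split_ifs with h
      · have := (IsMonomial.const h1).mul (IsMonomial.coord (Sum.inl (i, a) : Var m L K))
        convert this using 2
        rw [D.cy_zero]
        ring
      · exact IsMonomial.const one_ne_zero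
  · simp only [Var.pt, polePair, dbl_inr_inr, prod_const_one, one_mul, mul_one]
    have hq : ∀ j k : ℕ, j ≠ k → IsMonomial fun w : Var m L K → ℂ =>
        D.p.q3 ^ j * w (Sum.inr b) - D.p.q3 ^ k * w (Sum.inr b) := fun j k hjk => by
      have h2 : D.p.q3 ^ j - D.p.q3 ^ k ≠ 0 :=
        sub_ne_zero.2 fun e => hjk (q3_pow_injective (D := D) e)
      have := (IsMonomial.const h2).mul (IsMonomial.coord (Sum.inr b : Var m L K))
      convert this using 2
      ring
    refine IsMonomial.mul (IsMonomial.prod _ fun j _ => hq _ _ (by omega)) ?_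
    simpa using hq (m + 1) 0 (by omega)

/-- The numerator of the fusion factor. -/
def num (w : Var m L K → ℂ) : ℂ := ∏ x ∈ univ.offDiag, D.numPair w x.1 x.2

lemma eta_ne : D.eta ≠ 0 := by
  rw [eta]
  split_ifs
  · exact inv_ne_zero (mul_ne_zero (mul_ne_zero D.p.q_ne D.p.q1_ne) D.t_ne)
  · exact one_ne_zero

lemma psi_pts {w : Var m L K → ℂ} (h : Split w) : D.psi (Var.pts w) =
    (∏ u : Var m L K, Sum.elim (fun i => if i.1 = 0 then D.eta else 1) (fun _ => 1) u) *
      ∏ x ∈ univ.offDiag, D.g (Var.pt w x.1) (Var.pt w x.2) ^ (1 / 2 : ℂ) := by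
  classical
  rw [psi, Var.pts, prod_image h.pt_injective.injOn]
  congr 1
  · exact prod_congr rfl fun u _ => by rcases u with ⟨i, a⟩ | b <;> rfl
  · have e : (univ.image (Var.pt w)).offDiag =
        (univ.offDiag).image (Prod.map (Var.pt w) (Var.pt w)) := by
      ext ⟨u, v⟩
      simp only [mem_offDiag, mem_image, mem_univ, true_and, Prod.exists, Prod.map, Prod.mk.injEq]
      constructor
      · rintro ⟨⟨a, rfl⟩, ⟨b, rfl⟩, hab⟩
        exact ⟨a, b, fun e => hab (congrArg _ e), rfl, rfl⟩
      · rintro ⟨a, b, hab, rfl, rfl⟩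
        exact ⟨⟨a, rfl⟩, ⟨b, rfl⟩, fun e => hab (h.pt_injective e)⟩
    have e2 := prod_image (f := fun x : Pt m × Pt m => D.g x.1 x.2 ^ (1 / 2 : ℂ))
      (s := (univ : Finset (Var m L K)).offDiag) (g := Prod.map (Var.pt w) (Var.pt w))
      (h.pt_injective.prodMap h.pt_injective).injOn
    rw [← e] at e2
    exact Eq.trans (by congr!) e2

/-- The product of the fusion factor and the poles of the specialization. -/
lemma exists_psi_mul_poleDenom : ∃ μ : (Var m L K → ℂ) → ℂ, IsMonomial μ ∧ ∀ w, D.Generic w →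
    D.psi (Var.pts w) * poleDenom Prod.fst (D.spl w) = μ w * D.num w * poles w := by
  classical
  obtain ⟨k, hk, h⟩ := exists_prod_offDiag_eq
    (f := fun (w : Var m L K → ℂ) u v => D.g (Var.pt w u) (Var.pt w v) ^ (1 / 2 : ℂ) *
      D.polePair (Var.pt w u) (Var.pt w v))
    (g := fun w u v => D.numPair w u v * polePairT (Var.pt w u) (Var.pt w v))
    (good := D.Generic) univ D.exists_pair
  have h1 : (∏ u : Var m L K, Sum.elim (fun i => if i.1 = 0 then D.eta else 1) (fun _ => 1) u) ≠ 0 := by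
    refine prod_ne_zero_iff.2 fun u _ => ?_
    rcases u with u | u
    · simp only [Sum.elim_inl]; split_ifs
      · exact D.eta_ne
      · exact one_ne_zero
    · exact one_ne_zero
  refine ⟨_, (IsMonomial.const (mul_ne_zero h1 hk)).mul (IsMonomial.prod univ fun u _ => D.polePair_self u),
    fun w hw => ?_⟩
  have := h w hw
  simp only [prod_mul_distrib] at this
  rw [D.psi_pts hw.1, poleDenom_spl, num, poles_eq]
  convert congrArg (· * ((∏ u : Var m L K, Sum.elim (fun i => if i.1 = 0 then D.eta else 1) (fun _ => 1) u) *
    ∏ u, D.polePair (Var.pt w u) (Var.pt w u))) this using 1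
  · ring
  · ring
end FusionData

/-! ### Identification of `psi` with the explicit fusion factor -/

lemma sum_card_Ioi (n : ℕ) : ∑ a : Fin n, (Ioi a).card = n.choose 2 := by
  simp only [Fin.card_Ioi]
  rw [Fin.sum_univ_eq_sum_range (fun i => n - 1 - i) n, sum_range_reflect (fun i => i) n,
    Finset.sum_range_id, Nat.choose_two_right]

lemma prod_Ioi_const {n : ℕ} (c : ℂ) (f : Fin n → Fin n → ℂ) :
    ∏ a, ∏ b ∈ Ioi a, (c * f a b) = c ^ n.choose 2 * ∏ a, ∏ b ∈ Ioi a, f a b := by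
  simp only [prod_mul_distrib, prod_const]
  rw [prod_pow_eq_pow_sum, sum_card_Ioi]

lemma prod_prod_ne_lt {n : ℕ} (f : Fin n → Fin n → ℂ) :
    ∏ a, ∏ b, (if a ≠ b then (if a < b then f a b else 1) else 1) = ∏ a, ∏ b ∈ Ioi a, f a b := by
  refine prod_congr rfl fun a _ => ?_
  rw [← prod_filter_of_ne (p := fun b => a < b)]
  · refine prod_congr (by ext; simp) fun b hb => ?_
    rw [mem_Ioi] at hb
    rw [if_pos hb.ne, if_pos hb]
  · intro b _ h
    by_contra hb
    exact h (by simp [hb])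

/-- The fusion data given by `q₁^{1/(m+1)} = exp (ℓ / (m + 1))`. -/
def fusionData (m : ℕ) (p : Params) (hp : p.Generic) (ℓ : ℂ) (hℓ : Complex.exp ℓ = p.q1) :
    FusionData m where
  p := p
  pt := p.tilde ℓ (m + 2)
  pf := p.fused (m + 2)
  t := qpow ℓ (1 / (((m + 2 : ℕ) : ℚ) - 1))
  root := by
    rw [qpow_pow, ← hℓ, ← qpow_one]
    congr 1
    have : ((m : ℚ) + 1) ≠ 0 := by positivity
    push_cast
    rw [show (m : ℚ) + 2 - 1 = m + 1 by ring]
    field_simp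
  generic := hp
  pt_q := rfl
  pt_q1 := rfl
  pf_q := rfl
  pf_q1 := by
    change p.q1 * p.q3 ^ (-((m + 2 : ℕ) : ℤ) + 1) * p.q3 ^ (m + 1) = p.q1
    rw [mul_assoc, ← zpow_natCast, ← zpow_add₀ p.q3_ne]
    have : -((m + 2 : ℕ) : ℤ) + 1 + ((m + 1 : ℕ) : ℤ) = 0 := by push_cast; ring
    rw [this, zpow_zero, mul_one]

section
variable (m : ℕ) (p : Params) (hp : p.Generic) (ℓ : ℂ) (hℓ : Complex.exp ℓ = p.q1) {L K : ℕ}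

lemma qpow_eq_cy (i : ℕ) : qpow ℓ (-(((m + 2 : ℕ) : ℚ) - ((i : ℕ) + 1)) / (((m + 2 : ℕ) : ℚ) - 1)) =
    (fusionData m p hp ℓ hℓ).cy i := by
  change _ = p.q1⁻¹ * qpow ℓ (1 / (((m + 2 : ℕ) : ℚ) - 1)) ^ i
  rw [qpow_pow, ← hℓ, ← qpow_one, ← qpow_neg, ← qpow_add]
  congr 1
  have : ((m : ℚ) + 1) ≠ 0 := by positivity
  push_cast
  rw [show (m : ℚ) + 2 - 1 = m + 1 by ring]
  field_simp
  ring

lemma specialize_eq (y : Fin (m + 1) → Fin L → ℂ) (z : Fin K → ℂ) :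
    specialize m p ℓ y z = (fusionData m p hp ℓ hℓ).spl (Sum.elim (Function.uncurry y) z) := by
  funext l
  rcases l with ⟨i, a | b⟩
  · simp only [specialize, FusionData.spl, FusionData.coef, Src.var, Sum.elim_inl, Function.uncurry]
    rw [qpow_eq_cy m p hp ℓ hℓ]
  · rfl
end

namespace FusionData
variable {m : ℕ} (D : FusionData m) {L K : ℕ}

/-- The distribution of the constant `eps` over the ordered pairs of variables. -/
def epsPair (i : Fin (m + 1)) (a : Fin L) (i' : Fin (m + 1)) (a' : Fin L) : ℂ :=
  if m = 0 then (if a < a' then D.eps else 1) else if m = 1 then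
    (if i.val = 0 ∧ i'.val = 1 then D.eps else 1) else 1

def sPair (y y' : ℂ) : ℂ :=
  ((y - D.p.q2 * y') * (y - D.p.q2⁻¹ * y')) / ((y - D.p.q1 * y') * (y - D.p.q1⁻¹ * y'))

/-- A distribution of `g` over ordered pairs without square roots, adapted to the explicit formula:
nontrivial only for `a < b` where the formula has a product over `a < b`, and only in one order for
mixed pairs. -/
def halfPair (w : Var m L K → ℂ) : Var m L K → Var m L K → ℂ
  | Sum.inl (i, a), Sum.inl (i', a') =>
      (if i' = finRotate (m + 1) i then D.rr (w (Sum.inl (i, a))) (w (Sum.inl (i', a'))) else 1) *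
        D.epsPair i a i' a' * (if i = 0 then (if i' = 0 then (if a < a' then
          D.p.delta (m + 2) * D.sPair (w (Sum.inl (i, a))) (w (Sum.inl (i', a'))) else 1) else 1) else 1)
  | Sum.inl (i, a), Sum.inr b => D.gyz i (w (Sum.inl (i, a))) (w (Sum.inr b))
  | Sum.inr _, Sum.inl _ => 1
  | Sum.inr b, Sum.inr b' => if b < b' then D.gzz (w (Sum.inr b)) (w (Sum.inr b')) else 1

/-- With one target colour `eps` occurs once for every unordered pair, with two colours once for
every pair of different colours, and otherwise it is `1`. -/
lemma epsPair_mul {i i' : Fin (m + 1)} {a a' : Fin L} (h : (i, a) ≠ (i', a')) :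
    D.epsPair i a i' a' * D.epsPair i' a' i a = if i = finRotate (m + 1) i' then D.eps else 1 := by
  have h1 := i.2
  have h2 := i'.2
  rw [epsPair, epsPair]
  simp only [eq_finRotate_iff]
  by_cases hm : m = 0
  · subst hm
    have : a ≠ a' := fun e => h (by rw [e, Fin.ext (a := i) (b := i') (by omega)])
    have h3 : i.val = i'.val + 1 ∨ i'.val = 0 ∧ i.val = 0 := by omega
    rw [if_pos rfl, if_pos rfl, if_pos h3]
    rcases lt_or_gt_of_ne this with h4 | h4
    · rw [if_pos h4, if_neg h4.asymm, mul_one]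
    · rw [if_pos h4, if_neg h4.asymm, one_mul]
  by_cases hm' : m = 1
  · subst hm'
    simp only [hm, if_false, if_true]
    by_cases h3 : i.val = i'.val
    · rw [if_neg (by omega), if_neg (by omega), if_neg (by omega), mul_one]
    · rw [if_pos (by omega : i.val = i'.val + 1 ∨ i'.val = 1 ∧ i.val = 0)]
      by_cases h4 : i.val = 0 ∧ i'.val = 1
      · rw [if_pos h4, if_neg (by omega), mul_one]
      · rw [if_neg h4, if_pos (by omega), one_mul]
  · simp only [hm, hm', if_false]
    rw [D.eps_eq_one (by omega)]
    simp

lemma sPair_symm (y y' : ℂ) : D.sPair y y' = D.sPair y' y := by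
  have h1 := D.p.q1_ne
  have h2 := D.p.q2_ne
  rw [sPair, sPair]
  congr 1
  · field_simp; ring
  · field_simp; ring

lemma halfPair_mul (w : Var m L K → ℂ) {u v : Var m L K} (h : u ≠ v) :
    D.halfPair w u v * D.halfPair w v u = D.g (Var.pt w u) (Var.pt w v) := by
  rcases u with ⟨i, a⟩ | b <;> rcases v with ⟨i', a'⟩ | b'
  · have h' : (i, a) ≠ (i', a') := fun e => h (congrArg _ e)
    change _ = D.gyy i (w (Sum.inl (i, a))) i' (w (Sum.inl (i', a')))
    have e := D.epsPair_mul h'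
    rw [halfPair, halfPair, gyy]
    set y := w (Sum.inl (i, a))
    set y' := w (Sum.inl (i', a'))
    have e1 : (if i = finRotate (m + 1) i' then D.eps * D.rr y' y else 1) =
        (if i = finRotate (m + 1) i' then D.rr y' y else 1) *
          (D.epsPair i a i' a' * D.epsPair i' a' i a) := by
      rw [e]; split_ifs <;> ring
    have e2 : (if i = 0 ∧ i' = 0 then D.p.delta (m + 2) *
        (((y - D.p.q2 * y') * (y - D.p.q2⁻¹ * y')) / ((y - D.p.q1 * y') * (y - D.p.q1⁻¹ * y'))) else 1) =
        (if i = 0 then (if i' = 0 then (if a < a' then D.p.delta (m + 2) * D.sPair y y' else 1) else 1) else 1) *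
        (if i' = 0 then (if i = 0 then (if a' < a then D.p.delta (m + 2) * D.sPair y' y else 1) else 1) else 1) := by
      by_cases h1 : i = 0
      · by_cases h2 : i' = 0
        · have : a ≠ a' := fun e => h' (by rw [e, h1, h2])
          rw [if_pos ⟨h1, h2⟩, if_pos h1, if_pos h2, if_pos h2, if_pos h1, D.sPair_symm y' y]
          rcases lt_or_gt_of_ne this with h4 | h4
          · rw [if_pos h4, if_neg h4.asymm, mul_one]; rfl
          · rw [if_pos h4, if_neg h4.asymm, one_mul]; rfl
        · simp [h2]
      · simp [h1]
    rw [e1, e2]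
    ring
  · exact mul_one _
  · exact one_mul _
  · have h' : b ≠ b' := fun e => h (congrArg _ e)
    change _ = D.gzz (w (Sum.inr b)) (w (Sum.inr b'))
    rw [halfPair, halfPair]
    rcases lt_or_gt_of_ne h' with h4 | h4
    · rw [if_pos h4, if_neg h4.asymm, mul_one]
    · rw [if_pos h4, if_neg h4.asymm, one_mul, D.gzz_symm]

lemma psi_eq_halfPair {w : Var m L K → ℂ} (h : Split w) : D.psi (Var.pts w) =
    D.eta ^ L * ∏ x ∈ univ.offDiag, D.halfPair w x.1 x.2 := by
  rw [D.psi_pts h]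
  congr 1
  · simp only [Fintype.prod_sum_type, Sum.elim_inl, Sum.elim_inr, prod_const_one, mul_one,
      Fintype.prod_prod_type]
    rw [Fintype.prod_eq_single (0 : Fin (m + 1))]
    · simp
    · intro i hi; simp [hi]
  · refine prod_offDiag_congr (f := fun u v => D.g (Var.pt w u) (Var.pt w v) ^ (1 / 2 : ℂ)) univ
      fun u _ v _ huv => ?_
    rw [D.halfPair_mul w huv, D.g_symm (Var.pt w v), sqrt_mul_sqrt]

lemma prod_epsPair : ∏ x : Fin (m + 1) × Fin L, ∏ x' : Fin (m + 1) × Fin L,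
    (if x ≠ x' then D.epsPair x.1 x.2 x'.1 x'.2 else 1) =
      if m = 0 then D.eps ^ L.choose 2 else if m = 1 then D.eps ^ (L * L) else 1 := by
  by_cases hm : m = 0
  · subst hm
    simp only [epsPair, if_true, Fintype.prod_prod_type, Fin.prod_univ_succ, Fin.prod_univ_zero, mul_one]
    have e := prod_prod_ne_lt fun _ _ : Fin L => D.eps * 1
    rw [prod_Ioi_const] at e
    simp only [mul_one, prod_const_one] at e
    rw [← e]
    refine prod_congr rfl fun a _ => prod_congr rfl fun b _ => ?_
    simp
  by_cases hm' : m = 1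
  · subst hm'
    simp only [epsPair, hm, if_false, if_true, Fintype.prod_prod_type]
    have : (0 : Fin 2) ≠ 1 := by decide
    simp [this]
    ring
  · simp [epsPair, hm, hm']

lemma prod_rr (w : Var m L K → ℂ) : ∏ x : Fin (m + 1) × Fin L, ∏ x' : Fin (m + 1) × Fin L,
    (if x ≠ x' then (if x'.1 = finRotate (m + 1) x.1 then
      D.rr (w (Sum.inl (x.1, x.2))) (w (Sum.inl (x'.1, x'.2))) else 1) else 1) =
    ∏ i : Fin (m + 1), ∏ a : Fin L, ∏ b : Fin L, if m = 0 ∧ a = b then 1 else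
      D.rr (w (Sum.inl (i, a))) (w (Sum.inl (i + 1, b))) := by
  simp only [Fintype.prod_prod_type]
  refine prod_congr rfl fun i _ => prod_congr rfl fun a _ => ?_
  rw [Fintype.prod_eq_single (i + 1)]
  · refine prod_congr rfl fun b _ => ?_
    have h1 : i + 1 = finRotate (m + 1) i := by rw [finRotate_apply]
    rw [if_pos h1]
    by_cases h : m = 0 ∧ a = b
    · obtain ⟨rfl, rfl⟩ := h
      have : i + 1 = i := Fin.ext (by omega)
      simp
    · rw [if_neg h, if_pos]
      intro e
      simp only [Prod.mk.injEq] at e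
      refine h ⟨?_, e.2⟩
      by_contra hm
      exact finRotate_ne (by omega) i (h1.symm.trans e.1.symm)
  · intro j hj
    have h1 : j ≠ finRotate (m + 1) i := by rw [finRotate_apply]; exact hj
    refine prod_eq_one fun b _ => ?_
    rw [if_neg h1, ite_self]

lemma prod_sPair (w : Var m L K → ℂ) : ∏ x : Fin (m + 1) × Fin L, ∏ x' : Fin (m + 1) × Fin L,
    (if x ≠ x' then (if x.1 = 0 then (if x'.1 = 0 then (if x.2 < x'.2 then
          D.p.delta (m + 2) * D.sPair (w (Sum.inl (x.1, x.2))) (w (Sum.inl (x'.1, x'.2)))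
            else 1) else 1) else 1) else 1) =
    D.p.delta (m + 2) ^ L.choose 2 * ∏ a, ∏ b ∈ Ioi a,
      D.sPair (w (Sum.inl (0, a))) (w (Sum.inl (0, b))) := by
  rw [← prod_Ioi_const, ← prod_prod_ne_lt]
  simp only [Fintype.prod_prod_type]
  rw [Fintype.prod_eq_single (0 : Fin (m + 1)) fun i hi => by simp [hi]]
  refine prod_congr rfl fun a _ => ?_
  rw [Fintype.prod_eq_single (0 : Fin (m + 1)) fun i hi => by simp [hi]]
  simp

lemma prod_halfPair (w : Var m L K → ℂ) : ∏ x ∈ univ.offDiag, D.halfPair w x.1 x.2 =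
    (∏ i : Fin (m + 1), ∏ a : Fin L, ∏ b : Fin L, if m = 0 ∧ a = b then 1 else
      D.rr (w (Sum.inl (i, a))) (w (Sum.inl (i + 1, b)))) *
    (if m = 0 then D.eps ^ L.choose 2 else if m = 1 then D.eps ^ (L * L) else 1) *
    (D.p.delta (m + 2) ^ L.choose 2 * ∏ a, ∏ b ∈ Ioi a,
      D.sPair (w (Sum.inl (0, a))) (w (Sum.inl (0, b)))) *
    (∏ a, ∏ b, ∏ i, D.gyz i (w (Sum.inl (i, a))) (w (Sum.inr b))) *
    ∏ a, ∏ b ∈ Ioi a, D.gzz (w (Sum.inr a)) (w (Sum.inr b)) := by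
  rw [← prod_prod_ne fun u v => D.halfPair w u v]
  simp only [Fintype.prod_sum_type, prod_mul_distrib]
  have e1 : ∀ x x' : Fin (m + 1) × Fin L,
      (if (Sum.inl x : Var m L K) ≠ Sum.inl x' then D.halfPair w (Sum.inl x) (Sum.inl x') else 1) =
      (if x ≠ x' then (if x'.1 = finRotate (m + 1) x.1 then
        D.rr (w (Sum.inl (x.1, x.2))) (w (Sum.inl (x'.1, x'.2))) else 1) else 1) *
      (if x ≠ x' then D.epsPair x.1 x.2 x'.1 x'.2 else 1) *
      (if x ≠ x' then (if x.1 = 0 then (if x'.1 = 0 then (if x.2 < x'.2 then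
          D.p.delta (m + 2) * D.sPair (w (Sum.inl (x.1, x.2))) (w (Sum.inl (x'.1, x'.2)))
            else 1) else 1) else 1) else 1) := by
    intro x x'
    by_cases h : x = x'
    · simp [h]
    · have h' : (Sum.inl x : Var m L K) ≠ Sum.inl x' := fun e => h (Sum.inl_injective e)
      rw [if_pos h', if_pos h, if_pos h, if_pos h]
      rfl
  have e2 : ∀ b b' : Fin K,
      (if (Sum.inr b : Var m L K) ≠ Sum.inr b' then D.halfPair w (Sum.inr b) (Sum.inr b') else 1) =
      if b ≠ b' then (if b < b' then D.gzz (w (Sum.inr b)) (w (Sum.inr b')) else 1) else 1 := by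
    intro b b'
    simp [halfPair]
  have e3 : ∀ x (b : Fin K),
      (if (Sum.inl x : Var m L K) ≠ Sum.inr b then D.halfPair w (Sum.inl x) (Sum.inr b) else 1) =
      D.gyz x.1 (w (Sum.inl (x.1, x.2))) (w (Sum.inr b)) := by
    intro x b
    rw [if_pos (by simp)]; rfl
  have e4 : ∀ x (b : Fin K),
      (if (Sum.inr b : Var m L K) ≠ Sum.inl x then D.halfPair w (Sum.inr b) (Sum.inl x) else 1) = 1 := by
    intro x b
    rw [if_pos (by simp)]; rfl
  simp only [e1, e2, e3, e4, prod_mul_distrib, prod_const_one]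
  rw [D.prod_rr, D.prod_epsPair, D.prod_sPair, prod_prod_ne_lt]
  have e5 : ∏ x : Fin (m + 1) × Fin L, ∏ b : Fin K,
      D.gyz x.1 (w (Sum.inl (x.1, x.2))) (w (Sum.inr b)) =
      ∏ a, ∏ b, ∏ i, D.gyz i (w (Sum.inl (i, a))) (w (Sum.inr b)) := by
    rw [Fintype.prod_prod_type, prod_comm]
    refine prod_congr rfl fun a _ => ?_
    rw [prod_comm]
  rw [e5]
  ring
end FusionData

section
variable (m : ℕ) (p : Params) (hp : p.Generic) (ℓ : ℂ) (hℓ : Complex.exp ℓ = p.q1) {L K : ℕ}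

/-- Through `halfPair` the two products match factor by factor. What needs care are the constants
and the integer exponents of `q₃`. -/
lemma fusionFactor_eq (y : Fin (m + 1) → Fin L → ℂ) (z : Fin K → ℂ)
    (h : Split (Sum.elim (Function.uncurry y) z)) : fusionFactor m p ℓ y z =
      (fusionData m p hp ℓ hℓ).psi (Var.pts (Sum.elim (Function.uncurry y) z)) := by
  set D := fusionData m p hp ℓ hℓ with hD
  rw [D.psi_eq_halfPair h, D.prod_halfPair]
  have hd : p.d ≠ 0 := mul_ne_zero p.q_ne p.q1_ne
  have ht : qpow ℓ (1 / (((m + 2 : ℕ) : ℚ) - 1)) = D.t := rfl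
  have hδ : D.p.delta (m + 2) = if m = 0 then 1 else p.d := by
    change Params.delta p (m + 2) = _
    rw [Params.delta]
    by_cases hm : m = 0
    · rw [if_pos (by omega), if_pos hm]
    · rw [if_neg (by omega), if_neg hm]
  have hyz : ∀ (a : Fin L) (b : Fin K), ∏ i : Fin (m + 1), D.gyz i (y i a) (z b) =
      D.p.delta (m + 2) ^ (m + 2) * ((∏ i : Fin (m + 1), if i = 0 then 1 else
        ((D.cy i * y i a - p.q1 * p.q3 ^ ((i : ℤ) + 1) * z b)
          * (D.cy i * y i a - p.q1⁻¹ * p.q3 ^ ((i : ℤ) - 1) * z b))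
        / ((D.cy i * y i a - p.q3 ^ ((i : ℤ) + 1) * z b) * (D.cy i * y i a - p.q3 ^ ((i : ℤ) - 1) * z b)))
      * (((y 0 a - p.q1 ^ 2 * p.q3 * z b) * (y 0 a - p.q3⁻¹ * z b))
        / ((y 0 a - p.q1 * p.q3 * z b) * (y 0 a - z b)))
      * (((y 0 a - p.q1⁻¹ * p.q3 ^ (((m + 2 : ℕ) : ℤ) - 2) * z b) * (y 0 a - p.q1 * p.q3 ^ ((m + 2 : ℕ) : ℤ) * z b))
        / ((y 0 a - p.q3 ^ (((m + 2 : ℕ) : ℤ) - 2) * z b) * (y 0 a - p.q1 * p.q3 ^ (((m + 2 : ℕ) : ℤ) - 1) * z b)))) := by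
    intro a b
    have z1 : ∀ k : ℕ, p.q3 ^ ((k : ℤ) + 1) = p.q3 ^ (k + 1) := fun k => by
      rw [← zpow_natCast]; push_cast; rfl
    have z2 : p.q3 ^ (((m + 2 : ℕ) : ℤ) - 2) = p.q3 ^ m := by
      rw [← zpow_natCast]; push_cast; ring_nf
    have z3 : p.q3 ^ (((m + 2 : ℕ) : ℤ) - 1) = p.q3 ^ (m + 1) := by
      rw [← zpow_natCast]; push_cast; ring_nf
    have z4 : ∀ k : ℕ, p.q3 ^ (((k + 1 : ℕ) : ℤ) - 1) = p.q3 ^ k := fun k => by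
      rw [← zpow_natCast]; push_cast; ring_nf
    rw [z2, z3, zpow_natCast, Fin.prod_univ_succ, Fin.prod_univ_succ, if_pos rfl, one_mul,
      FusionData.gyz, if_pos rfl]
    have : ∀ k : Fin m, D.gyz k.succ (y k.succ a) (z b) = D.p.delta (m + 2) *
        (if k.succ = 0 then 1 else
        ((D.cy k.succ * y k.succ a - p.q1 * p.q3 ^ (((k.succ : ℕ) : ℤ) + 1) * z b)
          * (D.cy k.succ * y k.succ a - p.q1⁻¹ * p.q3 ^ (((k.succ : ℕ) : ℤ) - 1) * z b))
        / ((D.cy k.succ * y k.succ a - p.q3 ^ (((k.succ : ℕ) : ℤ) + 1) * z b) *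
          (D.cy k.succ * y k.succ a - p.q3 ^ (((k.succ : ℕ) : ℤ) - 1) * z b))) := by
      intro k
      rw [FusionData.gyz, if_neg (Fin.succ_ne_zero k), if_neg (Fin.succ_ne_zero k), z1, Fin.val_succ, z4]
      rfl
    simp only [this, prod_mul_distrib, prod_const, card_univ, Fintype.card_fin]
    have hD' : D.p = p := rfl
    rw [hD', show p.delta (m + 2) ^ (m + 2) = p.delta (m + 2) ^ m * p.delta (m + 2) ^ 2 from pow_add _ _ _]
    ring
  have hzz : ∀ a b : Fin K, D.gzz (z a) (z b) = D.p.delta (m + 2) ^ (m + 2) *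
      ((((z a - p.q2 * z b) * (z a - p.q2⁻¹ * z b))
        / ((z a - p.q3 * z b) * (z a - p.q3⁻¹ * z b))) ^ (m + 2 - 1)
      * ((z a - z b) ^ 2
        / ((z a - p.q3 ^ (((m + 2 : ℕ) : ℤ) - 1) * z b) * (z a - p.q3 ^ (-((m + 2 : ℕ) : ℤ) + 1) * z b)))) := by
    intro a b
    have z3 : p.q3 ^ (((m + 2 : ℕ) : ℤ) - 1) = p.q3 ^ (m + 1) := by
      rw [← zpow_natCast]; push_cast; ring_nf
    have z4 : p.q3 ^ (-((m + 2 : ℕ) : ℤ) + 1) = (p.q3 ^ (m + 1))⁻¹ := by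
      rw [← zpow_natCast, ← zpow_neg]; push_cast; ring_nf
    rw [z3, z4]
    rfl
  have hconst : fusionConst m p ℓ L K = D.eta ^ L *
      (if m = 0 then D.eps ^ L.choose 2 else if m = 1 then D.eps ^ (L * L) else 1) *
      D.p.delta (m + 2) ^ (L.choose 2 + (m + 2) * K.choose 2 + (m + 2) * (L * K)) := by
    rw [fusionConst, hδ, FusionData.eta]
    by_cases hm : m = 0
    · subst hm
      -- For two source colours `t = q₁`, and both constants `delta` are `1`.
      have h1 : D.eps = p.q1 := by
        have := D.root
        rw [FusionData.eps, Params.delta, Params.delta, if_pos (by omega), if_pos (by omega), one_mul, div_one,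
          ← pow_one D.t]
        exact this
      simp [h1]
    · by_cases hm' : m = 1
      · subst hm'
        have h1 : D.eps = p.d * D.t := by
          rw [FusionData.eps, Params.delta, Params.delta, if_neg (by omega), if_pos (by omega), div_one]
          rfl
        have h2 : qpow ℓ (1 / 2) = D.t := by
          rw [← ht]; norm_num
        have h3 : p.d * D.t ≠ 0 := mul_ne_zero hd D.t_ne
        -- The pairs of different colours give `eps ^ (L * L)`; `eta ^ L` reduces the exponent to `L
        -- (L - 1)`.
        have h4 : 2 * L.choose 2 + L = L * L := by
          rw [Nat.choose_two_right, Nat.mul_div_cancel' (Nat.even_mul_pred_self L).two_dvd]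
          cases L <;> simp [Nat.mul_succ]
        simp only [if_true, h1, h2, one_ne_zero, if_false]
        change _ = (p.d * D.t)⁻¹ ^ L * _ * _
        rw [← h4, pow_add (p.d * D.t)]
        field_simp
        rw [one_div, inv_pow, inv_mul_cancel₀ (pow_ne_zero _ h3)]
      · simp only [hm, hm', if_false, one_pow, one_mul]
  have hu : ∀ (i : Fin (m + 1)), qpow ℓ (-(((m + 2 : ℕ) : ℚ) - ((i : ℕ) + 1)) / (((m + 2 : ℕ) : ℚ) - 1)) =
      D.cy i := fun i => qpow_eq_cy m p hp ℓ hℓ i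
  rw [fusionFactor, hconst]
  simp only [hu, ht, Sum.elim_inl, Sum.elim_inr, Function.uncurry, hyz, hzz]
  rw [prod_Ioi_const]
  simp only [prod_mul_distrib (s := (univ : Finset (Fin K))), prod_mul_distrib (s := (univ : Finset (Fin L))),
    prod_const, card_univ, Fintype.card_fin]
  change _ * (∏ a : Fin L, ∏ b ∈ Ioi a, D.sPair (y 0 a) (y 0 b)) *
    (∏ i : Fin (m + 1), ∏ a : Fin L, ∏ b : Fin L, if m = 0 ∧ a = b then 1 else D.rr (y i a) (y (i + 1) b)) * _ * _ = _
  generalize D.p.delta (m + 2) = δ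
  ring
end

/-! ### Wheel conditions and divisibility by the numerator of the fusion factor -/

section Triple
variable {κ : Type} [DecidableEq κ]

/-- The substitution `x_v = α x_u`, `x_w = β x_u`. -/
def tripleVar (u v w l : κ) : κ := if l = v ∨ l = w then u else l

/-- The coefficients of the substitution `x_v = α x_u`, `x_w = β x_u`. -/
def tripleCoef (v w : κ) (α β : ℂ) (l : κ) : ℂ := if l = v then α else if l = w then β else 1

lemma triple_eq {u v w : κ} {α β : ℂ} {x : κ → ℂ} (hv : x v = α * x u) (hw : x w = β * x u) (l : κ) :
    tripleCoef v w α β l * x (tripleVar u v w l) = x l := by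
  by_cases h1 : l = v
  · subst h1; simp [tripleVar, tripleCoef, hv]
  · by_cases h2 : l = w
    · subst h2; simp [tripleVar, tripleCoef, hw, h1]
    · simp [tripleVar, tripleCoef, h1, h2]

lemma triple_inj {u v w : κ} {α β : ℂ} (hα1 : α ≠ 1) (hβ1 : β ≠ 1)
    (hαβ : α ≠ β) (l l' : κ) (h : tripleVar u v w l = tripleVar u v w l')
    (h' : tripleCoef v w α β l = tripleCoef v w α β l') : l = l' := by
  simp only [tripleVar, tripleCoef] at h h'
  grind

/-- Since `0`, `1`, `α`, `β` are distinct, the generic point of this subspace has distinct nonzero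
coordinates, and vanishing at such points spreads to the whole subspace. -/
lemma eval_eq_zero_of_triple [Fintype κ] {u v w : κ} (huv : u ≠ v) (huw : u ≠ w) (hvw : v ≠ w) {α β : ℂ}
    (hα : α ≠ 0) (hβ : β ≠ 0) (hα1 : α ≠ 1) (hβ1 : β ≠ 1) (hαβ : α ≠ β) {f : MvPolynomial κ ℂ}
    (h : ∀ x, Distinct x → x v = α * x u → x w = β * x u → MvPolynomial.eval x f = 0) (x : κ → ℂ)
    (hv : x v = α * x u) (hw : x w = β * x u) : MvPolynomial.eval x f = 0 := by
  have h1 := eval_eq_zero_of_distinct (f := f) (tripleVar u v w) (tripleCoef v w α β)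
    (fun l => by unfold tripleCoef; split_ifs <;> simp [*])
    (triple_inj hα1 hβ1 hαβ) (fun x hx => h _ hx ?_ ?_) x
  · simpa only [triple_eq hv hw] using h1
  · simp [tripleVar, tripleCoef, huv, huw]
  · simp [tripleVar, tripleCoef, huv, huw, hvw.symm]

/-- By `hJ` no form of `J` vanishes identically on the subspace, so finitely many proper hyperplanes
of it may be ignored. -/
lemma eval_eq_zero_of_triple_of_lin {u v w : κ} (huv : u ≠ v) (huw : u ≠ w) (hvw : v ≠ w) {α β : ℂ}
    (hα : α ≠ 0) (hβ : β ≠ 0) (J : Finset (κ × κ × ℂ))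
    (hJ : ∀ θ ∈ J, tripleVar u v w θ.1 = tripleVar u v w θ.2.1 →
      tripleCoef v w α β θ.1 ≠ θ.2.2 * tripleCoef v w α β θ.2.1) {f : MvPolynomial κ ℂ}
    (h : ∀ x, (∀ θ ∈ J, MvPolynomial.eval x (lin θ) ≠ 0) → x v = α * x u → x w = β * x u →
      MvPolynomial.eval x f = 0) (x : κ → ℂ)
    (hv : x v = α * x u) (hw : x w = β * x u) : MvPolynomial.eval x f = 0 := by
  have h1 : monoSubst (tripleVar u v w) (tripleCoef v w α β) f = 0 := by
    refine eq_zero_of_eval_of_ne J (fun θ => MvPolynomial.C (tripleCoef v w α β θ.1) *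
        MvPolynomial.X (tripleVar u v w θ.1) - MvPolynomial.C (θ.2.2 * tripleCoef v w α β θ.2.1) *
        MvPolynomial.X (tripleVar u v w θ.2.1)) (fun θ hθ => two_term_ne_zero ?_ (hJ θ hθ)) fun x hx => ?_
    · unfold tripleCoef; split_ifs <;> simp [*]
    · rw [eval_monoSubst]
      refine h _ (fun θ hθ => ?_) ?_ ?_
      · have := hx θ hθ
        rw [eval_lin]
        simpa [mul_assoc] using this
      · simp [tripleVar, tripleCoef, huv, huw]
      · simp [tripleVar, tripleCoef, huv, huw, hvw.symm]
  have h2 := eval_monoSubst (tripleVar u v w) (tripleCoef v w α β) f x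
  rw [h1, map_zero] at h2
  simpa only [triple_eq hv hw] using h2.symm
end Triple

/-- The vanishing conditions on the numerator of an element of the shuffle algebra. -/
structure WheelConditions {n : ℕ} (p : Params) {Λ : Type} (P : MvPolynomial (Fin n × Λ) ℂ) : Prop where
  up : ∀ (i j : Fin n) (a b c : Λ) (x : Fin n × Λ → ℂ), j = finRotate n i →
    (i, a) ≠ (j, b) → (i, a) ≠ (j, c) → b ≠ c →
    x (j, b) = p.q3 * x (i, a) → x (j, c) = p.q2 * x (j, b) → MvPolynomial.eval x P = 0
  down : ∀ (i j : Fin n) (a b c : Λ) (x : Fin n × Λ → ℂ), j = finRotate n i →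
    a ≠ b → (i, a) ≠ (j, c) → (i, b) ≠ (j, c) →
    x (i, b) = p.q2 * x (i, a) → x (j, c) = p.q3 * x (i, b) → MvPolynomial.eval x P = 0

lemma Params.Generic.pow_ne {p : Params} (hp : p.Generic) {a b : ℤ} (h : ¬ (a = 0 ∧ b = 0)) :
    p.q1 ^ a * p.q2 ^ b ≠ 1 := fun e => by
  have := hp a b 0 (by rw [e, zpow_zero, one_mul]); omega

/-- The zeros of `F` at wheels with distinct coordinates spread to all wheels, because genericity
makes the three ratios on a wheel different. The number of variables of each colour need not match
`N`: if it does not, `F` vanishes at these configurations. -/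
lemma exists_numerator {n : ℕ} {p : Params} (hp : p.Generic) {N : Fin n → ℕ} {F : ShFun n p}
    (hF : F ∈ Sh p N) (Λ : Type) [Fintype Λ] : ∃ (P : MvPolynomial (Fin n × Λ) ℂ) (k : ℕ),
      (∀ x, Distinct x → F (conf Prod.fst x) * poleDenom Prod.fst x * (∏ l, x l) ^ k =
        MvPolynomial.eval x P) ∧ WheelConditions p P := by
  classical
  obtain ⟨P, k, hP⟩ := laurent_sub (ι := Fin n × Λ) Prod.fst univ hF
  have hP' : ∀ x, Distinct x → F (conf Prod.fst x) * poleDenom Prod.fst x * (∏ l, x l) ^ k =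
        MvPolynomial.eval x P := fun x hx => hP x hx
  have hmem : ∀ (x : Fin n × Λ → ℂ) (i : Fin n) (a : Λ) (y : ℂ), x (i, a) = y → (i, y) ∈ conf Prod.fst x := by
    rintro x i a y rfl
    exact mem_image.2 ⟨(i, a), mem_univ _, rfl⟩
  have h1 := p.q1_ne
  have h2 := p.q2_ne
  have h3 := p.q3_ne
  have e3 : p.q3 = p.q1 ^ (-1 : ℤ) * p.q2 ^ (-1 : ℤ) := by rw [Params.q3, mul_inv]; simp
  have e23 : p.q2 * p.q3 = p.q1 ^ (-1 : ℤ) * p.q2 ^ (0 : ℤ) := by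
    rw [Params.q3, mul_inv]; field_simp
  have n3 : p.q3 ≠ 1 := by rw [e3]; exact hp.pow_ne (by omega)
  have n23 : p.q2 * p.q3 ≠ 1 := by rw [e23]; exact hp.pow_ne (by omega)
  have n2 : p.q2 ≠ 1 := by simpa using hp.pow_ne (a := 0) (b := 1) (by omega)
  refine ⟨P, k, hP', ⟨?_, ?_⟩⟩
  · intro i j a b c x hj hab hac hbc hxb hxc
    rw [hxb, ← mul_assoc] at hxc
    refine eval_eq_zero_of_triple hab hac (fun e => hbc (Prod.ext_iff.1 e).2) h3 (mul_ne_zero h2 h3) n3 n23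
      (fun e => n2 (mul_right_cancel₀ h3 (by rw [← e, one_mul]))) (fun x hx hb hc => ?_) x hxb hxc
    rw [← hP' x hx, hF.2.2.1 _ i (x (i, a)) (hmem _ _ _ _ rfl) (hmem _ _ b _ (hj ▸ hb))
      (hmem _ _ c _ (by rw [← hj, hc, mul_assoc])), zero_mul, zero_mul]
  · intro i j a b c x hj hab hac hbc hxb hxc
    rw [hxb, ← mul_assoc, mul_comm p.q3] at hxc
    refine eval_eq_zero_of_triple (v := (i, b)) (fun e => hab (Prod.ext_iff.1 e).2) hac hbc h2
      (mul_ne_zero h2 h3) n2 n23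
      (fun e => n3 (mul_left_cancel₀ h2 (by rw [← e, mul_one]))) (fun x hx hb hc => ?_) x hxb hxc
    rw [← hP' x hx, hF.2.2.2 _ i (x (i, a)) (hmem _ _ _ _ rfl) (hmem _ _ b _ hb)
      (hmem _ _ c _ (by rw [← hj, hc]; ring)), zero_mul, zero_mul]

/-- At parameter `0` of the curve `W` only the form `θ₀` vanishes, and to first order, so the
product of the forms has order `e θ₀`. The surplus order has to come from `h`. -/
lemma eval_eq_zero_of_order {κ : Type} {J : Finset (κ × κ × ℂ)} {e : κ × κ × ℂ → ℕ} {h : MvPolynomial κ ℂ}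
    (W : κ → Polynomial ℂ) {θ₀ : κ × κ × ℂ} (hθ : θ₀ ∈ J)
    (hJ : ∀ θ ∈ J, θ ≠ θ₀ → MvPolynomial.eval (fun u => (W u).eval 0) (lin θ) ≠ 0) {n : ℕ} {a : ℂ} (ha : a ≠ 0)
    (h0 : MvPolynomial.aeval W (lin θ₀) = (Polynomial.C a * Polynomial.X : Polynomial ℂ))
    (hn : (Polynomial.X ^ n : Polynomial ℂ) ∣ MvPolynomial.aeval W ((∏ θ ∈ J, lin θ ^ e θ) * h))
    (hlt : e θ₀ < n) : MvPolynomial.eval (fun u => (W u).eval 0) h = 0 := by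
  classical
  have h1 := (pow_dvd_pow (Polynomial.X : Polynomial ℂ) (Nat.succ_le_of_lt hlt)).trans hn
  rw [map_mul, ← mul_prod_erase J _ hθ, map_mul, map_pow, h0] at h1
  set R := MvPolynomial.aeval W (∏ θ ∈ J.erase θ₀, lin θ ^ e θ) with hR
  have h3 : (Polynomial.X : Polynomial ℂ) ^ e θ₀ * Polynomial.X ∣
      Polynomial.X ^ e θ₀ * (Polynomial.C (a ^ e θ₀) * (R * MvPolynomial.aeval W h)) := by
    rw [← pow_succ, Polynomial.C_pow]
    refine h1.trans (dvd_of_eq ?_)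
    ring
  have h2 := (mul_dvd_mul_iff_left (pow_ne_zero _ Polynomial.X_ne_zero)).1 h3
  rw [(Polynomial.isUnit_C.2 (pow_ne_zero _ ha).isUnit).dvd_mul_left, hR,
    Polynomial.X_dvd_iff, Polynomial.coeff_zero_eq_eval_zero, Polynomial.eval_mul, eval_aeval_poly,
    eval_aeval_poly, mul_eq_zero] at h2
  refine h2.resolve_left ?_
  rw [map_prod, ← ne_eq, prod_ne_zero_iff]
  intro θ hθ
  rw [map_pow]
  exact pow_ne_zero _ (hJ θ (mem_of_mem_erase hθ) (ne_of_mem_erase hθ))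

namespace FusionData
variable {m : ℕ} (D : FusionData m) {L K : ℕ}

lemma spl_castSucc (w : Var m L K → ℂ) {j : Fin (m + 2)} {i : Fin (m + 1)} (h : (j : ℕ) = i) (a : Fin L) :
    D.spl w (j, Sum.inl a) = D.cy i * w (Sum.inl (i, a)) := by
  obtain rfl : j = i.castSucc := Fin.ext h
  simp only [spl, Src.var, ofNat_castSucc, coef]
  rfl

lemma spl_last (w : Var m L K → ℂ) {j : Fin (m + 2)} (h : (j : ℕ) = m + 1) (a : Fin L) :
    D.spl w (j, Sum.inl a) = w (Sum.inl (0, a)) := by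
  obtain rfl : j = Fin.last (m + 1) := Fin.ext h
  rw [spl, Src.var, ofNat_last, coef, Fin.val_last, D.cy_last, one_mul]

lemma spl_inr (w : Var m L K → ℂ) (j : Fin (m + 2)) (b : Fin K) :
    D.spl w (j, Sum.inr b) = D.p.q3 ^ (j : ℕ) * w (Sum.inr b) := rfl

/-- The factors `u - α v` of the numerator of the fusion factor. -/
def factors : Finset (Var m L K × Var m L K × ℂ) :=
  (univ.offDiag.sigma fun x => D.roots x.1 x.2).map ⟨fun s => (s.1.1, s.1.2, s.2), by
    rintro ⟨⟨a, b⟩, c⟩ ⟨⟨a', b'⟩, c'⟩ h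
    obtain ⟨rfl, rfl, rfl⟩ : a = a' ∧ b = b' ∧ c = c' := by simpa using h
    rfl⟩

lemma mem_factors {θ : Var m L K × Var m L K × ℂ} :
    θ ∈ D.factors ↔ θ.1 ≠ θ.2.1 ∧ θ.2.2 ∈ D.roots θ.1 θ.2.1 := by
  obtain ⟨u, v, α⟩ := θ
  simp only [factors, mem_map, mem_sigma, mem_offDiag, mem_univ, true_and]
  constructor
  · rintro ⟨⟨⟨a, b⟩, c⟩, h, e⟩
    change (a, b, c) = (u, v, α) at e
    simp only [Prod.mk.injEq] at e
    obtain ⟨rfl, rfl, rfl⟩ := e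
    exact h
  · intro h
    exact ⟨⟨(u, v), α⟩, h, rfl⟩

/-- The multiplicity of a factor. -/
def factorMult (θ : Var m L K × Var m L K × ℂ) : ℕ := mult θ.1 θ.2.1

lemma eval_prod_factors (w : Var m L K → ℂ) :
    MvPolynomial.eval w (∏ θ ∈ D.factors, lin θ ^ factorMult θ) = D.num w := by
  rw [map_prod, factors, prod_map, prod_sigma, num]
  refine prod_congr rfl fun x _ => prod_congr rfl fun α _ => ?_
  rw [map_pow, eval_lin]
  rfl

/-- Moving the variables `x_{j,b}` above `z_b` independently of each other. -/
lemma pow_dvd_of_family {P : MvPolynomial (Src m L K) ℂ} {E : Type} [Fintype E] (b : Fin K)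
    (idx : Fin (m + 2) → E) (w : Var m L K → ℂ)
    (h : ∀ (x : Src m L K → ℂ) (e : E), (∀ l, l.2 ≠ Sum.inr b → x l = D.spl w l) →
      (∀ j, idx j = e → x (j, Sum.inr b) = D.p.q3 ^ (j : ℕ) * w (Sum.inr b)) → MvPolynomial.eval x P = 0) :
    (Polynomial.X ^ Fintype.card E : Polynomial ℂ) ∣ MvPolynomial.aeval
      (Function.update (fun u => Polynomial.C (w u)) (Sum.inr b)
        (Polynomial.C (w (Sum.inr b)) + Polynomial.X)) (monoSubst Src.var D.coef P) := by
  classical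
  rw [aeval_monoSubst]
  -- The parameter `s_e` displaces the points `x_{j,b}` with `idx j = e`, in proportion to their
  -- coefficients. The line on which all parameters are equal is the motion of `z_b` itself.
  refine pow_card_dvd_aeval P (fun l => MvPolynomial.C (D.coef l) * (if l.2 = Sum.inr b then
    MvPolynomial.C (w (Sum.inr b)) + MvPolynomial.X (idx l.1) else MvPolynomial.C (w l.var)))
    (fun s e hs => ?_) (fun _ => 1) _ fun l => ?_
  · refine h _ e (fun l hl => ?_) fun j hj => ?_
    · simp [hl, spl]
    · simp [hj, hs, coef]
  · by_cases hl : l.2 = Sum.inr b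
    · obtain ⟨j, _⟩ := l
      obtain rfl := hl
      simp [Src.var]
    · have : l.var ≠ Sum.inr b := by
        rcases l with ⟨j, a | b'⟩
        · simp [Src.var]
        · exact fun e => hl (congrArg Sum.inr (Sum.inr_injective e))
      simp [hl, this]

variable {D}

/-- At `u = α v` three specialized points, two of them above the same variable, form a wheel of the
source; every root arises in this way. The form `z_b - q₂ z_b'` arises from `m + 1` wheels, one for
each step of the chain above `z_b'`, hence its multiplicity. -/
lemma lin_pow_dvd_spl {P : MvPolynomial (Src m L K) ℂ} (hP : WheelConditions D.p P)
    {θ : Var m L K × Var m L K × ℂ} (hθ : θ ∈ D.factors) :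
    lin θ ^ factorMult θ ∣ monoSubst Src.var D.coef P := by
  have h1 := D.p.q1_ne
  have h2 := D.p.q2_ne
  have h3 := D.p.q3_ne
  have e23 := D.q2_q3
  have e12 := D.q1_q2
  have e13 := D.q1_q3
  obtain ⟨hne, hr⟩ := D.mem_factors.1 hθ
  obtain ⟨u, v, α⟩ := θ
  have simple : (∀ w : Var m L K → ℂ, w u = α * w v → MvPolynomial.eval (D.spl w) P = 0) →
      lin (u, v, α) ∣ monoSubst Src.var D.coef P := fun h =>
    (lin_dvd_iff hne _).2 fun w hw => by rw [eval_monoSubst]; exact h w hw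
  rcases u with ⟨i, a⟩ | b <;> rcases v with ⟨i', a'⟩ | b'
  · simp only [roots] at hr
    split_ifs at hr with hi
    swap
    · simp at hr
    obtain ⟨rfl, rfl⟩ := hi
    obtain rfl := mem_singleton.1 hr
    change lin _ ^ 1 ∣ _
    rw [pow_one]
    -- For `y_a = q₂ y_a'` the wheel consists of the last-colour point above `y_a` and the
    -- colour-`0` points above `y_a'` and `y_a`; the first ratio is `q₃` because `q₂ q₃ = q₁⁻¹`.
    refine simple fun w hw => ?_
    have haa : (Sum.inl a' : Fin L ⊕ Fin K) ≠ Sum.inl a := by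
      rintro e; exact hne (by rw [Sum.inl_injective e])
    refine hP.up (Fin.last (m + 1)) 0 (Sum.inl a) (Sum.inl a') (Sum.inl a) _
      ((eq_finRotate_iff _ _).2 (by simp)) (by simp [Fin.ext_iff]) (by simp [Fin.ext_iff]) haa ?_ ?_
    · rw [D.spl_castSucc w (i := 0) rfl, D.spl_last w rfl, hw, Fin.val_zero, D.cy_zero, ← e23]; ring
    · rw [D.spl_castSucc w (i := 0) rfl, D.spl_castSucc w (i := 0) rfl, hw]; ring
  · change lin _ ^ 1 ∣ _
    rw [pow_one]
    refine simple fun w hw => ?_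
    simp only [roots] at hr
    by_cases hi : i = 0
    · subst hi
      rw [if_pos rfl] at hr
      simp only [mem_insert, mem_singleton] at hr
      rcases hr with rfl | rfl | rfl | rfl
      · refine hP.down 0 1 (Sum.inl a) (Sum.inr b') (Sum.inr b') _
          ((eq_finRotate_iff _ _).2 (by simp)) (by simp) (by simp) (by simp) ?_ ?_
        · rw [spl_inr, D.spl_castSucc w (i := 0) rfl, hw]
          simp only [Fin.val_zero, pow_zero, one_mul, cy_zero]
          have : D.p.q2 * (D.p.q1⁻¹ * (D.p.q1 ^ 2 * D.p.q3 * w (Sum.inr b'))) =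
            D.p.q1 * D.p.q2 * D.p.q3 * w (Sum.inr b') := by field_simp
          rw [this, D.p.prod_eq_one, one_mul]
        · rw [spl_inr, spl_inr]; simp
      · refine hP.up (Fin.last (m + 1)) 0 (Sum.inl a) (Sum.inr b') (Sum.inl a) _
          ((eq_finRotate_iff _ _).2 (by simp)) (by simp) (by simp [Fin.ext_iff]) (by simp) ?_ ?_
        · rw [spl_inr, D.spl_last w rfl, hw]; field_simp; simp
        · rw [spl_inr, D.spl_castSucc w (i := 0) rfl, hw, Fin.val_zero, D.cy_zero, ← e12]; field_simp; simp
      · refine hP.up ⟨m, by omega⟩ (Fin.last (m + 1)) (Sum.inr b') (Sum.inr b') (Sum.inl a) _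
          ((eq_finRotate_iff _ _).2 (by simp)) (by simp [Fin.ext_iff]) (by simp) (by simp) ?_ ?_
        · rw [spl_inr, spl_inr, Fin.val_last]; ring
        · rw [spl_inr, D.spl_last w rfl, hw, Fin.val_last, ← e23]; ring
      · refine hP.down (Fin.last (m + 1)) 0 (Sum.inl a) (Sum.inr b') (Sum.inl a) _
          ((eq_finRotate_iff _ _).2 (by simp)) (by simp) (by simp [Fin.ext_iff]) (by simp) ?_ ?_
        · rw [spl_inr, D.spl_last w rfl, hw, Fin.val_last]
          linear_combination (-D.p.q3 ^ (m + 1) * w (Sum.inr b')) * D.p.prod_eq_one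
        · rw [spl_inr, D.spl_castSucc w (i := 0) rfl, hw, Fin.val_zero, D.cy_zero, Fin.val_last]
          field_simp
          ring
    · obtain ⟨k, hk⟩ : ∃ k, (i : ℕ) = k + 1 := Nat.exists_eq_succ_of_ne_zero (fun e => hi (Fin.ext e))
      have hlt := i.2
      have hcy := D.cy_ne i
      rw [if_neg hi, hk] at hr
      rw [hk] at hcy
      simp only [mem_insert, mem_singleton, Nat.add_sub_cancel] at hr
      rcases hr with rfl | rfl
      · refine hP.down i.castSucc i.succ (Sum.inl a) (Sum.inr b') (Sum.inr b') _
          ((eq_finRotate_iff _ _).2 (by simp)) (by simp) (by simp) (by simp [Fin.ext_iff]) ?_ ?_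
        · rw [spl_inr, D.spl_castSucc w (i := i) rfl, hw, Fin.val_castSucc, hk]
          have : D.cy (k + 1) * ((D.cy (k + 1))⁻¹ * (D.p.q1 * D.p.q3 ^ (k + 1 + 1)) * w (Sum.inr b')) =
            D.p.q1 * D.p.q3 ^ (k + 1 + 1) * w (Sum.inr b') := by field_simp
          rw [this]
          linear_combination (-D.p.q3 ^ (k + 1) * w (Sum.inr b')) * D.p.prod_eq_one
        · rw [spl_inr, spl_inr, Fin.val_succ, Fin.val_castSucc]; ring
      · refine hP.up ⟨k, by omega⟩ i.castSucc (Sum.inr b') (Sum.inr b') (Sum.inl a) _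
          ((eq_finRotate_iff _ _).2 (by simp [hk])) (by simp [Fin.ext_iff, hk]) (by simp) (by simp) ?_ ?_
        · rw [spl_inr, spl_inr, Fin.val_castSucc, hk]; ring
        · rw [spl_inr, D.spl_castSucc w (i := i) rfl, hw, Fin.val_castSucc, hk, ← e23]
          field_simp
          ring
  · simp [roots] at hr
  · obtain rfl := mem_singleton.1 hr
    refine lin_pow_dvd hne _ fun w => ?_
    have hbb : b ≠ b' := fun e => hne (congrArg _ e)
    -- The point of colour `e + 1` above `z_b` closes a wheel with the step from colour `e` to `e +
    -- 1` above `z_b'`. Colour `0` ends no step, so by truncated subtraction it shares the parameter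
    -- `0` with colour `1`.
    have := D.pow_dvd_of_family (P := P) (E := Fin (m + 1)) b (fun j => ⟨j - 1, by omega⟩)
      (Function.update w (Sum.inr b) (D.p.q2 * w (Sum.inr b'))) (fun x e hx hx' => by
        refine hP.up e.castSucc e.succ (Sum.inr b') (Sum.inr b') (Sum.inr b) _
          ((eq_finRotate_iff _ _).2 (by simp)) (by simp [Fin.ext_iff]) (by simp [Fin.ext_iff])
          (by simpa using hbb.symm) ?_ ?_
        · rw [hx _ (by simpa using hbb.symm), hx _ (by simpa using hbb.symm), spl_inr, spl_inr]
          simp; ring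
        · rw [hx' _ (by ext; simp), hx _ (by simpa using hbb.symm), spl_inr]
          have : (Sum.inr b' : Var m L K) ≠ Sum.inr b := by simpa using hbb.symm
          simp only [Function.update_self, Function.update_of_ne this]; ring)
    rw [Fintype.card_fin] at this
    change Polynomial.X ^ (m + 1) ∣ _
    convert this using 2
    refine congrArg MvPolynomial.aeval (funext fun u => ?_)
    by_cases hu : u = Sum.inr b
    · subst hu; simp
    · simp [hu]
end FusionData

/-! ### Wheel conditions for the quotient -/

lemma mem_of_tripleVar_eq {κ : Type} [DecidableEq κ] {u v w l l' : κ}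
    (h : tripleVar u v w l = tripleVar u v w l') (hl : l ≠ l') :
    (l = u ∨ l = v ∨ l = w) ∧ (l' = u ∨ l' = v ∨ l' = w) := by
  simp only [tripleVar] at h
  grind

lemma Src.var_eq_inl {m L K : ℕ} {l : Src m L K} {i : Fin (m + 1)} {a : Fin L} (h : l.var = Sum.inl (i, a)) :
    l = (i.castSucc, Sum.inl a) ∨ (i = 0 ∧ l = (Fin.last (m + 1), Sum.inl a)) := by
  obtain ⟨j, a' | b⟩ := l
  · simp only [Src.var, Sum.inl.injEq, Prod.mk.injEq] at h
    obtain ⟨rfl, rfl⟩ := h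
    induction j using Fin.lastCases with
    | last => exact Or.inr ⟨FusionData.ofNat_last, rfl⟩
    | cast j => rw [FusionData.ofNat_castSucc]; exact Or.inl rfl
  · simp [Src.var] at h

namespace FusionData
variable {m : ℕ} (D : FusionData m) {L K : ℕ}

lemma tripleCoef_ne {κ : Type} [DecidableEq κ] {v w l l' : κ} {a b c e : ℤ} {α β : ℂ}
    (hα : α = D.p.q1 ^ a * D.p.q2 ^ b) (hβ : β = D.p.q1 ^ c * D.p.q2 ^ e)
    (h : ¬ ((if l = v then a else if l = w then c else 0) = (if l' = v then a else if l' = w then c else 0) ∧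
      (if l = v then b else if l = w then e else 0) = (if l' = v then b else if l' = w then e else 0) + 1)) :
    tripleCoef v w α β l ≠ D.p.q2 * tripleCoef v w α β l' := by
  have key : ∀ l, tripleCoef v w α β l = D.p.q1 ^ (if l = v then a else if l = w then c else 0) *
      D.p.q2 ^ (if l = v then b else if l = w then e else 0) := by
    intro l
    unfold tripleCoef
    split_ifs <;> simp [hα, hβ]
  rw [key, key]
  intro e
  rw [mul_left_comm, ← zpow_one_add₀ D.p.q2_ne, add_comm] at e
  exact h (D.pow_eq e)

variable {D}

/-- The hypotheses `h1` to `h6` run through the six ordered pairs of `u`, `v`, `w` and exclude the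
ratio `q₂` by means of the exponents of `α` and `β`; only `θ₀` is exempt, in `h3` or `h6`. -/
lemma factors_tripleCoef_ne {u v w : Var m L K} (huv : u ≠ v) (huw : u ≠ w) (hvw : v ≠ w)
    {θ₀ : Var m L K × Var m L K × ℂ} {a b c e : ℤ} {α β : ℂ}
    (hα : α = D.p.q1 ^ a * D.p.q2 ^ b) (hβ : β = D.p.q1 ^ c * D.p.q2 ^ e)
    (hroot : ∀ l l' γ, (l, l', γ) ∈ D.factors → (l = u ∨ l = v ∨ l = w) → (l' = u ∨ l' = v ∨ l' = w) → γ = D.p.q2)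
    (h1 : ¬(a = 0 ∧ b = -1)) (h2 : ¬(c = 0 ∧ e = -1))
    (h3 : (v, u, D.p.q2) = θ₀ ∨ ¬(a = 0 ∧ b = 1)) (h4 : ¬(a = c ∧ b = e + 1))
    (h5 : ¬(c = 0 ∧ e = 1)) (h6 : (w, v, D.p.q2) = θ₀ ∨ ¬(c = a ∧ e = b + 1))
    (θ : Var m L K × Var m L K × ℂ) (hθ : θ ∈ D.factors) (hne : θ ≠ θ₀)
    (h : tripleVar u v w θ.1 = tripleVar u v w θ.2.1) :
    tripleCoef v w α β θ.1 ≠ θ.2.2 * tripleCoef v w α β θ.2.1 := by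
  obtain ⟨l, l', γ⟩ := θ
  have hl : l ≠ l' := (D.mem_factors.1 hθ).1
  change tripleVar u v w l = tripleVar u v w l' at h
  obtain ⟨m1, m2⟩ := mem_of_tripleVar_eq h hl
  obtain rfl := hroot l l' γ hθ m1 m2
  refine D.tripleCoef_ne hα hβ ?_
  dsimp only
  rcases m1 with rfl | rfl | rfl <;> rcases m2 with rfl | rfl | rfl <;>
    simp only [if_true, if_neg huv, if_neg huw, if_neg hvw, if_neg hvw.symm] <;>
      first | exact absurd rfl hl | skip
  · omega
  · omega
  · rcases h3 with h3 | h3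
    · exact absurd h3 hne
    · omega
  · omega
  · omega
  · rcases h6 with h6 | h6
    · exact absurd h6 hne
    · omega

/-- On this subspace `θ₀` is the only factor that vanishes identically. A curve transversal to its
hyperplane, along which the source numerator has one order more than the multiplicity of `θ₀`,
leaves a zero for `h`. -/
lemma eval_eq_zero_of_family {P : MvPolynomial (Src m L K) ℂ} {h : MvPolynomial (Var m L K) ℂ}
    (hh : monoSubst Src.var D.coef P = (∏ θ ∈ D.factors, lin θ ^ factorMult θ) * h)
    {u v w : Var m L K} (huv : u ≠ v) (huw : u ≠ w) (hvw : v ≠ w)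
    {θ₀ : Var m L K × Var m L K × ℂ} (hθ₀ : θ₀ ∈ D.factors) {α β : ℂ} (hα : α ≠ 0) (hβ : β ≠ 0)
    (hJ : ∀ θ ∈ D.factors, θ ≠ θ₀ → tripleVar u v w θ.1 = tripleVar u v w θ.2.1 →
      tripleCoef v w α β θ.1 ≠ θ.2.2 * tripleCoef v w α β θ.2.1)
    (hW : ∀ x : Var m L K → ℂ, x v = α * x u → x w = β * x u → ∃ (W : Var m L K → Polynomial ℂ) (s : ℂ),
      s ≠ 0 ∧ (∀ l, (W l).eval 0 = x l) ∧ MvPolynomial.aeval W (lin θ₀) = Polynomial.C s * Polynomial.X ∧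
      Polynomial.X ^ (factorMult θ₀ + 1) ∣ MvPolynomial.aeval W (monoSubst Src.var D.coef P))
    (x : Var m L K → ℂ) (hv : x v = α * x u) (hw : x w = β * x u) : MvPolynomial.eval x h = 0 := by
  refine eval_eq_zero_of_triple_of_lin huv huw hvw hα hβ (D.factors.erase θ₀)
    (fun θ hθ => hJ θ (mem_of_mem_erase hθ) (ne_of_mem_erase hθ)) (fun x hx hv hw => ?_) x hv hw
  obtain ⟨W, s, hs, h0, h1, h2⟩ := hW x hv hw
  have hx0 : (fun l => (W l).eval 0) = x := funext h0
  rw [← hx0]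
  refine eval_eq_zero_of_order W hθ₀ (fun θ hθ hne => ?_) hs h1 (by rw [← hh]; exact h2) (Nat.lt_succ_self _)
  rw [hx0]
  exact hx θ (mem_erase.2 ⟨hne, hθ⟩)

/-- No factor joins two of the three variables, so the factors are generically nonzero on the
subspace and a zero of the source numerator is one of `h`. -/
lemma eval_eq_zero_of_spl {P : MvPolynomial (Src m L K) ℂ} {h : MvPolynomial (Var m L K) ℂ}
    (hh : monoSubst Src.var D.coef P = (∏ θ ∈ D.factors, lin θ ^ factorMult θ) * h)
    {u v w : Var m L K} (huv : u ≠ v) (huw : u ≠ w) (hvw : v ≠ w) {α β : ℂ} (hα : α ≠ 0) (hβ : β ≠ 0)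
    (hJ : ∀ l l' γ, (l, l', γ) ∈ D.factors → (l = u ∨ l = v ∨ l = w) → (l' = u ∨ l' = v ∨ l' = w) → False)
    (hW : ∀ x : Var m L K → ℂ, x v = α * x u → x w = β * x u → MvPolynomial.eval (D.spl x) P = 0)
    (x : Var m L K → ℂ) (hv : x v = α * x u) (hw : x w = β * x u) : MvPolynomial.eval x h = 0 := by
  refine eval_eq_zero_of_triple_of_lin huv huw hvw hα hβ D.factors
    (fun θ hθ e => ?_) (fun x hx hv hw => ?_) x hv hw
  · obtain ⟨m1, m2⟩ := mem_of_tripleVar_eq e (D.mem_factors.1 hθ).1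
    exact (hJ _ _ _ hθ m1 m2).elim
  · have h1 := congrArg (MvPolynomial.eval x) hh
    rw [eval_monoSubst, map_mul, map_prod] at h1
    change MvPolynomial.eval (D.spl x) P = _ at h1
    rw [hW x hv hw, eq_comm, mul_eq_zero] at h1
    refine h1.resolve_left (prod_ne_zero_iff.2 fun θ hθ => ?_)
    rw [map_pow]
    exact pow_ne_zero _ (hx θ hθ)

lemma root_inr {b b' : Fin K} {γ : ℂ} (h : ((Sum.inr b : Var m L K), (Sum.inr b' : Var m L K), γ) ∈ D.factors) :
    γ = D.p.q2 := mem_singleton.1 (D.mem_factors.1 h).2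

lemma root_inl {x x' : Fin (m + 1) × Fin L} {γ : ℂ}
    (h : ((Sum.inl x : Var m L K), (Sum.inl x' : Var m L K), γ) ∈ D.factors) :
    γ = D.p.q2 ∧ x.1 = 0 ∧ x'.1 = 0 := by
  have h1 := (D.mem_factors.1 h).2
  simp only [roots] at h1
  split_ifs at h1 with h2
  · exact ⟨mem_singleton.1 h1, h2⟩
  · simp at h1

lemma mem_factors_inr {b b' : Fin K} (h : b ≠ b') : ((Sum.inr b : Var m L K), (Sum.inr b' : Var m L K), D.p.q2) ∈ D.factors :=
  D.mem_factors.2 ⟨by simpa using h, mem_singleton_self _⟩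

lemma mem_factors_inl {a a' : Fin L} (h : a ≠ a') :
    ((Sum.inl (0, a) : Var m L K), (Sum.inl (0, a') : Var m L K), D.p.q2) ∈ D.factors :=
  D.mem_factors.2 ⟨by simpa using h, by simp [roots]⟩

section
variable {P : MvPolynomial (Src m L K) ℂ} {h : MvPolynomial (Var m L K) ℂ}

/-- Besides the `m + 1` wheels behind the factor `z_c - q₂ z_b` there is one more: `z_b = q₃^{m+2}
z_a` makes the chain of `z_b` continue that of `z_a`, so the colour-`0` point above `z_c` closes a
wheel too. Hence all `m + 2` points above `z_c` can be moved independently. -/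
lemma wheel_inr_up (hP : WheelConditions D.p P)
    (hh : monoSubst Src.var D.coef P = (∏ θ ∈ D.factors, lin θ ^ factorMult θ) * h) {a b c : Fin K}
    (hab : a ≠ b) (hac : a ≠ c) (hbc : b ≠ c) (x : Var m L K → ℂ)
    (hb : x (Sum.inr b) = D.p.q3 ^ (m + 2) * x (Sum.inr a)) (hc : x (Sum.inr c) = D.p.q2 * x (Sum.inr b)) :
    MvPolynomial.eval x h = 0 := by
  have h2 := D.p.q2_ne
  have h3 := D.p.q3_ne
  have hu : (Sum.inr a : Var m L K) ≠ Sum.inr b := by simpa using hab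
  have hv : (Sum.inr a : Var m L K) ≠ Sum.inr c := by simpa using hac
  have hw : (Sum.inr b : Var m L K) ≠ Sum.inr c := by simpa using hbc
  refine eval_eq_zero_of_family hh hu hv hw (mem_factors_inr hbc.symm) (pow_ne_zero _ h3)
    (mul_ne_zero h2 (pow_ne_zero _ h3)) (factors_tripleCoef_ne hu hv hw (a := -(m + 2)) (b := -(m + 2))
      (c := -(m + 2)) (e := 1 - (m + 2)) ?_ ?_ ?_ (by omega) (by omega) (Or.inr (by omega)) (by omega) (by omega)
      (Or.inl rfl)) ?_ x hb (by rw [hc, hb, mul_assoc])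
  · rw [D.q3_pow]; push_cast; rfl
  · rw [D.q3_pow, mul_left_comm, ← zpow_one_add₀ h2]; push_cast; rfl
  · rintro l l' γ hl (rfl | rfl | rfl) (rfl | rfl | rfl) <;> exact root_inr hl
  · intro x hb hc
    refine ⟨_, 1, one_ne_zero, fun l => ?_, ?_, (dvd_of_eq (congrArg (Polynomial.X ^ ·)
      (Fintype.card_fin (m + 2)).symm)).trans (D.pow_dvd_of_family (P := P) (E := Fin (m + 2)) c id x
      fun y e hy hy' => ?_)⟩
    · by_cases hl : l = Sum.inr c
      · subst hl; simp
      · simp [hl]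
    · simp only [lin, map_sub, map_mul, MvPolynomial.aeval_X, MvPolynomial.aeval_C, Function.update_self,
        Function.update_of_ne hw, hb, hc, Polynomial.algebraMap_eq, map_one]
      ring
    · induction e using Fin.cases with
      | zero =>
        refine hP.up (Fin.last (m + 1)) 0 (Sum.inr a) (Sum.inr b) (Sum.inr c) y
          ((eq_finRotate_iff _ _).2 (by simp)) (by simp [Fin.ext_iff]) (by simp [Fin.ext_iff]) (by simpa using hbc) ?_ ?_
        · rw [hy _ (by simpa using hbc), hy _ (by simpa using hac), spl_inr, spl_inr, hb, Fin.val_last]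
          simp; ring
        · rw [hy' _ rfl, hy _ (by simpa using hbc), spl_inr, hb, hc]
          simp; ring
      | succ e =>
        refine hP.up e.castSucc e.succ (Sum.inr b) (Sum.inr b) (Sum.inr c) y
          ((eq_finRotate_iff _ _).2 (by simp)) (by simp [Fin.ext_iff]) (by simp [Fin.ext_iff]) (by simpa using hbc) ?_ ?_
        · rw [hy _ (by simpa using hbc), hy _ (by simpa using hbc), spl_inr, spl_inr]
          simp; ring
        · rw [hy' e.succ rfl, hy _ (by simpa using hbc), spl_inr, hb, hc]
          simp; ring

/-- Here the points above `z_a` are moved. The chain of `z_c` continues that of `z_b`, which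
supplies the additional wheel at the last colour. -/
lemma wheel_inr_down (hP : WheelConditions D.p P)
    (hh : monoSubst Src.var D.coef P = (∏ θ ∈ D.factors, lin θ ^ factorMult θ) * h) {a b c : Fin K}
    (hab : a ≠ b) (hac : a ≠ c) (hbc : b ≠ c) (x : Var m L K → ℂ)
    (hb : x (Sum.inr b) = D.p.q2 * x (Sum.inr a)) (hc : x (Sum.inr c) = D.p.q3 ^ (m + 2) * x (Sum.inr b)) :
    MvPolynomial.eval x h = 0 := by
  have h2 := D.p.q2_ne
  have h3 := D.p.q3_ne
  have hu : (Sum.inr a : Var m L K) ≠ Sum.inr b := by simpa using hab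
  have hv : (Sum.inr a : Var m L K) ≠ Sum.inr c := by simpa using hac
  have hw : (Sum.inr b : Var m L K) ≠ Sum.inr c := by simpa using hbc
  refine eval_eq_zero_of_family hh hu hv hw (mem_factors_inr hab.symm) h2
    (mul_ne_zero h2 (pow_ne_zero (m + 2) h3)) (factors_tripleCoef_ne hu hv hw (a := 0) (b := 1)
      (c := -(m + 2)) (e := 1 - (m + 2)) ?_ ?_ ?_ (by omega) (by omega) (Or.inl rfl) (by omega) (by omega)
      (Or.inr (by omega))) ?_ x hb (by rw [hc, hb]; ring)
  · simp
  · rw [D.q3_pow, mul_left_comm, ← zpow_one_add₀ h2]; push_cast; rfl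
  · rintro l l' γ hl (rfl | rfl | rfl) (rfl | rfl | rfl) <;> exact root_inr hl
  · intro x hb hc
    refine ⟨_, -D.p.q2, neg_ne_zero.2 h2, fun l => ?_, ?_, (dvd_of_eq (congrArg (Polynomial.X ^ ·)
      (Fintype.card_fin (m + 2)).symm)).trans (D.pow_dvd_of_family (P := P) (E := Fin (m + 2)) a id x
      fun y e hy hy' => ?_)⟩
    · by_cases hl : l = Sum.inr a
      · subst hl; simp
      · simp [hl]
    · simp only [lin, map_sub, map_mul, MvPolynomial.aeval_X, MvPolynomial.aeval_C, Function.update_self,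
        Function.update_of_ne hu.symm, hb, Polynomial.algebraMap_eq, map_neg]
      ring
    · induction e using Fin.lastCases with
      | last =>
        refine hP.down (Fin.last (m + 1)) 0 (Sum.inr a) (Sum.inr b) (Sum.inr c) y
          ((eq_finRotate_iff _ _).2 (by simp)) (by simpa using hab) (by simp [Fin.ext_iff]) (by simp [Fin.ext_iff]) ?_ ?_
        · rw [hy _ (by simpa using hab.symm), hy' (Fin.last _) rfl, spl_inr, hb]
          ring
        · rw [hy _ (by simpa using hac.symm), hy _ (by simpa using hab.symm), spl_inr, spl_inr, hb, hc, Fin.val_last]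
          simp; ring
      | cast e =>
        refine hP.down e.castSucc e.succ (Sum.inr a) (Sum.inr b) (Sum.inr b) y
          ((eq_finRotate_iff _ _).2 (by simp)) (by simpa using hab) (by simp [Fin.ext_iff]) (by simp [Fin.ext_iff]) ?_ ?_
        · rw [hy _ (by simpa using hab.symm), hy' e.castSucc rfl, spl_inr, hb]
          ring
        · rw [hy _ (by simpa using hab.symm), hy _ (by simpa using hab.symm), spl_inr, spl_inr, hb]
          simp; ring

/-- With one target colour all three variables on a wheel have colour `0`. Then `t = q₁` makes
`pt.q3` a monomial in `q₁` and `q₂`, as the exponent criterion requires. -/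
lemma pt_q3_cases (D : FusionData m) : m = 0 → D.pt.q3 = D.p.q1 ^ (-2 : ℤ) * D.p.q2 ^ (-1 : ℤ) := by
  rintro rfl
  have h1 := D.p.q1_ne
  have h2 := D.p.q2_ne
  have : D.t = D.p.q1 := by simpa using D.root
  rw [D.pt_q3, D.q3_def, this]
  simp only [zpow_neg, zpow_ofNat]
  field_simp

lemma q2_mul_q2_ne (D : FusionData m) : D.p.q2 * D.p.q2 ≠ 1 := fun e => by
  have := D.pow_eq (a := 0) (b := 2) (c := 0) (e := 0) (by simpa [sq] using e)
  omega

/-- If `j ≠ 0`, no factor joins the three variables, and the target wheel is the specialization of a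
source wheel. If `j = 0`, the factor `y_c - q₂ y_b` vanishes; order two comes from one source wheel
ending in the last colour and another one that passes from the last colour to colour `0`. -/
lemma wheel_inl_up (hP : WheelConditions D.p P)
    (hh : monoSubst Src.var D.coef P = (∏ θ ∈ D.factors, lin θ ^ factorMult θ) * h) {i j : Fin (m + 1)}
    {a b c : Fin L} (hij : j = finRotate (m + 1) i) (hab : (i, a) ≠ (j, b)) (hac : (i, a) ≠ (j, c)) (hbc : b ≠ c)
    (x : Var m L K → ℂ) (hb : x (Sum.inl (j, b)) = D.pt.q3 * x (Sum.inl (i, a)))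
    (hc : x (Sum.inl (j, c)) = D.p.q2 * x (Sum.inl (j, b))) : MvPolynomial.eval x h = 0 := by
  have h1 := D.p.q1_ne
  have h2 := D.p.q2_ne
  have h3 := D.p.q3_ne
  have ht := D.t_ne
  have hpt := D.pt.q3_ne
  have hu : (Sum.inl (i, a) : Var m L K) ≠ Sum.inl (j, b) := by simpa using hab
  have hv : (Sum.inl (i, a) : Var m L K) ≠ Sum.inl (j, c) := by simpa using hac
  have hw : (Sum.inl (j, b) : Var m L K) ≠ Sum.inl (j, c) := by simpa using hbc
  have hij' := (eq_finRotate_iff _ _).1 hij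
  have hilt := i.2
  by_cases hj : j = 0
  · have hi : (i : ℕ) = m := by subst hj; simp at hij'; omega
    subst hj
    refine eval_eq_zero_of_family hh hu hv hw (mem_factors_inl hbc.symm) (α := D.pt.q3) (β := D.p.q2 * D.pt.q3) hpt
      (mul_ne_zero h2 hpt) ?_ ?_ x hb (by rw [hc, hb, mul_assoc])
    · by_cases hm : m = 0
      · refine factors_tripleCoef_ne hu hv hw (a := -2) (b := -1) (c := -2) (e := 0) (D.pt_q3_cases hm) ?_ ?_
          (by omega) (by omega) (Or.inr (by omega)) (by omega) (by omega) (Or.inl rfl)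
        · rw [D.pt_q3_cases hm, mul_left_comm, ← zpow_one_add₀ h2]; rfl
        · rintro l l' γ hl (rfl | rfl | rfl) (rfl | rfl | rfl) <;> exact (root_inl hl).1
      · rintro ⟨l, l', γ⟩ hθ hne e
        obtain ⟨m1, m2⟩ := mem_of_tripleVar_eq e (D.mem_factors.1 hθ).1
        have hll : l ≠ l' := (D.mem_factors.1 hθ).1
        dsimp only at m1 m2 ⊢
        have hi0 : i ≠ 0 := fun e => hm (by rw [← hi, e]; rfl)
        rcases m1 with rfl | rfl | rfl <;> rcases m2 with rfl | rfl | rfl <;>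
          first | exact absurd rfl hll | exact absurd (root_inl hθ).2.1 hi0 |
            exact absurd (root_inl hθ).2.2 hi0 | skip
        · obtain rfl := (root_inl hθ).1
          simp only [tripleCoef, if_true, if_neg hw.symm]
          intro e
          exact D.q2_mul_q2_ne (mul_right_cancel₀ hpt (by rw [mul_assoc, ← e, one_mul]))
        · obtain rfl := (root_inl hθ).1
          exact absurd rfl hne
    · intro x hb hc
      have hc' : x (Sum.inl (0, c)) = D.p.q2 * x (Sum.inl (0, b)) := by rw [hc, hb, mul_assoc]
      refine ⟨Function.update (fun l => Polynomial.C (x l)) (Sum.inl (0, c))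
        (Polynomial.C (D.p.q2 * x (Sum.inl (0, b))) + Polynomial.X), 1, one_ne_zero, fun l => ?_, ?_, ?_⟩
      · by_cases hl : l = Sum.inl (0, c)
        · subst hl; simp [hc']
        · simp [hl]
      · simp only [lin, map_sub, map_mul, MvPolynomial.aeval_X, MvPolynomial.aeval_C, Function.update_self,
          Function.update_of_ne hw, Polynomial.algebraMap_eq, map_one]
        ring
      · change Polynomial.X ^ 2 ∣ _
        rw [aeval_monoSubst]
        -- `s₀` displaces `y_c`, and the colour-`0` point above `y_b` is displaced by `q₃ s₀ + s₁`.
        -- For `s₁ = 0` it keeps the ratio `q₃` to the last-colour point above `y_c`, and for `s₀ =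
        -- 0` the last-colour points form a wheel with the point above `y_a`.
        obtain ⟨φ, f1, f2, f3, f4⟩ : ∃ φ : Src m L K → MvPolynomial (Fin 2) ℂ,
            φ (Fin.last (m + 1), Sum.inl c) = MvPolynomial.C (D.p.q2 * x (Sum.inl (0, b))) + MvPolynomial.X 0 ∧
            φ (0, Sum.inl c) =
              MvPolynomial.C D.p.q1⁻¹ * (MvPolynomial.C (D.p.q2 * x (Sum.inl (0, b))) + MvPolynomial.X 0) ∧
            φ (0, Sum.inl b) = MvPolynomial.C (D.p.q1⁻¹ * x (Sum.inl (0, b))) +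
              MvPolynomial.C D.p.q3 * MvPolynomial.X 0 + MvPolynomial.X 1 ∧
            ∀ l, l ≠ (Fin.last (m + 1), Sum.inl c) → l ≠ (0, Sum.inl c) → l ≠ (0, Sum.inl b) →
              φ l = MvPolynomial.C (D.spl x l) := by
          refine ⟨fun l => if l = (Fin.last (m + 1), Sum.inl c) then _ else if l = (0, Sum.inl c) then _
            else if l = (0, Sum.inl b) then _ else _, if_pos rfl, (if_neg ?_).trans (if_pos rfl),
            (if_neg ?_).trans ((if_neg ?_).trans (if_pos rfl)),
            fun l e1 e2 e3 => (if_neg e1).trans ((if_neg e2).trans (if_neg e3))⟩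
          · simp [Fin.ext_iff]
          · simp [Fin.ext_iff]
          · simpa using hbc
        have fa : φ (⟨m, by omega⟩, Sum.inl a) = MvPolynomial.C (D.cy m * x (Sum.inl (i, a))) := by
          rw [f4, D.spl_castSucc x (i := i) hi.symm, hi]
          · simp [Fin.ext_iff]
          · rintro e
            simp only [Prod.mk.injEq, Fin.ext_iff, Fin.val_zero, Sum.inl.injEq] at e
            exact hac (Prod.ext (Fin.ext (hi.trans e.1)) (Fin.ext e.2))
          · rintro e
            simp only [Prod.mk.injEq, Fin.ext_iff, Fin.val_zero, Sum.inl.injEq] at e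
            exact hab (Prod.ext (Fin.ext (hi.trans e.1)) (Fin.ext e.2))
        have fb : φ (Fin.last (m + 1), Sum.inl b) = MvPolynomial.C (x (Sum.inl (0, b))) := by
          rw [f4, D.spl_last x rfl]
          · simpa using hbc
          · simp [Fin.ext_iff]
          · simp [Fin.ext_iff]
        -- On the line `s₀ = X`, `s₁ = -q₃ X` the displacement above `y_b` cancels, so only `y_c`
        -- moves.
        refine (dvd_of_eq (congrArg (Polynomial.X ^ ·) (Fintype.card_fin 2).symm)).trans
          (pow_card_dvd_aeval P φ ?_ ![1, -D.p.q3] _ ?_)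
        · intro s e hs
          fin_cases e
          · refine hP.up ⟨m, by omega⟩ (Fin.last (m + 1)) (Sum.inl a) (Sum.inl b) (Sum.inl c) _
              ((eq_finRotate_iff _ _).2 (by simp)) (by simp [Fin.ext_iff]) (by simp [Fin.ext_iff])
              (by simpa using hbc) ?_ ?_
            · have : D.p.q1 = D.t * D.t ^ m := by rw [← D.root, pow_succ']
              simp only [fa, fb, MvPolynomial.eval_C, hb, D.pt_q3, cy, this]
              field_simp
            · simp only [Fin.zero_eta] at hs
              simp [f1, fb, hs]
          · refine hP.up (Fin.last (m + 1)) 0 (Sum.inl c) (Sum.inl b) (Sum.inl c) _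
              ((eq_finRotate_iff _ _).2 (by simp)) (by simp [Fin.ext_iff]) (by simp [Fin.ext_iff])
              (by simpa using hbc) ?_ ?_
            · simp only [Fin.mk_one] at hs
              simp only [f1, f3, map_add, map_mul, MvPolynomial.eval_C, MvPolynomial.eval_X, hs, ← D.q2_q3]
              ring
            · simp only [Fin.mk_one] at hs
              simp only [f2, f3, map_add, map_mul, MvPolynomial.eval_C, MvPolynomial.eval_X, hs, ← D.q2_q3]
              ring
        · intro l
          by_cases e1 : l = (Fin.last (m + 1), Sum.inl c)
          · subst e1
            simp [f1, Src.var, coef, D.cy_last]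
          by_cases e2 : l = (0, Sum.inl c)
          · subst e2
            simp [f2, Src.var, coef, D.cy_zero]
          have hl : l.var ≠ Sum.inl (0, c) := fun e => by
            rcases Src.var_eq_inl e with e | e
            · exact e2 e
            · exact e1 e.2
          rw [Function.update_of_ne hl]
          by_cases e3 : l = (0, Sum.inl b)
          · subst e3
            simp [f3, Src.var, coef, D.cy_zero]
          · simp [f4 l e1 e2 e3, spl]
  · obtain hij'' : (j : ℕ) = i + 1 := hij'.resolve_right fun e => hj (Fin.ext e.2)
    refine eval_eq_zero_of_spl hh hu hv hw (α := D.pt.q3) (β := D.p.q2 * D.pt.q3) hpt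
      (mul_ne_zero h2 hpt) ?_ ?_ x hb (by rw [hc, hb, mul_assoc])
    · rintro l l' γ hl (rfl | rfl | rfl) (rfl | rfl | rfl) <;>
        first | exact absurd rfl (D.mem_factors.1 hl).1 | exact hj (root_inl hl).2.1 | exact hj (root_inl hl).2.2
    · intro x hb hc
      refine hP.up i.castSucc j.castSucc (Sum.inl a) (Sum.inl b) (Sum.inl c) _ ((eq_finRotate_iff _ _).2 (by simp [hij'']))
        (by simp [Fin.ext_iff, hij'']) (by simp [Fin.ext_iff, hij'']) (by simpa using hbc) ?_ ?_
      · rw [D.spl_castSucc x (j := i.castSucc) (i := i) rfl, D.spl_castSucc x (j := j.castSucc) (i := j) rfl, hb,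
          hij'', cy_succ, D.pt_q3]
        field_simp
      · rw [D.spl_castSucc x (j := j.castSucc) (i := j) rfl, D.spl_castSucc x (j := j.castSucc) (i := j) rfl, hc, hb]
        ring

/-- Only for `i = 0` does a factor, `y_b - q₂ y_a`, vanish. There `y_c` is moved along with `y_b`,
so that the ratio between them is kept and the wheel through `y_c` contributes to the order. -/
lemma wheel_inl_down (hP : WheelConditions D.p P)
    (hh : monoSubst Src.var D.coef P = (∏ θ ∈ D.factors, lin θ ^ factorMult θ) * h) {i j : Fin (m + 1)}
    {a b c : Fin L} (hij : j = finRotate (m + 1) i) (hab : a ≠ b) (hac : (i, a) ≠ (j, c)) (hbc : (i, b) ≠ (j, c))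
    (x : Var m L K → ℂ) (hb : x (Sum.inl (i, b)) = D.p.q2 * x (Sum.inl (i, a)))
    (hc : x (Sum.inl (j, c)) = D.pt.q3 * x (Sum.inl (i, b))) : MvPolynomial.eval x h = 0 := by
  have h1 := D.p.q1_ne
  have h2 := D.p.q2_ne
  have h3 := D.p.q3_ne
  have ht := D.t_ne
  have hpt := D.pt.q3_ne
  have hu : (Sum.inl (i, a) : Var m L K) ≠ Sum.inl (i, b) := by simpa using hab
  have hv : (Sum.inl (i, a) : Var m L K) ≠ Sum.inl (j, c) := by simpa using hac
  have hw : (Sum.inl (i, b) : Var m L K) ≠ Sum.inl (j, c) := by simpa using hbc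
  have hij' := (eq_finRotate_iff _ _).1 hij
  have hilt := i.2
  have hc0 : x (Sum.inl (j, c)) = D.p.q2 * D.pt.q3 * x (Sum.inl (i, a)) := by rw [hc, hb]; ring
  -- the colour of the source after that of `i`
  have hcol : ∀ x : Var m L K → ℂ, D.spl x (i.succ, Sum.inl c) = D.cy (i + 1) * x (Sum.inl (j, c)) := by
    intro x
    rcases hij' with hj | ⟨hi, hj⟩
    · exact (D.spl_castSucc x (i := j) (by simp [hj]) c).trans (by rw [hj])
    · obtain rfl : j = 0 := Fin.ext hj
      rw [hi, D.cy_last, one_mul]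
      exact D.spl_last x (by simp [hi]) c
  by_cases hi : i = 0
  · subst hi
    refine eval_eq_zero_of_family hh hu hv hw (mem_factors_inl hab.symm) (α := D.p.q2) (β := D.p.q2 * D.pt.q3) h2
      (mul_ne_zero h2 hpt) ?_ ?_ x hb hc0
    · by_cases hm : m = 0
      · refine factors_tripleCoef_ne hu hv hw (a := 0) (b := 1) (c := -2) (e := 0) (by simp) ?_ ?_
          (by omega) (by omega) (Or.inl rfl) (by omega) (by omega) (Or.inr (by omega))
        · rw [D.pt_q3_cases hm, mul_left_comm, ← zpow_one_add₀ h2]; rfl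
        · rintro l l' γ hl (rfl | rfl | rfl) (rfl | rfl | rfl) <;> exact (root_inl hl).1
      · rintro ⟨l, l', γ⟩ hθ hne e
        obtain ⟨m1, m2⟩ := mem_of_tripleVar_eq e (D.mem_factors.1 hθ).1
        have hll : l ≠ l' := (D.mem_factors.1 hθ).1
        dsimp only at m1 m2 ⊢
        have hj0 : j ≠ 0 := by
          rintro rfl
          simp at hij'
          omega
        rcases m1 with rfl | rfl | rfl <;> rcases m2 with rfl | rfl | rfl <;>
          first | exact absurd rfl hll | exact absurd (root_inl hθ).2.1 hj0 |
            exact absurd (root_inl hθ).2.2 hj0 | skip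
        · obtain rfl := (root_inl hθ).1
          simp only [tripleCoef, if_true, if_neg hu, if_neg hv]
          intro e
          exact D.q2_mul_q2_ne e.symm
        · obtain rfl := (root_inl hθ).1
          exact absurd rfl hne
    · intro x hb hc0
      have hc : x (Sum.inl (j, c)) = D.pt.q3 * x (Sum.inl (0, b)) := by rw [hc0, hb]; ring
      refine ⟨Function.update (Function.update (fun l => Polynomial.C (x l)) (Sum.inl (0, b))
        (Polynomial.C (D.p.q2 * x (Sum.inl (0, a))) + Polynomial.X)) (Sum.inl (j, c))
        (Polynomial.C D.pt.q3 * (Polynomial.C (D.p.q2 * x (Sum.inl (0, a))) + Polynomial.X)),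
        1, one_ne_zero, fun l => ?_, ?_, ?_⟩
      · by_cases hl : l = Sum.inl (j, c)
        · subst hl; simp [hc, hb]
        · rw [Function.update_of_ne hl]
          by_cases hl' : l = Sum.inl (0, b)
          · subst hl'; simp [hb]
          · simp [hl']
      · simp only [lin, map_sub, map_mul, MvPolynomial.aeval_X, MvPolynomial.aeval_C, Function.update_self,
          Function.update_of_ne hw, Function.update_of_ne hu, Function.update_of_ne hv,
          Polynomial.algebraMap_eq, map_one]
        ring
      · change Polynomial.X ^ 2 ∣ _
        rw [aeval_monoSubst]
        -- `s₀` displaces the last-colour point above `y_b`; `s₁` displaces the colour-`0` point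
        -- above `y_b` and everything above `y_c`. The wheel for `s₀ = 0` passes from the last
        -- colour to `0`, the one for `s₁ = 0` from colour `0` to `1`.
        obtain ⟨φ, f1, f2, f3, f4⟩ : ∃ φ : Src m L K → MvPolynomial (Fin 2) ℂ,
            φ (Fin.last (m + 1), Sum.inl b) = MvPolynomial.C (D.p.q2 * x (Sum.inl (0, a))) + MvPolynomial.X 0 ∧
            φ (0, Sum.inl b) =
              MvPolynomial.C (D.p.q1⁻¹ * D.p.q2 * x (Sum.inl (0, a))) + MvPolynomial.X 1 ∧
            (∀ l : Src m L K, l.var = Sum.inl (j, c) → φ l = MvPolynomial.C (D.coef l * D.pt.q3 * D.p.q1) *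
              (MvPolynomial.C (D.p.q1⁻¹ * D.p.q2 * x (Sum.inl (0, a))) + MvPolynomial.X 1)) ∧
            ∀ l : Src m L K, l.var ≠ Sum.inl (0, b) → l.var ≠ Sum.inl (j, c) → φ l = MvPolynomial.C (D.spl x l) := by
          refine ⟨fun l => if l = (Fin.last (m + 1), Sum.inl b) then _ else if l = (0, Sum.inl b) then _
            else if l.var = Sum.inl (j, c) then _ else _, if_pos rfl, (if_neg ?_).trans (if_pos rfl),
            fun l e => (if_neg ?_).trans ((if_neg ?_).trans (if_pos e)),
            fun l e1 e2 => (if_neg ?_).trans ((if_neg ?_).trans (if_neg e2))⟩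
          · simp [Fin.ext_iff]
          · rintro rfl
            exact hw (by rw [← e, Src.var, ofNat_last])
          · rintro rfl
            exact hw (by rw [← e]; rfl)
          · rintro rfl
            exact e1 (by rw [Src.var, ofNat_last])
          · rintro rfl
            exact e1 rfl
        have fa : φ (0, Sum.inl a) = MvPolynomial.C (D.p.q1⁻¹ * x (Sum.inl (0, a))) := by
          rw [f4 (0, Sum.inl a) hu hv, D.spl_castSucc x (i := 0) rfl, Fin.val_zero, D.cy_zero]
        have fl : φ (Fin.last (m + 1), Sum.inl a) = MvPolynomial.C (x (Sum.inl (0, a))) := by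
          have e : Src.var (Fin.last (m + 1), (Sum.inl a : Fin L ⊕ Fin K)) = Sum.inl (0, a) := by rw [Src.var, ofNat_last]
          rw [f4 _ (e.trans_ne hu) (e.trans_ne hv), D.spl_last x rfl]
        have fc : φ ((0 : Fin (m + 1)).succ, Sum.inl c) = MvPolynomial.C (D.cy 1 * D.pt.q3 * D.p.q1) *
              (MvPolynomial.C (D.p.q1⁻¹ * D.p.q2 * x (Sum.inl (0, a))) + MvPolynomial.X 1) := by
          refine (f3 _ ?_).trans rfl
          rw [Src.var]
          congr 2
          rcases hij' with hj | ⟨hi, hj⟩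
          · have := j.2
            simp only [Fin.val_zero, zero_add] at hj
            ext
            simp [hj]
            omega
          · obtain rfl : m = 0 := by simpa using hi.symm
            exact Fin.ext (by omega)
        -- The direction `(1, q₁⁻¹)` displaces the two points above `y_b` in the ratio of their
        -- coefficients, as a motion of `y_b` does.
        refine (dvd_of_eq (congrArg (Polynomial.X ^ ·) (Fintype.card_fin 2).symm)).trans
          (pow_card_dvd_aeval P φ ?_ ![1, D.p.q1⁻¹] _ ?_)
        · intro s e hs
          fin_cases e
          · simp only [Fin.zero_eta] at hs
            refine hP.down (Fin.last (m + 1)) 0 (Sum.inl a) (Sum.inl b) (Sum.inl a) _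
              ((eq_finRotate_iff _ _).2 (by simp)) (by simpa using hab) (by simp [Fin.ext_iff]) (by simp [Fin.ext_iff])
              ?_ ?_
            · simp [f1, fl, hs]
            · simp only [f1, fa, map_add, MvPolynomial.eval_C, MvPolynomial.eval_X, hs, ← D.q2_q3]
              ring
          · simp only [Fin.mk_one] at hs
            refine hP.down 0 (0 : Fin (m + 1)).succ (Sum.inl a) (Sum.inl b) (Sum.inl c) _
              ((eq_finRotate_iff _ _).2 (by simp)) (by simpa using hab) (by simp [Fin.ext_iff]) (by simp [Fin.ext_iff])
              ?_ ?_
            · simp only [f2, fa, map_add, MvPolynomial.eval_C, MvPolynomial.eval_X, hs]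
              ring
            · simp only [f2, fc, map_add, map_mul, MvPolynomial.eval_C, MvPolynomial.eval_X, hs, cy, D.pt_q3]
              field_simp
        · intro l
          by_cases e1 : l.var = Sum.inl (j, c)
          · rw [f3 l e1, e1, Function.update_self]
            simp only [map_mul, map_add, MvPolynomial.aeval_C, MvPolynomial.aeval_X, Polynomial.algebraMap_eq,
              Matrix.cons_val_one, Matrix.cons_val_fin_one]
            have : (Polynomial.C D.p.q1 : Polynomial ℂ) * Polynomial.C D.p.q1⁻¹ = 1 := by
              rw [← Polynomial.C_mul, mul_inv_cancel₀ h1, map_one]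
            linear_combination (Polynomial.C (D.coef l) * Polynomial.C D.pt.q3 *
              (Polynomial.C D.p.q2 * Polynomial.C (x (Sum.inl (0, a))) + Polynomial.X)) * this
          rw [Function.update_of_ne e1]
          by_cases e2 : l.var = Sum.inl (0, b)
          · rw [e2, Function.update_self]
            rcases Src.var_eq_inl e2 with rfl | ⟨-, rfl⟩
            · have : (Fin.castSucc (0 : Fin (m + 1)), Sum.inl b) = (0, (Sum.inl b : Fin L ⊕ Fin K)) := rfl
              rw [this, f2]
              simp [coef, D.cy_zero]
              ring
            · rw [f1]
              simp [coef, D.cy_last]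
          · simp [f4 l e2 e1, Function.update_of_ne e2, spl]
  · refine eval_eq_zero_of_spl hh hu hv hw (α := D.p.q2) (β := D.p.q2 * D.pt.q3) h2
      (mul_ne_zero h2 hpt) ?_ ?_ x hb hc0
    · rintro l l' γ hl (rfl | rfl | rfl) (rfl | rfl | rfl) <;>
        first | exact absurd rfl (D.mem_factors.1 hl).1 | exact hi (root_inl hl).2.1 | exact hi (root_inl hl).2.2
    · intro x hb hc
      refine hP.down i.castSucc i.succ (Sum.inl a) (Sum.inl b) (Sum.inl c) _ ((eq_finRotate_iff _ _).2 (by simp))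
        (by simpa using hab) (by simp [Fin.ext_iff]) (by simp [Fin.ext_iff]) ?_ ?_
      · rw [D.spl_castSucc x (j := i.castSucc) (i := i) rfl, D.spl_castSucc x (j := i.castSucc) (i := i) rfl, hb]
        ring
      · rw [hcol, D.spl_castSucc x (j := i.castSucc) (i := i) rfl, hc, hb, cy_succ, D.pt_q3]
        field_simp

end
end FusionData

/-! ### Enumerations of configurations and membership in the shuffle algebra -/

lemma Distinct.comp {κ ι : Type} {x : ι → ℂ} (hx : Distinct x) (σ : κ ≃ ι) : Distinct (x ∘ σ) :=
  ⟨fun _ => hx.1 _, hx.2.comp σ.injective⟩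

section Conf
variable {ι : Type} [Fintype ι] {n : ℕ} {c : ι → Fin n}

lemma mem_conf {x : ι → ℂ} {u : Fin n × ℂ} : u ∈ conf c x ↔ ∃ l, c l = u.1 ∧ x l = u.2 := by
  simp [conf, Prod.ext_iff]

lemma conf_comp {κ : Type} [Fintype κ] (σ : κ ≃ ι) (x : ι → ℂ) : conf (c ∘ σ) (x ∘ σ) = conf c x := by
  ext u
  simp only [mem_conf, Function.comp]
  exact ⟨fun ⟨l, h⟩ => ⟨σ l, h⟩, fun ⟨l, h⟩ => ⟨σ.symm l, by simpa using h⟩⟩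

lemma poleDenom_comp {κ : Type} [Fintype κ] (σ : κ ≃ ι) (x : ι → ℂ) :
    poleDenom (c ∘ σ) (x ∘ σ) = poleDenom c x :=
  Fintype.prod_equiv σ _ _ fun l => Fintype.prod_equiv σ _ _ fun l' => by
    by_cases h : l = l'
    · subst h; simp
    · simp [h]

/-- Variables that form the same configuration differ by a permutation. -/
lemma exists_perm_of_conf_eq {x x' : ι → ℂ} (hx' : Distinct x') (h : conf c x = conf c x') :
    ∃ σ : Equiv.Perm ι, c ∘ σ = c ∧ x ∘ σ = x' := by
  have h1 : ∀ l, ∃ l', c l' = c l ∧ x l' = x' l := fun l =>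
    mem_conf.1 (h ▸ mem_conf.2 ⟨l, rfl, rfl⟩ : (c l, x' l) ∈ conf c x)
  choose f hf hf' using h1
  have hinj : Function.Injective f := fun a b e => hx'.2 (by rw [← hf', ← hf', e])
  exact ⟨Equiv.ofBijective f (Finite.injective_iff_bijective.1 hinj), funext hf, funext hf'⟩

open Classical in
lemma card_filter_conf {x : ι → ℂ} (hx : Distinct x) (i : Fin n) :
    ((conf c x).filter fun u => u.1 = i).card = (univ.filter fun l => c l = i).card := by
  rw [conf, filter_image]
  exact card_image_of_injective _ fun a b e => hx.2 (Prod.ext_iff.1 e).2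

/-- Any index type with the right number of variables of each colour may replace the standard one.
The denominators do not vanish at distinct points, so the wheel conditions need to be known for the
numerator only. -/
lemma mem_Sh_of_equiv {p : Params} {N : Fin n → ℕ} (e : (Σ i, Fin (N i)) ≃ ι) (he : ∀ l, c (e l) = l.1)
    {G : ShFun n p} (h0 : ∀ S, G S ≠ 0 → ∃ x : ι → ℂ, Distinct x ∧ conf c x = S) {f : MvPolynomial ι ℂ} {k : ℕ}
    (hf : ∀ x, Distinct x → G (conf c x) * ((∏ l, x l) ^ k * poleDenom c x) = MvPolynomial.eval x f)
    (up : ∀ x, Distinct x → ∀ a b b', c b = finRotate n (c a) → c b' = c b → x b = p.q3 * x a →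
      x b' = p.q2 * x b → MvPolynomial.eval x f = 0)
    (down : ∀ x, Distinct x → ∀ a b b', c b = c a → c b' = finRotate n (c b) → x b = p.q2 * x a →
      x b' = p.q3 * x b → MvPolynomial.eval x f = 0) : G ∈ Sh p N := by
  classical
  have hc : c ∘ e = Sigma.fst := funext he
  have h0' : ∀ x, Distinct x → MvPolynomial.eval x f = 0 → G (conf c x) = 0 := fun x hx e => by
    have := hf x hx
    rw [e, mul_eq_zero] at this
    exact this.resolve_right (mul_ne_zero (pow_ne_zero _ hx.prod_ne_zero) (poleDenom_ne_zero c hx))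
  refine ⟨fun S hS i => ?_, ⟨MvPolynomial.rename e.symm f, k, fun x hx => ?_⟩, fun S i u m1 m2 m3 => ?_,
    fun S i u m1 m2 m3 => ?_⟩
  · obtain ⟨x, hx, rfl⟩ := h0 S hS
    have h1 : (univ.filter fun l => c l = i).card = N i := by
      rw [← card_map e.symm.toEmbedding]
      have : (univ.filter fun l => c l = i).map e.symm.toEmbedding =
          (univ : Finset (Fin (N i))).map (Function.Embedding.sigmaMk i) := by
        ext ⟨j, a⟩
        simp only [mem_filter, mem_univ, true_and, mem_map,
          Function.Embedding.sigmaMk_apply, Sigma.mk.injEq]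
        constructor
        · rintro ⟨l, hl, e1⟩
          obtain rfl : l = e ⟨j, a⟩ := (Equiv.symm_apply_eq e).1 e1
          obtain rfl : j = i := by rw [← hl, he]
          exact ⟨a, rfl, HEq.rfl⟩
        · rintro ⟨b, rfl, h⟩
          obtain rfl := eq_of_heq h
          exact ⟨e ⟨i, b⟩, he _, e.symm_apply_apply _⟩
      rw [this, card_map, card_univ, Fintype.card_fin]
    rw [← h1, ← card_filter_conf hx]
  · have hx' : Distinct (x ∘ e.symm) := hx.comp e.symm
    have e2 : (x ∘ e.symm) ∘ e = x := by ext; simp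
    have h1 : conf Sigma.fst x = conf c (x ∘ e.symm) := by
      rw [← conf_comp e, hc, e2]
    have h2 : poleDenom Sigma.fst x = poleDenom c (x ∘ e.symm) := by
      rw [← poleDenom_comp e, hc, e2]
    have h3 : ∏ l, x l = ∏ l, (x ∘ e.symm) l := (Equiv.prod_comp e.symm x).symm
    rw [h1, h2, h3, MvPolynomial.eval_rename, ← hf _ hx', div_div, mul_div_cancel_right₀]
    exact mul_ne_zero (pow_ne_zero _ hx'.prod_ne_zero) (poleDenom_ne_zero c hx')
  · by_contra hne
    obtain ⟨x, hx, rfl⟩ := h0 S hne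
    obtain ⟨a, ha, ha'⟩ := mem_conf.1 m1
    obtain ⟨b, hb, hb'⟩ := mem_conf.1 m2
    obtain ⟨d, hd, hd'⟩ := mem_conf.1 m3
    dsimp only at *
    exact hne (h0' x hx (up x hx a b d (by rw [hb, ha]) (by rw [hd, hb]) (by rw [hb', ha']) (by rw [hd', hb'])))
  · by_contra hne
    obtain ⟨x, hx, rfl⟩ := h0 S hne
    obtain ⟨a, ha, ha'⟩ := mem_conf.1 m1
    obtain ⟨b, hb, hb'⟩ := mem_conf.1 m2
    obtain ⟨d, hd, hd'⟩ := mem_conf.1 m3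
    dsimp only at *
    exact hne (h0' x hx (down x hx a b d (by rw [hb, ha]) (by rw [hd, hb]) (by rw [hb', ha']) (by rw [hd', hb'])))
end Conf

/-! ### Functions of finite rank -/

/-- A function of finite rank is a finite sum of products of combinations of its sections. -/
lemma exists_sum_mul {α β : Type*} (A : Submodule ℂ (α → ℂ)) (B : Submodule ℂ (β → ℂ)) (n : ℕ)
    (V : Submodule ℂ (α → ℂ)) [FiniteDimensional ℂ V] (hn : Module.finrank ℂ V ≤ n) (H : α → β → ℂ)
    (hV : ∀ T, (fun S => H S T) ∈ V) (hA : ∀ T, (fun S => H S T) ∈ A) (hB : ∀ S, H S ∈ B) :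
    ∃ (r : ℕ) (a : Fin r → A) (b : Fin r → B), ∀ S T, H S T = ∑ i, (a i).1 S * (b i).1 T := by
  induction n generalizing V H with
  | zero =>
    refine ⟨0, Fin.elim0, Fin.elim0, fun S T => ?_⟩
    have : V = ⊥ := Submodule.finrank_eq_zero.1 (Nat.le_zero.1 hn)
    have h := hV T
    rw [this, Submodule.mem_bot] at h
    simpa using congrFun h S
  | succ n ih =>
    by_cases h0 : ∀ S T, H S T = 0
    · exact ⟨0, Fin.elim0, Fin.elim0, fun S T => by simp [h0]⟩
    push Not at h0
    obtain ⟨S₀, T₀, h0⟩ := h0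
    -- Subtracting the rank-one term through `(S₀, T₀)` makes all sections vanish at `S₀`, which
    -- lowers the dimension. The sections of the difference still lie in `A` and `B`.
    let V' : Submodule ℂ (α → ℂ) := V ⊓ LinearMap.ker (LinearMap.proj (R := ℂ) (φ := fun _ : α => ℂ) S₀)
    have hlt : V' < V := by
      refine lt_of_le_of_ne inf_le_left fun e => h0 ?_
      have := hV T₀
      rw [← e] at this
      exact this.2
    have : FiniteDimensional ℂ V' := Submodule.finiteDimensional_of_le hlt.le
    have hf := Submodule.finrank_lt_finrank_of_lt hlt
    have hV' : ∀ T, (fun S => H S T - H S T₀ * (H S₀ T₀)⁻¹ * H S₀ T) ∈ V' := fun T => by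
      refine ⟨?_, ?_⟩
      · change _ ∈ V
        convert V.sub_mem (hV T) (V.smul_mem ((H S₀ T₀)⁻¹ * H S₀ T) (hV T₀)) using 1
        funext S
        simp only [Pi.sub_apply, Pi.smul_apply, smul_eq_mul]
        ring
      · simp [h0]
    obtain ⟨r, a, b, hab⟩ := ih V' (by omega) (fun S T => H S T - H S T₀ * (H S₀ T₀)⁻¹ * H S₀ T) hV'
      (fun T => by
        convert A.sub_mem (hA T) (A.smul_mem ((H S₀ T₀)⁻¹ * H S₀ T) (hA T₀)) using 1
        funext S
        simp only [Pi.sub_apply, Pi.smul_apply, smul_eq_mul]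
        ring)
      (fun S => B.sub_mem (hB S) (B.smul_mem (H S T₀ * (H S₀ T₀)⁻¹) (hB S₀)))
    refine ⟨r + 1, Fin.cons ⟨_, A.smul_mem (H S₀ T₀)⁻¹ (hA T₀)⟩ a, Fin.cons ⟨_, hB S₀⟩ b, fun S T => ?_⟩
    rw [Fin.sum_univ_succ]
    simp only [Fin.cons_zero, Fin.cons_succ, ← hab, Pi.smul_apply, smul_eq_mul]
    ring

/-! ### The fused function: numerator, wheel conditions and symmetry -/

namespace FusionData
variable {m : ℕ} (D : FusionData m) {L K : ℕ}

lemma spl_coef_ne {l l' : Src m L K} (h : l ≠ l') (hv : l.var = l'.var) : D.coef l ≠ D.coef l' := by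
  obtain ⟨j, a | b⟩ := l
  · obtain ⟨i, hi⟩ : ∃ i, Src.var (j, (Sum.inl a : Fin L ⊕ Fin K)) = Sum.inl (i, a) := ⟨_, rfl⟩
    have h1 := Src.var_eq_inl hi
    have h2 := Src.var_eq_inl (hv.symm.trans hi)
    rcases h1 with h1 | ⟨rfl, h1⟩ <;> rcases h2 with h2 | ⟨h3, h2⟩
    · exact absurd (h1.trans h2.symm) h
    · subst h3
      rw [h1, h2]
      simp only [coef, Fin.castSucc_zero, Fin.val_zero, Fin.val_last, D.cy_zero, D.cy_last]
      exact fun e => q1_ne_one (inv_eq_one.1 e)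
    · rw [h1, h2]
      simp only [coef, Fin.castSucc_zero, Fin.val_zero, Fin.val_last, D.cy_zero, D.cy_last]
      exact fun e => q1_ne_one (inv_eq_one.1 e.symm)
    · exact absurd (h1.trans h2.symm) h
  · obtain ⟨j', a' | b'⟩ := l'
    · simp [Src.var] at hv
    · obtain rfl : b = b' := by simpa [Src.var] using hv
      exact fun e => h (by rw [Fin.ext (q3_pow_injective e)])

/-- A polynomial that vanishes at all points where the fusion is defined is zero. -/
lemma eq_zero_of_generic {P : MvPolynomial (Var m L K) ℂ}
    (h : ∀ w, D.Generic w → D.num w ≠ 0 → MvPolynomial.eval w P = 0) : P = 0 := by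
  classical
  -- The excluded hypersurfaces: vanishing or coinciding variables, coinciding specialized
  -- variables, and the factors of the numerator of the fusion factor.
  refine eq_zero_of_eval_of_ne (univ.image MvPolynomial.X ∪
    (univ : Finset (Var m L K)).offDiag.image (fun x => MvPolynomial.C 1 * MvPolynomial.X x.1 - MvPolynomial.C 1 * MvPolynomial.X x.2) ∪
    (univ : Finset (Src m L K)).offDiag.image (fun x => MvPolynomial.C (D.coef x.1) * MvPolynomial.X x.1.var -
      MvPolynomial.C (D.coef x.2) * MvPolynomial.X x.2.var) ∪ D.factors.image lin) id ?_ fun w hw => ?_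
  · intro Q hQ
    simp only [mem_union, mem_image, mem_offDiag, mem_univ, true_and] at hQ
    rcases hQ with ((⟨u, rfl⟩ | ⟨x, hx, rfl⟩) | ⟨x, hx, rfl⟩) | ⟨θ, hθ, rfl⟩
    · exact MvPolynomial.X_ne_zero u
    · exact two_term_ne_zero one_ne_zero fun e => absurd e hx
    · exact two_term_ne_zero (D.coef_ne _) (D.spl_coef_ne hx)
    · exact (prime_lin (D.mem_factors.1 hθ).1).ne_zero
  · simp only [mem_union, mem_image, mem_offDiag, mem_univ, true_and, id] at hw
    have h1 : ∀ u, w u ≠ 0 := fun u => by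
      simpa using hw _ (Or.inl (Or.inl (Or.inl ⟨u, rfl⟩)))
    have h2 : Function.Injective w := fun u v e => by
      by_contra hne
      exact hw _ (Or.inl (Or.inl (Or.inr ⟨(u, v), hne, rfl⟩))) (by simp [e])
    refine h w ⟨⟨⟨fun _ => h1 _, h2.comp Sum.inl_injective⟩, ⟨fun _ => h1 _, h2.comp Sum.inr_injective⟩⟩,
      ⟨fun l => mul_ne_zero (D.coef_ne l) (h1 _), fun l l' e => ?_⟩⟩ ?_
    · by_contra hne
      refine hw _ (Or.inl (Or.inr ⟨(l, l'), hne, rfl⟩)) ?_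
      simpa [sub_eq_zero, spl] using e
    · rw [← D.eval_prod_factors, map_prod, prod_ne_zero_iff]
      intro θ hθ
      rw [map_pow]
      exact pow_ne_zero _ (hw _ (Or.inr ⟨θ, hθ, rfl⟩))
end FusionData

section Points
variable {m L K : ℕ}

lemma Var.pts_eq (w : Var m L K → ℂ) :
    Var.pts w = (conf Prod.fst (w ∘ Sum.inl)).disjSum (conf (fun _ => 0) (w ∘ Sum.inr)) := by
  rw [← Var.toLeft_pts, ← Var.toRight_pts, toLeft_disjSum_toRight]

/-- Variables that form the same points differ by a permutation that preserves the colours. -/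
lemma exists_perm_of_pts_eq {w w' : Var m L K → ℂ} (hw' : Split w') (h : Var.pts w = Var.pts w') :
    ∃ σ : Equiv.Perm (Var m L K), w ∘ σ = w' ∧ ∀ v : Var m L K → ℂ, Var.pts (v ∘ σ) = Var.pts v ∧
      FusionData.poles (v ∘ σ) = FusionData.poles v ∧ (Split v → Split (v ∘ σ)) := by
  have hl := congrArg Finset.toLeft h
  have hr := congrArg Finset.toRight h
  rw [Var.toLeft_pts, Var.toLeft_pts] at hl
  rw [Var.toRight_pts, Var.toRight_pts] at hr
  obtain ⟨σ, h1, h2⟩ := exists_perm_of_conf_eq hw'.1 hl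
  obtain ⟨τ, h3, h4⟩ := exists_perm_of_conf_eq hw'.2 hr
  refine ⟨Equiv.sumCongr σ τ, ?_, fun v => ?_⟩
  · funext u
    rcases u with u | u
    · exact congrFun h2 u
    · exact congrFun h4 u
  · have e1 : (v ∘ Equiv.sumCongr σ τ) ∘ Sum.inl = (v ∘ Sum.inl) ∘ σ := rfl
    have e2 : (v ∘ Equiv.sumCongr σ τ) ∘ Sum.inr = (v ∘ Sum.inr) ∘ τ := rfl
    have c1 := conf_comp (c := Prod.fst) σ (v ∘ Sum.inl)
    have c2 := conf_comp (c := fun _ => (0 : Fin 1)) τ (v ∘ Sum.inr)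
    have c3 := poleDenom_comp (c := Prod.fst) σ (v ∘ Sum.inl)
    have c4 := poleDenom_comp (c := fun _ => (0 : Fin 1)) τ (v ∘ Sum.inr)
    rw [h1] at c1 c3
    rw [h3] at c2 c4
    refine ⟨?_, ?_, fun hv => ⟨hv.1.comp σ, hv.2.comp τ⟩⟩
    · rw [Var.pts_eq, Var.pts_eq, e1, e2, c1, c2]
    · rw [FusionData.poles, FusionData.poles, e1, e2, c3, c4]
end Points

/-- The vanishing conditions on the numerator of an element of the target. -/
structure TargetWheels {m : ℕ} (D : FusionData m) {L K : ℕ} (h : MvPolynomial (Var m L K) ℂ) : Prop where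
  inl_up : ∀ w : Var m L K → ℂ, (∀ u, w u ≠ 0) → ∀ a b b' : Fin (m + 1) × Fin L,
    b.1 = finRotate (m + 1) a.1 → b'.1 = b.1 → w (Sum.inl b) = D.pt.q3 * w (Sum.inl a) →
    w (Sum.inl b') = D.pt.q2 * w (Sum.inl b) → MvPolynomial.eval w h = 0
  inl_down : ∀ w : Var m L K → ℂ, (∀ u, w u ≠ 0) → ∀ a b b' : Fin (m + 1) × Fin L,
    b.1 = a.1 → b'.1 = finRotate (m + 1) b.1 → w (Sum.inl b) = D.pt.q2 * w (Sum.inl a) →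
    w (Sum.inl b') = D.pt.q3 * w (Sum.inl b) → MvPolynomial.eval w h = 0
  inr_up : ∀ w : Var m L K → ℂ, (∀ u, w u ≠ 0) → ∀ a b b' : Fin K, w (Sum.inr b) = D.pf.q3 * w (Sum.inr a) →
    w (Sum.inr b') = D.pf.q2 * w (Sum.inr b) → MvPolynomial.eval w h = 0
  inr_down : ∀ w : Var m L K → ℂ, (∀ u, w u ≠ 0) → ∀ a b b' : Fin K, w (Sum.inr b) = D.pf.q2 * w (Sum.inr a) →
    w (Sum.inr b') = D.pf.q3 * w (Sum.inr b) → MvPolynomial.eval w h = 0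

lemma TargetWheels.mul_right {m : ℕ} {D : FusionData m} {L K : ℕ} {h : MvPolynomial (Var m L K) ℂ}
    (hh : TargetWheels D h) (Q : MvPolynomial (Var m L K) ℂ) : TargetWheels D (h * Q) := by
  refine ⟨fun w hw a b b' h1 h2 h3 h4 => ?_, fun w hw a b b' h1 h2 h3 h4 => ?_,
    fun w hw a b b' h1 h2 => ?_, fun w hw a b b' h1 h2 => ?_⟩ <;> rw [map_mul]
  · rw [hh.inl_up w hw a b b' h1 h2 h3 h4, zero_mul]
  · rw [hh.inl_down w hw a b b' h1 h2 h3 h4, zero_mul]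
  · rw [hh.inr_up w hw a b b' h1 h2, zero_mul]
  · rw [hh.inr_down w hw a b b' h1 h2, zero_mul]

namespace FusionData
variable {m : ℕ} {D : FusionData m} {L K : ℕ}

lemma q2_ne_one : D.p.q2 ≠ 1 := fun e => by
  have := D.pow_eq (a := 0) (b := 1) (c := 0) (e := 0) (by simp [e]); omega

/-- `pt.q3` involves the root `t`. Its power of exponent `m + 1` is a monomial in `q₁` and `q₂`, and
it is there that genericity applies. -/
lemma pt_q3_pow : D.pt.q3 ^ (m + 1) = D.p.q1 ^ (-(m + 2) : ℤ) * D.p.q2 ^ (-(m + 1) : ℤ) := by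
  have h1 := D.p.q1_ne
  rw [D.pt_q3, mul_pow, inv_pow, D.root, q3_pow, show (-(m + 2) : ℤ) = -(m + 1) - 1 by ring, zpow_sub_one₀ h1]
  push_cast
  ring

lemma pt_q3_ne_one : D.pt.q3 ≠ 1 := fun e => by
  have := D.pow_eq (a := 0) (b := 0) (c := -(m + 2)) (e := -(m + 1)) (by rw [← pt_q3_pow, e]; simp)
  omega

lemma q2_mul_pt_q3_ne_one : D.p.q2 * D.pt.q3 ≠ 1 := fun e => by
  have h2 := D.p.q2_ne
  have h3 : (D.p.q2 * D.pt.q3) ^ (m + 1) = D.p.q1 ^ (-(m + 2) : ℤ) * D.p.q2 ^ (0 : ℤ) := by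
    rw [mul_pow, pt_q3_pow, mul_left_comm, ← zpow_natCast D.p.q2 (m + 1), ← zpow_add₀ h2]
    congr 2
    push_cast; ring
  have := D.pow_eq (a := 0) (b := 0) (c := -(m + 2)) (e := 0) (by rw [← h3, e]; simp)
  omega

lemma q3_pow_ne_one : D.p.q3 ^ (m + 2) ≠ 1 := fun e => by
  have := q3_pow_injective (D := D) (j := m + 2) (k := 0) (by rw [e, pow_zero])
  omega

lemma q2_mul_q3_pow_ne_one : D.p.q2 * D.p.q3 ^ (m + 2) ≠ 1 := fun e => by
  rw [D.q3_pow, mul_left_comm, ← zpow_one_add₀ D.p.q2_ne] at e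
  have := D.pow_eq (c := 0) (e := 0) (by rw [e]; simp)
  omega

/-- The four wheel lemmas need different variables on the wheel. A repeated variable would have
ratio `q₂`, the relevant `q₃`, or their product to itself, and none of these is `1`. -/
lemma targetWheels {P : MvPolynomial (Src m L K) ℂ} {h : MvPolynomial (Var m L K) ℂ} (hP : WheelConditions D.p P)
    (hh : monoSubst Src.var D.coef P = (∏ θ ∈ D.factors, lin θ ^ factorMult θ) * h) : TargetWheels D h := by
  have h2 := D.p.q2_ne
  have key : ∀ (c s : ℂ), c ≠ 1 → s ≠ 0 → s ≠ c * s := fun c s hc hs e => by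
    refine hc (mul_right_cancel₀ hs ?_)
    rw [← e, one_mul]
  refine ⟨?_, ?_, fun w hw a b b' hb hc => ?_, fun w hw a b b' hb hc => ?_⟩
  · rintro w hw ⟨i, a⟩ ⟨j, b⟩ ⟨j', c⟩ (rfl : j = _) rfl hb hc
    rw [D.pt_q2] at hc
    refine wheel_inl_up hP hh (i := i) (a := a) (b := b) (c := c) rfl ?_ ?_ ?_ w hb hc
    · intro e
      rw [← e] at hb
      exact key _ _ pt_q3_ne_one (hw _) hb
    · intro e
      rw [← e, hb, ← mul_assoc] at hc
      exact key _ _ q2_mul_pt_q3_ne_one (hw _) hc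
    · rintro rfl
      exact key _ _ q2_ne_one (hw _) hc
  · rintro w hw ⟨i, a⟩ ⟨j', b⟩ ⟨j, c⟩ rfl (rfl : j = _) hb hc
    rw [D.pt_q2] at hb
    refine wheel_inl_down hP hh (i := j') (a := a) (b := b) (c := c) rfl ?_ ?_ ?_ w hb hc
    · rintro rfl
      exact key _ _ q2_ne_one (hw _) hb
    · intro e
      rw [← e, hb, ← mul_assoc, mul_comm D.pt.q3] at hc
      exact key _ _ q2_mul_pt_q3_ne_one (hw _) hc
    · intro e
      rw [← e] at hc
      exact key _ _ pt_q3_ne_one (hw _) hc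
  · rw [D.pf_q2] at hc
    rw [D.pf_q3] at hb
    refine wheel_inr_up hP hh ?_ ?_ ?_ w hb hc
    · rintro rfl
      exact key _ _ q3_pow_ne_one (hw _) hb
    · rintro rfl
      rw [hb, ← mul_assoc] at hc
      exact key _ _ q2_mul_q3_pow_ne_one (hw _) hc
    · rintro rfl
      exact key _ _ q2_ne_one (hw _) hc
  · rw [D.pf_q2] at hb
    rw [D.pf_q3] at hc
    refine wheel_inr_down hP hh ?_ ?_ ?_ w hb hc
    · rintro rfl
      exact key _ _ q2_ne_one (hw _) hb
    · rintro rfl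
      rw [hb, ← mul_assoc, mul_comm (D.p.q3 ^ _)] at hc
      exact key _ _ q2_mul_q3_pow_ne_one (hw _) hc
    · rintro rfl
      exact key _ _ q3_pow_ne_one (hw _) hc

lemma root_ne_zero {θ : Var m L K × Var m L K × ℂ} (hθ : θ ∈ D.factors) : θ.2.2 ≠ 0 := by
  have h1 := D.p.q1_ne
  have h2 := D.p.q2_ne
  have h3 := D.p.q3_ne
  obtain ⟨u, v, γ⟩ := θ
  have hr := (D.mem_factors.1 hθ).2
  rcases u with ⟨i, a⟩ | b <;> rcases v with ⟨i', a'⟩ | b'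
  · rw [(root_inl hθ).1]; exact h2
  · simp only [roots] at hr
    have := D.cy_ne i
    split_ifs at hr <;> simp only [mem_insert, mem_singleton] at hr
    · rcases hr with rfl | rfl | rfl | rfl <;> positivity
    · rcases hr with rfl | rfl <;> positivity
  · simp [roots] at hr
  · rw [root_inr hθ]; exact h2

/-- Forms joining the same two variables in both orders occur only between two `y` of colour `0` or
between two `z`. Both then have the root `q₂`, and `q₂² ≠ 1`, so different forms are not associated.
-/
lemma exists_quotient {P : MvPolynomial (Src m L K) ℂ} (hP : WheelConditions D.p P) :
    ∃ h, monoSubst Src.var D.coef P = (∏ θ ∈ D.factors, lin θ ^ factorMult θ) * h := by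
  refine lin_prod_dvd D.factors factorMult (fun θ hθ => (D.mem_factors.1 hθ).1) (fun θ hθ => root_ne_zero hθ) ?_
    fun θ hθ => lin_pow_dvd_spl hP hθ
  rintro ⟨u, v, γ⟩ hθ ⟨u', v', γ'⟩ hη e1 e2
  obtain rfl : u' = v := e1
  obtain rfl : v' = u := e2
  rcases u' with ⟨i, a⟩ | b <;> rcases v' with ⟨i', a'⟩ | b'
  · rw [show γ = D.p.q2 from (root_inl hθ).1, show γ' = D.p.q2 from (root_inl hη).1]
    exact D.q2_mul_q2_ne
  · have := (D.mem_factors.1 hθ).2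
    simp [roots] at this
  · have := (D.mem_factors.1 hη).2
    simp [roots] at this
  · rw [show γ = D.p.q2 from root_inr hθ, show γ' = D.p.q2 from root_inr hη]
    exact D.q2_mul_q2_ne

/-- The source numerator is `num * h`, and `psi` times the source poles is a monomial times `num`
times the target poles. The factor `num` cancels, and the inverse of the monomial is absorbed into
the numerator and the power of the variables. -/
lemma exists_fused_numerator {N : ℕ} {F : Sh0 (m + 2) D.p} (hF : F ∈ Sh0.deg (m + 2) D.p N) (L K : ℕ) :
    ∃ (h : MvPolynomial (Var m L K) ℂ) (k : ℕ), TargetWheels D h ∧ ∀ w, D.Generic w →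
      Sh0.ev (D.spec (Var.pts w)) F * ((∏ u, w u) ^ k * poles w) = D.psi (Var.pts w) * MvPolynomial.eval w h := by
  obtain ⟨P, k, hP, hW⟩ := exists_numerator (p := D.p) D.generic (show F.1 ∈ Sh D.p fun _ => N from hF) (Fin L ⊕ Fin K)
  obtain ⟨h, hh⟩ := exists_quotient (L := L) (K := K) hW
  obtain ⟨μ, hμ, hψ⟩ := D.exists_psi_mul_poleDenom (L := L) (K := K)
  have hmon : IsMonomial fun w : Var m L K → ℂ => (∏ l, D.spl w l) ^ k * μ w :=
    ((IsMonomial.prod univ fun l _ => (IsMonomial.const (D.coef_ne l)).mul (IsMonomial.coord _)).pow k).mul hμ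
  obtain ⟨Q, k', hQ⟩ := hmon.exists_inv
  refine ⟨h * Q, k', (targetWheels hW hh).mul_right Q, fun w hw => ?_⟩
  have h1 := hP _ hw.2
  have h2 := congrArg (MvPolynomial.eval w) hh
  rw [eval_monoSubst, map_mul, eval_prod_factors] at h2
  change MvPolynomial.eval (D.spl w) P = _ at h2
  rw [h2, conf_spl] at h1
  have h3 := hψ w hw
  have h4 := poleDenom_ne_zero Prod.fst hw.2
  have h5 := hQ w
  refine mul_right_cancel₀ h4 ?_
  change F.1 _ * _ * _ = _
  rw [map_mul]
  linear_combination (μ w * poles w * MvPolynomial.eval w Q) * h1 -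
    (F.1 (D.spec (Var.pts w)) * poleDenom Prod.fst (D.spl w) * poles w) * h5 - (MvPolynomial.eval w h * MvPolynomial.eval w Q) * h3

lemma distinct_spl_of_good {w : Var m L K → ℂ} (h : Split w) (hg : D.Good (Var.pts w)) : Distinct (D.spl w) := by
  have hmem : ∀ l, (l.1, D.spl w l) ∈ D.fib (Var.pt w l.var) := fun l => D.mem_fib_pt.2 ⟨l, rfl, rfl⟩
  have hpt : ∀ u, Var.pt w u ∈ Var.pts w := fun u => mem_image_of_mem _ (mem_univ u)
  refine ⟨fun l => mul_ne_zero (D.coef_ne l) (h.ne_zero _), fun l l' e => ?_⟩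
  have h1 := hg.admissible_spec.2 (mem_coe.2 (mem_spec.2 ⟨_, hpt _, hmem l⟩)) (mem_coe.2 (mem_spec.2 ⟨_, hpt _, hmem l'⟩)) e
  have h2 := h.pt_injective (hg.eq (hpt _) (hpt _) (hmem l) (h1 ▸ hmem l'))
  by_contra hne
  refine D.spl_coef_ne hne h2 (mul_right_cancel₀ (h.ne_zero l.var) ?_)
  rw [spl, spl, ← h2] at e
  exact e

lemma psi_ne_zero {w : Var m L K → ℂ} (hw : D.Generic w) (h0 : D.num w ≠ 0) : D.psi (Var.pts w) ≠ 0 := by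
  obtain ⟨μ, hμ, hψ⟩ := D.exists_psi_mul_poleDenom (L := L) (K := K)
  intro e
  have h1 := hψ w hw
  rw [e, zero_mul, eq_comm] at h1
  exact mul_ne_zero (mul_ne_zero (hμ.ne_zero hw.1.ne_zero) h0)
    (mul_ne_zero (poleDenom_ne_zero _ hw.1.1) (poleDenom_ne_zero _ hw.1.2)) h1

/-- The fused function is symmetric. -/
lemma fused_symm {F : Sh0 (m + 2) D.p} {h : MvPolynomial (Var m L K) ℂ} {k : ℕ} (hF : ∀ w, D.Generic w →
      Sh0.ev (D.spec (Var.pts w)) F * ((∏ u, w u) ^ k * poles w) = D.psi (Var.pts w) * MvPolynomial.eval w h)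
    {w w' : Var m L K → ℂ} (hw' : Split w') (e : Var.pts w = Var.pts w') :
    MvPolynomial.eval w h / ((∏ u, w u) ^ k * poles w) = MvPolynomial.eval w' h / ((∏ u, w' u) ^ k * poles w') := by
  obtain ⟨σ, rfl, hσ⟩ := exists_perm_of_pts_eq hw' e
  -- `psi` and `spec` depend only on the set of points, so `h` is invariant under `σ` at generic
  -- points and hence as a polynomial. This gives symmetry also where `psi` vanishes.
  have h1 : MvPolynomial.rename σ h - h = 0 := by
    refine D.eq_zero_of_generic fun v hv hv0 => ?_
    obtain ⟨e1, e2, e3⟩ := hσ v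
    have hg : D.Generic (v ∘ σ) := by
      refine ⟨e3 hv.1, distinct_spl_of_good (e3 hv.1) ?_⟩
      rw [e1]
      exact D.good_pts hv.1 hv.2
    have h3 := hF _ hg
    rw [e1, e2, show ∏ u, (v ∘ σ) u = ∏ u, v u from Equiv.prod_comp σ v, hF v hv] at h3
    rw [map_sub, MvPolynomial.eval_rename, ← mul_left_cancel₀ (psi_ne_zero hv hv0) h3, sub_self]
  have h2 := congrArg (MvPolynomial.eval w) (sub_eq_zero.1 h1)
  rw [MvPolynomial.eval_rename] at h2
  rw [h2, (hσ w).2.1, show ∏ u, (w ∘ σ) u = ∏ u, w u from Equiv.prod_comp σ w]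
end FusionData

/-! ### From the fused function to an element of the tensor product -/

lemma eval_aeval_mv {ι κ : Type} (f : MvPolynomial ι ℂ) (φ : ι → MvPolynomial κ ℂ) (y : κ → ℂ) :
    MvPolynomial.eval y (MvPolynomial.aeval φ f) = MvPolynomial.eval (fun l => MvPolynomial.eval y (φ l)) f := by
  have : (MvPolynomial.aeval y : MvPolynomial κ ℂ →ₐ[ℂ] ℂ).comp (MvPolynomial.aeval φ) =
      MvPolynomial.aeval (fun l => MvPolynomial.eval y (φ l)) := by
    ext l; simp
  simpa [MvPolynomial.coe_aeval_eq_eval] using DFunLike.congr_fun this f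

/-- The values at all configurations, as a linear map. -/
def ShFun.values {n : ℕ} {p : Params} : ShFun n p →ₗ[ℂ] (Finset (Fin n × ℂ) → ℂ) where
  toFun F := F.toFun
  map_add' _ _ := rfl
  map_smul' _ _ := rfl

section Enum
variable {ι : Type} [Fintype ι] {n : ℕ} (c : ι → Fin n)

/-- `S` consists of distinct variables of the colours `c`. -/
def IsConf (S : Finset (Fin n × ℂ)) : Prop := ∃ x : ι → ℂ, Distinct x ∧ conf c x = S

open Classical in
/-- An enumeration of a configuration. -/
def enum (S : Finset (Fin n × ℂ)) : ι → ℂ := if h : IsConf c S then h.choose else 0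

variable {c}
lemma IsConf.distinct_enum {S : Finset (Fin n × ℂ)} (h : IsConf c S) : Distinct (enum c S) := by
  rw [enum, dif_pos h]; exact h.choose_spec.1

lemma IsConf.conf_enum {S : Finset (Fin n × ℂ)} (h : IsConf c S) : conf c (enum c S) = S := by
  rw [enum, dif_pos h]; exact h.choose_spec.2

lemma Distinct.isConf {x : ι → ℂ} (hx : Distinct x) : IsConf c (conf c x) := ⟨x, hx, rfl⟩

lemma IsConf.admissible {S : Finset (Fin n × ℂ)} (h : IsConf c S) : Admissible S := by
  obtain ⟨x, hx, rfl⟩ := h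
  exact hx.admissible c
end Enum

namespace FusionData
variable {m : ℕ} {D : FusionData m} {L K : ℕ}

/-- The rational function with the numerator `h`. -/
def frac (h : MvPolynomial (Var m L K) ℂ) (k : ℕ) (w : Var m L K → ℂ) : ℂ :=
  MvPolynomial.eval w h / ((∏ u, w u) ^ k * poles w)

open Classical in
/-- The function of pairs of configurations with the numerator `h`. -/
def value (h : MvPolynomial (Var m L K) ℂ) (k : ℕ) (S : Finset (Fin (m + 1) × ℂ)) (T : Finset (Fin 1 × ℂ)) : ℂ :=
  if IsConf (Prod.fst : Fin (m + 1) × Fin L → Fin (m + 1)) S ∧ IsConf (fun _ : Fin K => (0 : Fin 1)) T then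
    frac h k (Sum.elim (enum Prod.fst S) (enum (fun _ => 0) T)) else 0

lemma isConf_of_value_ne_zero {h : MvPolynomial (Var m L K) ℂ} {k : ℕ} {S : Finset (Fin (m + 1) × ℂ)}
    {T : Finset (Fin 1 × ℂ)} (h0 : value h k S T ≠ 0) :
    IsConf (Prod.fst : Fin (m + 1) × Fin L → Fin (m + 1)) S ∧ IsConf (fun _ : Fin K => (0 : Fin 1)) T := by
  by_contra hne
  exact h0 (if_neg hne)

/-- Symmetry in the variables of each colour. -/
def Symm (h : MvPolynomial (Var m L K) ℂ) (k : ℕ) : Prop :=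
  ∀ w w', Split w → Split w' → Var.pts w = Var.pts w' → frac h k w = frac h k w'

lemma Symm.value_eq {h : MvPolynomial (Var m L K) ℂ} {k : ℕ} (hs : Symm h k) {y : Fin (m + 1) × Fin L → ℂ}
    {z : Fin K → ℂ} (hy : Distinct y) (hz : Distinct z) :
    value h k (conf Prod.fst y) (conf (fun _ => 0) z) = frac h k (Sum.elim y z) := by
  have h1 : IsConf Prod.fst (conf Prod.fst y) := hy.isConf
  have h2 : IsConf (fun _ => (0 : Fin 1)) (conf (fun _ => 0) z) := hz.isConf
  rw [value, if_pos ⟨h1, h2⟩]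
  refine hs _ _ ⟨h1.distinct_enum, h2.distinct_enum⟩ ⟨hy, hz⟩ ?_
  rw [Var.pts_eq, Var.pts_eq]
  simp only [Sum.elim_comp_inl, Sum.elim_comp_inr]
  rw [h1.conf_enum, h2.conf_enum]

lemma frac_elim_mul {h : MvPolynomial (Var m L K) ℂ} {k : ℕ} {y : Fin (m + 1) × Fin L → ℂ}
    {z : Fin K → ℂ} (hy : Distinct y) : frac h k (Sum.elim y z) * ((∏ l, y l) ^ k * poleDenom Prod.fst y) =
      ((∏ l, z l) ^ k * poleDenom (fun _ => (0 : Fin 1)) z)⁻¹ * MvPolynomial.eval (Sum.elim y z) h := by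
  have h1 := hy.prod_ne_zero
  have h2 := poleDenom_ne_zero Prod.fst hy
  rw [frac, poles, Fintype.prod_sum_type, mul_pow]
  simp only [Sum.elim_comp_inl, Sum.elim_comp_inr, Sum.elim_inl, Sum.elim_inr]
  generalize (∏ l, y l) = A at *
  generalize poleDenom Prod.fst y = B at *
  field_simp

lemma frac_elim_mul' {h : MvPolynomial (Var m L K) ℂ} {k : ℕ} {y : Fin (m + 1) × Fin L → ℂ}
    {z : Fin K → ℂ} (hz : Distinct z) :
    frac h k (Sum.elim y z) * ((∏ l, z l) ^ k * poleDenom (fun _ => (0 : Fin 1)) z) =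
      ((∏ l, y l) ^ k * poleDenom Prod.fst y)⁻¹ * MvPolynomial.eval (Sum.elim y z) h := by
  have h1 := hz.prod_ne_zero
  have h2 := poleDenom_ne_zero (fun _ => (0 : Fin 1)) hz
  rw [frac, poles, Fintype.prod_sum_type, mul_pow]
  simp only [Sum.elim_comp_inl, Sum.elim_comp_inr, Sum.elim_inl, Sum.elim_inr]
  generalize (∏ l, z l) = A at *
  generalize poleDenom (fun _ => (0 : Fin 1)) z = B at *
  field_simp

lemma elim_ne_zero {y : Fin (m + 1) × Fin L → ℂ} {z : Fin K → ℂ} (hy : Distinct y) (hz : Distinct z)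
    (u : Var m L K) : (Sum.elim y z : Var m L K → ℂ) u ≠ 0 := by
  rcases u with u | u
  · exact hy.1 u
  · exact hz.1 u

/-- Fixing `z` leaves a numerator in `y` alone, and the wheel conditions of `h` in the variables `y`
become those of the section. -/
lemma value_left_mem {h : MvPolynomial (Var m L K) ℂ} {k : ℕ} (hW : TargetWheels D h) (hs : Symm h k)
    (T : Finset (Fin 1 × ℂ)) :
    (fun S => value h k S T) ∈ (Sh D.pt fun _ : Fin (m + 1) => L).map ShFun.values := by
  by_cases hT : IsConf (fun _ : Fin K => (0 : Fin 1)) T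
  swap
  · refine ⟨0, Submodule.zero_mem _, funext fun S => ?_⟩
    rw [value, if_neg fun e => hT e.2]
    rfl
  obtain ⟨z, hz, rfl⟩ := hT
  refine ⟨⟨fun S => value h k S (conf (fun _ => 0) z), fun S hS => if_neg fun e => hS e.1.admissible⟩, ?_, rfl⟩
  have ev : ∀ y, MvPolynomial.eval y (MvPolynomial.aeval (Sum.elim MvPolynomial.X (MvPolynomial.C ∘ z)) h) =
      MvPolynomial.eval (Sum.elim y z) h := fun y => by
    rw [eval_aeval_mv]
    congr 2
    funext u
    rcases u with u | u <;> simp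
  refine mem_Sh_of_equiv (ι := Fin (m + 1) × Fin L) (c := Prod.fst) (Equiv.sigmaEquivProd _ _) (fun _ => rfl)
    (fun S hS => (isConf_of_value_ne_zero hS).1)
    (f := MvPolynomial.C (((∏ l, z l) ^ k * poleDenom (fun _ => (0 : Fin 1)) z)⁻¹) *
      MvPolynomial.aeval (Sum.elim MvPolynomial.X (MvPolynomial.C ∘ z)) h) (k := k) (fun y hy => ?_)
    (fun y hy a b b' h1 h2 h3 h4 => ?_) (fun y hy a b b' h1 h2 h3 h4 => ?_)
  · rw [map_mul, MvPolynomial.eval_C, ev, ← frac_elim_mul hy, ← hs.value_eq hy hz]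
    rfl
  · rw [map_mul, ev, hW.inl_up _ (elim_ne_zero hy hz) a b b' h1 h2 h3 h4, mul_zero]
  · rw [map_mul, ev, hW.inl_down _ (elim_ne_zero hy hz) a b b' h1 h2 h3 h4, mul_zero]

lemma value_right_mem {h : MvPolynomial (Var m L K) ℂ} {k : ℕ} (hW : TargetWheels D h) (hs : Symm h k)
    (S : Finset (Fin (m + 1) × ℂ)) : value h k S ∈ (Sh D.pf fun _ : Fin 1 => K).map ShFun.values := by
  by_cases hS : IsConf (Prod.fst : Fin (m + 1) × Fin L → Fin (m + 1)) S
  swap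
  · refine ⟨0, Submodule.zero_mem _, funext fun T => ?_⟩
    rw [value, if_neg fun e => hS e.1]
    rfl
  obtain ⟨y, hy, rfl⟩ := hS
  refine ⟨⟨fun T => value h k (conf Prod.fst y) T, fun T hT => if_neg fun e => hT e.2.admissible⟩, ?_, rfl⟩
  have ev : ∀ z, MvPolynomial.eval z (MvPolynomial.aeval (Sum.elim (MvPolynomial.C ∘ y) MvPolynomial.X) h) =
      MvPolynomial.eval (Sum.elim y z) h := fun z => by
    rw [eval_aeval_mv]
    congr 2
    funext u
    rcases u with u | u <;> simp
  refine mem_Sh_of_equiv (ι := Fin K) (c := fun _ => 0) ((Equiv.sigmaEquivProd _ _).trans (Equiv.uniqueProd _ _))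
    (fun _ => Subsingleton.elim _ _) (fun T hT => (isConf_of_value_ne_zero hT).2)
    (f := MvPolynomial.C (((∏ l, y l) ^ k * poleDenom Prod.fst y)⁻¹) *
      MvPolynomial.aeval (Sum.elim (MvPolynomial.C ∘ y) MvPolynomial.X) h) (k := k) (fun z hz => ?_)
    (fun z hz a b b' _ _ h3 h4 => ?_) (fun z hz a b b' _ _ h3 h4 => ?_)
  · rw [map_mul, MvPolynomial.eval_C, ev, ← frac_elim_mul' hz, ← hs.value_eq hy hz]
    rfl
  · rw [map_mul, ev, hW.inr_up _ (elim_ne_zero hy hz) a b b' h3 h4, mul_zero]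
  · rw [map_mul, ev, hW.inr_down _ (elim_ne_zero hy hz) a b b' h3 h4, mul_zero]

/-- Each monomial of `h` separates the variables `y` and `z`, so the function has finite rank.
Single monomials need be neither symmetric nor zero on wheels; the sections are, and
`exists_sum_mul` uses these instead. -/
lemma exists_tensor {h : MvPolynomial (Var m L K) ℂ} {k : ℕ} (hW : TargetWheels D h) (hs : Symm h k) :
    ∃ t ∈ tensorDeg (m + 1) D.pt D.pf (L + K), ∀ S T, evTensor S T t = value h k S T := by
  classical
  let e : (Var m L K →₀ ℕ) → Finset (Fin (m + 1) × ℂ) → ℂ := fun d S =>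
    if IsConf (Prod.fst : Fin (m + 1) × Fin L → Fin (m + 1)) S then
      (∏ u, enum Prod.fst S u ^ d (Sum.inl u)) /
        ((∏ u : Fin (m + 1) × Fin L, enum Prod.fst S u) ^ k * poleDenom (Prod.fst : Fin (m + 1) × Fin L → Fin (m + 1)) (enum Prod.fst S))
      else 0
  let f : (Var m L K →₀ ℕ) → Finset (Fin 1 × ℂ) → ℂ := fun d T =>
    if IsConf (fun _ : Fin K => (0 : Fin 1)) T then
      h.coeff d * (∏ u, enum (fun _ => 0) T u ^ d (Sum.inr u)) /
        ((∏ u : Fin K, enum (fun _ => 0) T u) ^ k * poleDenom (fun _ : Fin K => (0 : Fin 1)) (enum (fun _ => 0) T))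
      else 0
  have hef : ∀ S T, value h k S T = ∑ d ∈ h.support, e d S * f d T := by
    intro S T
    by_cases hS : IsConf (Prod.fst : Fin (m + 1) × Fin L → Fin (m + 1)) S
    · by_cases hT : IsConf (fun _ : Fin K => (0 : Fin 1)) T
      · simp only [value, e, f, if_pos hS, if_pos hT, if_pos (And.intro hS hT)]
        rw [frac, MvPolynomial.eval_eq', poles, Fintype.prod_sum_type, sum_div]
        refine sum_congr rfl fun d _ => ?_
        simp only [Sum.elim_comp_inl, Sum.elim_comp_inr, Sum.elim_inl, Sum.elim_inr, Fintype.prod_sum_type]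
        rw [div_mul_div_comm]
        congr 1 <;> ring
      · simp [value, f, hT]
    · simp [value, e, hS]
  let V : Submodule ℂ (Finset (Fin (m + 1) × ℂ) → ℂ) := Submodule.span ℂ (h.support.image e : Finset _)
  have hV : ∀ T, (fun S => value h k S T) ∈ V := fun T => by
    have : (fun S => value h k S T) = ∑ d ∈ h.support, f d T • e d := by
      funext S
      rw [hef, Finset.sum_apply]
      exact sum_congr rfl fun d _ => mul_comm _ _
    rw [this]
    exact Submodule.sum_mem _ fun d hd => Submodule.smul_mem _ _ (Submodule.subset_span (mem_coe.2 (mem_image_of_mem _ hd)))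
  have : FiniteDimensional ℂ V := FiniteDimensional.span_finset ℂ _
  obtain ⟨r, a, b, hab⟩ := exists_sum_mul _ _ _ V le_rfl (value h k) hV (value_left_mem hW hs) (value_right_mem hW hs)
  choose A hA hA' using fun i => (a i).2
  choose B hB hB' using fun i => (b i).2
  refine ⟨∑ i, (⟨A i, Submodule.mem_iSup_of_mem L (hA i)⟩ : Sh0 (m + 1) D.pt) ⊗ₜ[ℂ]
    (⟨B i, Submodule.mem_iSup_of_mem K (hB i)⟩ : Sh0 1 D.pf),
    Submodule.sum_mem _ fun i _ => Submodule.subset_span ⟨L, K, rfl, _, hA i, _, hB i, rfl⟩, fun S T => ?_⟩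
  rw [map_sum, hab]
  refine sum_congr rfl fun i _ => ?_
  rw [evTensor_tmul, ← hA' i, ← hB' i]
  rfl
end FusionData

/-! ### Existence of the fusion in each degree -/

lemma isConf_of_card {ι : Type} [Fintype ι] {n : ℕ} {c : ι → Fin n} {S : Finset (Fin n × ℂ)} (hS : Admissible S)
    (h : ∀ i, Fintype.card {l // c l = i} = (S.filter fun u => u.1 = i).card) : IsConf c S := by
  have h1 : ∀ i, Nonempty ({l // c l = i} ≃ {u : S // u.1.1 = i}) := fun i => by
    refine Fintype.card_eq.1 ((h i).trans ?_)
    rw [← Fintype.card_coe]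
    refine Fintype.card_congr ⟨fun u => ⟨⟨u.1, (mem_filter.1 u.2).1⟩, (mem_filter.1 u.2).2⟩,
      fun u => ⟨u.1.1, mem_filter.2 ⟨u.1.2, u.2⟩⟩, fun _ => rfl, fun _ => rfl⟩
  let e : ι ≃ S := (Equiv.sigmaFiberEquiv c).symm.trans ((Equiv.sigmaCongrRight fun i => (h1 i).some).trans
    (Equiv.sigmaFiberEquiv fun u : S => u.1.1))
  have he : ∀ l, (e l).1.1 = c l := fun l => ((h1 (c l)).some ⟨l, rfl⟩).2
  refine ⟨fun l => (e l).1.2, ⟨fun l => hS.1 _ (e l).2, fun l l' hl => ?_⟩, ?_⟩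
  · exact e.injective (Subtype.ext (hS.2 (e l).2 (e l').2 hl))
  · ext u
    rw [mem_conf]
    constructor
    · rintro ⟨l, h2, h3⟩
      have : u = (e l).1 := Prod.ext (by rw [he, h2]) h3.symm
      rw [this]
      exact (e l).2
    · intro hu
      refine ⟨e.symm ⟨u, hu⟩, ?_, ?_⟩
      · rw [← he, e.apply_symm_apply]
      · rw [e.apply_symm_apply]

namespace FusionData
variable {m : ℕ} {D : FusionData m} {L K : ℕ}

lemma card_filter_fib_inl (i : Fin (m + 1)) (y : ℂ) (j : Fin (m + 2)) :
    ((D.fib (Sum.inl (i, y))).filter fun u => u.1 = j).card = if i = Fin.ofNat (m + 1) j then 1 else 0 := by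
  classical
  induction j using Fin.lastCases with
  | last =>
    rw [ofNat_last]
    by_cases hi : i = 0
    · have : (D.fib (Sum.inl (i, y))).filter (fun u => u.1 = Fin.last (m + 1)) = {(Fin.last (m + 1), y)} := by
        ext u
        simp only [fib, if_pos hi, mem_filter, mem_insert, mem_singleton]
        constructor
        · rintro ⟨rfl | rfl, h⟩
          · exact absurd h (Fin.castSucc_lt_last i).ne
          · rfl
        · rintro rfl; exact ⟨Or.inr rfl, rfl⟩
      rw [this, if_pos hi, card_singleton]
    · rw [if_neg hi, card_eq_zero, filter_eq_empty_iff]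
      intro u hu
      simp only [fib, if_neg hi, mem_insert, notMem_empty, or_false] at hu
      subst hu
      exact (Fin.castSucc_lt_last i).ne
  | cast j =>
    rw [ofNat_castSucc]
    by_cases hi : i = j
    · subst hi
      have : (D.fib (Sum.inl (i, y))).filter (fun u => u.1 = i.castSucc) = {(i.castSucc, D.cy i * y)} := by
        ext u
        simp only [fib, mem_filter, mem_insert, mem_singleton]
        constructor
        · rintro ⟨rfl | hu, h⟩
          · rfl
          · split_ifs at hu
            · obtain rfl := mem_singleton.1 hu
              exact absurd h.symm (Fin.castSucc_lt_last i).ne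
            · simp at hu
        · rintro rfl; exact ⟨Or.inl rfl, rfl⟩
      rw [this, if_pos rfl, card_singleton]
    · rw [if_neg hi, card_eq_zero, filter_eq_empty_iff]
      intro u hu e
      simp only [fib, mem_insert] at hu
      rcases hu with rfl | hu
      · exact hi (Fin.castSucc_injective _ e)
      · split_ifs at hu
        · obtain rfl := mem_singleton.1 hu
          exact (Fin.castSucc_lt_last j).ne e.symm
        · simp at hu

lemma card_filter_fib_inr (z : Fin 1 × ℂ) (j : Fin (m + 2)) :
    ((D.fib (Sum.inr z)).filter fun u => u.1 = j).card = 1 := by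
  classical
  rw [card_eq_one]
  refine ⟨(j, D.p.q3 ^ (j : ℕ) * z.2), ?_⟩
  ext u
  simp only [fib, mem_filter, mem_image, mem_univ, true_and, mem_singleton]
  constructor
  · rintro ⟨⟨i, rfl⟩, rfl⟩; rfl
  · rintro rfl; exact ⟨⟨j, rfl⟩, rfl⟩

lemma Good.card_filter_spec {U : Finset (Pt m)} (hU : D.Good U) (j : Fin (m + 2)) :
    ((D.spec U).filter fun u => u.1 = j).card =
      (U.toLeft.filter fun u => u.1 = Fin.ofNat (m + 1) j).card + U.toRight.card := by
  classical
  rw [spec, filter_biUnion, card_biUnion fun u hu v hv huv =>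
    disjoint_filter_filter (hU.pairwiseDisjoint hu hv huv)]
  conv_lhs => rw [← toLeft_disjSum_toRight (u := U)]
  rw [sum_disjSum, card_filter, card_eq_sum_ones]
  congr 1
  · refine sum_congr rfl fun u _ => ?_
    exact card_filter_fib_inl u.1 u.2 j
  · exact sum_congr rfl fun u _ => card_filter_fib_inr u j

/-- The points of a source colour come from the `y` of the corresponding target colour and from all
`z`. Equal numbers for all source colours thus force equally many `y` of each colour. -/
lemma Good.exists_pts {U : Finset (Pt m)} (hU : D.Good U) {N : ℕ}
    (h : ∀ j, ((D.spec U).filter fun u => u.1 = j).card = N) :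
    ∃ L K, L + K = N ∧ ∃ w : Var m L K → ℂ, Split w ∧ Var.pts w = U := by
  classical
  have h1 : ∀ i : Fin (m + 1), (U.toLeft.filter fun u => u.1 = i).card + U.toRight.card = N := fun i => by
    have := hU.card_filter_spec i.castSucc
    rw [ofNat_castSucc, h] at this
    exact this.symm
  refine ⟨N - U.toRight.card, U.toRight.card, by have := h1 0; omega, ?_⟩
  obtain ⟨y, hy, hy'⟩ : IsConf (Prod.fst : Fin (m + 1) × Fin (N - U.toRight.card) → Fin (m + 1)) U.toLeft := by
    refine isConf_of_card hU.left fun i => ?_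
    rw [Fintype.card_congr (⟨fun l => l.1.2, fun a => ⟨(i, a), rfl⟩, fun l => by
      obtain ⟨⟨j, a⟩, rfl⟩ := l; rfl, fun _ => rfl⟩ :
        {l : Fin (m + 1) × Fin (N - U.toRight.card) // l.1 = i} ≃ Fin (N - U.toRight.card)), Fintype.card_fin]
    have := h1 i
    omega
  obtain ⟨z, hz, hz'⟩ : IsConf (fun _ : Fin U.toRight.card => (0 : Fin 1)) U.toRight := by
    refine isConf_of_card hU.right fun i => ?_
    rw [filter_true_of_mem fun u _ => Subsingleton.elim _ _,
      Fintype.card_congr (Equiv.subtypeUnivEquiv fun _ => Subsingleton.elim _ _), Fintype.card_fin]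
  refine ⟨Sum.elim y z, ⟨hy, hz⟩, ?_⟩
  rw [Var.pts_eq]
  simp only [Sum.elim_comp_inl, Sum.elim_comp_inr]
  rw [hy', hz', toLeft_disjSum_toRight]

lemma card_toRight_pts {w : Var m L K → ℂ} (hw : Split w) : (Var.pts w).toRight.card = K := by
  classical
  rw [Var.toRight_pts, conf, card_image_of_injective _ fun a b e => hw.2.2 (Prod.ext_iff.1 e).2, card_univ,
    Fintype.card_fin]

open Classical in
-- One component for each `(L, K)`. It is zero on configurations of any other shape, so that the
-- components can be added.
lemma exists_component {N : ℕ} {F : Sh0 (m + 2) D.p} (hF : F ∈ Sh0.deg (m + 2) D.p N) (L K : ℕ) :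
    ∃ t ∈ tensorDeg (m + 1) D.pt D.pf (L + K), ∀ U, D.Good U →
      evTensor U.toLeft U.toRight t * D.psi U =
        if ∃ w : Var m L K → ℂ, Split w ∧ Var.pts w = U then Sh0.ev (D.spec U) F else 0 := by
  obtain ⟨h, k, hW, hh⟩ := exists_fused_numerator hF L K
  have hs : Symm h k := fun w w' _ hw' e => fused_symm hh hw' e
  obtain ⟨t, ht, hev⟩ := exists_tensor hW hs
  refine ⟨t, ht, fun U hU => ?_⟩
  rw [hev]
  split_ifs with hw
  · obtain ⟨w, hw, rfl⟩ := hw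
    rw [Var.toLeft_pts, Var.toRight_pts, hs.value_eq hw.1 hw.2, Sum.elim_comp_inl_inr, frac]
    have h1 := hh w ⟨hw, distinct_spl_of_good hw hU⟩
    have h2 : (∏ u, w u) ^ k * poles w ≠ 0 := mul_ne_zero (pow_ne_zero _ (prod_ne_zero_iff.2 fun u _ => hw.ne_zero u))
      (mul_ne_zero (poleDenom_ne_zero _ hw.1) (poleDenom_ne_zero _ hw.2))
    rw [div_mul_eq_mul_div, div_eq_iff h2, h1, mul_comm]
  · have : value h k U.toLeft U.toRight = 0 := by
      by_contra hne
      obtain ⟨⟨y, hy, hy'⟩, z, hz, hz'⟩ := isConf_of_value_ne_zero hne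
      refine hw ⟨Sum.elim y z, ⟨hy, hz⟩, ?_⟩
      rw [Var.pts_eq]
      simp only [Sum.elim_comp_inl, Sum.elim_comp_inr]
      rw [hy', hz', toLeft_disjSum_toRight]
    rw [this, zero_mul]

/-- At a given `U` only one component survives: `K` is the number of `z` in `U`, and `L = N - K`. -/
theorem exists_isFused_of_mem_deg {N : ℕ} {F : Sh0 (m + 2) D.p} (hF : F ∈ Sh0.deg (m + 2) D.p N) :
    ∃ t ∈ tensorDeg (m + 1) D.pt D.pf N, D.IsFused F t := by
  classical
  choose t ht hev using fun L K => exists_component hF L K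
  refine ⟨∑ x ∈ antidiagonal N, t x.1 x.2, Submodule.sum_mem _ fun x hx => ?_, fun U hU => ?_⟩
  · have := ht x.1 x.2
    rwa [mem_antidiagonal.1 hx] at this
  · rw [map_sum, sum_mul, sum_congr rfl fun x _ => hev x.1 x.2 U hU]
    by_cases h0 : Sh0.ev (D.spec U) F = 0
    · rw [h0]; simp
    · obtain ⟨L, K, hLK, hw⟩ := hU.exists_pts (N := N) fun j => by
        convert hF.1 _ h0 j
      rw [sum_eq_single (L, K), if_pos hw]
      · rintro ⟨L', K'⟩ hx hne
        refine if_neg ?_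
        rintro ⟨w', hw', e'⟩
        obtain ⟨w, hw, e⟩ := hw
        have h1 := card_toRight_pts hw
        have h2 := card_toRight_pts hw'
        rw [e] at h1
        rw [e', h1] at h2
        have h3 := mem_antidiagonal.1 hx
        dsimp only at h2 h3
        exact hne (Prod.ext (by dsimp only; omega) h2.symm)
      · exact fun hx => absurd (mem_antidiagonal.2 hLK) hx

theorem exists_isFused (F : Sh0 (m + 2) D.p) : ∃ t, D.IsFused F t := by
  induction F using Sh0.induction with
  | hom N F hF => exact (exists_isFused_of_mem_deg hF).imp fun t h => h.2
  | zero => exact ⟨0, isFused_zero⟩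
  | add F G hF hG =>
    obtain ⟨s, hs⟩ := hF
    obtain ⟨t, ht⟩ := hG
    exact ⟨s + t, hs.add ht⟩
end FusionData

/-! ### Uniqueness of the fusion and the algebra homomorphism -/

/-- Expand `t` in a basis of `B` with coefficients in `A`. Applying `f r` gives a combination of
basis vectors that every `g s` kills, so `f r` kills the coefficients, for all `r`. -/
lemma eq_zero_of_forall_map_eq_zero {A B α β : Type*} [AddCommGroup A] [Module ℂ A] [AddCommGroup B] [Module ℂ B]
    (f : α → A →ₗ[ℂ] ℂ) (g : β → B →ₗ[ℂ] ℂ) (hf : ∀ a, (∀ s, f s a = 0) → a = 0) (hg : ∀ b, (∀ s, g s b = 0) → b = 0)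
    {t : A ⊗[ℂ] B} (h : ∀ r s, LinearMap.mul' ℂ ℂ (TensorProduct.map (f r) (g s) t) = 0) : t = 0 := by
  classical
  let b := Module.Basis.ofVectorSpace ℂ B
  obtain ⟨a, rfl⟩ := (TensorProduct.equivFinsuppOfBasisRight (M := A) b).symm.surjective t
  suffices a = 0 by rw [this, map_zero]
  ext i
  rw [Finsupp.zero_apply]
  refine hf _ fun r => ?_
  have h1 : a.sum (fun i x => f r x • b i) = 0 := hg _ fun s => by
    have := h r s
    rw [TensorProduct.equivFinsuppOfBasisRight_symm_apply, Finsupp.sum, map_sum, map_sum] at this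
    rw [Finsupp.sum, map_sum, ← this]
    exact sum_congr rfl fun i _ => by simp
  have h2 : Finsupp.linearCombination ℂ b (a.mapRange (f r) (map_zero _)) = 0 := by
    rw [Finsupp.linearCombination_apply]
    exact (Finsupp.sum_mapRange_index fun i => zero_smul ℂ (b i)).trans h1
  have h3 := (linearIndependent_iff.1 b.linearIndependent) _ h2
  exact DFunLike.congr_fun h3 i

lemma Sh0.eq_zero_of_ev {n : ℕ} {p : Params} {F : Sh0 n p} (h : ∀ S, Sh0.ev S F = 0) : F = 0 :=
  Subtype.ext (ShFun.ext fun S _ => h S)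

lemma Sh0.isLaurent {ι : Type} [Fintype ι] {n : ℕ} {p : Params} (c : ι → Fin n) (F : Sh0 n p) :
    IsLaurent fun x : ι → ℂ => Sh0.ev (conf c x) F * poleDenom c x := by
  induction F using Sh0.induction with
  | hom N F hF => exact laurent_sub c univ hF
  | zero => exact (IsLaurent.const 0).congr fun x _ => by simp
  | add F G hF hG => exact (hF.add hG).congr fun x _ => by rw [map_add, add_mul]

lemma Sh0.exists_isConf {n : ℕ} {p : Params} {F : Sh0 n p} {S : Finset (Fin n × ℂ)} (h : Sh0.ev S F ≠ 0) :
    ∃ L : ℕ, IsConf (Prod.fst : Fin n × Fin L → Fin n) S := by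
  induction F using Sh0.induction with
  | hom N F hF =>
    refine ⟨N, isConf_of_card (not_not.1 fun hS => h (F.1.eq_zero hS)) fun i => ?_⟩
    rw [Fintype.card_congr (⟨fun l => l.1.2, fun a => ⟨(i, a), rfl⟩, fun l => by
      obtain ⟨⟨j, a⟩, rfl⟩ := l; rfl, fun _ => rfl⟩ : {l : Fin n × Fin N // l.1 = i} ≃ Fin N), Fintype.card_fin]
    exact (hF.1 S h i).symm
  | zero => simp at h
  | add F G hF hG =>
    by_cases h0 : Sh0.ev S F = 0
    · rw [map_add, h0, zero_add] at h
      exact hG h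
    · exact hF h0

namespace FusionData
variable {m : ℕ} {D : FusionData m} {L K : ℕ}

lemma exists_numerator_evTensor (t : Sh0 (m + 1) D.pt ⊗[ℂ] Sh0 1 D.pf) (L K : ℕ) :
    ∃ (Q : MvPolynomial (Var m L K) ℂ) (k : ℕ), ∀ w, Split w →
      evTensor (conf Prod.fst (w ∘ Sum.inl)) (conf (fun _ => 0) (w ∘ Sum.inr)) t * (poles w * (∏ u, w u) ^ k) =
        MvPolynomial.eval w Q := by
  induction t with
  | zero => exact ⟨0, 0, fun w _ => by simp⟩
  | tmul G H =>
    obtain ⟨P, k, hP⟩ := Sh0.isLaurent (Prod.fst : Fin (m + 1) × Fin L → Fin (m + 1)) G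
    obtain ⟨Q, j, hQ⟩ := Sh0.isLaurent (fun _ : Fin K => (0 : Fin 1)) H
    refine ⟨MvPolynomial.rename Sum.inl (P * (∏ l, MvPolynomial.X l) ^ j) *
      MvPolynomial.rename Sum.inr (Q * (∏ l, MvPolynomial.X l) ^ k), k + j, fun w hw => ?_⟩
    simp only [map_mul, MvPolynomial.eval_rename, map_pow, map_prod, MvPolynomial.eval_X,
      ← hP _ hw.1, ← hQ _ hw.2, evTensor_tmul, Fintype.prod_sum_type, poles, Function.comp]
    ring
  | add s t hs ht =>
    obtain ⟨P, k, hP⟩ := hs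
    obtain ⟨Q, j, hQ⟩ := ht
    refine ⟨P * (∏ l, MvPolynomial.X l) ^ j + Q * (∏ l, MvPolynomial.X l) ^ k, k + j, fun w hw => ?_⟩
    simp only [map_add, map_mul, map_pow, map_prod, MvPolynomial.eval_X, ← hP w hw, ← hQ w hw]
    ring

/-- An element of the target is determined by its values at generic points. -/
lemma eq_zero_of_evTensor {t : Sh0 (m + 1) D.pt ⊗[ℂ] Sh0 1 D.pf} (h : ∀ (L K : ℕ) (w : Var m L K → ℂ),
      D.Generic w → D.psi (Var.pts w) ≠ 0 →
      evTensor (conf Prod.fst (w ∘ Sum.inl)) (conf (fun _ => 0) (w ∘ Sum.inr)) t = 0) : t = 0 := by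
  have h1 : ∀ (L K : ℕ) (w : Var m L K → ℂ), Split w →
      evTensor (conf Prod.fst (w ∘ Sum.inl)) (conf (fun _ => 0) (w ∘ Sum.inr)) t = 0 := fun L K w hw => by
    obtain ⟨Q, k, hQ⟩ := exists_numerator_evTensor t L K
    have hQ0 : Q = 0 := D.eq_zero_of_generic fun v hv hv0 => by
      rw [← hQ v hv.1, h L K v hv (psi_ne_zero hv hv0), zero_mul]
    have h2 := hQ w hw
    rw [hQ0, map_zero, mul_eq_zero] at h2
    exact h2.resolve_right (mul_ne_zero (mul_ne_zero (poleDenom_ne_zero _ hw.1) (poleDenom_ne_zero _ hw.2))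
      (pow_ne_zero _ (prod_ne_zero_iff.2 fun u _ => hw.ne_zero u)))
  have h2 : ∀ S T, evTensor S T t = 0 := by
    intro S T
    by_cases hS : ∃ L : ℕ, IsConf (Prod.fst : Fin (m + 1) × Fin L → Fin (m + 1)) S
    · by_cases hT : ∃ K : ℕ, IsConf (Prod.fst : Fin 1 × Fin K → Fin 1) T
      · obtain ⟨L, y, hy, rfl⟩ := hS
        obtain ⟨K, z, hz, rfl⟩ := hT
        have e := conf_comp (c := (Prod.fst : Fin 1 × Fin K → Fin 1)) (Equiv.uniqueProd (Fin K) (Fin 1)).symm z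
        rw [← e]
        exact h1 L K (Sum.elim y (z ∘ (Equiv.uniqueProd (Fin K) (Fin 1)).symm)) ⟨hy, hz.comp _⟩
      -- At configurations of other shapes every element of `Sh⁰` vanishes, so evaluation there is
      -- the zero form.
      · have : (Sh0.ev T : Sh0 1 D.pf →ₗ[ℂ] ℂ) = 0 := LinearMap.ext fun F => by
          by_contra h0
          exact hT (Sh0.exists_isConf h0)
        rw [evTensor, this, TensorProduct.map_zero_right, LinearMap.comp_zero, LinearMap.zero_apply]
    · have : (Sh0.ev S : Sh0 (m + 1) D.pt →ₗ[ℂ] ℂ) = 0 := LinearMap.ext fun F => by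
        by_contra h0
        exact hS (Sh0.exists_isConf h0)
      rw [evTensor, this, TensorProduct.map_zero_left, LinearMap.comp_zero, LinearMap.zero_apply]
  exact eq_zero_of_forall_map_eq_zero Sh0.ev Sh0.ev (fun _ => Sh0.eq_zero_of_ev) (fun _ => Sh0.eq_zero_of_ev) h2

/-- Two fusions agree at generic points with `psi ≠ 0`, and these determine an element of the
target. Linearity and multiplicativity of `fuse` follow from this uniqueness. -/
lemma IsFused.unique {F : Sh0 (m + 2) D.p} {s t} (hs : D.IsFused F s) (ht : D.IsFused F t) : s = t := by
  refine sub_eq_zero.1 (eq_zero_of_evTensor (D := D) fun L K w hw h0 => ?_)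
  have hg := D.good_pts hw.1 hw.2
  have h1 := hs _ hg
  rw [← ht _ hg] at h1
  have h2 := mul_right_cancel₀ h0 h1
  rw [Var.toLeft_pts, Var.toRight_pts] at h2
  rw [map_sub, h2, sub_self]

variable (D) in
/-- The fusion of an element of the shuffle algebra. -/
def fuse (F : Sh0 (m + 2) D.p) : Sh0 (m + 1) D.pt ⊗[ℂ] Sh0 1 D.pf := (exists_isFused F).choose

lemma isFused_fuse (F : Sh0 (m + 2) D.p) : D.IsFused F (D.fuse F) := (exists_isFused F).choose_spec

lemma fuse_add (F G : Sh0 (m + 2) D.p) : D.fuse (F + G) = D.fuse F + D.fuse G :=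
  (isFused_fuse _).unique ((isFused_fuse F).add (isFused_fuse G))

lemma fuse_smul (c : ℂ) (F : Sh0 (m + 2) D.p) : D.fuse (c • F) = c • D.fuse F :=
  (isFused_fuse _).unique ((isFused_fuse F).smul c)

lemma fuse_mul (F G : Sh0 (m + 2) D.p) : D.fuse (F * G) = D.fuse F * D.fuse G := by
  induction F using Sh0.induction with
  | hom M F hF =>
    exact (isFused_fuse _).unique (IsFused.mul hF (isFused_fuse F) (isFused_fuse G))
  | zero => rw [(isFused_fuse 0).unique isFused_zero, zero_mul, zero_mul, (isFused_fuse 0).unique isFused_zero]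
  | add F H hF hH => rw [add_mul, fuse_add, fuse_add, add_mul, hF, hH]

variable (D) in
/-- The fusion map, as a linear map. -/
def fuseLinear : Sh0 (m + 2) D.p →ₗ[ℂ] Sh0 (m + 1) D.pt ⊗[ℂ] Sh0 1 D.pf where
  toFun := D.fuse
  map_add' := fuse_add
  map_smul' := fuse_smul

variable (D) in
/-- The fusion map. -/
def fusionHom : Sh0 (m + 2) D.p →ₐ[ℂ] Sh0 (m + 1) D.pt ⊗[ℂ] Sh0 1 D.pf :=
  AlgHom.ofLinearMap D.fuseLinear ((isFused_fuse _).unique isFused_one) fuse_mul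

lemma isFused_fusionHom (F : Sh0 (m + 2) D.p) : D.IsFused F (D.fusionHom F) := isFused_fuse F

lemma fusionHom_mem {N : ℕ} {F : Sh0 (m + 2) D.p} (hF : F ∈ Sh0.deg (m + 2) D.p N) :
    D.fusionHom F ∈ tensorDeg (m + 1) D.pt D.pf N := by
  obtain ⟨t, ht, h⟩ := exists_isFused_of_mem_deg hF
  rw [(isFused_fusionHom F).unique h]
  exact ht
/-- The fusion map is characterized by its values at generic points. -/
lemma eq_fusionHom_iff {π : Sh0 (m + 2) D.p →ₐ[ℂ] Sh0 (m + 1) D.pt ⊗[ℂ] Sh0 1 D.pf} :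
    π = D.fusionHom ↔ ∀ (F : Sh0 (m + 2) D.p) (L K : ℕ) (w : Var m L K → ℂ), D.Generic w →
      evTensor (conf Prod.fst (w ∘ Sum.inl)) (conf (fun _ => 0) (w ∘ Sum.inr)) (π F) * D.psi (Var.pts w) =
        Sh0.ev (conf Prod.fst (D.spl w)) F := by
  have key : ∀ (F : Sh0 (m + 2) D.p) (L K : ℕ) (w : Var m L K → ℂ), D.Generic w →
      evTensor (conf Prod.fst (w ∘ Sum.inl)) (conf (fun _ => 0) (w ∘ Sum.inr)) (D.fusionHom F) * D.psi (Var.pts w) =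
        Sh0.ev (conf Prod.fst (D.spl w)) F := fun F L K w hw => by
    have h2 := isFused_fusionHom F _ (D.good_pts hw.1 hw.2)
    rwa [Var.toLeft_pts, Var.toRight_pts, ← conf_spl] at h2
  constructor
  · rintro rfl
    exact key
  · intro h
    refine AlgHom.ext fun F => sub_eq_zero.1 (eq_zero_of_evTensor (D := D) fun L K w hw h0 => ?_)
    rw [map_sub, sub_eq_zero]
    exact mul_right_cancel₀ h0 ((h F L K w hw).trans (key F L K w hw).symm)
-- The three equations let the types be stated with concrete parameters while the construction uses
-- the projections of `D`.
lemma exists_fusion {p pt pf : Params} (hp : D.p = p) (hpt : D.pt = pt) (hpf : D.pf = pf) :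
    ∃ π : Sh0 (m + 2) p →ₐ[ℂ] Sh0 (m + 1) pt ⊗[ℂ] Sh0 1 pf,
      (∀ π' : Sh0 (m + 2) p →ₐ[ℂ] Sh0 (m + 1) pt ⊗[ℂ] Sh0 1 pf, π' = π ↔
        ∀ (F : Sh0 (m + 2) p) (L K : ℕ) (w : Var m L K → ℂ), D.Generic w →
          evTensor (conf Prod.fst (w ∘ Sum.inl)) (conf (fun _ => 0) (w ∘ Sum.inr)) (π' F) * D.psi (Var.pts w) =
            Sh0.ev (conf Prod.fst (D.spl w)) F) ∧
      ∀ N, ∀ F ∈ Sh0.deg (m + 2) p N, π F ∈ tensorDeg (m + 1) pt pf N := by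
  subst hp hpt hpf
  exact ⟨D.fusionHom, fun π' => eq_fusionHom_iff, fun N F hF => fusionHom_mem hF⟩
end FusionData

/-- `specialize_eq` and `fusionFactor_eq` translate the explicit formula into the one with `spl` and
`psi`, which characterizes the fusion map. -/
theorem exists_isFusion (m : ℕ) {p : Params} (hp : p.Generic) {ℓ : ℂ} (hℓ : Complex.exp ℓ = p.q1) :
    ∃ π : Sh0 (m + 2) p →ₐ[ℂ] Sh0 (m + 1) (p.tilde ℓ (m + 2)) ⊗[ℂ] Sh0 1 (p.fused (m + 2)),
      (∀ π', IsFusion m p ℓ π' ↔ π' = π) ∧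
      ∀ N, ∀ F ∈ Sh0.deg (m + 2) p N, π F ∈ tensorDeg (m + 1) (p.tilde ℓ (m + 2)) (p.fused (m + 2)) N := by
  obtain ⟨π, h, hd⟩ := FusionData.exists_fusion (D := fusionData m p hp ℓ hℓ) (p := p) (pt := p.tilde ℓ (m + 2))
    (pf := p.fused (m + 2)) rfl rfl rfl
  refine ⟨π, fun π' => Iff.trans ?_ (h π').symm, hd⟩
  constructor
  · intro h F L K w hw
    have h1 := h F L K (Function.curry (w ∘ Sum.inl)) (w ∘ Sum.inr)
    have e : (Sum.elim (Function.uncurry (Function.curry (w ∘ Sum.inl))) (w ∘ Sum.inr) : Var m L K → ℂ) = w := by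
      rw [Function.uncurry_curry, Sum.elim_comp_inl_inr]
    rw [specialize_eq m p hp ℓ hℓ, fusionFactor_eq m p hp ℓ hℓ _ _ (by rw [e]; exact hw.1), e,
      Function.uncurry_curry] at h1
    exact h1 hw.1.1 hw.1.2 hw.2
  · intro h F L K y z hy hz hd
    rw [specialize_eq m p hp ℓ hℓ] at hd ⊢
    rw [fusionFactor_eq m p hp ℓ hℓ _ _ ⟨hy, hz⟩]
    have h1 := h F L K (Sum.elim (Function.uncurry y) z) ⟨⟨hy, hz⟩, hd⟩
    rw [Sum.elim_comp_inl, Sum.elim_comp_inr] at h1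
    exact h1

/-! ### Iteration of the fusion maps -/

section Join
variable {n : ℕ} {A : Fin (n + 1) → Type} [∀ j, Ring (A j)]

lemma snoc_mul_snoc (x y : ∀ j : Fin n, A j.castSucc) (a b : A (Fin.last n)) :
    (Fin.snoc x a * Fin.snoc y b : ∀ j, A j) = Fin.snoc (x * y) (a * b) := by
  funext j
  refine Fin.lastCases ?_ (fun i => ?_) j <;> simp

lemma snoc_one_one : (Fin.snoc (1 : ∀ j : Fin n, A j.castSucc) (1 : A (Fin.last n)) : ∀ j, A j) = 1 := by
  funext j
  refine Fin.lastCases ?_ (fun i => ?_) j <;> simp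

lemma mulSingle_last (b : A (Fin.last n)) :
    (Pi.mulSingle (Fin.last n) b : ∀ j, A j) = Fin.snoc (1 : ∀ j : Fin n, A j.castSucc) b := by
  funext j
  refine Fin.lastCases ?_ (fun i => ?_) j
  · simp
  · simp

variable [∀ j, Algebra ℂ (A j)]

/-- The algebra map `⨂_{j < n} A j → ⨂_{j ≤ n} A j`, `x ↦ x ⊗ 1`. -/
def initHom : (⨂[ℂ] j : Fin n, A j.castSucc) →ₐ[ℂ] ⨂[ℂ] j, A j :=
  PiTensorProduct.liftAlgHom
    ((LinearMap.applyₗ (1 : A (Fin.last n))).compMultilinearMap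
      (MultilinearMap.curryRight (PiTensorProduct.tprod ℂ (s := A))))
    (by
      change PiTensorProduct.tprod ℂ (Fin.snoc _ _) = _
      rw [snoc_one_one]; rfl)
    (fun x y => by
      change PiTensorProduct.tprod ℂ (Fin.snoc _ _) =
        PiTensorProduct.tprod ℂ (Fin.snoc _ _) * PiTensorProduct.tprod ℂ (Fin.snoc _ _)
      rw [PiTensorProduct.tprod_mul_tprod, snoc_mul_snoc, mul_one])

lemma initHom_tprod (x : ∀ j : Fin n, A j.castSucc) :
    initHom (PiTensorProduct.tprod ℂ x) = PiTensorProduct.tprod ℂ (Fin.snoc x 1 : ∀ j, A j) := by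
  exact (PiTensorProduct.liftAlgHom_apply _ _ _ _).trans (PiTensorProduct.lift.tprod _)

lemma initHom_mul_single (x : ∀ j : Fin n, A j.castSucc) (b : A (Fin.last n)) :
    initHom (PiTensorProduct.tprod ℂ x) * PiTensorProduct.singleAlgHom (R := ℂ) (Fin.last n) b =
      PiTensorProduct.tprod ℂ (Fin.snoc x b : ∀ j, A j) := by
  rw [initHom_tprod, PiTensorProduct.singleAlgHom_apply, MonoidHom.mulSingle_apply, mulSingle_last,
    PiTensorProduct.tprod_mul_tprod, snoc_mul_snoc, mul_one, one_mul]

/-- The algebras `A j` need not be commutative, but the two images sit in complementary tensor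
factors and multiplication is componentwise. -/
lemma commute_initHom_single (x : ⨂[ℂ] j : Fin n, A j.castSucc) (b : A (Fin.last n)) :
    Commute (initHom x) (PiTensorProduct.singleAlgHom (R := ℂ) (Fin.last n) b) := by
  induction x using PiTensorProduct.induction_on with
  | smul_tprod r x =>
    rw [map_smul]
    refine Commute.smul_left ?_ r
    change _ * _ = _ * _
    rw [initHom_mul_single, initHom_tprod, PiTensorProduct.singleAlgHom_apply,
      MonoidHom.mulSingle_apply, mulSingle_last, PiTensorProduct.tprod_mul_tprod, snoc_mul_snoc,
      mul_one, one_mul]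
  | add x y hx hy => rw [map_add]; exact hx.add_left hy

/-- The algebra map `(⨂_{j < n} A j) ⊗ A n → ⨂_{j ≤ n} A j`. -/
def joinHom : (⨂[ℂ] j : Fin n, A j.castSucc) ⊗[ℂ] A (Fin.last n) →ₐ[ℂ] ⨂[ℂ] j, A j :=
  Algebra.TensorProduct.lift initHom (PiTensorProduct.singleAlgHom (Fin.last n))
    commute_initHom_single

lemma joinHom_tprod (x : ∀ j : Fin n, A j.castSucc) (b : A (Fin.last n)) :
    joinHom (A := A) (PiTensorProduct.tprod ℂ x ⊗ₜ[ℂ] b) =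
      PiTensorProduct.tprod ℂ (Fin.snoc x b : ∀ j, A j) := by
  rw [joinHom, Algebra.TensorProduct.lift_tmul, initHom_mul_single]
end Join

lemma evPi_tprod {m : ℕ} {p : Fin m → Params} (S : Fin m → Finset (Fin 1 × ℂ))
    (H : ∀ j, Sh0 1 (p j)) :
    evPi S (PiTensorProduct.tprod ℂ H) = ∏ j, Sh0.ev (S j) (H j) := by
  rw [evPi, PiTensorProduct.lift.tprod]; rfl

lemma evPi_joinHom {n : ℕ} {p : Fin (n + 1) → Params} (S : Fin n → Finset (Fin 1 × ℂ))
    (T : Finset (Fin 1 × ℂ)) (x : ⨂[ℂ] j : Fin n, Sh0 1 (p j.castSucc))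
    (b : Sh0 1 (p (Fin.last n))) :
    evPi (p := p) (Fin.snoc (α := fun _ => Finset (Fin 1 × ℂ)) S T)
      (joinHom (A := fun j => Sh0 1 (p j)) (x ⊗ₜ[ℂ] b)) =
        evPi (p := fun j : Fin n => p j.castSucc) S x * Sh0.ev T b := by
  induction x using PiTensorProduct.induction_on with
  | smul_tprod r x =>
    rw [← TensorProduct.smul_tmul', map_smul, map_smul, map_smul, smul_mul_assoc,
      joinHom_tprod (A := fun j => Sh0 1 (p j)), evPi_tprod, evPi_tprod, Fin.prod_univ_castSucc]
    simp
  | add x y hx hy => rw [TensorProduct.add_tmul, map_add, map_add, hx, hy, map_add, add_mul]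

lemma joinHom_mem {n : ℕ} {p : Fin (n + 1) → Params} {N K : ℕ}
    {x : ⨂[ℂ] j : Fin n, Sh0 1 (p j.castSucc)} (hx : x ∈ piDeg (fun j : Fin n => p j.castSucc) N)
    {b : Sh0 1 (p (Fin.last n))} (hb : b ∈ Sh0.deg 1 (p (Fin.last n)) K) :
    joinHom (A := fun j => Sh0 1 (p j)) (x ⊗ₜ[ℂ] b) ∈ piDeg p (N + K) := by
  induction hx using Submodule.span_induction with
  | mem x hx =>
    obtain ⟨k, rfl, H, hH, rfl⟩ := hx
    rw [joinHom_tprod (A := fun j => Sh0 1 (p j))]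
    refine Submodule.subset_span ⟨Fin.snoc (α := fun _ => ℕ) k K, ?_, _, fun j => ?_, rfl⟩
    · simp [Fin.sum_univ_castSucc]
    · refine Fin.lastCases ?_ (fun i => ?_) j
      · simpa using hb
      · simpa using hH i
  | zero => rw [TensorProduct.zero_tmul, map_zero]; exact Submodule.zero_mem _
  | add x y _ _ hx hy => rw [TensorProduct.add_tmul, map_add]; exact Submodule.add_mem _ hx hy
  | smul r x _ hx => rw [← TensorProduct.smul_tmul', map_smul]; exact Submodule.smul_mem _ _ hx

theorem exists_joinHom {n : ℕ} {p₀ : Fin n → Params} {p₁ : Params} {p : Fin (n + 1) → Params}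
    (h₀ : p₀ = fun j => p j.castSucc) (h₁ : p₁ = p (Fin.last n)) :
    ∃ J : (⨂[ℂ] j, Sh0 1 (p₀ j)) ⊗[ℂ] Sh0 1 p₁ →ₐ[ℂ] ⨂[ℂ] j, Sh0 1 (p j),
      (∀ S T x b, evPi (Fin.snoc (α := fun _ => Finset (Fin 1 × ℂ)) S T) (J (x ⊗ₜ[ℂ] b)) =
        evPi S x * Sh0.ev T b) ∧
      ∀ N K, ∀ x ∈ piDeg p₀ N, ∀ b ∈ Sh0.deg 1 p₁ K, J (x ⊗ₜ[ℂ] b) ∈ piDeg p (N + K) := by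
  subst h₀ h₁
  exact ⟨joinHom (A := fun j => Sh0 1 (p j)), evPi_joinHom, fun N K x hx b hb => joinHom_mem hx hb⟩

/-- The map `(Φ' ⊗ id) ∘ π` of the iteration, in terms of values. -/
theorem exists_iterate_step {m n : ℕ} {pt p₁ q : Params} {p₀ : Fin n → Params}
    {p : Fin (n + 1) → Params} (h₀ : p₀ = fun j => p j.castSucc) (h₁ : p₁ = p (Fin.last n))
    (π : Sh0 (m + 1) q →ₐ[ℂ] Sh0 m pt ⊗[ℂ] Sh0 1 p₁)
    (hπ : ∀ N, ∀ F ∈ Sh0.deg (m + 1) q N, π F ∈ tensorDeg m pt p₁ N)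
    (Φ : Sh0 m pt →ₐ[ℂ] ⨂[ℂ] j, Sh0 1 (p₀ j))
    (hΦ : ∀ N, ∀ F ∈ Sh0.deg m pt N, Φ F ∈ piDeg p₀ N) :
    ∃ Ψ : Sh0 (m + 1) q →ₐ[ℂ] ⨂[ℂ] j, Sh0 1 (p j),
      (∀ F S T, evPi (Fin.snoc (α := fun _ => Finset (Fin 1 × ℂ)) S T) (Ψ F) =
        LinearMap.mul' ℂ ℂ (TensorProduct.map (evPi S ∘ₗ Φ.toLinearMap) (Sh0.ev T) (π F))) ∧
      ∀ N, ∀ F ∈ Sh0.deg (m + 1) q N, Ψ F ∈ piDeg p N := by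
  obtain ⟨J, hJ, hJd⟩ := exists_joinHom h₀ h₁
  refine ⟨(J.comp (Algebra.TensorProduct.map Φ (AlgHom.id ℂ _))).comp π, fun F S T => ?_,
    fun N F hF => ?_⟩
  · change evPi _ (J (Algebra.TensorProduct.map Φ (AlgHom.id ℂ _) (π F))) = _
    generalize π F = t
    induction t using TensorProduct.induction_on with
    | zero => simp only [map_zero]
    | tmul x b =>
      rw [Algebra.TensorProduct.map_tmul, hJ, TensorProduct.map_tmul, LinearMap.mul'_apply]; rfl
    | add x y hx hy => simp only [map_add, hx, hy]
  · change J (Algebra.TensorProduct.map Φ (AlgHom.id ℂ _) (π F)) ∈ _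
    have h := hπ N F hF
    rw [tensorDeg] at h
    generalize π F = t at h ⊢
    induction h using Submodule.span_induction with
    | mem t ht =>
      obtain ⟨L, K, rfl, G, hG, H, hH, rfl⟩ := ht
      rw [Algebra.TensorProduct.map_tmul]
      exact hJd L K _ (hΦ L G hG) _ hH
    | zero => simp only [map_zero]; exact Submodule.zero_mem _
    | add x y _ _ hx hy => simp only [map_add]; exact Submodule.add_mem _ hx hy
    | smul r x _ hx => simp only [map_smul]; exact Submodule.smul_mem _ _ hx

theorem exists_iterate_one {q : Params} {p : Fin 1 → Params} (h : q = p 0) :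
    ∃ Φ : Sh0 1 q →ₐ[ℂ] ⨂[ℂ] j, Sh0 1 (p j), (∀ F S, evPi S (Φ F) = Sh0.ev (S 0) F) ∧
      ∀ N, ∀ F ∈ Sh0.deg 1 q N, Φ F ∈ piDeg p N := by
  subst h
  refine ⟨PiTensorProduct.singleAlgHom (R := ℂ) (A := fun j => Sh0 1 (p j)) 0, fun F S => ?_,
    fun N F hF => ?_⟩
  · rw [PiTensorProduct.singleAlgHom_apply, evPi_tprod]
    simp
  · rw [PiTensorProduct.singleAlgHom_apply]
    refine Submodule.subset_span ⟨fun _ => N, by simp, _, fun j => ?_, rfl⟩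
    obtain rfl := Subsingleton.elim j 0
    simpa using hF

lemma Params.ext_of {p p' : Params} (h : p.q = p'.q) (h1 : p.q1 = p'.q1) : p = p' := by
  cases p; cases p'; simp_all

lemma qpow_inv_pow (ℓ : ℂ) (m : ℕ) :
    qpow ℓ (1 / (((m + 2 : ℕ) : ℚ) - 1)) ^ (m + 1) = Complex.exp ℓ := by
  have : (m : ℂ) + 1 ≠ 0 := Nat.cast_add_one_ne_zero m
  rw [qpow, ← Complex.exp_nat_mul]
  congr 1
  push_cast
  rw [show (m : ℂ) + 2 - 1 = m + 1 by ring]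
  field_simp

/-- Since `t^{m+1} = q₁`, the power `(q₁ t)^{m+1}` is `q₁^{m+2}`. The parameters of the one-colour
factors are thus the same at every stage of the iteration. -/
lemma Params.tilde_iter (p : Params) {ℓ : ℂ} (hℓ : Complex.exp ℓ = p.q1) (m j : ℕ) :
    (p.tilde ℓ (m + 2)).iter (m + 1) j = p.iter (m + 2) j := by
  refine ext_of rfl ?_
  change p.q2 ^ j * (p.q1 * qpow ℓ _) ^ (m + 1) = p.q2 ^ j * p.q1 ^ (m + 2)
  rw [mul_pow, qpow_inv_pow, hℓ, ← pow_succ]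

/-- `q₃⁻¹ = q₁ q₂`, so the one-colour algebra split off from `m + 2` colours is the last factor of
the final tensor product. -/
lemma Params.fused_eq_iter (p : Params) (m : ℕ) : p.fused (m + 2) = p.iter (m + 2) (m + 1) := by
  refine ext_of rfl ?_
  change p.q1 * p.q3 ^ (-((m + 2 : ℕ) : ℤ) + 1) = p.q2 ^ (m + 1) * p.q1 ^ (m + 2)
  rw [show -((m + 2 : ℕ) : ℤ) + 1 = -((m + 1 : ℕ) : ℤ) by push_cast; ring, zpow_neg, zpow_natCast,
    q3, inv_pow, inv_inv, mul_pow]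
  ring

lemma Params.iter_one (p : Params) : p = p.iter 1 0 :=
  ext_of rfl (by change p.q1 = p.q2 ^ 0 * p.q1 ^ 1; simp)

/-- A relation between the new parameters, raised to the power `m + 1` to remove `t`, is a relation
between the old ones with exponents `(m+2)a - c`, `(m+1)b`, `(m+1)c`. Equality of these exponents
gives `b = c` and then `a = b`. -/
lemma Params.Generic.tilde {p : Params} (hp : p.Generic) {ℓ : ℂ} (hℓ : Complex.exp ℓ = p.q1) (m : ℕ) :
    (p.tilde ℓ (m + 2)).Generic := by
  intro a b c h
  have hq1 := p.q1_ne
  have hq3 := p.q3_ne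
  have ht : qpow ℓ (1 / (((m + 2 : ℕ) : ℚ) - 1)) ^ (m + 1) = p.q1 := (qpow_inv_pow ℓ m).trans hℓ
  have e1 : (p.tilde ℓ (m + 2)).q1 ^ (m + 1) = p.q1 ^ (m + 2) := by
    change (p.q1 * qpow ℓ _) ^ (m + 1) = _
    rw [mul_pow, ht, ← pow_succ]
  have e3 : (p.tilde ℓ (m + 2)).q3 ^ (m + 1) = p.q3 ^ (m + 1) * p.q1⁻¹ := by
    change (p.q1 * qpow ℓ _ * p.q2)⁻¹ ^ (m + 1) = (p.q1 * p.q2)⁻¹ ^ (m + 1) * _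
    rw [inv_pow, inv_pow, mul_right_comm, mul_pow, ht, mul_inv]
  have h' : ∀ {x y z : ℂ}, x ^ a * y ^ b * z ^ c = 1 →
      (x ^ (m + 1)) ^ a * (y ^ (m + 1)) ^ b * (z ^ (m + 1)) ^ c = 1 := fun {x y z} h => by
    refine Eq.trans ?_ ((congrArg (· ^ (m + 1)) h).trans (one_pow _))
    rw [mul_pow, mul_pow]
    congr 1
    · congr 1 <;> rw [← zpow_natCast, ← zpow_natCast, ← zpow_mul, ← zpow_mul, mul_comm]
    · rw [← zpow_natCast, ← zpow_natCast, ← zpow_mul, ← zpow_mul, mul_comm]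
  replace h' := h' h
  rw [e1, e3] at h'
  have := hp ((m + 2) * a - c) ((m + 1) * b) ((m + 1) * c) (by
    rw [← h', zpow_sub₀ hq1, mul_zpow, inv_zpow, zpow_mul, zpow_mul, zpow_mul]
    norm_cast
    change _ = _ * (p.q2 ^ _) ^ b * _
    field_simp)
  have hm : (m : ℤ) + 1 ≠ 0 := by positivity
  obtain ⟨u, v⟩ := this
  have hbc := mul_left_cancel₀ hm v
  subst hbc
  refine ⟨?_, rfl⟩
  have : ((m : ℤ) + 2) * (a - b) = 0 := by linear_combination u
  have hm2 : (m : ℤ) + 2 ≠ 0 := by positivity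
  exact sub_eq_zero.1 ((mul_eq_zero.1 this).resolve_left hm2)

/-- The fusion map and the iterated map for one colour less are composed by `exists_iterate_step`;
by `tilde_iter` and `fused_eq_iter` their parameters make up the required list. -/
theorem exists_isIteratedFusion (m : ℕ) {p : Params} (hp : p.Generic) {ℓ : ℂ}
    (hℓ : Complex.exp ℓ = p.q1) :
    ∃ Φ : Sh0 (m + 1) p →ₐ[ℂ] ⨂[ℂ] j : Fin (m + 1), Sh0 1 (p.iter (m + 1) j),
      IsIteratedFusion m p ℓ Φ ∧
      ∀ N, ∀ F ∈ Sh0.deg (m + 1) p N, Φ F ∈ piDeg (fun j : Fin (m + 1) => p.iter (m + 1) j) N := by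
  induction m generalizing p ℓ with
  | zero => exact exists_iterate_one (p := fun j : Fin 1 => p.iter 1 j) p.iter_one
  | succ m ih =>
    obtain ⟨π, hπ, hπd⟩ := exists_isFusion m hp hℓ
    obtain ⟨Φ, hΦ, hΦd⟩ := ih (hp.tilde hℓ m) (exp_logTilde p hℓ (m + 2))
    obtain ⟨Ψ, hΨ, hΨd⟩ := exists_iterate_step
      (p₀ := fun j : Fin (m + 1) => (p.tilde ℓ (m + 2)).iter (m + 1) j)
      (p := fun j : Fin (m + 2) => p.iter (m + 2) j)
      (funext fun j => p.tilde_iter hℓ m j) (p.fused_eq_iter m) π hπd Φ hΦd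
    exact ⟨Ψ, ⟨π, Φ, (hπ π).2 rfl, hΦ, hΨ⟩, hΨd⟩

end
end Shuffle

theorem mainTheorem4 (p : Shuffle.Params) (hp : p.Generic) (ℓ : ℂ)
    (hℓ : Complex.exp ℓ = p.q1) (m : ℕ) :
    (∃! π : Shuffle.Sh0 (m + 2) p →ₐ[ℂ]
        Shuffle.Sh0 (m + 1) (p.tilde ℓ (m + 2)) ⊗[ℂ] Shuffle.Sh0 1 (p.fused (m + 2)),
      Shuffle.IsFusion m p ℓ π ∧
      ∀ N, ∀ F ∈ Shuffle.Sh0.deg (m + 2) p N,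
        π F ∈ Shuffle.tensorDeg (m + 1) (p.tilde ℓ (m + 2)) (p.fused (m + 2)) N) ∧
    (∃ Φ : Shuffle.Sh0 (m + 1) p →ₐ[ℂ]
        ⨂[ℂ] j : Fin (m + 1), Shuffle.Sh0 1 (p.iter (m + 1) j),
      Shuffle.IsIteratedFusion m p ℓ Φ ∧
      ∀ N, ∀ F ∈ Shuffle.Sh0.deg (m + 1) p N,
        Φ F ∈ Shuffle.piDeg (fun j : Fin (m + 1) => p.iter (m + 1) j) N) := by
  obtain ⟨π, hπ, hπd⟩ := Shuffle.exists_isFusion m hp hℓ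
  exact ⟨⟨π, ⟨(hπ π).2 rfl, hπd⟩, fun π' h => (hπ π').1 h.1⟩,
    Shuffle.exists_isIteratedFusion m hp hℓ⟩
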